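/- Manifolds are finite-dimensional (of constant dimension), smooth and without boundary. A \emph{double Lie groupoid} $\mathcal D=(D;V,H;M)$ consists of Lie groupoids $D\rightrightarrows H$ (structure maps $s_H,t_H,\cdot_H$), $D\rightrightarrows V$ (structure maps $s_V,t_V,\cdot_V$), $V\rightrightarrows M$ and $H\rightrightarrows M$ (structure maps $s,t,\cdot$) such that (i) $s\,s_H=s\,s_V$, $t\,t_H=t\,t_V$, $t\,s_H=s\,t_V$, $s\,t_H=t\,s_V$; (ii) $s_V,t_V$ are multiplicative for $\cdot_H$, and $s_H,t_H$ are multiplicative for $\cdot_V$, on composable pairs; (iii) $(\alpha_{11}\cdot_H\alpha_{12})\cdot_V(\alpha_{21}\cdot_H\alpha_{22})=(\alpha_{11}\cdot_V\alpha_{21})\cdot_H(\alpha_{12}\cdot_V\alpha_{22})$ whenever $s_H(\alpha_{i1})=t_H(\alpha_{i2})$ and $s_V(\alpha_{1i})=t_V(\alpha_{2i})$ for $i=1,2$; (iv) the double-source map $(s_V,s_H):D\to V\times_{s,M,s}H$ is a submersion (not necessarily surjective). A 2-form on the arrow space $G$ of a Lie groupoid with multiplication $\mathsf m$ is \emph{multiplicative}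 if $\mathsf m^*\omega=\mathrm{pr}_1^*\omega+\mathrm{pr}_2^*\omega$ on the manifold of composable pairs. $(\mathcal D,\omega)$ is a \emph{presymplectic double groupoid} if $\omega$ is a closed 2-form on $D$ which is multiplicative for both $D\rightrightarrows H$ and $D\rightrightarrows V$. \emph{Nerve and bar construction.} $N_{p,q}\mathcal D$ is the set of double functors from $[p]\times[q]$ to $\mathcal D$; equivalently, of $p\times q$ arrays $(\alpha_{ij})$ in $D$ with $s_H(\alpha_{ij})=t_H(\alpha_{i(j+1)})$, $s_V(\alpha_{ij})=t_V(\alpha_{(i+1)j})$ if $p,q>0$, of composable $q$-tuples in $V$ if $p=0<q$, of composable $p$-tuples in $H$ if $q=0<p$, and of points of $M$ if $p=q=0$. Let $h_i$ and $v_j$ be the face maps deleting the $i$-th row and the $j$-th column, and let $\eta_i,\mu_j$ be the corresponding degeneracy maps, inserting units. Then $\overline W_rN\mathcal D$ is the set of $(x_0,\dots,x_r)$ with $x_p\in N_{p,r-p}\mathcal D$ and $v_0x_p=h_{p+1}x_{p+1}$ for $0\le p<r$, with $$f_i(x_0,\dots,x_r)=(v_ix_0,v_{i-1}x_1,\dots,v_1x_{i-1},h_ix_{i+1},\dots,h_ix_r),$$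 $$\delta_i(x_0,\dots,x_r)=(\mu_ix_0,\mu_{i-1}x_1,\dots,\mu_0x_i,\eta_ix_i,\dots,\eta_ix_r).$$ In particular $\overline W_2N\mathcal D=V\times_MD\times_MH$; let $\nu:\overline W_2N\mathcal D\to D$ be the projection $(\theta,\alpha,\eta)\mapsto\alpha$. \emph{Symplectic 2-groupoids.} A \emph{simplicial manifold} $X_\bullet$ is a sequence of manifolds with face maps $f_i$ that are surjective submersions and degeneracy maps $\delta_i$ that are embeddings, satisfying the simplicial identities. Let $\Lambda_{q,k}X\subset (X_{q-1})^q$ be the space of families $(x_i)_{0\le i\le q,\,i\neq k}$ with $f_ix_j=f_{j-1}x_i$ for $i<j$, and let $\lambda_{q,k}:X_q\to\Lambda_{q,k}X$, $x\mapsto(f_ix)_{i\ne k}$. $X_\bullet$ is a \emph{local Lie 2-groupoid} if, for all $q\ge1$ and $0\le k\le q$, $\Lambda_{q,k}X$ is an embedded submanifold and $\lambda_{q,k}$ is a submersion, and $\lambda_{q,k}$ is injective and étale for all $q>2$. A \emph{local presymplectic 2-groupoid} is a local Lie 2-groupoid with a closed 2-form $\Omega$ on $X_2$ such that $\sum_{i=0}^3(-1)^if_i^*\Omega=0$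 on $X_3$. For $y\in X_1$ and $i=0,1$ put $((\delta_i)^*\ker\Omega)_y=\{w\in T_yX_1:(\delta_i)_*w\in\ker\Omega_{\delta_i(y)}\}$. A \emph{local symplectic 2-groupoid} is a local presymplectic 2-groupoid such that (1) for all $x\in X_2$, $(f_2)_*$ maps $\ker(f_0)_*\cap\ker\Omega$ at $x$ isomorphically onto $((\delta_1)^*\ker\Omega)_{f_2(x)}$, where $f_0,f_2:X_2\to X_1$; (2) for all $x\in X_2$, $(f_0)_*$ maps $\ker(f_2)_*\cap\ker\Omega$ at $x$ isomorphically onto $((\delta_0)^*\ker\Omega)_{f_0(x)}$; (3) for all $m\in X_0$, $T_{\delta_0(m)}X_1=W_0^0\oplus W_0^1\oplus W_1^1$, where $W_0^0=(\delta_0)_*T_mX_0$ and $W_i^1=((\delta_i)^*\ker\Omega)_{\delta_0(m)}$. \textbf{Theorem.} Let $(\mathcal D,\omega)$ be a presymplectic double groupoid. Then each $\overline W_rN\mathcal D$ is an embedded submanifold (of a finite product of copies of $D$, via all squares of the grids $x_0,\dots,x_r$), with these manifold structures $\overline WN\mathcal D$ is a local Lie 2-groupoid, and $\overline WN\mathcal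 D$ with the 2-form $\Omega=\nu^*\omega$ is a local symplectic 2-groupoid if and only if $\omega$ is nondegenerate. -/

import Mathlib

open scoped Manifold ContDiff

universe u

noncomputable section

/-! ### Manifolds, differentials and differential 2-forms -/

/-- A finite-dimensional smooth manifold without boundary. (Hausdorffness and second countability
are not imposed; they pass to subspaces of finite products.) -/
structure SmoothMfd : Type (u + 1) where
  carrier : Type u
  dim : ℕ
  [top : TopologicalSpace carrier]
  [charted : ChartedSpace (EuclideanSpace ℝ (Fin dim)) carrier]
  [isManifold : IsManifold (𝓡 dim) ∞ carrier]

namespace SmoothMfd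

instance : CoeSort SmoothMfd.{u} (Type u) := ⟨SmoothMfd.carrier⟩

instance (X : SmoothMfd.{u}) : TopologicalSpace X := X.top

instance (X : SmoothMfd.{u}) : ChartedSpace (EuclideanSpace ℝ (Fin X.dim)) X := X.charted

instance (X : SmoothMfd.{u}) : IsManifold (𝓡 X.dim) ∞ X := X.isManifold

/-- The tangent space `T_x X`. -/
abbrev T (X : SmoothMfd.{u}) (x : X) : Type := TangentSpace (𝓡 X.dim) x

variable {X Y Z : SmoothMfd.{u}}

/-- Smooth maps. -/
abbrev Smooth (f : X → Y) : Prop := ContMDiff (𝓡 X.dim) (𝓡 Y.dim) ∞ f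

/-- The differential `f_* : T_x X → T_{f x} Y`. -/
abbrev diff (f : X → Y) (x : X) : X.T x →L[ℝ] Y.T (f x) := mfderiv (𝓡 X.dim) (𝓡 Y.dim) f x

/-- Submersions. -/
abbrev Submersion (f : X → Y) : Prop := Manifold.IsSubmersion (𝓡 X.dim) (𝓡 Y.dim) ∞ f

/-- Embeddings. -/
abbrev Embedding (f : X → Y) : Prop := Manifold.IsSmoothEmbedding (𝓡 X.dim) (𝓡 Y.dim) ∞ f

/-- Étale maps, i.e. local diffeomorphisms. -/
abbrev Etale (f : X → Y) : Prop := IsLocalDiffeomorph (𝓡 X.dim) (𝓡 Y.dim) ∞ f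

/-- A (not necessarily smooth) field of alternating bilinear forms on the tangent spaces. -/
abbrev TwoForm (X : SmoothMfd.{u}) : Type u := ∀ x : X, X.T x [⋀^Fin 2]→L[ℝ] ℝ

namespace TwoForm

/-- The expression of `ϖ` in the preferred chart at `x₀`, i.e. its pullback along the inverse of
that chart; only its values on the target of the chart are meaningful. -/
def inChart (ϖ : TwoForm X) (x₀ : X) (y : EuclideanSpace ℝ (Fin X.dim)) :
    EuclideanSpace ℝ (Fin X.dim) [⋀^Fin 2]→L[ℝ] ℝ :=
  (ϖ ((extChartAt (𝓡 X.dim) x₀).symm y)).compContinuousLinearMap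
    (mfderiv 𝓘(ℝ, EuclideanSpace ℝ (Fin X.dim)) (𝓡 X.dim) (extChartAt (𝓡 X.dim) x₀).symm y)

/-- `ϖ` is a smooth differential form. -/
def IsSmooth (ϖ : TwoForm X) : Prop :=
  ∀ x₀ : X, ContDiffOn ℝ ∞ (ϖ.inChart x₀) (extChartAt (𝓡 X.dim) x₀).target

/-- `ϖ` is a closed smooth differential form. -/
def IsClosed (ϖ : TwoForm X) : Prop :=
  ϖ.IsSmooth ∧ ∀ x₀ : X, ∀ y ∈ (extChartAt (𝓡 X.dim) x₀).target, extDeriv (ϖ.inChart x₀) y = 0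

/-- The pullback `f^* ϖ`. -/
def pullback (f : X → Y) (ϖ : TwoForm Y) : TwoForm X :=
  fun x => (ϖ (f x)).compContinuousLinearMap (diff f x)

/-- The kernel of `ϖ` at `x`: all `v ∈ T_x X` with `ϖ(v, w) = 0` for all `w ∈ T_x X`. -/
def ker (ϖ : TwoForm X) (x : X) : Submodule ℝ (X.T x) where
  carrier := {v | ∀ w : X.T x, ϖ x ![v, w] = 0}
  zero_mem' := fun w => (ϖ x).map_coord_zero 0 rfl
  add_mem' := by
    intro a b ha hb w
    have h := (ϖ x).map_update_add ![a, w] 0 a b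
    have e : ∀ c : X.T x, Function.update ![a, w] 0 c = ![c, w] := by
      intro c; ext i; fin_cases i <;> rfl
    rw [e, e, e] at h
    rw [h, ha w, hb w, add_zero]
  smul_mem' := by
    intro c a ha w
    have h := (ϖ x).map_update_smul ![a, w] 0 c a
    have e : ∀ c : X.T x, Function.update ![a, w] 0 c = ![c, w] := by
      intro c; ext i; fin_cases i <;> rfl
    rw [e, e] at h
    rw [h, ha w, smul_zero]

/-- `ϖ` is nondegenerate. -/
def Nondegenerate (ϖ : TwoForm X) : Prop := ∀ x : X, ϖ.ker x = ⊥

end TwoForm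

end SmoothMfd

open SmoothMfd

/-! ### Embedded submanifolds of products -/

/-- A smooth manifold structure on a type `S` for which the map `(pr i)_i : S → ∏ i, A i` is a
smooth embedding, i.e. a topological embedding which is smooth with injective differentials
(recall that `T (∏ A i) = ∏ T (A i)`). If `S` is a subset of the product and `pr i` are the
coordinates, then this says that `S` is an embedded submanifold of the product; the manifold
structure is then unique (up to the choice of an atlas). -/
structure EmbeddedStructure {S : Type u} {ι : Type*} {A : ι → SmoothMfd.{u}}
    (pr : ∀ i, S → A i) where
  top : TopologicalSpace S
  isEmbedding : Topology.IsEmbedding (fun x i => pr i x : S → ∀ i, A i)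
  dim : ℕ
  charted : ChartedSpace (EuclideanSpace ℝ (Fin dim)) S
  isManifold : IsManifold (𝓡 dim) ∞ S
  contMDiff_pr : ∀ i, ContMDiff (𝓡 dim) (𝓡 (A i).dim) ∞ (pr i)
  immersive : ∀ (x : S) (v : TangentSpace (𝓡 dim) x),
    (∀ i, mfderiv (𝓡 dim) (𝓡 (A i).dim) (pr i) x v = 0) → v = 0

/-- `S` as a manifold. -/
def EmbeddedStructure.mfd {S : Type u} {ι : Type*} {A : ι → SmoothMfd.{u}}
    {pr : ∀ i, S → A i} (σ : EmbeddedStructure pr) : SmoothMfd.{u} :=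
  letI := σ.top
  letI := σ.charted
  haveI := σ.isManifold
  { carrier := S, dim := σ.dim }

section FiberProduct

variable {X Y Z : SmoothMfd.{u}}

/-- The fiber product `X ×_Z Y` of `f : X → Z` and `g : Y → Z`. -/
abbrev FiberProduct (f : X → Z) (g : Y → Z) : Type u := {p : X × Y // f p.1 = g p.2}

/-- The family `(X, Y)`. -/
abbrev pairFamily (X Y : SmoothMfd.{u}) : Bool → SmoothMfd.{u}
  | false => X
  | true => Y

/-- The two projections of a fiber product. -/
def fiberProj (f : X → Z) (g : Y → Z) : ∀ b, FiberProduct f g → pairFamily X Y b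
  | false => fun p => p.1.1
  | true => fun p => p.1.2

/-- The structure of an embedded submanifold of `X × Y` on `X ×_Z Y` (it exists, and is unique,
as soon as `f` or `g` is a submersion). -/
abbrev FiberProductStructure (f : X → Z) (g : Y → Z) := EmbeddedStructure (fiberProj f g)

end FiberProduct

/-! ### Lie groupoids and double Lie groupoids -/

/-- A Lie groupoid `G ⇉ M`. The product `mul g h` is meaningful if `src g = tgt h` only; its
values on other pairs are arbitrary and never used. -/
structure LieGroupoid (G M : SmoothMfd.{u}) where
  src : G → M
  tgt : G → M
  one : M → G
  inv : G → G
  mul : G → G → G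
  src_one : ∀ m, src (one m) = m
  tgt_one : ∀ m, tgt (one m) = m
  src_inv : ∀ g, src (inv g) = tgt g
  tgt_inv : ∀ g, tgt (inv g) = src g
  src_mul : ∀ g h, src g = tgt h → src (mul g h) = src h
  tgt_mul : ∀ g h, src g = tgt h → tgt (mul g h) = tgt g
  mul_assoc : ∀ g h k, src g = tgt h → src h = tgt k → mul (mul g h) k = mul g (mul h k)
  one_mul : ∀ g, mul (one (tgt g)) g = g
  mul_one : ∀ g, mul g (one (src g)) = g
  inv_mul : ∀ g, mul (inv g) g = one (src g)
  mul_inv : ∀ g, mul g (inv g) = one (tgt g)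
  submersion_src : Submersion src
  submersion_tgt : Submersion tgt
  smooth_one : Smooth one
  smooth_inv : Smooth inv
  /-- The multiplication is smooth on the manifold of composable pairs. -/
  smooth_mul : ∀ σ : FiberProductStructure src tgt,
    Smooth (X := σ.mfd) (fun p : FiberProduct src tgt => mul p.1.1 p.1.2)

/-- A 2-form `ϖ` on `G` is multiplicative: on the manifold `G ×_M G` of composable pairs `(g, h)`
one has `pr₂^* ϖ - mul^* ϖ + pr₁^* ϖ = 0`. -/
def LieGroupoid.Multiplicative {G M : SmoothMfd.{u}} (𝒢 : LieGroupoid G M)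
    (ϖ : TwoForm G) : Prop :=
  ∀ σ : FiberProductStructure 𝒢.src 𝒢.tgt,
    TwoForm.pullback (X := σ.mfd) (fun p : FiberProduct 𝒢.src 𝒢.tgt => p.1.2) ϖ
      - TwoForm.pullback (X := σ.mfd)
          (fun p : FiberProduct 𝒢.src 𝒢.tgt => 𝒢.mul p.1.1 p.1.2) ϖ
      + TwoForm.pullback (X := σ.mfd) (fun p : FiberProduct 𝒢.src 𝒢.tgt => p.1.1) ϖ = 0

/-- A double Lie groupoid with total space `D`, sides `V`, `H` and base `M`. Here `hor` is the
groupoid `D ⇉ H` with structure maps `s_H, t_H, ·_H`, and `ver` is the groupoid `D ⇉ V` with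
structure maps `s_V, t_V, ·_V`. The double-source map is not required to be surjective. -/
structure DoubleLieGroupoid (D V H M : SmoothMfd.{u}) where
  hor : LieGroupoid D H
  ver : LieGroupoid D V
  sideV : LieGroupoid V M
  sideH : LieGroupoid H M
  src_src : ∀ α, sideH.src (hor.src α) = sideV.src (ver.src α)
  tgt_tgt : ∀ α, sideH.tgt (hor.tgt α) = sideV.tgt (ver.tgt α)
  tgt_src : ∀ α, sideH.tgt (hor.src α) = sideV.src (ver.tgt α)
  src_tgt : ∀ α, sideH.src (hor.tgt α) = sideV.tgt (ver.src α)
  ver_src_mul : ∀ α β, hor.src α = hor.tgt β →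
    ver.src (hor.mul α β) = sideV.mul (ver.src α) (ver.src β)
  ver_tgt_mul : ∀ α β, hor.src α = hor.tgt β →
    ver.tgt (hor.mul α β) = sideV.mul (ver.tgt α) (ver.tgt β)
  hor_src_mul : ∀ α β, ver.src α = ver.tgt β →
    hor.src (ver.mul α β) = sideH.mul (hor.src α) (hor.src β)
  hor_tgt_mul : ∀ α β, ver.src α = ver.tgt β →
    hor.tgt (ver.mul α β) = sideH.mul (hor.tgt α) (hor.tgt β)
  interchange : ∀ α₁₁ α₁₂ α₂₁ α₂₂,
    hor.src α₁₁ = hor.tgt α₁₂ → hor.src α₂₁ = hor.tgt α₂₂ →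
    ver.src α₁₁ = ver.tgt α₂₁ → ver.src α₁₂ = ver.tgt α₂₂ →
    ver.mul (hor.mul α₁₁ α₁₂) (hor.mul α₂₁ α₂₂) = hor.mul (ver.mul α₁₁ α₂₁) (ver.mul α₁₂ α₂₂)
  /-- The double-source map `(s_V, s_H) : D → V ×_M H` is a submersion. -/
  submersion_doubleSrc : ∀ σ : FiberProductStructure sideV.src sideH.src,
    Submersion (Y := σ.mfd)
      (fun α => (⟨(ver.src α, hor.src α), (src_src α).symm⟩ : FiberProduct sideV.src sideH.src))

/-- `(D, ϖ)` is a presymplectic double groupoid. -/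
structure DoubleLieGroupoid.IsPresymplectic {D V H M : SmoothMfd.{u}}
    (𝒟 : DoubleLieGroupoid D V H M) (ϖ : TwoForm D) : Prop where
  isClosed : ϖ.IsClosed
  multiplicative_hor : 𝒟.hor.Multiplicative ϖ
  multiplicative_ver : 𝒟.ver.Multiplicative ϖ

/-! ### The nerve of a double Lie groupoid and the bar construction -/

/-- The arrows `i ≤ j` of the ordered set `[n] = {0, …, n}`. -/
abbrev Arrow (n : ℕ) : Type := {c : Fin (n + 1) × Fin (n + 1) // c.1 ≤ c.2}

/-- The arrow `i ≤ j`. -/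
abbrev Arrow.mk {n : ℕ} {i j : Fin (n + 1)} (h : i ≤ j) : Arrow n := ⟨(i, j), h⟩

/-- The action of a monotone map on arrows. -/
def Arrow.map {m n : ℕ} (a : Fin (m + 1) →o Fin (n + 1)) (c : Arrow m) : Arrow n :=
  ⟨(a c.1.1, a c.1.2), a.monotone c.2⟩

namespace DoubleLieGroupoid

variable {D V H M : SmoothMfd.{u}} (𝒟 : DoubleLieGroupoid D V H M)

/-- Double functors from `[p] × [q]` to `D`: the square `α (i ≤ i') (j ≤ j')` occupies the rows
from `i` to `i'` and the columns from `j` to `j'`. -/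
structure IsDoubleFunctor {p q : ℕ} (α : Arrow p → Arrow q → D) : Prop where
  ver_comp : ∀ {i j k : Fin (p + 1)} (hij : i ≤ j) (hjk : j ≤ k) (c : Arrow q),
    𝒟.ver.src (α (.mk hij) c) = 𝒟.ver.tgt (α (.mk hjk) c) ∧
      α (.mk (hij.trans hjk)) c = 𝒟.ver.mul (α (.mk hij) c) (α (.mk hjk) c)
  ver_id : ∀ (i : Fin (p + 1)) (c : Arrow q),
    α (.mk (le_refl i)) c = 𝒟.ver.one (𝒟.ver.src (α (.mk (le_refl i)) c))
  hor_comp : ∀ {i j k : Fin (q + 1)} (hij : i ≤ j) (hjk : j ≤ k) (c : Arrow p),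
    𝒟.hor.src (α c (.mk hij)) = 𝒟.hor.tgt (α c (.mk hjk)) ∧
      α c (.mk (hij.trans hjk)) = 𝒟.hor.mul (α c (.mk hij)) (α c (.mk hjk))
  hor_id : ∀ (i : Fin (q + 1)) (c : Arrow p),
    α c (.mk (le_refl i)) = 𝒟.hor.one (𝒟.hor.src (α c (.mk (le_refl i))))

/-- The nerve `N_{p,q} D`. For `p, q > 0` a double functor `α` is the same as the composable
`p × q` array of squares `α_{ij} = α (i - 1 ≤ i) (j - 1 ≤ j)`, all other values being composites
and units. For `p = 0` it is the same as a composable `q`-tuple in `V` (all values are units for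
`·_V`), for `q = 0` the same as a composable `p`-tuple in `H`, and for `p = q = 0` a point of `M`
(represented by its double unit). -/
def Nerve (p q : ℕ) : Type u := {α : Arrow p → Arrow q → D // 𝒟.IsDoubleFunctor α}

variable {𝒟}

/-- The action of monotone maps on the nerve. -/
def Nerve.map {p q p' q' : ℕ} (a : Fin (p' + 1) →o Fin (p + 1)) (b : Fin (q' + 1) →o Fin (q + 1))
    (x : 𝒟.Nerve p q) : 𝒟.Nerve p' q' :=
  ⟨fun c d => x.1 (c.map a) (d.map b),
    { ver_comp := fun hij hjk c => x.2.ver_comp (a.monotone hij) (a.monotone hjk) (c.map b)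
      ver_id := fun i c => x.2.ver_id (a i) (c.map b)
      hor_comp := fun hij hjk c => x.2.hor_comp (b.monotone hij) (b.monotone hjk) (c.map a)
      hor_id := fun i c => x.2.hor_id (b i) (c.map a) }⟩

/-- The injective monotone map `[n] → [n + 1]` whose image omits `i`. -/
abbrev coface {n : ℕ} (i : Fin (n + 2)) : Fin (n + 1) →o Fin (n + 2) :=
  (Fin.succAboveOrderEmb i).toOrderHom

/-- The surjective monotone map `[n + 1] → [n]` which takes the value `i` twice. -/
abbrev codegen {n : ℕ} (i : Fin (n + 1)) : Fin (n + 2) →o Fin (n + 1) :=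
  Fin.predAboveOrderHom i

/-- The vertical face map `v_j : N_{p,q+1} D → N_{p,q} D`; it deletes the `j`-th column. -/
def Nerve.v {p q : ℕ} (j : Fin (q + 2)) (x : 𝒟.Nerve p (q + 1)) : 𝒟.Nerve p q :=
  x.map OrderHom.id (coface j)

/-- The horizontal face map `h_i : N_{p+1,q} D → N_{p,q} D`; it deletes the `i`-th row. -/
def Nerve.h {p q : ℕ} (i : Fin (p + 2)) (x : 𝒟.Nerve (p + 1) q) : 𝒟.Nerve p q :=
  x.map (coface i) OrderHom.id

/-- The vertical degeneracy map `μ_j : N_{p,q} D → N_{p,q+1} D`; it inserts units. -/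
def Nerve.μ {p q : ℕ} (j : Fin (q + 1)) (x : 𝒟.Nerve p q) : 𝒟.Nerve p (q + 1) :=
  x.map OrderHom.id (codegen j)

/-- The horizontal degeneracy map `η_i : N_{p,q} D → N_{p+1,q} D`; it inserts units. -/
def Nerve.η {p q : ℕ} (i : Fin (p + 1)) (x : 𝒟.Nerve p q) : 𝒟.Nerve (p + 1) q :=
  x.map (codegen i) OrderHom.id

theorem Nerve.v_h {p q : ℕ} (i : Fin (p + 2)) (j : Fin (q + 2)) (x : 𝒟.Nerve (p + 1) (q + 1)) :
    (x.h i).v j = (x.v j).h i := rfl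

theorem Nerve.μ_h {p q : ℕ} (i : Fin (p + 2)) (j : Fin (q + 1)) (x : 𝒟.Nerve (p + 1) q) :
    (x.h i).μ j = (x.μ j).h i := rfl

theorem Nerve.v_η {p q : ℕ} (i : Fin (p + 1)) (j : Fin (q + 2)) (x : 𝒟.Nerve p (q + 1)) :
    (x.η i).v j = (x.v j).η i := rfl

theorem Nerve.v_v_zero {p q : ℕ} (k : Fin (q + 2)) (x : 𝒟.Nerve p (q + 2)) :
    (x.v k.succ).v 0 = (x.v 0).v k := by
  have e : (coface k.succ).comp (coface 0) = (coface 0).comp (coface k) := by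
    ext i; simp [coface]
  change x.map OrderHom.id ((coface k.succ).comp (coface 0)) =
    x.map OrderHom.id ((coface 0).comp (coface k))
  rw [e]

theorem Nerve.h_h_last {p q : ℕ} (i : Fin (p + 2)) (x : 𝒟.Nerve (p + 2) q) :
    (x.h i.castSucc).h (Fin.last (p + 1)) = (x.h (Fin.last (p + 2))).h i := by
  have e : (coface i.castSucc).comp (coface (Fin.last (p + 1))) =
      (coface (Fin.last (p + 2))).comp (coface i) := by
    ext j; simp [coface]
  change x.map ((coface i.castSucc).comp (coface (Fin.last (p + 1)))) OrderHom.id =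
    x.map ((coface (Fin.last (p + 2))).comp (coface i)) OrderHom.id
  rw [e]

theorem Nerve.v_μ_succ {p q : ℕ} (k : Fin (q + 1)) (x : 𝒟.Nerve p (q + 1)) :
    (x.μ k.succ).v 0 = (x.v 0).μ k := by
  have e : (codegen k.succ).comp (coface 0) = (coface 0).comp (codegen k) := by
    ext i; simp [coface, codegen]
  change x.map OrderHom.id ((codegen k.succ).comp (coface 0)) =
    x.map OrderHom.id ((coface 0).comp (codegen k))
  rw [e]

theorem Nerve.v_μ_zero {p q : ℕ} (x : 𝒟.Nerve p q) : (x.μ 0).v 0 = x := by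
  have e : (codegen (0 : Fin (q + 1))).comp (coface 0) = OrderHom.id := by
    ext i; simp [coface, codegen]
  change x.map OrderHom.id ((codegen (0 : Fin (q + 1))).comp (coface 0)) = x
  rw [e]
  rfl

theorem Nerve.h_η_last {p q : ℕ} (x : 𝒟.Nerve p q) :
    (x.η (Fin.last p)).h (Fin.last (p + 1)) = x := by
  have e : (codegen (Fin.last p)).comp (coface (Fin.last (p + 1))) = OrderHom.id := by
    ext i; simp [coface, codegen]
  change x.map ((codegen (Fin.last p)).comp (coface (Fin.last (p + 1)))) OrderHom.id = x
  rw [e]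
  rfl

theorem Nerve.h_η_castSucc {p q : ℕ} (i : Fin (p + 1)) (x : 𝒟.Nerve (p + 1) q) :
    (x.η i.castSucc).h (Fin.last (p + 2)) = (x.h (Fin.last (p + 1))).η i := by
  have e : (codegen i.castSucc).comp (coface (Fin.last (p + 2))) =
      (coface (Fin.last (p + 1))).comp (codegen i) := by
    ext j; simp [coface, codegen]
  change x.map ((codegen i.castSucc).comp (coface (Fin.last (p + 2)))) OrderHom.id =
    x.map ((coface (Fin.last (p + 1))).comp (codegen i)) OrderHom.id
  rw [e]

variable (𝒟)

/-- The bar construction: `W̄_r ND` is the set of tuples `(x_0, …, x_r)` with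
`x_p ∈ N_{p,r-p} D` and `v_0 x_p = h_{p+1} x_{p+1}`. -/
def Bar (r : ℕ) : Type u :=
  {x : ∀ p q : ℕ, p + q = r → 𝒟.Nerve p q //
    ∀ (p q : ℕ) (e : p + q + 1 = r),
      (x p (q + 1) (by omega)).v 0 = (x (p + 1) q (by omega)).h (Fin.last (p + 1))}

variable {𝒟}

/-- The face map
`f_i (x_0, …, x_{r+1}) = (v_i x_0, v_{i-1} x_1, …, v_1 x_{i-1}, h_i x_{i+1}, …, h_i x_{r+1})`. -/
def Bar.face {r : ℕ} (i : Fin (r + 2)) (x : 𝒟.Bar (r + 1)) : 𝒟.Bar r :=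
  ⟨fun p q e =>
    if hp : p < i then (x.1 p (q + 1) (by omega)).v ⟨i - p, by omega⟩
    else (x.1 (p + 1) q (by omega)).h ⟨i, by omega⟩,
   by
    intro p q e
    obtain ⟨i, hi⟩ := i
    dsimp only
    rcases lt_trichotomy (p + 1) i with h | h | h
    · rw [dif_pos (by omega), dif_pos h, ← Nerve.v_h, ← x.2 p (q + 1) (by omega),
        ← Nerve.v_v_zero]
      congr 2
      simp only [Fin.succ_mk, Fin.mk.injEq]
      omega
    · subst h
      rw [dif_pos (by omega), dif_neg (by omega)]
      have e1 : (⟨p + 1 - p, by omega⟩ : Fin (q + 3)) = (0 : Fin (q + 2)).succ := by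
        ext; simp
      have e2 : (⟨p + 1, by omega⟩ : Fin (p + 3)) = (Fin.last (p + 1)).castSucc := by
        ext; simp
      rw [e1, e2, Nerve.v_v_zero, x.2 p (q + 1) (by omega), Nerve.v_h,
        x.2 (p + 1) q (by omega), ← Nerve.h_h_last]
    · rw [dif_neg (by omega), dif_neg (by omega), Nerve.v_h, x.2 (p + 1) q (by omega),
        ← Nerve.h_h_last]
      rfl⟩

/-- The degeneracy map
`δ_i (x_0, …, x_r) = (μ_i x_0, μ_{i-1} x_1, …, μ_0 x_i, η_i x_i, …, η_i x_r)`. -/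
def Bar.degen {r : ℕ} (i : Fin (r + 1)) (x : 𝒟.Bar r) : 𝒟.Bar (r + 1) :=
  ⟨fun p q e =>
    if hp : p ≤ i then
      match q, e with
      | 0, e => absurd e (by omega)
      | q + 1, e => (x.1 p q (by omega)).μ ⟨i - p, by omega⟩
    else
      match p, hp, e with
      | 0, hp, _ => absurd (Nat.zero_le _) hp
      | p + 1, hp, e => (x.1 p q (by omega)).η ⟨i, by omega⟩,
   by
    intro p q e
    obtain ⟨i, hi⟩ := i
    dsimp only
    rcases lt_trichotomy p i with h | h | h
    · obtain ⟨q, rfl⟩ : ∃ q', q = q' + 1 := ⟨q - 1, by omega⟩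
      rw [dif_pos (by omega), dif_pos (by omega)]
      dsimp only
      rw [← Nerve.μ_h, ← x.2 p q (by omega), ← Nerve.v_μ_succ]
      congr 2
      simp only [Fin.succ_mk, Fin.mk.injEq]
      omega
    · subst h
      rw [dif_pos le_rfl, dif_neg (by omega)]
      have e1 : (⟨p - p, by omega⟩ : Fin (q + 1)) = 0 := by
        ext; simp
      rw [e1, Nerve.v_μ_zero]
      exact (Nerve.h_η_last _).symm
    · obtain ⟨p, rfl⟩ : ∃ p', p = p' + 1 := ⟨p - 1, by omega⟩
      rw [dif_neg (by omega), dif_neg (by omega)]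
      dsimp only
      rw [Nerve.v_η, x.2 p q (by omega), ← Nerve.h_η_castSucc]
      rfl⟩

/-- The coordinates of `W̄_r ND` in the product of copies of `D`: all squares of all the grids
`x_0, …, x_r`. -/
def Bar.coord {r : ℕ} (k : Σ a : {a : ℕ × ℕ // a.1 + a.2 = r}, Arrow a.1.1 × Arrow a.1.2)
    (x : 𝒟.Bar r) : D :=
  (x.1 k.1.1.1 k.1.1.2 k.1.2).1 k.2.1 k.2.2

/-- The projection `ν : W̄_2 ND = V ×_M D ×_M H → D`, `(θ, α, η) ↦ α`: the only square of the
grid `x_1 ∈ N_{1,1} D`. -/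
def Bar.ν (x : 𝒟.Bar 2) : D :=
  (x.1 1 1 rfl).1 (.mk (Fin.zero_le 1)) (.mk (Fin.zero_le 1))

end DoubleLieGroupoid

/-! ### Simplicial manifolds and symplectic 2-groupoids -/

/-- The data underlying a simplicial manifold: manifolds `X_q`, face maps `f_i` and degeneracy
maps `δ_i`. -/
structure SimplicialData : Type (u + 1) where
  X : ℕ → SmoothMfd.{u}
  f : ∀ {q : ℕ}, Fin (q + 2) → X (q + 1) → X q
  δ : ∀ {q : ℕ}, Fin (q + 1) → X q → X (q + 1)

namespace SimplicialData

variable (𝒳 : SimplicialData.{u})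

/-- The data `𝒳` form a simplicial manifold. -/
structure IsSimplicialManifold : Prop where
  f_surjective : ∀ {q : ℕ} (i : Fin (q + 2)), Function.Surjective (𝒳.f i)
  f_submersion : ∀ {q : ℕ} (i : Fin (q + 2)), Submersion (𝒳.f i)
  δ_embedding : ∀ {q : ℕ} (i : Fin (q + 1)), Embedding (𝒳.δ i)
  /-- `f_i f_{j+1} = f_j f_i` for `i < j + 1`. -/
  f_f : ∀ {q : ℕ} (i j : Fin (q + 2)), i ≤ j → ∀ x : 𝒳.X (q + 2),
    𝒳.f i (𝒳.f j.succ x) = 𝒳.f j (𝒳.f i.castSucc x)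
  /-- `δ_i δ_j = δ_{j+1} δ_i` for `i ≤ j`. -/
  δ_δ : ∀ {q : ℕ} (i j : Fin (q + 1)), i ≤ j → ∀ x : 𝒳.X q,
    𝒳.δ i.castSucc (𝒳.δ j x) = 𝒳.δ j.succ (𝒳.δ i x)
  /-- `f_i δ_{j+1} = δ_j f_i` for `i < j + 1`. -/
  f_δ_of_lt : ∀ {q : ℕ} (i : Fin (q + 2)) (j : Fin (q + 1)), i ≤ j.castSucc → ∀ x : 𝒳.X (q + 1),
    𝒳.f i.castSucc (𝒳.δ j.succ x) = 𝒳.δ j (𝒳.f i x)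
  f_δ_self : ∀ {q : ℕ} (j : Fin (q + 1)) (x : 𝒳.X q), 𝒳.f j.castSucc (𝒳.δ j x) = x
  f_δ_succ : ∀ {q : ℕ} (j : Fin (q + 1)) (x : 𝒳.X q), 𝒳.f j.succ (𝒳.δ j x) = x
  /-- `f_{i+1} δ_j = δ_j f_i` for `i + 1 > j + 1`. -/
  f_δ_of_gt : ∀ {q : ℕ} (i : Fin (q + 2)) (j : Fin (q + 1)), j.castSucc < i → ∀ x : 𝒳.X (q + 1),
    𝒳.f i.succ (𝒳.δ j.castSucc x) = 𝒳.δ j (𝒳.f i x)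

/-- The space `Λ_{q,k} X` of `(q, k)`-horns, `q = n + 2`: families `(x_i)_{i ≠ k}` in `X_{q-1}`
such that `f_i x_j = f_{j-1} x_i` for `i < j`. -/
def Horn {n : ℕ} (k : Fin (n + 3)) : Type u :=
  {x : {i : Fin (n + 3) // i ≠ k} → 𝒳.X (n + 1) //
    ∀ (i j : Fin (n + 2)), i ≤ j → ∀ (hi : i.castSucc ≠ k) (hj : j.succ ≠ k),
      𝒳.f i (x ⟨j.succ, hj⟩) = 𝒳.f j (x ⟨i.castSucc, hi⟩)}

variable {𝒳}

/-- The coordinates of a horn. -/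
def Horn.coord {n : ℕ} {k : Fin (n + 3)} (i : {i : Fin (n + 3) // i ≠ k}) (x : 𝒳.Horn k) :
    𝒳.X (n + 1) := x.1 i

/-- The horn map `λ_{q,k} : X_q → Λ_{q,k} X`, `q = n + 2`, which forgets the `k`-th face. -/
def IsSimplicialManifold.hornMap (hX : 𝒳.IsSimplicialManifold) {n : ℕ} (k : Fin (n + 3))
    (x : 𝒳.X (n + 2)) : 𝒳.Horn k :=
  ⟨fun i => 𝒳.f i.1 x, fun i j hij _ _ => hX.f_f i j hij x⟩

variable (𝒳)

/-- `𝒳` is a local Lie 2-groupoid: the horn spaces `Λ_{q,k} X` are embedded submanifolds of the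
products `(X_{q-1})^q`, the horn maps `λ_{q,k}` are submersions for `q ≥ 2`, and they are
injective étale maps for `q > 2`. (For `q = 1` the horn maps are the face maps `X_1 → X_0`, which
are submersions in any simplicial manifold.) -/
structure IsLocalLieTwoGroupoid : Prop extends 𝒳.IsSimplicialManifold where
  horn_submersion : ∀ {n : ℕ} (k : Fin (n + 3)),
    ∃ τ : EmbeddedStructure (Horn.coord (𝒳 := 𝒳) (k := k)),
      Submersion (Y := τ.mfd) (toIsSimplicialManifold.hornMap k)
  horn_injective : ∀ {n : ℕ} (k : Fin (n + 4)),
    Function.Injective (toIsSimplicialManifold.hornMap k)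
  horn_etale : ∀ {n : ℕ} (k : Fin (n + 4)),
    ∃ τ : EmbeddedStructure (Horn.coord (𝒳 := 𝒳) (k := k)),
      Etale (Y := τ.mfd) (toIsSimplicialManifold.hornMap k)

variable {𝒳}

/-- A differential form on `X_q` (here a 2-form) is multiplicative if `∑ i, (-1)^i f_i^* Ω = 0`
on `X_{q+1}`. -/
def Multiplicative {q : ℕ} (Ω : TwoForm (𝒳.X q)) : Prop :=
  ∑ i : Fin (q + 2), (-1 : ℝ) ^ (i : ℕ) • Ω.pullback (𝒳.f i) = 0

/-- `(𝒳, Ω)` is a local presymplectic 2-groupoid. -/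
structure IsLocalPresymplectic (Ω : TwoForm (𝒳.X 2)) : Prop extends
    𝒳.IsLocalLieTwoGroupoid where
  isClosed : Ω.IsClosed
  multiplicative : Multiplicative Ω

/-- The fiber over `y` of `(δ_i)^* ker Ω ⊆ T X_1`: the vectors `w` with `(δ_i)_* w ∈ ker Ω`. -/
def degenKer (Ω : TwoForm (𝒳.X 2)) (i : Fin 2) (y : 𝒳.X 1) : Submodule ℝ ((𝒳.X 1).T y) :=
  (Ω.ker (𝒳.δ i y)).comap (diff (𝒳.δ i) y).toLinearMap

/-- The subspaces `W_0^0 = (δ_0)_* T_m X_0`, `W_0^1` and `W_1^1` of `T_{δ_0 m} X_1`, where `W_i^1`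
is the fiber of `(δ_i)^* ker Ω` over `δ_0 m`. -/
def W (Ω : TwoForm (𝒳.X 2)) (m : 𝒳.X 0) : Fin 3 → Submodule ℝ ((𝒳.X 1).T (𝒳.δ 0 m)) :=
  ![LinearMap.range (diff (𝒳.δ 0) m).toLinearMap, degenKer Ω 0 (𝒳.δ 0 m), degenKer Ω 1 (𝒳.δ 0 m)]

/-- `(𝒳, Ω)` is a local symplectic 2-groupoid. -/
structure IsLocalSymplectic (Ω : TwoForm (𝒳.X 2)) : Prop extends IsLocalPresymplectic Ω where
  /-- `(f_2)_*` maps `ker (f_0)_* ∩ ker Ω` fiberwise isomorphically onto `(δ_1)^* ker Ω`. -/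
  iso_two_zero : ∀ x : 𝒳.X 2, Set.BijOn (diff (𝒳.f 2) x)
    ((LinearMap.ker (diff (𝒳.f 0) x).toLinearMap ⊓ Ω.ker x : Submodule ℝ ((𝒳.X 2).T x)) :
      Set ((𝒳.X 2).T x))
    (degenKer Ω 1 (𝒳.f 2 x) : Set ((𝒳.X 1).T (𝒳.f 2 x)))
  /-- `(f_0)_*` maps `ker (f_2)_* ∩ ker Ω` fiberwise isomorphically onto `(δ_0)^* ker Ω`. -/
  iso_zero_two : ∀ x : 𝒳.X 2, Set.BijOn (diff (𝒳.f 0) x)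
    ((LinearMap.ker (diff (𝒳.f 2) x).toLinearMap ⊓ Ω.ker x : Submodule ℝ ((𝒳.X 2).T x)) :
      Set ((𝒳.X 2).T x))
    (degenKer Ω 0 (𝒳.f 0 x) : Set ((𝒳.X 1).T (𝒳.f 0 x)))
  /-- `T_{δ_0 m} X_1 = W_0^0 ⊕ W_0^1 ⊕ W_1^1` for all `m ∈ X_0`. -/
  directSum : ∀ m : 𝒳.X 0, DirectSum.IsInternal (W Ω m)

end SimplicialData

namespace DoubleLieGroupoid

variable {D V H M : SmoothMfd.{u}} (𝒟 : DoubleLieGroupoid D V H M)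

/-- The structure of an embedded submanifold, of a product of copies of `D`, on `W̄_r ND`. -/
abbrev BarStructure (r : ℕ) := EmbeddedStructure (Bar.coord (𝒟 := 𝒟) (r := r))

variable {𝒟}

/-- `W̄ ND` with its manifold structures, face maps and degeneracy maps. -/
def barData (σ : ∀ r, 𝒟.BarStructure r) : SimplicialData.{u} where
  X := fun r => (σ r).mfd
  f := fun i => Bar.face i
  δ := fun i => Bar.degen i

/-- The 2-form `Ω = ν^* ϖ` on `W̄_2 ND`. -/
def barForm (σ : ∀ r, 𝒟.BarStructure r) (ϖ : TwoForm D) : TwoForm ((barData σ).X 2) :=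
  TwoForm.pullback (X := (σ 2).mfd) Bar.ν ϖ

end DoubleLieGroupoid

end

/-!
The bar construction is analyzed through the squares of its elements. The grids `x_0, …, x_r` of an
element `x` of `W̄_r ND` overlap, and together they form a staircase: it has one square
`x.sq i i' j j'`, with rows from `i` to `i'` and columns from `j` to `j'`, for all vertices
`i ≤ i' ≤ j ≤ j'` of `[r]`, and these squares are functorial in the rows and in the columns
(`IsStairOn`). Faces and degeneracies omit or repeat vertices (`sq_face`, `sq_degen`), so the
simplicial identities are those of the simplex category. Reflection in the antidiagonal, which
exchanges the two groupoid structures, reverses the order of the vertices.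

*Manifolds and submersions.* By cancellation in the groupoids, a staircase is determined by its
squares `F i j = x.sq 0 i i j`, and it suffices that these fit together along their targets
(`IsFan`, `Bar.exists_germ_of_fan`). The double target map is a submersion, since the double source
map is, so a square may be chosen with given targets, depending smoothly on them
(`exists_lift_tgt_tgt`). Hence `W̄_{m+2} ND` is an iterated fiber product along submersions: of its
two last faces, which share a face, and of one more square (`Bar.nonempty_barStructure_add_two`).
Likewise germs of elements lift through the face maps (`Bar.exists_lift_face`), where `f_0` is
reduced to another face map by reflection. A smooth map with local sections through all points is a
submersion (`SmoothMfd.submersion_of_sections`).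

*Horns.* In dimension 2 an element of `W̄_2 ND` is a triple `(θ, α, η)` in `V ×_M D ×_M H`, and a
horn prescribes `θ`, `η` or products with them, and a pair of adjacent sides of `α`; such a horn is
filled by a choice of `α` (`Bar.exists_lift_horn_zero`, `Bar.exists_lift_horn_one`,
`Bar.exists_lift_horn_two`). In dimension at least 3, the horn opposite to the vertex `k` contains
the squares whose vertices lie in a triple containing `k`. Again by cancellation, and by the
interchange law, such squares extend uniquely to a staircase (`isStairOn_glue`,
`IsStairOn.eq_glue`), which is the unique filler.

*The form.* For `y` in `W̄_3 ND`, with a suitable square `β` of `y`, `ν (f_1 y)` is the vertical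
product of `β` and `ν (f_0 y)`, and `ν (f_2 y)` is the horizontal product of `ν (f_3 y)` and `β`. So
the alternating sum of the forms `f_i^* ν^* ω` vanishes, as `ω` is multiplicative
(`Bar.multiplicative_barForm`).

*Nondegenerate forms.* As `ν` is a submersion, if `ω` is nondegenerate then the kernel of
`Ω = ν^* ω` is that of `ν_*`, and the kernels of `Ω` along `δ_0` and `δ_1` are those of the
projections of `W̄_1 ND = V ×_M H` to `V` and to `H`. The three conditions on a symplectic
2-groupoid become statements about the tangent spaces of `V ×_M H` and `V ×_M D ×_M H`
(`Bar.bijOn_tmap_face_two`, `Bar.bijOn_tmap_face_zero`, `Bar.isInternal_W`).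

*Conversely*, let `Ω` be symplectic (`Bar.nondegenerate_of_isLocalSymplectic`). The kernel of a
multiplicative form is stable under `1_* s_*` and `1_* t_*` and under products
(`LieGroupoid.Multiplicative.tmap_one_src_mem`, `LieGroupoid.Multiplicative.tmap_mul_mem`). The
direct sum condition excludes kernel vectors tangent to `M`, and then those tangent to `V` or `H` at
points of `M`. By right translation there are none tangent to `V` or `H` at all
(`LieGroupoid.Multiplicative.eq_zero_of_tmap_mem`). So a kernel vector `b` of `ω` satisfies
`(s_V)_* b = 0` and `(t_H)_* b = 0`. It lifts to the kernel vector `(0, b, 0)` of `Ω`, which is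
killed by `f_0` and by `f_2`, so it vanishes by the injectivity in the first condition.
-/

universe v w v'

noncomputable section

open SmoothMfd Set Filter
open scoped Topology

/-! ### Germs of smooth maps and their differentials -/

/-- The inverse function theorem, with smoothness of both maps on whole open sets. -/
theorem exists_openPartialHomeomorph_of_hasFDerivAt_equiv {E F : Type*}
    [NormedAddCommGroup E] [NormedSpace ℝ E] [FiniteDimensional ℝ E]
    [NormedAddCommGroup F] [NormedSpace ℝ F]
    {h : E → F} {U : Set E} (hU : IsOpen U) (hh : ContDiffOn ℝ ∞ h U) {a : E} (ha : a ∈ U)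
    {h' : E ≃L[ℝ] F} (hd : HasFDerivAt h (h' : E →L[ℝ] F) a) :
    ∃ e : OpenPartialHomeomorph E F, a ∈ e.source ∧ e.source ⊆ U ∧ (∀ b, e b = h b) ∧
      ContDiffOn ℝ ∞ e.symm e.target := by
  have : CompleteSpace E := FiniteDimensional.complete ℝ E
  have hca : ContDiffAt ℝ ∞ h a := hh.contDiffAt (hU.mem_nhds ha)
  let e₀ := hca.toOpenPartialHomeomorph h hd (by simp)
  have he₀ : ∀ b, e₀ b = h b := fun b => rfl
  have hinv : {b | ∃ g : E ≃L[ℝ] F, (g : E →L[ℝ] F) = fderiv ℝ h b} ∈ 𝓝 a := by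
    have h1 : ContinuousAt (fderiv ℝ h) a :=
      (hh.continuousOn_fderiv_of_isOpen hU (by simp)).continuousAt (hU.mem_nhds ha)
    refine h1.preimage_mem_nhds (t := range ((↑) : (E ≃L[ℝ] F) → E →L[ℝ] F)) ?_
    rw [hd.fderiv]
    exact (ContinuousLinearEquiv.isOpen (𝕜 := ℝ) (E := E) (F := F)).mem_nhds ⟨h', rfl⟩
  obtain ⟨W, hW, hWo, haW⟩ := mem_nhds_iff.1 hinv
  refine ⟨e₀.restr (U ∩ W), ?_, ?_, fun b => rfl, ?_⟩
  · rw [OpenPartialHomeomorph.restr_source, (hU.inter hWo).interior_eq]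
    exact ⟨hca.mem_toOpenPartialHomeomorph_source hd (by simp), ha, haW⟩
  · rw [OpenPartialHomeomorph.restr_source, (hU.inter hWo).interior_eq]
    exact fun b hb => hb.2.1
  · intro b hb
    have hb' : (e₀.restr (U ∩ W)).symm b ∈ (e₀.restr (U ∩ W)).source :=
      (e₀.restr (U ∩ W)).map_target hb
    rw [OpenPartialHomeomorph.restr_source, (hU.inter hWo).interior_eq] at hb'
    obtain ⟨g, hg⟩ := hW hb'.2.2
    have hc : ContDiffAt ℝ ∞ h ((e₀.restr (U ∩ W)).symm b) :=
      hh.contDiffAt (hU.mem_nhds hb'.2.1)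
    refine (OpenPartialHomeomorph.contDiffAt_symm (e₀.restr (U ∩ W)) (f₀' := g) hb ?_
      hc).contDiffWithinAt
    rw [hg]
    exact (hc.differentiableAt (by simp)).hasFDerivAt

namespace SmoothMfd

/-- The Euclidean space `ℝ^k` as a manifold. -/
abbrev euc (k : ℕ) : SmoothMfd.{0} where
  carrier := EuclideanSpace ℝ (Fin k)
  dim := k

/-- The model vector space of `X`; every tangent space of `X` is this space. -/
abbrev Model (X : SmoothMfd.{u}) : Type := EuclideanSpace ℝ (Fin X.dim)

/-- `f` is smooth at `x`. -/
abbrev SmoothAt {X : SmoothMfd.{u}} {Y : SmoothMfd.{v}} (f : X → Y) (x : X) : Prop :=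
  ContMDiffAt (𝓡 X.dim) (𝓡 Y.dim) ∞ f x

/-- The differential of `f` at `x` as a map between the model spaces. Since its type does not
depend on `x`, it is easier to rewrite with than `diff f x`, to which it is equal by
definition. -/
def tmap {X : SmoothMfd.{u}} {Y : SmoothMfd.{v}} (f : X → Y) (x : X) : X.Model →L[ℝ] Y.Model :=
  mfderiv (𝓡 X.dim) (𝓡 Y.dim) f x

variable {X : SmoothMfd.{u}} {Y : SmoothMfd.{v}} {Z : SmoothMfd.{w}}

theorem SmoothAt.mdiff {f : X → Y} {x : X} (hf : SmoothAt f x) :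
    MDifferentiableAt (𝓡 X.dim) (𝓡 Y.dim) f x :=
  ContMDiffAt.mdifferentiableAt hf (by simp)

theorem SmoothAt.congr {f g : X → Y} {x : X} (hf : SmoothAt f x) (h : g =ᶠ[𝓝 x] f) :
    SmoothAt g x := ContMDiffAt.congr_of_eventuallyEq hf h

theorem SmoothAt.comp_of_eq {g : Y → Z} {f : X → Y} {x : X} {y : Y} (hg : SmoothAt g y)
    (hf : SmoothAt f x) (hy : f x = y) : SmoothAt (fun a => g (f a)) x := by
  subst hy
  exact ContMDiffAt.comp x hg hf

theorem tmap_comp {g : Y → Z} {f : X → Y} {x : X} (hg : SmoothAt g (f x)) (hf : SmoothAt f x) :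
    tmap (fun a => g (f a)) x = (tmap g (f x)).comp (tmap f x) :=
  mfderiv_comp x hg.mdiff hf.mdiff

theorem tmap_comp_apply {g : Y → Z} {f : X → Y} {x : X} (hg : SmoothAt g (f x))
    (hf : SmoothAt f x) (a : X.Model) :
    tmap (fun a => g (f a)) x a = tmap g (f x) (tmap f x a) := by
  rw [tmap_comp hg hf]; rfl

theorem tmap_congr {f g : X → Y} {x : X} (h : f =ᶠ[𝓝 x] g) : tmap f x = tmap g x :=
  h.mfderiv_eq

theorem tmap_const (y : Y) (x : X) : tmap (fun _ : X => y) x = 0 := mfderiv_const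

theorem tmap_id (x : X) : tmap (fun a : X => a) x = ContinuousLinearMap.id ℝ X.Model := mfderiv_id

theorem smoothAt_const (y : Y) (x : X) : SmoothAt (fun _ : X => y) x := contMDiffAt_const

theorem smoothAt_id (x : X) : SmoothAt (fun a : X => a) x := contMDiffAt_id

/-- Charts may be composed with diffeomorphisms between open subsets of the model space. -/
theorem trans_mem_maximalAtlas {φ : OpenPartialHomeomorph X X.Model}
    (hφ : φ ∈ IsManifold.maximalAtlas (𝓡 X.dim) ∞ X) {e : OpenPartialHomeomorph X.Model X.Model}
    (he : ContDiffOn ℝ ∞ e e.source) (hes : ContDiffOn ℝ ∞ e.symm e.target) :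
    φ ≫ₕ e ∈ IsManifold.maximalAtlas (𝓡 X.dim) ∞ X := by
  apply OpenPartialHomeomorph.mem_maximalAtlas_of_contMDiffOn
  · intro a ha
    have h1 := contMDiffAt_of_mem_maximalAtlas hφ ha.1
    have h2 : ContMDiffAt 𝓘(ℝ, X.Model) 𝓘(ℝ, X.Model) ∞ e (φ a) :=
      contMDiffAt_iff_contDiffAt.2 (he.contDiffAt (e.open_source.mem_nhds ha.2))
    exact (h2.comp a h1).contMDiffWithinAt
  · intro b hb
    have h1 := contMDiffAt_symm_of_mem_maximalAtlas hφ hb.2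
    have h2 : ContMDiffAt 𝓘(ℝ, X.Model) 𝓘(ℝ, X.Model) ∞ e.symm b :=
      contMDiffAt_iff_contDiffAt.2 (hes.contDiffAt (e.open_target.mem_nhds hb.1))
    exact (h1.comp b h2).contMDiffWithinAt

/-- A smooth map with a smooth local section at each point is a submersion. -/
theorem submersion_of_sections {X Y : SmoothMfd.{u}} {f : X → Y} (hf : Smooth f)
    (hs : ∀ x, ∃ g : Y → X, SmoothAt g (f x) ∧ g (f x) = x ∧ ∀ᶠ y in 𝓝 (f x), f (g y) = y) :
    Submersion f := by
  let F := EuclideanSpace ℝ (Fin (X.dim - Y.dim))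
  refine ⟨F, inferInstance, inferInstance, fun x => ?_⟩
  let φ := chartAt (EuclideanSpace ℝ (Fin X.dim)) x
  let ψ := chartAt (EuclideanSpace ℝ (Fin Y.dim)) (f x)
  have hφ : φ ∈ IsManifold.maximalAtlas (𝓡 X.dim) ∞ X := IsManifold.chart_mem_maximalAtlas x
  have hψ : ψ ∈ IsManifold.maximalAtlas (𝓡 Y.dim) ∞ Y := IsManifold.chart_mem_maximalAtlas (f x)
  have hxφ : x ∈ φ.source := mem_chart_source _ x
  have hxψ : f x ∈ ψ.source := mem_chart_source _ (f x)
  let U : Set X.Model := φ.target ∩ φ.symm ⁻¹' (f ⁻¹' ψ.source)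
  have hfc : Continuous f := hf.continuous
  have hU : IsOpen U := φ.symm.isOpen_inter_preimage (ψ.open_source.preimage hfc)
  have ha : φ x ∈ U := ⟨φ.map_source hxφ, by simp [φ.left_inv hxφ, hxψ]⟩
  -- `k` is `f` in charts; its differential `T` is onto because of the section
  let k : X.Model → Y.Model := fun a => ψ (f (φ.symm a))
  have hk : ContDiffOn ℝ ∞ k U := by
    rw [← contMDiffOn_iff_contDiffOn]
    intro a ha
    have h1 := contMDiffAt_symm_of_mem_maximalAtlas hφ ha.1
    have h2 := contMDiffAt_of_mem_maximalAtlas hψ ha.2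
    exact ((h2.comp _ (hf _)).comp a h1).contMDiffWithinAt
  have hkd : DifferentiableAt ℝ k (φ x) :=
    (hk.contDiffAt (hU.mem_nhds ha)).differentiableAt (by simp)
  let T := fderiv ℝ k (φ x)
  have hT : Function.Surjective T := by
    obtain ⟨g, hg, hgx, hfg⟩ := hs x
    let s : Y.Model → X.Model := fun b => φ (g (ψ.symm b))
    have hs : DifferentiableAt ℝ s (ψ (f x)) := by
      have h1 : ContMDiffAt 𝓘(ℝ, Y.Model) (𝓡 Y.dim) ∞ ψ.symm (ψ (f x)) :=
        contMDiffAt_symm_of_mem_maximalAtlas hψ (ψ.map_source hxψ)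
      have h2 : ContMDiffAt (𝓡 X.dim) 𝓘(ℝ, X.Model) ∞ φ x :=
        contMDiffAt_of_mem_maximalAtlas hφ hxφ
      have h3 := h2.comp_of_eq (ContMDiffAt.comp_of_eq hg h1 (ψ.left_inv hxψ))
        (by simp [ψ.left_inv hxψ, hgx])
      exact (contMDiffAt_iff_contDiffAt.1 h3).differentiableAt (by simp)
    have hsx : s (ψ (f x)) = φ x := by simp [s, ψ.left_inv hxψ, hgx]
    have hks : (fun b => k (s b)) =ᶠ[𝓝 (ψ (f x))] fun b => b := by
      have hc : ContinuousAt (fun b => g (ψ.symm b)) (ψ (f x)) :=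
        ContinuousAt.comp_of_eq hg.continuousAt (ψ.continuousAt_symm (ψ.map_source hxψ))
          (ψ.left_inv hxψ)
      have hmem : ∀ᶠ b in 𝓝 (ψ (f x)), g (ψ.symm b) ∈ φ.source := by
        apply hc.eventually_mem
        rw [ψ.left_inv hxψ, hgx]; exact φ.open_source.mem_nhds hxφ
      have h2 : ∀ᶠ b in 𝓝 (ψ (f x)), f (g (ψ.symm b)) = ψ.symm b := by
        refine (ψ.continuousAt_symm (ψ.map_source hxψ)).eventually (p := fun y => f (g y) = y) ?_
        rwa [ψ.left_inv hxψ]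
      filter_upwards [hmem, h2, ψ.open_target.mem_nhds (ψ.map_source hxψ)] with b hb1 hb2 hb3
      simp only [k, s]
      rw [φ.left_inv hb1, hb2, ψ.right_inv hb3]
    have hcomp : T.comp (fderiv ℝ s (ψ (f x))) = ContinuousLinearMap.id ℝ _ := by
      have h4 := fderiv_fun_comp (ψ (f x)) (by rw [hsx]; exact hkd) hs
      rw [hsx] at h4
      rw [← h4, hks.fderiv_eq, fderiv_fun_id]
    intro b
    exact ⟨fderiv ℝ s (ψ (f x)) b, by
      rw [← ContinuousLinearMap.comp_apply, hcomp]; rfl⟩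
  have hTr : LinearMap.range T.toLinearMap = ⊤ := LinearMap.range_eq_top.2 hT
  have hdim : Module.finrank ℝ (LinearMap.ker T.toLinearMap) = X.dim - Y.dim := by
    have := LinearMap.finrank_range_add_finrank_ker T.toLinearMap
    rw [hTr, finrank_top] at this
    simp at this
    omega
  let κ : LinearMap.ker T.toLinearMap ≃L[ℝ] F :=
    ContinuousLinearEquiv.ofFinrankEq (by rw [hdim]; simp [F])
  -- `P₀` is a projection onto `ker T`, so that `L = (T, κ ∘ P₀)` is an isomorphism
  obtain ⟨P₀, hP₀⟩ := LinearMap.exists_leftInverse_of_injective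
    (LinearMap.ker T.toLinearMap).subtype (by simp)
  let Lm : X.Model →ₗ[ℝ] Y.Model × F := T.toLinearMap.prod (κ.toLinearEquiv.toLinearMap ∘ₗ P₀)
  have hLinj : Function.Injective Lm := by
    rw [injective_iff_map_eq_zero]
    intro a ha
    have h1 : T a = 0 := congrArg Prod.fst ha
    have h2 : κ (P₀ a) = 0 := congrArg Prod.snd ha
    have h3 : P₀ a = 0 := by simpa using h2
    have h4 := LinearMap.congr_fun hP₀ ⟨a, h1⟩
    simp only [LinearMap.comp_apply, Submodule.subtype_apply, LinearMap.id_apply] at h4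
    rw [h3] at h4
    exact (congrArg Subtype.val h4).symm
  have hle : Y.dim ≤ X.dim := by
    have := LinearMap.finrank_le_finrank_of_surjective (f := T.toLinearMap) hT
    simpa using this
  let L : X.Model ≃L[ℝ] Y.Model × F :=
    (LinearEquiv.ofInjectiveOfFinrankEq Lm hLinj (by simp [F]; omega)).toContinuousLinearEquiv
  have hL1 : ∀ a, (L a).1 = T a := fun a => rfl
  -- in the coordinates `h` the map `f` becomes the first component of `L`
  let h : X.Model → X.Model := fun a => L.symm (k a, (L a).2)
  have hh : ContDiffOn ℝ ∞ h U := by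
    refine L.symm.contDiff.comp_contDiffOn (hk.prodMk ?_)
    exact (contDiff_snd.comp L.contDiff).contDiffOn
  have hd : HasFDerivAt h (ContinuousLinearEquiv.refl ℝ X.Model : X.Model →L[ℝ] X.Model)
      (φ x) := by
    have h1 := (L.symm : (Y.Model × F) →L[ℝ] X.Model).hasFDerivAt.comp (φ x)
      (hkd.hasFDerivAt.prodMk
        ((ContinuousLinearMap.snd ℝ Y.Model F).comp (L : X.Model →L[ℝ] _)).hasFDerivAt)
    refine h1.congr_fderiv ?_
    ext1 a
    change L.symm (T a, (L a).2) = a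
    rw [← hL1]
    exact L.symm_apply_apply a
  obtain ⟨e, hxe, heU, heh, hes⟩ := exists_openPartialHomeomorph_of_hasFDerivAt_equiv hU hh ha hd
  refine Manifold.IsSubmersionAtOfComplement.mk_of_charts L (φ ≫ₕ e) ψ
    ⟨hxφ, hxe⟩ hxψ (trans_mem_maximalAtlas hφ ?_ hes) hψ (fun a ha => ?_) ?_
  · exact (hh.mono heU).congr fun b _ => heh b
  · have := (heU ha.2).2
    simpa [φ.left_inv ha.1] using this
  · intro b hb
    have hb' : b ∈ e.target := by
      have : b ∈ (φ ≫ₕ e).target := by simpa using hb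
      exact this.1
    have h1 : h (e.symm b) = b := by rw [← heh, e.right_inv hb']
    have h2 : (L b).1 = k (e.symm b) := by
      conv_lhs => rw [← h1]
      simp [h]
    simpa [k] using h2.symm

/-- A smooth map with a smooth left inverse is an immersion. -/
theorem immersion_of_leftInverse {X Y : SmoothMfd.{u}} {f : X → Y} (hf : Smooth f)
    {g : Y → X} (hg : Smooth g) (hgf : ∀ x, g (f x) = x) :
    Manifold.IsImmersion (𝓡 X.dim) (𝓡 Y.dim) ∞ f := by
  let F := EuclideanSpace ℝ (Fin (Y.dim - X.dim))
  refine ⟨F, inferInstance, inferInstance, fun x => ?_⟩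
  let φ := chartAt (EuclideanSpace ℝ (Fin X.dim)) x
  let ψ := chartAt (EuclideanSpace ℝ (Fin Y.dim)) (f x)
  have hφ : φ ∈ IsManifold.maximalAtlas (𝓡 X.dim) ∞ X := IsManifold.chart_mem_maximalAtlas x
  have hψ : ψ ∈ IsManifold.maximalAtlas (𝓡 Y.dim) ∞ Y := IsManifold.chart_mem_maximalAtlas (f x)
  have hxφ : x ∈ φ.source := mem_chart_source _ x
  have hxψ : f x ∈ ψ.source := mem_chart_source _ (f x)
  -- The set of `b` at which both `R b`, the local expression of `g`, and `S (R b)`, where `S` is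
  -- the local expression of `f`, are defined.
  let U : Set Y.Model := ψ.target ∩ ψ.symm ⁻¹' (g ⁻¹' (φ.source ∩ f ⁻¹' ψ.source))
  have hU : IsOpen U := ψ.symm.isOpen_inter_preimage
    ((φ.open_source.inter (ψ.open_source.preimage hf.continuous)).preimage hg.continuous)
  have ha : ψ (f x) ∈ U := by
    refine ⟨ψ.map_source hxψ, ?_⟩
    simp [ψ.left_inv hxψ, hgf, hxφ, hxψ]
  let R : Y.Model → X.Model := fun b => φ (g (ψ.symm b))
  let SR : Y.Model → Y.Model := fun b => ψ (f (g (ψ.symm b)))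
  have hR : ContDiffOn ℝ ∞ R U := by
    rw [← contMDiffOn_iff_contDiffOn]
    intro b hb
    have h1 := contMDiffAt_symm_of_mem_maximalAtlas hψ hb.1
    have h2 := contMDiffAt_of_mem_maximalAtlas hφ hb.2.1
    exact ((h2.comp _ (hg _)).comp b h1).contMDiffWithinAt
  have hSR : ContDiffOn ℝ ∞ SR U := by
    rw [← contMDiffOn_iff_contDiffOn]
    intro b hb
    have h1 := contMDiffAt_symm_of_mem_maximalAtlas hψ hb.1
    have h2 := contMDiffAt_of_mem_maximalAtlas hψ hb.2.2
    exact (((h2.comp _ (hf _)).comp _ (hg _)).comp b h1).contMDiffWithinAt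
  have hRd : DifferentiableAt ℝ R (ψ (f x)) :=
    (hR.contDiffAt (hU.mem_nhds ha)).differentiableAt (by simp)
  have hSRd : DifferentiableAt ℝ SR (ψ (f x)) :=
    (hSR.contDiffAt (hU.mem_nhds ha)).differentiableAt (by simp)
  let T := fderiv ℝ R (ψ (f x))
  let Q := fderiv ℝ SR (ψ (f x))
  have hRSR : (fun b => R (SR b)) =ᶠ[𝓝 (ψ (f x))] R := by
    filter_upwards [hU.mem_nhds ha] with b hb
    simp only [R, SR]
    rw [ψ.left_inv hb.2.2, hgf]
  have hSRx : SR (ψ (f x)) = ψ (f x) := by simp [SR, ψ.left_inv hxψ, hgf]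
  have hTQ : ∀ b, T (Q b) = T b := by
    intro b
    have h4 := fderiv_fun_comp (ψ (f x)) (g := R) (f := SR) (by rw [hSRx]; exact hRd) hSRd
    rw [hSRx, hRSR.fderiv_eq] at h4
    exact (DFunLike.congr_fun h4 b).symm
  -- `S` is the local expression of `f`; its differential is a right inverse of `T`.
  let S : X.Model → Y.Model := fun a => ψ (f (φ.symm a))
  have hSd : DifferentiableAt ℝ S (φ x) := by
    have h1 : ContMDiffAt 𝓘(ℝ, X.Model) (𝓡 X.dim) ∞ φ.symm (φ x) :=
      contMDiffAt_symm_of_mem_maximalAtlas hφ (φ.map_source hxφ)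
    have h2 : ContMDiffAt (𝓡 Y.dim) 𝓘(ℝ, Y.Model) ∞ ψ (f x) :=
      contMDiffAt_of_mem_maximalAtlas hψ hxψ
    have h3 := h2.comp_of_eq (ContMDiffAt.comp_of_eq (hf x) h1 (φ.left_inv hxφ))
      (by simp [φ.left_inv hxφ])
    exact (contMDiffAt_iff_contDiffAt.1 h3).differentiableAt (by simp)
  have hSx : S (φ x) = ψ (f x) := by simp [S, φ.left_inv hxφ]
  have hTS : ∀ a, T (fderiv ℝ S (φ x) a) = a := by
    intro a
    have h4 := fderiv_fun_comp (φ x) (g := R) (f := S) (by rw [hSx]; exact hRd) hSd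
    have h5 : (fun a => R (S a)) =ᶠ[𝓝 (φ x)] fun a => a := by
      have h6 : ∀ᶠ a in 𝓝 (φ x), φ.symm a ∈ f ⁻¹' ψ.source := by
        apply (φ.continuousAt_symm (φ.map_source hxφ)).eventually_mem
        rw [φ.left_inv hxφ]
        exact (ψ.open_source.preimage hf.continuous).mem_nhds hxψ
      filter_upwards [h6, φ.open_target.mem_nhds (φ.map_source hxφ)] with a h7 h8
      simp only [R, S]
      rw [ψ.left_inv h7, hgf, φ.right_inv h8]
    rw [hSx, h5.fderiv_eq, fderiv_fun_id] at h4
    exact (DFunLike.congr_fun h4 a).symm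
  have hT : Function.Surjective T := fun a => ⟨_, hTS a⟩
  have hTr : LinearMap.range T.toLinearMap = ⊤ := LinearMap.range_eq_top.2 hT
  have hdim : Module.finrank ℝ (LinearMap.ker T.toLinearMap) = Y.dim - X.dim := by
    have := LinearMap.finrank_range_add_finrank_ker T.toLinearMap
    rw [hTr, finrank_top] at this
    simp at this
    omega
  have hle : X.dim ≤ Y.dim := by
    have := LinearMap.finrank_le_finrank_of_surjective (f := T.toLinearMap) hT
    simpa using this
  let κ : LinearMap.ker T.toLinearMap ≃L[ℝ] F :=
    ContinuousLinearEquiv.ofFinrankEq (by rw [hdim]; simp [F])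
  -- The projection to the kernel of `T` along the image of the differential of `f`.
  let P₀ : Y.Model →ₗ[ℝ] LinearMap.ker T.toLinearMap :=
    LinearMap.codRestrict _ (LinearMap.id - (fderiv ℝ S (φ x)).toLinearMap ∘ₗ T.toLinearMap)
      (fun b => by simp [hTS])
  let Lm : Y.Model →ₗ[ℝ] X.Model × F := T.toLinearMap.prod (κ.toLinearEquiv.toLinearMap ∘ₗ P₀)
  have hLinj : Function.Injective Lm := by
    rw [injective_iff_map_eq_zero]
    intro a ha
    have h1 : T a = 0 := congrArg Prod.fst ha
    have h2 : κ (P₀ a) = 0 := congrArg Prod.snd ha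
    have h3 : P₀ a = 0 := by simpa using h2
    have h4 : a - fderiv ℝ S (φ x) (T a) = 0 := congrArg Subtype.val h3
    simpa [h1] using h4
  let L : Y.Model ≃L[ℝ] X.Model × F :=
    (LinearEquiv.ofInjectiveOfFinrankEq Lm hLinj (by simp [F]; omega)).toContinuousLinearEquiv
  -- In the coordinates `h` the map `f` is the inclusion `a ↦ (a, 0)`.
  let h : Y.Model → Y.Model := fun b => L.symm (R b, (L (b - SR b)).2)
  have hh : ContDiffOn ℝ ∞ h U := by
    refine L.symm.contDiff.comp_contDiffOn (hR.prodMk ?_)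
    exact (contDiff_snd.comp L.contDiff).comp_contDiffOn (contDiffOn_id.sub hSR)
  have hSRS : ∀ b, fderiv ℝ S (φ x) (T b) = Q b := by
    intro b
    have hRx : R (ψ (f x)) = φ x := by simp [R, ψ.left_inv hxψ, hgf]
    have h4 := fderiv_fun_comp (ψ (f x)) (g := S) (f := R) (by rw [hRx]; exact hSd) hRd
    have h5 : (fun b => S (R b)) =ᶠ[𝓝 (ψ (f x))] SR := by
      filter_upwards [hU.mem_nhds ha] with b hb
      simp only [R, S, SR]
      rw [φ.left_inv hb.2.1]
    rw [hRx, h5.fderiv_eq] at h4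
    exact (DFunLike.congr_fun h4 b).symm
  have hd : HasFDerivAt h (ContinuousLinearEquiv.refl ℝ Y.Model : Y.Model →L[ℝ] Y.Model)
      (ψ (f x)) := by
    have h1 := (L.symm : (X.Model × F) →L[ℝ] Y.Model).hasFDerivAt.comp (ψ (f x))
      (hRd.hasFDerivAt.prodMk
        (((ContinuousLinearMap.snd ℝ X.Model F).comp (L : Y.Model →L[ℝ] _)).hasFDerivAt.comp
          (ψ (f x)) ((hasFDerivAt_id (ψ (f x))).sub hSRd.hasFDerivAt)))
    refine h1.congr_fderiv ?_
    ext1 b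
    change L.symm (T b, (L (b - Q b)).2) = b
    rw [ContinuousLinearEquiv.symm_apply_eq]
    have h2 : (L (b - Q b)).2 = (L b).2 := by
      change κ (P₀ (b - Q b)) = κ (P₀ b)
      congr 1
      apply Subtype.ext
      change (b - Q b) - fderiv ℝ S (φ x) (T (b - Q b)) = b - fderiv ℝ S (φ x) (T b)
      rw [map_sub, hTQ, sub_self, map_zero, sub_zero, hSRS]
    rw [h2]
    rfl
  obtain ⟨e, hxe, heU, heh, hes⟩ := exists_openPartialHomeomorph_of_hasFDerivAt_equiv hU hh ha hd
  have hVo : IsOpen (f ⁻¹' ψ.source) := ψ.open_source.preimage hf.continuous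
  refine Manifold.IsImmersionAtOfComplement.mk_of_continuousAt hf.continuous.continuousAt
    L.symm (φ.restr (f ⁻¹' ψ.source)) (ψ ≫ₕ e) ⟨hxφ, by rwa [hVo.interior_eq]⟩ ⟨hxψ, hxe⟩
    (restr_mem_maximalAtlas _ hφ hVo)
    (trans_mem_maximalAtlas hψ ((hh.mono heU).congr fun b _ => heh b) hes) ?_
  intro a ha
  have ha' : a ∈ φ.target ∧ f (φ.symm a) ∈ ψ.source := by
    have h1 : a ∈ (φ.restr (f ⁻¹' ψ.source)).target := by simpa using ha
    have h2 := (φ.restr (f ⁻¹' ψ.source)).map_target h1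
    rw [OpenPartialHomeomorph.restr_source, hVo.interior_eq] at h2
    exact ⟨h1.1, h2.2⟩
  have h1 : R (ψ (f (φ.symm a))) = a := by
    simp [R, ψ.left_inv ha'.2, hgf, φ.right_inv ha'.1]
  have h2 : SR (ψ (f (φ.symm a))) = ψ (f (φ.symm a)) := by
    simp [SR, ψ.left_inv ha'.2, hgf]
  have h3 : h (ψ (f (φ.symm a))) = L.symm (a, 0) := by
    simp [h, h1, h2]
  simpa [heh] using h3

end SmoothMfd

namespace SmoothMfd

variable {X : SmoothMfd.{u}} {Y : SmoothMfd.{v}} {Z : SmoothMfd.{w}}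

/-- A submersion is locally a product projection: near `x` there is a map `q` to `ℝ^k` such that
`(f, q)` has a smooth local inverse `Φ`. Here `U` and `W` are the open sets on which the maps are
defined. -/
theorem Submersion.exists_straightening {X Y : SmoothMfd.{u}} {f : X → Y} (hf : Submersion f)
    (x : X) : ∃ (k : ℕ) (q : X → euc k) (Φ : Y × euc k → X) (U : Set X) (W : Set (Y × euc k)),
      Y.dim + k = X.dim ∧ IsOpen U ∧ IsOpen W ∧ x ∈ U ∧
      (∀ a ∈ U, SmoothAt q a ∧ (f a, q a) ∈ W ∧ Φ (f a, q a) = a) ∧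
      (∀ p ∈ W, Φ p ∈ U ∧ f (Φ p) = p.1 ∧ q (Φ p) = p.2) ∧
      ∀ p ∈ W, ContMDiffAt ((𝓡 Y.dim).prod (𝓡 k)) (𝓡 X.dim) ∞ Φ p := by
  obtain ⟨F, _, _, h⟩ := hf
  have hx := h x
  let φ := hx.domChart
  let ψ := hx.codChart
  let e : X.Model ≃L[ℝ] Y.Model × F := hx.equiv
  have hφ : φ ∈ IsManifold.maximalAtlas (𝓡 X.dim) ∞ X := hx.domChart_mem_maximalAtlas
  have hψ : ψ ∈ IsManifold.maximalAtlas (𝓡 Y.dim) ∞ Y := hx.codChart_mem_maximalAtlas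
  have hw : ∀ b ∈ φ.target, ψ (f (φ.symm b)) = (e b).1 := by
    intro b hb
    have := hx.writtenInCharts (show b ∈ (φ.extend (𝓡 X.dim)).target by simpa using hb)
    simpa using this
  have hmaps : ∀ a ∈ φ.source, f a ∈ ψ.source := hx.source_subset_preimage_source
  have : FiniteDimensional ℝ F := by
    have : Function.Surjective ((LinearMap.snd ℝ Y.Model F) ∘ₗ e.toLinearEquiv.toLinearMap) :=
      (LinearMap.snd_surjective (R := ℝ) (M := Y.Model) (M₂ := F)).comp e.surjective
    exact Module.Finite.of_surjective _ this
  let k := Module.finrank ℝ F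
  let κ : F ≃L[ℝ] EuclideanSpace ℝ (Fin k) := ContinuousLinearEquiv.ofFinrankEq (by simp [k])
  have hdim : Y.dim + k = X.dim := by
    have := e.toLinearEquiv.finrank_eq
    simp at this
    omega
  have hwa : ∀ a ∈ φ.source, ψ (f a) = (e (φ a)).1 := by
    intro a ha
    have := hw _ (φ.map_source ha)
    rwa [φ.left_inv ha] at this
  -- `e` identifies the model space of `X` with a product, in such a way that `f` becomes the first
  -- projection; `q` is the second component, and `Φ` puts the two components together
  let W : Set (Y × euc k) :=
    (ψ.source ×ˢ univ) ∩ (fun p => e.symm (ψ p.1, κ.symm p.2)) ⁻¹' φ.target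
  have hc1 : ContinuousOn (fun p : Y × euc k => e.symm (ψ p.1, κ.symm p.2))
      (ψ.source ×ˢ univ) := by
    refine e.symm.continuous.comp_continuousOn (ContinuousOn.prodMk ?_ ?_)
    · exact ψ.continuousOn.comp continuousOn_fst fun p hp => hp.1
    · exact (κ.symm.continuous.comp continuous_snd).continuousOn
  refine ⟨k, fun a => κ (e (φ a)).2, fun p => φ.symm (e.symm (ψ p.1, κ.symm p.2)), φ.source, W,
    hdim, φ.open_source, hc1.isOpen_inter_preimage (ψ.open_source.prod isOpen_univ) φ.open_target,
    hx.mem_domChart_source, ?_, ?_, ?_⟩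
  · intro a ha
    have h1 : e.symm (ψ (f a), κ.symm (κ (e (φ a)).2)) = φ a := by
      rw [hwa a ha, κ.symm_apply_apply]
      exact e.symm_apply_apply _
    refine ⟨?_, ⟨⟨hmaps a ha, mem_univ _⟩, ?_⟩, ?_⟩
    · have h2 := contMDiffAt_of_mem_maximalAtlas hφ ha
      have h3 : ContDiff ℝ ∞ fun b : X.Model => κ (e b).2 :=
        κ.contDiff.comp (contDiff_snd.comp e.contDiff)
      exact h3.contDiffAt.contMDiffAt.comp a h2
    · change e.symm (ψ (f a), κ.symm (κ (e (φ a)).2)) ∈ φ.target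
      rw [h1]; exact φ.map_source ha
    · change φ.symm (e.symm (ψ (f a), κ.symm (κ (e (φ a)).2))) = a
      rw [h1, φ.left_inv ha]
  · rintro ⟨b, c⟩ ⟨hb, hc⟩
    have hc' : e.symm (ψ b, κ.symm c) ∈ φ.target := hc
    refine ⟨φ.map_target hc', ?_, ?_⟩
    · apply ψ.injOn (hmaps _ (φ.map_target hc')) hb.1
      rw [hw _ hc', e.apply_symm_apply]
    · change κ (e (φ (φ.symm (e.symm (ψ b, κ.symm c))))).2 = c
      rw [φ.right_inv hc', e.apply_symm_apply, κ.apply_symm_apply]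
  · rintro ⟨b, c⟩ ⟨hb, hc⟩
    have h1 := contMDiffAt_symm_of_mem_maximalAtlas hφ hc
    have h2 : ContMDiffAt (𝓡 Y.dim) 𝓘(ℝ, Y.Model) ∞ ψ b := contMDiffAt_of_mem_maximalAtlas hψ hb.1
    have h3 : ContMDiffAt ((𝓡 Y.dim).prod (𝓡 k)) 𝓘(ℝ, Y.Model) ∞
        (fun p : Y × euc k => ψ p.1) (b, c) := h2.comp (b, c) contMDiffAt_fst
    have h4 : ContMDiffAt ((𝓡 Y.dim).prod (𝓡 k)) 𝓘(ℝ, F) ∞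
        (fun p : Y × euc k => κ.symm p.2) (b, c) :=
      κ.symm.contDiff.contMDiff.contMDiffAt.comp (b, c) contMDiffAt_snd
    have h5 : ContMDiffAt ((𝓡 Y.dim).prod (𝓡 k)) 𝓘(ℝ, X.Model) ∞
        (fun p : Y × euc k => e.symm (ψ p.1, κ.symm p.2)) (b, c) :=
      e.symm.contDiff.contMDiff.contMDiffAt.comp (b, c) (h3.prodMk_space h4)
    exact h1.comp (b, c) h5

/-- Smooth germs lift through submersions. -/
theorem Submersion.exists_lift {X Y : SmoothMfd.{u}} {f : X → Y} (hf : Submersion f) (x : X)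
    {z : Z} {g : Z → Y} (hg : SmoothAt g z) (hz : g z = f x) :
    ∃ l : Z → X, SmoothAt l z ∧ l z = x ∧ ∀ᶠ ζ in 𝓝 z, f (l ζ) = g ζ := by
  obtain ⟨k, q, Φ, U, W, -, -, hW, hxU, h1, h2, h3⟩ := hf.exists_straightening x
  have hq : ContMDiffAt (𝓡 Z.dim) ((𝓡 Y.dim).prod (𝓡 k)) ∞ (fun ζ => (g ζ, q x)) z :=
    hg.prodMk contMDiffAt_const
  have hxW : (g z, q x) ∈ W := by rw [hz]; exact (h1 x hxU).2.1
  refine ⟨fun ζ => Φ (g ζ, q x), (h3 _ hxW).comp z hq, ?_, ?_⟩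
  · change Φ (g z, q x) = x
    rw [hz]; exact (h1 x hxU).2.2
  · filter_upwards [hq.continuousAt.preimage_mem_nhds (hW.mem_nhds hxW)] with ζ hζ
    exact (h2 _ hζ).2.1

/-- The chain rule for a map on a product of two manifolds. -/
theorem tmap_comp₂ {X' : SmoothMfd.{v'}} {Φ : X × X' → Y} {p : X × X'}
    (hΦ : ContMDiffAt ((𝓡 X.dim).prod (𝓡 X'.dim)) (𝓡 Y.dim) ∞ Φ p)
    {f : Z → X} {g : Z → X'} {z : Z} (hf : SmoothAt f z) (hg : SmoothAt g z)
    (hp : (f z, g z) = p) (c : Z.Model) :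
    tmap (fun ζ => Φ (f ζ, g ζ)) z c =
      (mfderiv ((𝓡 X.dim).prod (𝓡 X'.dim)) (𝓡 Y.dim) Φ p : X.Model × X'.Model →L[ℝ] Y.Model)
        (tmap f z c, tmap g z c) := by
  have h1 := mfderiv_comp_apply_of_eq z (hΦ.mdifferentiableAt (by simp))
    ((hf.prodMk hg).mdifferentiableAt (by simp)) hp c
  rw [mfderiv_prodMk hf.mdiff hg.mdiff] at h1
  exact h1

/-- The standard tangent vector of the line. -/
def vel : (euc 1).Model := EuclideanSpace.single 0 1

/-- The affine curve `t ↦ b + t a` in a Euclidean space. -/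
theorem smoothAt_line {k : ℕ} (a b : EuclideanSpace ℝ (Fin k)) :
    SmoothAt (X := euc 1) (Y := euc k) (fun t => b + t 0 • a) 0 ∧
      tmap (X := euc 1) (Y := euc k) (fun t => b + t 0 • a) 0 vel = a := by
  let A : EuclideanSpace ℝ (Fin 1) →L[ℝ] EuclideanSpace ℝ (Fin k) :=
    (EuclideanSpace.proj (0 : Fin 1)).smulRight a
  have hA : HasFDerivAt (fun t : EuclideanSpace ℝ (Fin 1) => b + t 0 • a) A 0 :=
    (A.hasFDerivAt (x := 0)).const_add b
  refine ⟨?_, ?_⟩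
  · have : ContDiff ℝ ∞ fun t : EuclideanSpace ℝ (Fin 1) => b + t 0 • a :=
      contDiff_const.add A.contDiff
    exact this.contDiffAt.contMDiffAt
  · have h1 : tmap (X := euc 1) (Y := euc k) (fun t => b + t 0 • a) 0 = A :=
      hA.hasMFDerivAt.mfderiv
    rw [h1]
    simp [A, vel]

/-- Every tangent vector is the velocity of a smooth curve. -/
theorem exists_curve (x : X) (a : X.Model) : ∃ c : euc 1 → X, SmoothAt c 0 ∧ c 0 = x ∧
    tmap c 0 vel = a := by
  let φ : OpenPartialHomeomorph X (EuclideanSpace ℝ (Fin X.dim)) := chartAt _ x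
  have hφ : φ ∈ IsManifold.maximalAtlas (𝓡 X.dim) ∞ X := IsManifold.chart_mem_maximalAtlas x
  have hxφ : x ∈ φ.source := mem_chart_source _ x
  have h1 : SmoothAt (Y := euc X.dim) (fun b => φ b) x := contMDiffAt_of_mem_maximalAtlas hφ hxφ
  have h2' : ContMDiffAt (𝓡 X.dim) (𝓡 X.dim) ∞ φ.symm (φ x) :=
    contMDiffAt_symm_of_mem_maximalAtlas hφ (φ.map_source hxφ)
  have h2 : SmoothAt (X := euc X.dim) (Y := X) (fun b => φ.symm b) (φ x) := h2'
  obtain ⟨h3, h4⟩ := smoothAt_line (tmap (Y := euc X.dim) (fun b => φ b) x a) (φ x)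
  have h0 : φ x + (0 : EuclideanSpace ℝ (Fin 1)) 0 •
      tmap (Y := euc X.dim) (fun b => φ b) x a = φ x := by
    simp
  refine ⟨fun t => φ.symm (φ x + t 0 • tmap (Y := euc X.dim) (fun b => φ b) x a),
    SmoothAt.comp_of_eq (Y := euc X.dim) (Z := X) h2 h3 h0, ?_, ?_⟩
  · change φ.symm (φ x + (0 : EuclideanSpace ℝ (Fin 1)) 0 • tmap (Y := euc X.dim) (fun b => φ b) x a) = x
    rw [h0, φ.left_inv hxφ]
  · rw [tmap_comp_apply (g := fun b => φ.symm b) (Y := euc X.dim)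
      (f := fun t : euc 1 => φ x + t 0 • tmap (Y := euc X.dim) (fun b => φ b) x a)
        (by rw [h0]; exact h2) h3, h4, h0,
      ← tmap_comp_apply h2 h1]
    have : (fun a => φ.symm (φ a)) =ᶠ[𝓝 x] fun a => a := by
      filter_upwards [φ.open_source.mem_nhds hxφ] with a ha using φ.left_inv ha
    rw [tmap_congr this, tmap_id]
    rfl

/-- Curves lift through submersions, with prescribed velocity. -/
theorem Submersion.exists_lift_curve {X Y : SmoothMfd.{u}} {f : X → Y} (hf : Submersion f) (x : X)
    {g : euc 1 → Y} (hg : SmoothAt g 0) (hz : g 0 = f x) (a : X.Model)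
    (ha : tmap f x a = tmap g 0 vel) :
    ∃ l : euc 1 → X, SmoothAt l 0 ∧ l 0 = x ∧ (∀ᶠ ζ in 𝓝 0, f (l ζ) = g ζ) ∧
      tmap l 0 vel = a := by
  obtain ⟨k, q, Φ, U, W, -, hU, hW, hxU, h1, h2, h3⟩ := hf.exists_straightening x
  obtain ⟨hq, hxW, hΦx⟩ := h1 x hxU
  obtain ⟨h4, h5⟩ := smoothAt_line (tmap q x a) (q x)
  have h0 : q x + (0 : EuclideanSpace ℝ (Fin 1)) 0 • tmap q x a = q x := by simp
  have hq' : ContMDiffAt (𝓡 1) ((𝓡 Y.dim).prod (𝓡 k)) ∞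
      (fun t : euc 1 => (g t, q x + t 0 • tmap q x a)) 0 := hg.prodMk h4
  have h00 : (g 0, q x + (0 : EuclideanSpace ℝ (Fin 1)) 0 • tmap q x a) = (f x, q x) := by
    rw [hz, h0]
  have hfx : SmoothAt f x := hf.contMDiff x
  refine ⟨fun t => Φ (g t, q x + t 0 • tmap q x a), (h3 _ hxW).comp_of_eq hq' h00, ?_, ?_, ?_⟩
  · change Φ (g 0, q x + (0 : EuclideanSpace ℝ (Fin 1)) 0 • tmap q x a) = x
    rw [h00, hΦx]
  · filter_upwards [hq'.continuousAt.preimage_mem_nhds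
      (by rw [h00]; exact hW.mem_nhds hxW)] with ζ hζ
    exact (h2 _ hζ).2.1
  · -- `Φ ∘ (f, q)` is the identity near `x`, so the differential of `Φ` takes `(f_* a, q_* a)`
    -- to `a`.
    have h6 : MDifferentiableAt ((𝓡 Y.dim).prod (𝓡 k)) (𝓡 X.dim) Φ (f x, q x) :=
      (h3 _ hxW).mdifferentiableAt (by simp)
    have h7 : (fun b => Φ (f b, q b)) =ᶠ[𝓝 x] fun b => b := by
      filter_upwards [hU.mem_nhds hxU] with b hb using (h1 b hb).2.2
    have h8 := tmap_comp₂ (h3 _ hxW) hfx hq rfl a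
    rw [tmap_congr h7, tmap_id] at h8
    have h9 := tmap_comp₂ (h3 _ hxW) hg h4 h00 vel
    rw [h5, ← ha, ← h8] at h9
    exact h9

end SmoothMfd

/-! ### Families of maps which embed a manifold into a product -/

/-- The family `c` of smooth maps embeds the manifold `X` into the product of the `A i`. -/
structure Embeds {X : SmoothMfd.{u}} {ι : Type*} {A : ι → SmoothMfd.{u}} (c : ∀ i, X → A i) :
    Prop where
  smooth : ∀ i, Smooth (c i)
  isEmbedding : Topology.IsEmbedding (fun x i => c i x : X → ∀ i, A i)
  immersive : ∀ (x : X) (a : X.Model), (∀ i, tmap (c i) x a = 0) → a = 0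

theorem EmbeddedStructure.embeds {S : Type u} {ι : Type*} {A : ι → SmoothMfd.{u}}
    {pr : ∀ i, S → A i} (σ : EmbeddedStructure pr) : Embeds (X := σ.mfd) pr where
  smooth := σ.contMDiff_pr
  isEmbedding := σ.isEmbedding
  immersive := σ.immersive

namespace Embeds

variable {X : SmoothMfd.{u}} {Z : SmoothMfd.{w}} {ι : Type*} {A : ι → SmoothMfd.{u}}
  {c : ∀ i, X → A i}

theorem injective (hc : Embeds c) {x y : X} (h : ∀ i, c i x = c i y) : x = y :=
  hc.isEmbedding.injective (funext h)

theorem continuousAt (hc : Embeds c) {T : Type*} [TopologicalSpace T] {f : T → X} {t : T}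
    (hf : ∀ i, ContinuousAt (fun s => c i (f s)) t) : ContinuousAt f t := by
  rw [hc.isEmbedding.isInducing.continuousAt_iff]
  exact continuousAt_pi.2 hf

/-- A map to `X` is smooth as soon as its coordinates are. -/
theorem smoothAt [Finite ι] (hc : Embeds c) {f : Z → X} {z : Z}
    (hf : ∀ i, SmoothAt (fun ζ => c i (f ζ)) z) : SmoothAt f z := by
  have := Fintype.ofFinite ι
  have hfc : ContinuousAt f z := hc.continuousAt fun i => (hf i).continuousAt
  let x := f z
  let φ : OpenPartialHomeomorph X (EuclideanSpace ℝ (Fin X.dim)) := chartAt _ x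
  have hφ : φ ∈ IsManifold.maximalAtlas (𝓡 X.dim) ∞ X := IsManifold.chart_mem_maximalAtlas x
  have hxφ : x ∈ φ.source := mem_chart_source _ x
  let ψ : ∀ i, OpenPartialHomeomorph (A i) (EuclideanSpace ℝ (Fin (A i).dim)) :=
    fun i => chartAt _ (c i x)
  have hψ : ∀ i, ψ i ∈ IsManifold.maximalAtlas (𝓡 (A i).dim) ∞ (A i) :=
    fun i => IsManifold.chart_mem_maximalAtlas (c i x)
  have hxψ : ∀ i, c i x ∈ (ψ i).source := fun i => mem_chart_source _ (c i x)
  -- The local expression of the embedding; its differential has a left inverse `L`.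
  let F : X.Model → ∀ i, (A i).Model := fun b i => ψ i (c i (φ.symm b))
  have hφs : ContMDiffAt 𝓘(ℝ, X.Model) (𝓡 X.dim) ∞ φ.symm (φ x) :=
    contMDiffAt_symm_of_mem_maximalAtlas hφ (φ.map_source hxφ)
  have hF : ContDiffAt ℝ ∞ F (φ x) := by
    rw [contDiffAt_pi]
    intro i
    have h2 : ContMDiffAt (𝓡 (A i).dim) 𝓘(ℝ, (A i).Model) ∞ (ψ i) (c i x) :=
      contMDiffAt_of_mem_maximalAtlas (hψ i) (hxψ i)
    have h3 := h2.comp_of_eq (ContMDiffAt.comp_of_eq (hc.smooth i x) hφs (φ.left_inv hxφ))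
      (by simp [φ.left_inv hxφ])
    exact contMDiffAt_iff_contDiffAt.1 h3
  have hFd : DifferentiableAt ℝ F (φ x) := hF.differentiableAt (by simp)
  have hinj : Function.Injective (fderiv ℝ F (φ x)) := by
    rw [injective_iff_map_eq_zero]
    intro b hb
    have h1 : SmoothAt (X := euc X.dim) (Y := X) (fun b => φ.symm b) (φ x) := hφs
    have hleft : φ.symm (φ x) = x := φ.left_inv hxφ
    -- `φ.symm` has injective differential
    have h2 : tmap (X := euc X.dim) (Y := X) (fun b => φ.symm b) (φ x) b = 0 := by
      apply hc.immersive (φ.symm (φ x))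
      intro i
      have hci : SmoothAt (c i) (φ.symm (φ x)) := hc.smooth i _
      rw [← tmap_comp_apply (X := euc X.dim) (g := c i) (f := fun b => φ.symm b) hci h1]
      have hψi : ContMDiffAt (𝓡 (A i).dim) 𝓘(ℝ, (A i).Model) ∞ (ψ i) (c i (φ.symm (φ x))) := by
        rw [hleft]; exact contMDiffAt_of_mem_maximalAtlas (hψ i) (hxψ i)
      have h3 : fderiv ℝ (fun b => F b i) (φ x) b = 0 := by
        rw [fderiv_apply hFd i]
        simp [hb]
      have hcs : SmoothAt (X := euc X.dim) (fun b => c i (φ.symm b)) (φ x) :=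
        SmoothAt.comp_of_eq (Y := X) (hc.smooth i _) h1 rfl
      have h4 : tmap (X := euc X.dim) (Y := euc (A i).dim) (fun b => F b i) (φ x) b = 0 := by
        have : tmap (X := euc X.dim) (Y := euc (A i).dim) (fun b => F b i) (φ x) =
          fderiv ℝ (fun b => F b i) (φ x) := mfderiv_eq_fderiv
        rw [this]; exact h3
      have hψs' : ContMDiffAt (𝓡 (A i).dim) (𝓡 (A i).dim) ∞ (ψ i).symm
          (F (φ x) i) := contMDiffAt_symm_of_mem_maximalAtlas (hψ i)
            ((ψ i).map_source (by rw [hleft]; exact hxψ i))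
      have hψs : SmoothAt (X := euc (A i).dim) (Y := A i) (fun b => (ψ i).symm b)
          (F (φ x) i) := hψs'
      have hFi : SmoothAt (X := euc X.dim) (Y := euc (A i).dim) (fun b => F b i) (φ x) :=
        (contDiffAt_pi.1 hF i).contMDiffAt
      have h5 : (fun b => c i (φ.symm b)) =ᶠ[𝓝 (φ x)] fun b => (ψ i).symm (F b i) := by
        have : ∀ᶠ b in 𝓝 (φ x), c i (φ.symm b) ∈ (ψ i).source := by
          apply hcs.continuousAt.eventually_mem
          rw [hleft]; exact (ψ i).open_source.mem_nhds (hxψ i)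
        filter_upwards [this] with b hb
        exact ((ψ i).left_inv hb).symm
      rw [tmap_congr (X := euc X.dim) h5, tmap_comp_apply (X := euc X.dim) (Y := euc (A i).dim)
        (g := fun b => (ψ i).symm b) (f := fun b => F b i) hψs hFi, h4, map_zero]
    have h6 : ContMDiffAt (𝓡 X.dim) (𝓡 X.dim) ∞ φ (φ.symm (φ x)) := by
      rw [hleft]; exact contMDiffAt_of_mem_maximalAtlas hφ hxφ
    have h7 : SmoothAt (Y := euc X.dim) (fun b => φ b) (φ.symm (φ x)) := h6
    have h8 : (fun b => φ (φ.symm b)) =ᶠ[𝓝 (φ x)] fun b => b := by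
      filter_upwards [φ.open_target.mem_nhds (φ.map_source hxφ)] with b hb using φ.right_inv hb
    have h9 := tmap_comp_apply (X := euc X.dim) (Y := X) (Z := euc X.dim)
      (g := fun b => φ b) (f := fun b => φ.symm b) h7 h1 b
    rw [h2, map_zero, tmap_congr (X := euc X.dim) (Y := euc X.dim) h8, tmap_id] at h9
    exact h9
  obtain ⟨L₀, hL₀⟩ := LinearMap.exists_leftInverse_of_injective
    (fderiv ℝ F (φ x)).toLinearMap (LinearMap.ker_eq_bot.2 hinj)
  let L : (∀ i, (A i).Model) →L[ℝ] X.Model := LinearMap.toContinuousLinearMap L₀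
  have hLF : ContDiffAt ℝ ∞ (fun b => L (F b)) (φ x) := L.contDiff.contDiffAt.comp _ hF
  have hd : HasFDerivAt (fun b => L (F b))
      (ContinuousLinearEquiv.refl ℝ X.Model : X.Model →L[ℝ] X.Model) (φ x) := by
    refine (L.hasFDerivAt.comp (φ x) hFd.hasFDerivAt).congr_fderiv ?_
    ext1 b
    exact LinearMap.congr_fun hL₀ b
  -- `L ∘ F` has a smooth local inverse `k`, and `f` is `φ.symm ∘ k ∘ L` of the coordinates of `f`
  let k := hLF.localInverse hd (by simp)
  have hk : ContDiffAt ℝ ∞ k (L (F (φ x))) := hLF.to_localInverse hd (by simp)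
  have hkl : ∀ᶠ b in 𝓝 (φ x), k (L (F b)) = b :=
    (hLF.hasStrictFDerivAt' hd (by simp)).eventually_left_inverse
  have hG : ContMDiffAt (𝓡 Z.dim) 𝓘(ℝ, ∀ i, (A i).Model) ∞ (fun ζ i => ψ i (c i (f ζ))) z := by
    rw [contMDiffAt_pi_space]
    intro i
    have h2 : ContMDiffAt (𝓡 (A i).dim) 𝓘(ℝ, (A i).Model) ∞ (ψ i) (c i (f z)) :=
      contMDiffAt_of_mem_maximalAtlas (hψ i) (hxψ i)
    exact h2.comp z (hf i)
  have hFx : F (φ x) = fun i => ψ i (c i (f z)) := by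
    funext i
    simp only [F, φ.left_inv hxφ, x]
  have hk' : ContDiffAt ℝ ∞ (fun p => k (L p)) (fun i => ψ i (c i (f z))) := by
    rw [← hFx]
    exact hk.comp _ L.contDiff.contDiffAt
  have h1 : ContMDiffAt (𝓡 Z.dim) 𝓘(ℝ, X.Model) ∞
      (fun ζ => k (L (fun i => ψ i (c i (f ζ))))) z :=
    ContMDiffAt.comp (g := fun p => k (L p)) z hk'.contMDiffAt hG
  have hmem : ∀ᶠ ζ in 𝓝 z, f ζ ∈ φ.source := hfc.eventually_mem (φ.open_source.mem_nhds hxφ)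
  have h2 : ∀ᶠ ζ in 𝓝 z, k (L (F (φ (f ζ)))) = φ (f ζ) :=
    (ContinuousAt.comp (φ.continuousAt hxφ) hfc).eventually hkl
  have h3 : f =ᶠ[𝓝 z] fun ζ => φ.symm (k (L (fun i => ψ i (c i (f ζ))))) := by
    filter_upwards [hmem, h2] with ζ h3 h4
    have : F (φ (f ζ)) = fun i => ψ i (c i (f ζ)) := by
      funext i
      simp only [F, φ.left_inv h3]
    rw [← this, h4, φ.left_inv h3]
  have h4 : k (L (fun i => ψ i (c i (f z)))) = φ x := by
    rw [← hFx]; exact hkl.self_of_nhds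
  exact ContMDiffAt.congr_of_eventuallyEq (hφs.comp_of_eq h1 h4) h3

end Embeds

/-! ### Construction of embedded submanifolds -/

/-- A set `S` embedded topologically into a product of manifolds is an embedded submanifold as
soon as it is covered by charts `χ` such that the coordinates of the inverse of `χ` are smooth and
immersive, and such that `χ` is smooth along maps whose coordinates are smooth. -/
theorem nonempty_embeddedStructure_of_charts {S : Type u} [t : TopologicalSpace S] {ι : Type*}
    {A : ι → SmoothMfd.{u}} {pr : ∀ i, S → A i}
    (hpr : Topology.IsEmbedding (fun x i => pr i x : S → ∀ i, A i)) (d : ℕ)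
    (H : ∀ s : S, ∃ χ : OpenPartialHomeomorph S (EuclideanSpace ℝ (Fin d)), s ∈ χ.source ∧
      (∀ b ∈ χ.target, ∀ i, SmoothAt (X := euc d) (fun b => pr i (χ.symm b)) b) ∧
      (∀ (f : euc d → S) (z : euc d), ContinuousAt f z → f z ∈ χ.source →
        (∀ i, SmoothAt (fun ζ => pr i (f ζ)) z) →
        SmoothAt (Y := euc d) (fun ζ => χ (f ζ)) z) ∧
      (∀ b ∈ χ.target, ∀ a : (euc d).Model,
        (∀ i, tmap (X := euc d) (fun b => pr i (χ.symm b)) b a = 0) → a = 0)) :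
    Nonempty (EmbeddedStructure pr) := by
  choose χ hmem hsymm hχ himm using H
  let _ : ChartedSpace (EuclideanSpace ℝ (Fin d)) S :=
    { atlas := range χ
      chartAt := χ
      mem_chart_source := hmem
      chart_mem_atlas := fun s => mem_range_self s }
  have hM : IsManifold (𝓡 d) ∞ S := by
    apply isManifold_of_contDiffOn
    rintro _ _ ⟨s, rfl⟩ ⟨s', rfl⟩
    intro b hb
    have hb' : b ∈ ((χ s).symm ≫ₕ χ s').source := by simpa using hb
    -- the coordinates of `(χ s).symm` are smooth, so `χ s'` is smooth along it
    have h1 : SmoothAt (X := euc d) (Y := euc d) (fun b => χ s' ((χ s).symm b)) b :=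
      hχ s' (fun b => (χ s).symm b) b ((χ s).continuousAt_symm hb'.1) hb'.2 (hsymm s b hb'.1)
    have h2 : ContDiffAt ℝ ∞ (fun b => χ s' ((χ s).symm b)) b := contMDiffAt_iff_contDiffAt.1 h1
    exact h2.contDiffWithinAt
  refine ⟨{ top := t, isEmbedding := hpr, dim := d, charted := inferInstance, isManifold := hM,
            contMDiff_pr := ?_, immersive := ?_ }⟩
  · intro i s
    have h1 : ContMDiffAt (𝓡 d) (𝓡 d) ∞ (χ s) s :=
      contMDiffAt_of_mem_maximalAtlas (IsManifold.chart_mem_maximalAtlas s) (hmem s)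
    have h2 : ContMDiffAt (𝓡 d) (𝓡 (A i).dim) ∞ (fun b => pr i ((χ s).symm b)) (χ s s) :=
      hsymm s _ ((χ s).map_source (hmem s)) i
    refine (ContMDiffAt.comp s h2 h1).congr_of_eventuallyEq ?_
    filter_upwards [(χ s).open_source.mem_nhds (hmem s)] with s' hs'
    simp [(χ s).left_inv hs']
  · intro s (a : EuclideanSpace ℝ (Fin d)) ha
    let S' : SmoothMfd.{u} := { carrier := S, dim := d }
    have h0 := (χ s).map_source (hmem s)
    have h1' : ContMDiffAt (𝓡 d) (𝓡 d) ∞ (χ s) s :=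
      contMDiffAt_of_mem_maximalAtlas (IsManifold.chart_mem_maximalAtlas s) (hmem s)
    have h1 : SmoothAt (X := S') (Y := euc d) (fun x => χ s x) s := h1'
    have h2' : ContMDiffAt (𝓡 d) (𝓡 d) ∞ (χ s).symm (χ s s) :=
      contMDiffAt_symm_of_mem_maximalAtlas (IsManifold.chart_mem_maximalAtlas s) h0
    have h2 : SmoothAt (X := euc d) (Y := S') (fun b => (χ s).symm b) (χ s s) := h2'
    have h3 : (fun x => (χ s).symm (χ s x)) =ᶠ[𝓝 s] fun x => x := by
      filter_upwards [(χ s).open_source.mem_nhds (hmem s)] with x hx using (χ s).left_inv hx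
    -- `a` is killed by the chart, since the inverse of the chart is immersive
    have h4 : tmap (X := S') (Y := euc d) (fun x => χ s x) s a = 0 := by
      apply himm s _ h0
      intro i
      have h5 : (fun x => pr i ((χ s).symm (χ s x))) =ᶠ[𝓝 s] pr i := by
        filter_upwards [(χ s).open_source.mem_nhds (hmem s)] with x hx
        rw [(χ s).left_inv hx]
      rw [← tmap_comp_apply (X := S') (Y := euc d) (g := fun b => pr i ((χ s).symm b))
        (f := fun x => χ s x) (hsymm s _ h0 i) h1, tmap_congr (X := S') h5]
      exact ha i
    have h6 := tmap_comp_apply (X := S') (Y := euc d) (Z := S') (g := fun b => (χ s).symm b)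
      (f := fun x => χ s x) h2 h1 a
    rw [h4, map_zero, tmap_congr (X := S') (Y := S') h3, tmap_id] at h6
    exact h6

/-- A bijection of `S` with a manifold which is embedded by the corresponding coordinates makes
`S` an embedded submanifold. -/
theorem Embeds.nonempty_embeddedStructure {X : SmoothMfd.{u}} {S : Type u} (e : S ≃ X) {ι : Type*}
    [Finite ι] {A : ι → SmoothMfd.{u}} {pr : ∀ i, S → A i} (h : Embeds fun i x => pr i (e.symm x)) :
    Nonempty (EmbeddedStructure pr) := by
  let _ : TopologicalSpace S := TopologicalSpace.induced e inferInstance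
  -- the charts of `S` are those of `X`, transported along `e`
  let E : S ≃ₜ X := e.toHomeomorphOfIsInducing ⟨rfl⟩
  have hE : ∀ x, E x = e x := fun x => rfl
  have hEs : ∀ x, E.symm x = e.symm x := fun x => rfl
  refine nonempty_embeddedStructure_of_charts ?_ X.dim fun s => ?_
  · have : (fun x i => pr i x : S → ∀ i, A i) = (fun x i => pr i (e.symm x)) ∘ E := by
      funext x i; simp [hE]
    rw [this]
    exact h.isEmbedding.comp E.isEmbedding
  · let φ : OpenPartialHomeomorph X (EuclideanSpace ℝ (Fin X.dim)) := chartAt _ (e s)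
    have hφ : φ ∈ IsManifold.maximalAtlas (𝓡 X.dim) ∞ X := IsManifold.chart_mem_maximalAtlas (e s)
    have hs : ∀ b ∈ φ.target, SmoothAt (X := euc X.dim) (Y := X) (fun b => φ.symm b) b := by
      intro b hb
      have : ContMDiffAt (𝓡 X.dim) (𝓡 X.dim) ∞ φ.symm b :=
        contMDiffAt_symm_of_mem_maximalAtlas hφ hb
      exact this
    refine ⟨E.toOpenPartialHomeomorph ≫ₕ φ, ?_, ?_, ?_, ?_⟩
    · simp [hE, φ]
    · intro b hb i
      have hb' : b ∈ φ.target := by simpa using hb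
      exact SmoothAt.comp_of_eq (Y := X) (h.smooth i _) (hs b hb') rfl
    · intro f z hf hz hpr
      have h1 : SmoothAt (X := euc X.dim) (fun ζ => e (f ζ)) z := by
        apply h.smoothAt
        simpa using hpr
      have hz' : e (f z) ∈ φ.source := by simpa [hE] using hz
      have h2' : ContMDiffAt (𝓡 X.dim) (𝓡 X.dim) ∞ φ (e (f z)) :=
        contMDiffAt_of_mem_maximalAtlas hφ hz'
      have h2 : SmoothAt (Y := euc X.dim) (fun b => φ b) (e (f z)) := h2'
      exact SmoothAt.comp_of_eq (X := euc X.dim) h2 h1 rfl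
    · intro b hb a ha
      have hb' : b ∈ φ.target := by simpa using hb
      have h2 : tmap (X := euc X.dim) (Y := X) (fun b => φ.symm b) b a = 0 := by
        apply h.immersive (φ.symm b)
        intro i
        rw [← tmap_comp_apply (X := euc X.dim) (g := fun x => pr i (e.symm x))
          (f := fun b => φ.symm b) (h.smooth i _) (hs b hb')]
        exact ha i
      have h7' : ContMDiffAt (𝓡 X.dim) (𝓡 X.dim) ∞ φ (φ.symm b) :=
        contMDiffAt_of_mem_maximalAtlas hφ (φ.map_target hb')
      have h7 : SmoothAt (Y := euc X.dim) (fun b => φ b) (φ.symm b) := h7'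
      have h8 : (fun b => φ (φ.symm b)) =ᶠ[𝓝 b] fun b => b := by
        filter_upwards [φ.open_target.mem_nhds hb'] with b hb using φ.right_inv hb
      have h9 := tmap_comp_apply (X := euc X.dim) (Y := X) (Z := euc X.dim)
        (g := fun b => φ b) (f := fun b => φ.symm b) h7 (hs b hb') a
      rw [h2, map_zero, tmap_congr (X := euc X.dim) (Y := euc X.dim) h8, tmap_id] at h9
      exact h9

variable {X Y Z : SmoothMfd.{u}}

theorem isEmbedding_fiberProj (f : X → Z) (g : Y → Z) :
    Topology.IsEmbedding (fun x i => fiberProj f g i x : FiberProduct f g → ∀ i, pairFamily X Y i) := by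
  have hJ : Continuous (fun x i => fiberProj f g i x : FiberProduct f g → ∀ i, pairFamily X Y i) := by
    refine continuous_pi fun i => ?_
    cases i
    · exact continuous_fst.comp continuous_subtype_val
    · exact continuous_snd.comp continuous_subtype_val
  let π : (∀ i, pairFamily X Y i) → X × Y := fun a => (a false, a true)
  have hπ : Continuous π := (continuous_apply false).prodMk (continuous_apply true)
  exact Topology.IsEmbedding.of_comp hJ hπ Topology.IsEmbedding.subtypeVal

/-- The fiber product of a submersion and a smooth map is an embedded submanifold. If `q` is a
complementary coordinate for the submersion `f : X → Z` and `ψ` is a chart of `Y`, then `(ψ, q)`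
is a chart of the fiber product. -/
theorem nonempty_fiberProductStructure {f : X → Z} {g : Y → Z} (hf : Submersion f)
    (hg : Smooth g) : Nonempty (FiberProductStructure f g) := by
  classical
  refine nonempty_embeddedStructure_of_charts (isEmbedding_fiberProj f g)
    (Y.dim + (X.dim - Z.dim)) fun s => ?_
  obtain ⟨k, q, Φ, U, W, hk, hU, hW, hxU, h1, h2, h3⟩ := hf.exists_straightening s.1.1
  obtain rfl : k = X.dim - Z.dim := by omega
  let d := Y.dim + (X.dim - Z.dim)
  let ψ : OpenPartialHomeomorph Y (EuclideanSpace ℝ (Fin Y.dim)) := chartAt _ s.1.2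
  have hψ : ψ ∈ IsManifold.maximalAtlas (𝓡 Y.dim) ∞ Y := IsManifold.chart_mem_maximalAtlas s.1.2
  let E := EuclideanSpace ℝ (Fin (X.dim - Z.dim))
  let L : EuclideanSpace ℝ (Fin d) ≃L[ℝ] Y.Model × E :=
    ContinuousLinearEquiv.ofFinrankEq (by simp [d, E])
  -- the components of the inverse chart
  let y : EuclideanSpace ℝ (Fin d) → Y := fun b => ψ.symm (L b).1
  let p : EuclideanSpace ℝ (Fin d) → Z × E := fun b => (g (y b), (L b).2)
  let T : Set (EuclideanSpace ℝ (Fin d)) := (fun b => (L b).1) ⁻¹' ψ.target ∩ p ⁻¹' W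
  have hT0 : IsOpen ((fun b => (L b).1) ⁻¹' ψ.target) :=
    ψ.open_target.preimage (continuous_fst.comp L.continuous)
  have hys : ∀ b, (L b).1 ∈ ψ.target → SmoothAt (X := euc d) y b := by
    intro b hb
    have h4 : ContMDiffAt 𝓘(ℝ, Y.Model) (𝓡 Y.dim) ∞ ψ.symm (L b).1 :=
      contMDiffAt_symm_of_mem_maximalAtlas hψ hb
    have h5 : ContMDiffAt 𝓘(ℝ, EuclideanSpace ℝ (Fin d)) 𝓘(ℝ, Y.Model) ∞ (fun b => (L b).1) b :=
      (contDiff_fst.comp L.contDiff).contMDiff.contMDiffAt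
    exact ContMDiffAt.comp b h4 h5
  have hps : ∀ b, (L b).1 ∈ ψ.target →
      ContMDiffAt (𝓡 d) ((𝓡 Z.dim).prod (𝓡 (X.dim - Z.dim))) ∞ p b := by
    intro b hb
    have h5 : ContDiff ℝ ∞ fun b => (L b).2 := contDiff_snd.comp L.contDiff
    exact ((hg _).comp b (hys b hb)).prodMk h5.contMDiff.contMDiffAt
  have hT : IsOpen T := by
    refine ContinuousOn.isOpen_inter_preimage (fun b hb => ?_) hT0 hW
    exact (hps b hb).continuousAt.continuousWithinAt
  have hΦs : ∀ b ∈ T, SmoothAt (X := euc d) (fun b => Φ (p b)) b := fun b hb =>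
    (h3 _ hb.2).comp b (hps b hb.1)
  have hmem : ∀ b ∈ T, f (Φ (p b)) = g (y b) := fun b hb => (h2 _ hb.2).2.1
  -- the inverse chart; its value outside `T` is irrelevant
  let inv : EuclideanSpace ℝ (Fin d) → FiberProduct f g := fun b =>
    if h : f (Φ (p b)) = g (y b) then ⟨(Φ (p b), y b), h⟩ else s
  have hinv : ∀ b ∈ T, (inv b).1 = (Φ (p b), y b) := by
    intro b hb
    simp only [inv, dif_pos (hmem b hb)]
  have hinv' : ∀ b ∈ T, ∀ᶠ b' in 𝓝 b, (inv b').1 = (Φ (p b'), y b') := fun b hb =>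
    Filter.mem_of_superset (hT.mem_nhds hb) hinv
  let χ : OpenPartialHomeomorph (FiberProduct f g) (EuclideanSpace ℝ (Fin d)) :=
    { toFun := fun a => L.symm (ψ a.1.2, q a.1.1)
      invFun := inv
      source := {a | a.1.1 ∈ U ∧ a.1.2 ∈ ψ.source}
      target := T
      map_source' := by
        rintro a ⟨ha1, ha2⟩
        have hy : y (L.symm (ψ a.1.2, q a.1.1)) = a.1.2 := by simp [y, ψ.left_inv ha2]
        refine ⟨by simpa using ψ.map_source ha2, ?_⟩
        change (g (y (L.symm (ψ a.1.2, q a.1.1))), (L (L.symm (ψ a.1.2, q a.1.1))).2) ∈ W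
        rw [hy, L.apply_symm_apply, ← a.2]
        exact (h1 _ ha1).2.1
      map_target' := by
        intro b hb
        change (inv b).1.1 ∈ U ∧ (inv b).1.2 ∈ ψ.source
        rw [hinv b hb]
        exact ⟨(h2 _ hb.2).1, ψ.map_target hb.1⟩
      left_inv' := by
        rintro a ⟨ha1, ha2⟩
        have hy : y (L.symm (ψ a.1.2, q a.1.1)) = a.1.2 := by simp [y, ψ.left_inv ha2]
        have hp : p (L.symm (ψ a.1.2, q a.1.1)) = (f a.1.1, q a.1.1) := by
          simp only [p, hy, L.apply_symm_apply, a.2]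
        have hb : L.symm (ψ a.1.2, q a.1.1) ∈ T :=
          ⟨by simpa using ψ.map_source ha2, by
            change p _ ∈ W
            rw [hp]; exact (h1 _ ha1).2.1⟩
        apply Subtype.ext
        rw [hinv _ hb, hp, hy, (h1 _ ha1).2.2]
      right_inv' := by
        intro b hb
        have h4 := (h2 _ hb.2).2.2
        change L.symm (ψ (inv b).1.2, q (inv b).1.1) = b
        rw [hinv b hb, L.symm_apply_eq]
        exact Prod.ext (ψ.right_inv hb.1) h4
      open_source := (hU.preimage (continuous_fst.comp continuous_subtype_val)).inter
        (ψ.open_source.preimage (continuous_snd.comp continuous_subtype_val))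
      open_target := hT
      continuousOn_toFun := by
        refine L.symm.continuous.comp_continuousOn (ContinuousOn.prodMk ?_ ?_)
        · exact ψ.continuousOn.comp (continuous_snd.comp continuous_subtype_val).continuousOn
            fun a ha => ha.2
        · intro a ha
          exact (ContinuousAt.comp (g := q) (f := fun a : FiberProduct f g => a.1.1)
            (h1 _ ha.1).1.continuousAt
            (continuous_fst.comp continuous_subtype_val).continuousAt).continuousWithinAt
      continuousOn_invFun := by
        intro b hb
        refine ContinuousAt.continuousWithinAt ?_
        rw [Topology.IsEmbedding.subtypeVal.isInducing.continuousAt_iff]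
        refine ContinuousAt.congr_of_eventuallyEq ?_ (hinv' b hb)
        exact (hΦs b hb).continuousAt.prodMk (hys b hb.1).continuousAt }
  refine ⟨χ, ⟨hxU, mem_chart_source _ s.1.2⟩, ?_, ?_, ?_⟩
  · intro b hb i
    cases i
    · refine SmoothAt.congr (X := euc d) (Y := X) (hΦs b hb) ?_
      filter_upwards [hinv' b hb] with b' hb'
      exact congrArg Prod.fst hb'
    · refine SmoothAt.congr (X := euc d) (Y := Y) (hys b hb.1) ?_
      filter_upwards [hinv' b hb] with b' hb'
      exact congrArg Prod.snd hb'
  · intro c z hc hz hpr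
    have hx : SmoothAt (X := euc d) (Y := X) (fun ζ => (c ζ).1.1) z := hpr false
    have hy : SmoothAt (X := euc d) (Y := Y) (fun ζ => (c ζ).1.2) z := hpr true
    have h4 : ContMDiffAt (𝓡 d) 𝓘(ℝ, E) ∞ (fun ζ => q (c ζ).1.1) z :=
      ContMDiffAt.comp (g := q) (f := fun ζ => (c ζ).1.1) z (h1 _ hz.1).1 hx
    have h5 : ContMDiffAt (𝓡 Y.dim) 𝓘(ℝ, Y.Model) ∞ ψ (c z).1.2 :=
      contMDiffAt_of_mem_maximalAtlas hψ hz.2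
    have h6 : ContMDiffAt (𝓡 d) 𝓘(ℝ, Y.Model) ∞ (fun ζ => ψ (c ζ).1.2) z :=
      ContMDiffAt.comp (g := ψ) (f := fun ζ => (c ζ).1.2) z h5 hy
    exact ContMDiffAt.comp (g := fun v : Y.Model × E => L.symm v) z
      L.symm.contDiff.contMDiff.contMDiffAt (h6.prodMk_space h4)
  · intro b hb a ha
    have hx : tmap (X := euc d) (Y := X) (fun b => (inv b).1.1) b a = 0 := ha false
    have hy : tmap (X := euc d) (Y := Y) (fun b => (inv b).1.2) b a = 0 := ha true
    have hxs : SmoothAt (X := euc d) (Y := X) (fun b => (inv b).1.1) b := by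
      refine SmoothAt.congr (X := euc d) (Y := X) (hΦs b hb) ?_
      filter_upwards [hinv' b hb] with b' hb'
      exact congrArg Prod.fst hb'
    have hys : SmoothAt (X := euc d) (Y := Y) (fun b => (inv b).1.2) b := by
      refine SmoothAt.congr (X := euc d) (Y := Y) (hys b hb.1) ?_
      filter_upwards [hinv' b hb] with b' hb'
      exact congrArg Prod.snd hb'
    have hb' := χ.map_target hb
    have hqs : SmoothAt q (inv b).1.1 := (h1 _ hb'.1).1
    have h5 : SmoothAt (Y := euc Y.dim) (fun b => ψ b) (inv b).1.2 := by
      have : ContMDiffAt (𝓡 Y.dim) 𝓘(ℝ, Y.Model) ∞ ψ (inv b).1.2 :=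
        contMDiffAt_of_mem_maximalAtlas hψ hb'.2
      exact this
    have h6 := tmap_comp_apply (X := euc d) (Y := X) (g := q) (f := fun b => (inv b).1.1) hqs hxs a
    have h7 := tmap_comp_apply (X := euc d) (Y := Y) (Z := euc Y.dim) (g := fun b => ψ b)
      (f := fun b => (inv b).1.2) h5 hys a
    rw [hx, map_zero] at h6
    rw [hy, map_zero] at h7
    have h8 : (fun b => ψ (inv b).1.2) =ᶠ[𝓝 b] fun b => (L b).1 := by
      filter_upwards [hT.mem_nhds hb] with b' hb'
      rw [hinv b' hb', ψ.right_inv hb'.1]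
    have h9 : (fun b => q (inv b).1.1) =ᶠ[𝓝 b] fun b => (L b).2 := by
      filter_upwards [hT.mem_nhds hb] with b' hb'
      rw [hinv b' hb', (h2 _ hb'.2).2.2]
    rw [tmap_congr (X := euc d) (Y := euc _) h9] at h6
    rw [tmap_congr (X := euc d) (Y := euc _) h8] at h7
    have h10 : tmap (X := euc d) (Y := euc _) (fun b => (L b).2) b =
        (ContinuousLinearMap.snd ℝ Y.Model E).comp
          (L : EuclideanSpace ℝ (Fin d) →L[ℝ] Y.Model × E) := by
      have h12 : HasFDerivAt (fun b => (L b).2) ((ContinuousLinearMap.snd ℝ Y.Model E).comp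
          (L : EuclideanSpace ℝ (Fin d) →L[ℝ] Y.Model × E)) b :=
        ((ContinuousLinearMap.snd ℝ Y.Model E).comp
          (L : EuclideanSpace ℝ (Fin d) →L[ℝ] Y.Model × E)).hasFDerivAt
      exact h12.hasMFDerivAt.mfderiv
    have h11 : tmap (X := euc d) (Y := euc _) (fun b => (L b).1) b =
        (ContinuousLinearMap.fst ℝ Y.Model E).comp
          (L : EuclideanSpace ℝ (Fin d) →L[ℝ] Y.Model × E) := by
      have h12 : HasFDerivAt (fun b => (L b).1) ((ContinuousLinearMap.fst ℝ Y.Model E).comp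
          (L : EuclideanSpace ℝ (Fin d) →L[ℝ] Y.Model × E)) b :=
        ((ContinuousLinearMap.fst ℝ Y.Model E).comp
          (L : EuclideanSpace ℝ (Fin d) →L[ℝ] Y.Model × E)).hasFDerivAt
      exact h12.hasMFDerivAt.mfderiv
    rw [h10] at h6
    rw [h11] at h7
    apply L.injective
    rw [map_zero]
    exact Prod.ext h7 h6

variable {X Y : SmoothMfd.{u}} {B : SmoothMfd.{u}} {Z : SmoothMfd.{w}}

theorem Embeds.tendsto {ι : Type*} {A : ι → SmoothMfd.{u}} {c : ∀ i, X → A i} (hc : Embeds c)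
    {T : Type*} {F : Filter T} {f : T → X} {x : X}
    (hf : ∀ i, Tendsto (fun t => c i (f t)) F (𝓝 (c i x))) : Tendsto f F (𝓝 x) := by
  rw [hc.isEmbedding.isInducing.nhds_eq_comap, tendsto_comap_iff, tendsto_pi_nhds]
  exact hf

/-- A pair of germs into the factors of a fiber product is a germ into the fiber product. -/
theorem EmbeddedStructure.exists_germ {f : X → B} {g : Y → B} (σ : FiberProductStructure f g)
    {a : Z → X} {b : Z → Y} {z : Z} (ha : SmoothAt a z) (hb : SmoothAt b z)
    (h : ∀ᶠ ζ in 𝓝 z, f (a ζ) = g (b ζ)) :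
    ∃ p : Z → σ.mfd, SmoothAt p z ∧
      ∀ᶠ ζ in 𝓝 z, (show FiberProduct f g from p ζ).1 = (a ζ, b ζ) := by
  classical
  -- the value of `p` where `(a ζ, b ζ)` is not in the fiber product is irrelevant
  let p₀ : FiberProduct f g := ⟨(a z, b z), h.self_of_nhds⟩
  let p : Z → FiberProduct f g := fun ζ => if h : f (a ζ) = g (b ζ) then ⟨(a ζ, b ζ), h⟩ else p₀
  have hp : ∀ᶠ ζ in 𝓝 z, (p ζ).1 = (a ζ, b ζ) := by
    filter_upwards [h] with ζ hζ
    simp only [p, dif_pos hζ]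
  refine ⟨p, σ.embeds.smoothAt fun i => ?_, hp⟩
  cases i
  · refine SmoothAt.congr (Y := X) ha ?_
    filter_upwards [hp] with ζ hζ
    exact congrArg Prod.fst hζ
  · refine SmoothAt.congr (Y := Y) hb ?_
    filter_upwards [hp] with ζ hζ
    exact congrArg Prod.snd hζ

/-! ### Lie groupoids -/

namespace LieGroupoid

variable {G M : SmoothMfd.{u}} (𝒢 : LieGroupoid G M)

attribute [simp] src_one tgt_one src_inv tgt_inv one_mul mul_one inv_mul mul_inv

theorem inv_mul_cancel_left {g h : G} (e : 𝒢.src g = 𝒢.tgt h) :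
    𝒢.mul (𝒢.inv g) (𝒢.mul g h) = h := by
  rw [← 𝒢.mul_assoc _ _ _ (𝒢.src_inv g) e, 𝒢.inv_mul, e, 𝒢.one_mul]

theorem mul_inv_cancel_left {g h : G} (e : 𝒢.tgt g = 𝒢.tgt h) :
    𝒢.mul g (𝒢.mul (𝒢.inv g) h) = h := by
  rw [← 𝒢.mul_assoc _ _ _ (𝒢.tgt_inv g).symm (by simpa using e), 𝒢.mul_inv, e, 𝒢.one_mul]

theorem mul_inv_cancel_right {g h : G} (e : 𝒢.src g = 𝒢.tgt h) :
    𝒢.mul (𝒢.mul g h) (𝒢.inv h) = g := by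
  rw [𝒢.mul_assoc _ _ _ e (𝒢.tgt_inv h).symm, 𝒢.mul_inv, ← e, 𝒢.mul_one]

theorem inv_mul_cancel_right {g h : G} (e : 𝒢.src g = 𝒢.src h) :
    𝒢.mul (𝒢.mul g (𝒢.inv h)) h = g := by
  rw [𝒢.mul_assoc _ _ _ (by simpa using e) (𝒢.src_inv h), 𝒢.inv_mul, ← e, 𝒢.mul_one]

theorem mul_left_cancel {g h k : G} (e : 𝒢.src g = 𝒢.tgt h) (e' : 𝒢.src g = 𝒢.tgt k)
    (E : 𝒢.mul g h = 𝒢.mul g k) : h = k := by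
  rw [← 𝒢.inv_mul_cancel_left e, E, 𝒢.inv_mul_cancel_left e']

theorem eq_inv_of_mul_eq_one {g h : G} (e : 𝒢.src g = 𝒢.tgt h)
    (E : 𝒢.mul g h = 𝒢.one (𝒢.tgt g)) : h = 𝒢.inv g := by
  refine 𝒢.mul_left_cancel e (𝒢.tgt_inv g).symm ?_
  rw [E, 𝒢.mul_inv]

@[simp] theorem inv_inv (g : G) : 𝒢.inv (𝒢.inv g) = g :=
  (𝒢.eq_inv_of_mul_eq_one (𝒢.src_inv g) (by simp)).symm

@[simp] theorem inv_one (m : M) : 𝒢.inv (𝒢.one m) = 𝒢.one m := by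
  refine (𝒢.eq_inv_of_mul_eq_one (by simp) ?_).symm
  have := 𝒢.one_mul (𝒢.one m)
  rwa [𝒢.tgt_one] at this ⊢

@[simp] theorem one_mul_one (m : M) : 𝒢.mul (𝒢.one m) (𝒢.one m) = 𝒢.one m := by
  have := 𝒢.one_mul (𝒢.one m)
  rwa [𝒢.tgt_one] at this

theorem inv_mul_rev {g h : G} (e : 𝒢.src g = 𝒢.tgt h) :
    𝒢.inv (𝒢.mul g h) = 𝒢.mul (𝒢.inv h) (𝒢.inv g) := by
  refine (𝒢.eq_inv_of_mul_eq_one ?_ ?_).symm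
  · rw [𝒢.src_mul _ _ e, 𝒢.tgt_mul _ _ (by simp [e]), 𝒢.tgt_inv]
  · rw [𝒢.mul_assoc _ _ _ e (by rw [𝒢.tgt_mul _ _ (by simp [e]), 𝒢.tgt_inv]),
      𝒢.mul_inv_cancel_left (by simp [e]), 𝒢.mul_inv, 𝒢.tgt_mul _ _ e]

theorem eq_one_of_mul_self {g : G} (e : 𝒢.src g = 𝒢.tgt g) (E : 𝒢.mul g g = g) :
    g = 𝒢.one (𝒢.src g) := by
  refine 𝒢.mul_left_cancel e (by simp) ?_
  rw [E, 𝒢.mul_one]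

theorem eq_one_tgt {g : G} (h : g = 𝒢.one (𝒢.src g)) : g = 𝒢.one (𝒢.tgt g) := by
  have e : 𝒢.tgt g = 𝒢.src g := by rw [h]; simp
  rwa [e]

/-- The product of smooth germs is smooth, and its differential depends only on those of the
factors. -/
theorem mul_germ {g h : Z → G} {z : Z} (hg : SmoothAt g z) (hh : SmoothAt h z)
    (hc : ∀ᶠ ζ in 𝓝 z, 𝒢.src (g ζ) = 𝒢.tgt (h ζ)) :
    SmoothAt (fun ζ => 𝒢.mul (g ζ) (h ζ)) z ∧
      ∀ a : Z.Model, tmap g z a = 0 → tmap h z a = 0 →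
        tmap (fun ζ => 𝒢.mul (g ζ) (h ζ)) z a = 0 := by
  obtain ⟨σ⟩ := nonempty_fiberProductStructure 𝒢.submersion_src 𝒢.submersion_tgt.contMDiff
  obtain ⟨p, hp, hpe⟩ := σ.exists_germ hg hh hc
  have hm := 𝒢.smooth_mul σ
  have he : (fun ζ => 𝒢.mul (g ζ) (h ζ)) =ᶠ[𝓝 z]
      fun ζ => 𝒢.mul (show FiberProduct 𝒢.src 𝒢.tgt from p ζ).1.1
        (show FiberProduct 𝒢.src 𝒢.tgt from p ζ).1.2 := by
    filter_upwards [hpe] with ζ hζ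
    rw [hζ]
  refine ⟨SmoothAt.congr (SmoothAt.comp_of_eq (Y := σ.mfd) (hm (p z)) hp rfl) he, fun a h1 h2 => ?_⟩
  rw [tmap_congr he, tmap_comp_apply (Y := σ.mfd) (g := fun p : FiberProduct 𝒢.src 𝒢.tgt =>
    𝒢.mul p.1.1 p.1.2) (f := p) (hm (p z)) hp]
  have h3 : tmap p z a = 0 := by
    apply σ.embeds.immersive
    intro i
    rw [← tmap_comp_apply (Y := σ.mfd) (σ.embeds.smooth i _) hp]
    cases i
    · rw [← h1]
      refine DFunLike.congr_fun (tmap_congr (Y := G) ?_) a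
      filter_upwards [hpe] with ζ hζ
      exact congrArg Prod.fst hζ
    · rw [← h2]
      refine DFunLike.congr_fun (tmap_congr (Y := G) ?_) a
      filter_upwards [hpe] with ζ hζ
      exact congrArg Prod.snd hζ
  rw [h3, map_zero]

theorem smoothAt_mul {g h : Z → G} {z : Z} (hg : SmoothAt g z) (hh : SmoothAt h z)
    (hc : ∀ᶠ ζ in 𝓝 z, 𝒢.src (g ζ) = 𝒢.tgt (h ζ)) :
    SmoothAt (fun ζ => 𝒢.mul (g ζ) (h ζ)) z := (𝒢.mul_germ hg hh hc).1

theorem tmap_mul_eq_zero {g h : Z → G} {z : Z} (hg : SmoothAt g z) (hh : SmoothAt h z)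
    (hc : ∀ᶠ ζ in 𝓝 z, 𝒢.src (g ζ) = 𝒢.tgt (h ζ)) {a : Z.Model} (h1 : tmap g z a = 0)
    (h2 : tmap h z a = 0) : tmap (fun ζ => 𝒢.mul (g ζ) (h ζ)) z a = 0 :=
  (𝒢.mul_germ hg hh hc).2 a h1 h2

theorem tendsto_mul {T : Type*} {F : Filter T} {g h : T → G} {g₀ h₀ : G} (e : 𝒢.src g₀ = 𝒢.tgt h₀)
    (hg : Tendsto g F (𝓝 g₀)) (hh : Tendsto h F (𝓝 h₀))
    (hc : ∀ t, 𝒢.src (g t) = 𝒢.tgt (h t)) :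
    Tendsto (fun t => 𝒢.mul (g t) (h t)) F (𝓝 (𝒢.mul g₀ h₀)) := by
  obtain ⟨σ⟩ := nonempty_fiberProductStructure 𝒢.submersion_src 𝒢.submersion_tgt.contMDiff
  have h1 : ContinuousAt (X := σ.mfd) (fun p : FiberProduct 𝒢.src 𝒢.tgt => 𝒢.mul p.1.1 p.1.2)
      (⟨(g₀, h₀), e⟩ : FiberProduct 𝒢.src 𝒢.tgt) := (𝒢.smooth_mul σ).continuous.continuousAt
  let f : T → σ.mfd := fun t => (⟨(g t, h t), hc t⟩ : FiberProduct 𝒢.src 𝒢.tgt)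
  have h2 : Tendsto f F (@nhds σ.mfd _ (⟨(g₀, h₀), e⟩ : FiberProduct 𝒢.src 𝒢.tgt)) := by
    refine σ.embeds.tendsto fun i => ?_
    cases i
    · exact hg
    · exact hh
  exact Tendsto.comp (y := @nhds σ.mfd _ (⟨(g₀, h₀), e⟩ : FiberProduct 𝒢.src 𝒢.tgt)) h1 h2

theorem smoothAt_inv {g : Z → G} {z : Z} (hg : SmoothAt g z) :
    SmoothAt (fun ζ => 𝒢.inv (g ζ)) z := SmoothAt.comp_of_eq (𝒢.smooth_inv _) hg rfl

theorem smoothAt_src {g : Z → G} {z : Z} (hg : SmoothAt g z) :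
    SmoothAt (fun ζ => 𝒢.src (g ζ)) z := SmoothAt.comp_of_eq (𝒢.submersion_src.contMDiff _) hg rfl

theorem smoothAt_tgt {g : Z → G} {z : Z} (hg : SmoothAt g z) :
    SmoothAt (fun ζ => 𝒢.tgt (g ζ)) z := SmoothAt.comp_of_eq (𝒢.submersion_tgt.contMDiff _) hg rfl

theorem smoothAt_one {g : Z → M} {z : Z} (hg : SmoothAt g z) :
    SmoothAt (fun ζ => 𝒢.one (g ζ)) z := SmoothAt.comp_of_eq (𝒢.smooth_one _) hg rfl

/-- The opposite groupoid. -/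
def op : LieGroupoid G M where
  src := 𝒢.tgt
  tgt := 𝒢.src
  one := 𝒢.one
  inv := 𝒢.inv
  mul g h := 𝒢.mul h g
  src_one := 𝒢.tgt_one
  tgt_one := 𝒢.src_one
  src_inv := 𝒢.tgt_inv
  tgt_inv := 𝒢.src_inv
  src_mul g h e := 𝒢.tgt_mul h g e.symm
  tgt_mul g h e := 𝒢.src_mul h g e.symm
  mul_assoc g h k e e' := (𝒢.mul_assoc k h g e'.symm e.symm).symm
  one_mul := 𝒢.mul_one
  mul_one := 𝒢.one_mul
  inv_mul := 𝒢.mul_inv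
  mul_inv := 𝒢.inv_mul
  submersion_src := 𝒢.submersion_tgt
  submersion_tgt := 𝒢.submersion_src
  smooth_one := 𝒢.smooth_one
  smooth_inv := 𝒢.smooth_inv
  smooth_mul σ p := 𝒢.smoothAt_mul (Z := σ.mfd) (g := fun p : FiberProduct 𝒢.tgt 𝒢.src => p.1.2)
    (h := fun p : FiberProduct 𝒢.tgt 𝒢.src => p.1.1) (σ.embeds.smooth true p)
    (σ.embeds.smooth false p) (Eventually.of_forall fun q : FiberProduct 𝒢.tgt 𝒢.src => q.2.symm)

/-- The multiplicativity of a 2-form, evaluated on a pair of germs. -/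
theorem Multiplicative.apply {𝒢 : LieGroupoid G M} {ϖ : TwoForm G} (hϖ : 𝒢.Multiplicative ϖ)
    {g h : Z → G} {z : Z} (hg : SmoothAt g z) (hh : SmoothAt h z)
    (hc : ∀ᶠ ζ in 𝓝 z, 𝒢.src (g ζ) = 𝒢.tgt (h ζ)) (a b : Z.Model) :
    ϖ (𝒢.mul (g z) (h z)) ![tmap (fun ζ => 𝒢.mul (g ζ) (h ζ)) z a,
        tmap (fun ζ => 𝒢.mul (g ζ) (h ζ)) z b] =
      ϖ (g z) ![tmap g z a, tmap g z b] + ϖ (h z) ![tmap h z a, tmap h z b] := by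
  obtain ⟨σ⟩ := nonempty_fiberProductStructure 𝒢.submersion_src 𝒢.submersion_tgt.contMDiff
  obtain ⟨p, hp, hpe⟩ := σ.exists_germ hg hh hc
  let P : Type _ := FiberProduct 𝒢.src 𝒢.tgt
  let p' : Z → P := p
  have hp' : ∀ᶠ ζ in 𝓝 z, (p' ζ).1 = (g ζ, h ζ) := hpe
  -- the differential of a map which factors through `p`
  have key : ∀ (k : P → G) (k' : Z → G), Smooth (X := σ.mfd) k →
      (∀ᶠ ζ in 𝓝 z, k (p' ζ) = k' ζ) → ∀ c, tmap (X := σ.mfd) k (p z)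
        (tmap p z c) = tmap k' z c := by
    intro k k' hk hkk c
    rw [← tmap_comp_apply (Y := σ.mfd) (g := k) (f := p) (hk _) hp]
    exact DFunLike.congr_fun (tmap_congr hkk) c
  have h1 := key (fun q => q.1.1) g (σ.embeds.smooth false)
    (hp'.mono fun ζ hζ => congrArg Prod.fst hζ)
  have h2 := key (fun q => q.1.2) h (σ.embeds.smooth true)
    (hp'.mono fun ζ hζ => congrArg Prod.snd hζ)
  have h3 := key (fun q => 𝒢.mul q.1.1 q.1.2) (fun ζ => 𝒢.mul (g ζ) (h ζ)) (𝒢.smooth_mul σ)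
    (hp'.mono fun ζ hζ => by simp only [hζ])
  have h4 := DFunLike.congr_fun (congrFun (hϖ σ) (p z)) ![tmap p z a, tmap p z b]
  have hz : (p' z).1 = (g z, h z) := hp'.self_of_nhds
  have key2 : ∀ (k : P → G) (x : G), k (p' z) = x →
      (TwoForm.pullback (X := σ.mfd) k ϖ) (p z) ![tmap p z a, tmap p z b] =
      ϖ x ![tmap (X := σ.mfd) k (p z) (tmap p z a), tmap (X := σ.mfd) k (p z) (tmap p z b)] := by
    rintro k _ rfl
    change ϖ (k (p z)) (fun i => tmap (X := σ.mfd) k (p z) (![tmap p z a, tmap p z b] i)) = _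
    congr 1
    ext i
    fin_cases i <;> rfl
  have h5 := key2 (fun q => q.1.1) (g z) (congrArg Prod.fst hz)
  have h6 := key2 (fun q => q.1.2) (h z) (congrArg Prod.snd hz)
  have h7 := key2 (fun q => 𝒢.mul q.1.1 q.1.2) (𝒢.mul (g z) (h z)) (by simp only [hz])
  rw [h1, h1] at h5
  rw [h2, h2] at h6
  rw [h3, h3] at h7
  rw [← h5, ← h6, ← h7]
  have h8 : (TwoForm.pullback (X := σ.mfd) (fun q : P => q.1.2) ϖ) (p z) ![tmap p z a, tmap p z b]
      - (TwoForm.pullback (X := σ.mfd) (fun q : P => 𝒢.mul q.1.1 q.1.2) ϖ) (p z)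
          ![tmap p z a, tmap p z b]
      + (TwoForm.pullback (X := σ.mfd) (fun q : P => q.1.1) ϖ) (p z)
          ![tmap p z a, tmap p z b] = 0 := h4
  linarith

end LieGroupoid

/-! ### Double Lie groupoids -/

theorem Submersion.exists_lift_fiberProduct {W X Y B : SmoothMfd.{u}} {Z : SmoothMfd.{w}}
    {f : X → B} {g : Y → B} (σ : FiberProductStructure f g) {F : W → FiberProduct f g}
    (hF : Submersion (Y := σ.mfd) F) (x : W) {a : Z → X} {b : Z → Y} {z : Z}
    (ha : SmoothAt a z) (hb : SmoothAt b z) (h : ∀ᶠ ζ in 𝓝 z, f (a ζ) = g (b ζ))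
    (haz : a z = (F x).1.1) (hbz : b z = (F x).1.2) :
    ∃ l : Z → W, SmoothAt l z ∧ l z = x ∧
      ∀ᶠ ζ in 𝓝 z, (F (l ζ)).1.1 = a ζ ∧ (F (l ζ)).1.2 = b ζ := by
  obtain ⟨p, hp, hpe⟩ := σ.exists_germ ha hb h
  have hz : p z = F x := by
    have := hpe.self_of_nhds
    rw [haz, hbz] at this
    exact Subtype.ext this
  obtain ⟨l, hl, hlz, hle⟩ := hF.exists_lift x hp hz
  refine ⟨l, hl, hlz, ?_⟩
  filter_upwards [hle, hpe] with ζ h1 h2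
  rw [h1]
  exact ⟨congrArg Prod.fst h2, congrArg Prod.snd h2⟩

namespace DoubleLieGroupoid

variable {D V H M : SmoothMfd.{u}} (𝒟 : DoubleLieGroupoid D V H M) {Z : SmoothMfd.{w}}

@[simp] theorem ver_src_hor_one (h : H) :
    𝒟.ver.src (𝒟.hor.one h) = 𝒟.sideV.one (𝒟.sideH.src h) := by
  have h1 : 𝒟.sideV.src (𝒟.ver.src (𝒟.hor.one h)) = 𝒟.sideH.src h := by
    rw [← 𝒟.src_src, 𝒟.hor.src_one]
  rw [← h1]
  apply LieGroupoid.eq_one_of_mul_self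
  · rw [h1, ← 𝒟.src_tgt, 𝒟.hor.tgt_one]
  · rw [← 𝒟.ver_src_mul _ _ (by simp), 𝒟.hor.one_mul_one]

@[simp] theorem ver_tgt_hor_one (h : H) :
    𝒟.ver.tgt (𝒟.hor.one h) = 𝒟.sideV.one (𝒟.sideH.tgt h) := by
  have h1 : 𝒟.sideV.src (𝒟.ver.tgt (𝒟.hor.one h)) = 𝒟.sideH.tgt h := by
    rw [← 𝒟.tgt_src, 𝒟.hor.src_one]
  rw [← h1]
  apply LieGroupoid.eq_one_of_mul_self
  · rw [h1, ← 𝒟.tgt_tgt, 𝒟.hor.tgt_one]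
  · rw [← 𝒟.ver_tgt_mul _ _ (by simp), 𝒟.hor.one_mul_one]

@[simp] theorem hor_src_ver_one (v : V) :
    𝒟.hor.src (𝒟.ver.one v) = 𝒟.sideH.one (𝒟.sideV.src v) := by
  have h1 : 𝒟.sideH.src (𝒟.hor.src (𝒟.ver.one v)) = 𝒟.sideV.src v := by
    rw [𝒟.src_src, 𝒟.ver.src_one]
  rw [← h1]
  apply LieGroupoid.eq_one_of_mul_self
  · rw [h1, 𝒟.tgt_src, 𝒟.ver.tgt_one]
  · rw [← 𝒟.hor_src_mul _ _ (by simp), 𝒟.ver.one_mul_one]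

@[simp] theorem hor_tgt_ver_one (v : V) :
    𝒟.hor.tgt (𝒟.ver.one v) = 𝒟.sideH.one (𝒟.sideV.tgt v) := by
  have h1 : 𝒟.sideH.src (𝒟.hor.tgt (𝒟.ver.one v)) = 𝒟.sideV.tgt v := by
    rw [𝒟.src_tgt, 𝒟.ver.src_one]
  rw [← h1]
  apply LieGroupoid.eq_one_of_mul_self
  · rw [h1, 𝒟.tgt_tgt, 𝒟.ver.tgt_one]
  · rw [← 𝒟.hor_tgt_mul _ _ (by simp), 𝒟.ver.one_mul_one]

@[simp] theorem ver_src_hor_inv (α : D) :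
    𝒟.ver.src (𝒟.hor.inv α) = 𝒟.sideV.inv (𝒟.ver.src α) := by
  apply LieGroupoid.eq_inv_of_mul_eq_one
  · rw [← 𝒟.src_src, ← 𝒟.src_tgt, 𝒟.hor.tgt_inv]
  · rw [← 𝒟.ver_src_mul _ _ (by simp), 𝒟.hor.mul_inv, ver_src_hor_one, 𝒟.src_tgt]

@[simp] theorem ver_tgt_hor_inv (α : D) :
    𝒟.ver.tgt (𝒟.hor.inv α) = 𝒟.sideV.inv (𝒟.ver.tgt α) := by
  apply LieGroupoid.eq_inv_of_mul_eq_one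
  · rw [← 𝒟.tgt_src, ← 𝒟.tgt_tgt, 𝒟.hor.tgt_inv]
  · rw [← 𝒟.ver_tgt_mul _ _ (by simp), 𝒟.hor.mul_inv, ver_tgt_hor_one, 𝒟.tgt_tgt]

@[simp] theorem hor_src_ver_inv (α : D) :
    𝒟.hor.src (𝒟.ver.inv α) = 𝒟.sideH.inv (𝒟.hor.src α) := by
  apply LieGroupoid.eq_inv_of_mul_eq_one
  · rw [𝒟.src_src, 𝒟.tgt_src, 𝒟.ver.tgt_inv]
  · rw [← 𝒟.hor_src_mul _ _ (by simp), 𝒟.ver.mul_inv, hor_src_ver_one, 𝒟.tgt_src]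

@[simp] theorem hor_tgt_ver_inv (α : D) :
    𝒟.hor.tgt (𝒟.ver.inv α) = 𝒟.sideH.inv (𝒟.hor.tgt α) := by
  apply LieGroupoid.eq_inv_of_mul_eq_one
  · rw [𝒟.src_tgt, 𝒟.tgt_tgt, 𝒟.ver.tgt_inv]
  · rw [← 𝒟.hor_tgt_mul _ _ (by simp), 𝒟.ver.mul_inv, hor_tgt_ver_one, 𝒟.tgt_tgt]

theorem hor_one_mul {h h' : H} (e : 𝒟.sideH.src h = 𝒟.sideH.tgt h') :
    𝒟.hor.one (𝒟.sideH.mul h h') = 𝒟.ver.mul (𝒟.hor.one h) (𝒟.hor.one h') := by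
  have e1 : 𝒟.ver.src (𝒟.hor.one h) = 𝒟.ver.tgt (𝒟.hor.one h') := by simp [e]
  have h1 : 𝒟.hor.src (𝒟.ver.mul (𝒟.hor.one h) (𝒟.hor.one h')) = 𝒟.sideH.mul h h' := by
    simp [𝒟.hor_src_mul _ _ e1]
  have h2 : 𝒟.hor.tgt (𝒟.ver.mul (𝒟.hor.one h) (𝒟.hor.one h')) = 𝒟.sideH.mul h h' := by
    simp [𝒟.hor_tgt_mul _ _ e1]
  rw [← h1]
  refine (𝒟.hor.eq_one_of_mul_self (h1.trans h2.symm) ?_).symm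
  rw [← 𝒟.interchange _ _ _ _ (by simp) (by simp) e1 e1]
  simp

theorem ver_one_mul {v v' : V} (e : 𝒟.sideV.src v = 𝒟.sideV.tgt v') :
    𝒟.ver.one (𝒟.sideV.mul v v') = 𝒟.hor.mul (𝒟.ver.one v) (𝒟.ver.one v') := by
  have e1 : 𝒟.hor.src (𝒟.ver.one v) = 𝒟.hor.tgt (𝒟.ver.one v') := by simp [e]
  have h1 : 𝒟.ver.src (𝒟.hor.mul (𝒟.ver.one v) (𝒟.ver.one v')) = 𝒟.sideV.mul v v' := by
    simp [𝒟.ver_src_mul _ _ e1]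
  have h2 : 𝒟.ver.tgt (𝒟.hor.mul (𝒟.ver.one v) (𝒟.ver.one v')) = 𝒟.sideV.mul v v' := by
    simp [𝒟.ver_tgt_mul _ _ e1]
  rw [← h1]
  refine (𝒟.ver.eq_one_of_mul_self (h1.trans h2.symm) ?_).symm
  rw [𝒟.interchange _ _ _ _ e1 e1 (by simp) (by simp)]
  simp

theorem hor_one_one (m : M) : 𝒟.hor.one (𝒟.sideH.one m) = 𝒟.ver.one (𝒟.sideV.one m) := by
  have h1 : 𝒟.ver.src (𝒟.hor.one (𝒟.sideH.one m)) = 𝒟.sideV.one m := by simp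
  rw [← h1]
  apply LieGroupoid.eq_one_of_mul_self
  · simp
  · rw [← 𝒟.hor_one_mul (by simp), 𝒟.sideH.one_mul_one]

theorem hor_inv_ver_mul {a b : D} (e : 𝒟.ver.src a = 𝒟.ver.tgt b) :
    𝒟.hor.inv (𝒟.ver.mul a b) = 𝒟.ver.mul (𝒟.hor.inv a) (𝒟.hor.inv b) := by
  have e1 : 𝒟.ver.src (𝒟.hor.inv a) = 𝒟.ver.tgt (𝒟.hor.inv b) := by simp [e]
  symm
  apply LieGroupoid.eq_inv_of_mul_eq_one
  · rw [𝒟.hor_src_mul _ _ e, 𝒟.hor_tgt_mul _ _ e1]; simp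
  · rw [← 𝒟.interchange _ _ _ _ (by simp) (by simp) e e1, 𝒟.hor_tgt_mul _ _ e, 𝒟.hor_one_mul]
    · simp
    · rw [𝒟.src_tgt, 𝒟.tgt_tgt, e]

theorem ver_inv_hor_mul {a b : D} (e : 𝒟.hor.src a = 𝒟.hor.tgt b) :
    𝒟.ver.inv (𝒟.hor.mul a b) = 𝒟.hor.mul (𝒟.ver.inv a) (𝒟.ver.inv b) := by
  have e1 : 𝒟.hor.src (𝒟.ver.inv a) = 𝒟.hor.tgt (𝒟.ver.inv b) := by simp [e]
  symm
  apply LieGroupoid.eq_inv_of_mul_eq_one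
  · rw [𝒟.ver_src_mul _ _ e, 𝒟.ver_tgt_mul _ _ e1]; simp
  · rw [𝒟.interchange _ _ _ _ e e1 (by simp) (by simp), 𝒟.ver_tgt_mul _ _ e, 𝒟.ver_one_mul]
    · simp
    · rw [← 𝒟.tgt_src, ← 𝒟.tgt_tgt, e]

@[simp] theorem hor_inv_ver_one (v : V) : 𝒟.hor.inv (𝒟.ver.one v) = 𝒟.ver.one (𝒟.sideV.inv v) := by
  symm
  apply LieGroupoid.eq_inv_of_mul_eq_one
  · simp
  · rw [← 𝒟.ver_one_mul (by simp)]
    simp [hor_one_one]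

@[simp] theorem ver_inv_hor_one (h : H) : 𝒟.ver.inv (𝒟.hor.one h) = 𝒟.hor.one (𝒟.sideH.inv h) := by
  symm
  apply LieGroupoid.eq_inv_of_mul_eq_one
  · simp
  · rw [← 𝒟.hor_one_mul (by simp)]
    simp [hor_one_one]

theorem hor_inv_ver_inv (a : D) : 𝒟.hor.inv (𝒟.ver.inv a) = 𝒟.ver.inv (𝒟.hor.inv a) := by
  apply LieGroupoid.eq_inv_of_mul_eq_one
  · simp
  · rw [← 𝒟.hor_inv_ver_mul (by simp)]
    simp

/-! Squares may be prescribed, smoothly in parameters, by one of their sides in `V` and one of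
their sides in `H`: this is the condition on the double source map, and inverses exchange sources
and targets. -/

theorem exists_lift_src_src (x : D) {a : Z → V} {b : Z → H} {z : Z} (ha : SmoothAt a z)
    (hb : SmoothAt b z) (h : ∀ᶠ ζ in 𝓝 z, 𝒟.sideV.src (a ζ) = 𝒟.sideH.src (b ζ))
    (haz : a z = 𝒟.ver.src x) (hbz : b z = 𝒟.hor.src x) :
    ∃ l : Z → D, SmoothAt l z ∧ l z = x ∧
      ∀ᶠ ζ in 𝓝 z, 𝒟.ver.src (l ζ) = a ζ ∧ 𝒟.hor.src (l ζ) = b ζ := by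
  obtain ⟨σ⟩ := nonempty_fiberProductStructure 𝒟.sideV.submersion_src
    𝒟.sideH.submersion_src.contMDiff
  exact Submersion.exists_lift_fiberProduct σ (𝒟.submersion_doubleSrc σ) x ha hb h haz hbz

theorem exists_lift_src_tgt (x : D) {a : Z → V} {b : Z → H} {z : Z} (ha : SmoothAt a z)
    (hb : SmoothAt b z) (h : ∀ᶠ ζ in 𝓝 z, 𝒟.sideV.tgt (a ζ) = 𝒟.sideH.src (b ζ))
    (haz : a z = 𝒟.ver.src x) (hbz : b z = 𝒟.hor.tgt x) :
    ∃ l : Z → D, SmoothAt l z ∧ l z = x ∧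
      ∀ᶠ ζ in 𝓝 z, 𝒟.ver.src (l ζ) = a ζ ∧ 𝒟.hor.tgt (l ζ) = b ζ := by
  obtain ⟨l, hl, hlz, hle⟩ := 𝒟.exists_lift_src_src (𝒟.hor.inv x) (𝒟.sideV.smoothAt_inv ha) hb
    (by simpa using h) (by simp [haz]) (by simp [hbz])
  refine ⟨fun ζ => 𝒟.hor.inv (l ζ), 𝒟.hor.smoothAt_inv hl, by simp [hlz], ?_⟩
  filter_upwards [hle] with ζ hζ
  simp [hζ.1, hζ.2]

theorem exists_lift_tgt_tgt (x : D) {a : Z → V} {b : Z → H} {z : Z} (ha : SmoothAt a z)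
    (hb : SmoothAt b z) (h : ∀ᶠ ζ in 𝓝 z, 𝒟.sideV.tgt (a ζ) = 𝒟.sideH.tgt (b ζ))
    (haz : a z = 𝒟.ver.tgt x) (hbz : b z = 𝒟.hor.tgt x) :
    ∃ l : Z → D, SmoothAt l z ∧ l z = x ∧
      ∀ᶠ ζ in 𝓝 z, 𝒟.ver.tgt (l ζ) = a ζ ∧ 𝒟.hor.tgt (l ζ) = b ζ := by
  obtain ⟨l, hl, hlz, hle⟩ := 𝒟.exists_lift_src_tgt (𝒟.ver.inv x) ha (𝒟.sideH.smoothAt_inv hb)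
    (by simpa using h) (by simp [haz]) (by simp [hbz])
  refine ⟨fun ζ => 𝒟.ver.inv (l ζ), 𝒟.ver.smoothAt_inv hl, by simp [hlz], ?_⟩
  filter_upwards [hle] with ζ hζ
  simp [hζ.1, hζ.2]

theorem submersion_tgt_tgt (σ : FiberProductStructure 𝒟.sideV.tgt 𝒟.sideH.tgt) :
    Submersion (Y := σ.mfd) (fun α => (⟨(𝒟.ver.tgt α, 𝒟.hor.tgt α), (𝒟.tgt_tgt α).symm⟩ :
      FiberProduct 𝒟.sideV.tgt 𝒟.sideH.tgt)) := by
  refine submersion_of_sections (fun x => σ.embeds.smoothAt fun i => ?_) fun x => ?_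
  · cases i
    · exact 𝒟.ver.submersion_tgt.contMDiff x
    · exact 𝒟.hor.submersion_tgt.contMDiff x
  · let p₀ : FiberProduct 𝒟.sideV.tgt 𝒟.sideH.tgt := ⟨(𝒟.ver.tgt x, 𝒟.hor.tgt x), (𝒟.tgt_tgt x).symm⟩
    obtain ⟨l, hl, hlz, hle⟩ := 𝒟.exists_lift_tgt_tgt (Z := σ.mfd) (z := p₀) x
      (σ.embeds.smooth false _) (σ.embeds.smooth true _) (Eventually.of_forall fun p => p.2) rfl rfl
    refine ⟨l, hl, hlz, ?_⟩
    filter_upwards [hle] with p hp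
    exact Subtype.ext (Prod.ext hp.1 hp.2)

theorem submersion_src_tgt (σ : FiberProductStructure 𝒟.sideV.tgt 𝒟.sideH.src) :
    Submersion (Y := σ.mfd) (fun α => (⟨(𝒟.ver.src α, 𝒟.hor.tgt α), (𝒟.src_tgt α).symm⟩ :
      FiberProduct 𝒟.sideV.tgt 𝒟.sideH.src)) := by
  refine submersion_of_sections (fun x => σ.embeds.smoothAt fun i => ?_) fun x => ?_
  · cases i
    · exact 𝒟.ver.submersion_src.contMDiff x
    · exact 𝒟.hor.submersion_tgt.contMDiff x
  · let p₀ : FiberProduct 𝒟.sideV.tgt 𝒟.sideH.src := ⟨(𝒟.ver.src x, 𝒟.hor.tgt x), (𝒟.src_tgt x).symm⟩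
    obtain ⟨l, hl, hlz, hle⟩ := 𝒟.exists_lift_src_tgt (Z := σ.mfd) (z := p₀) x
      (σ.embeds.smooth false _) (σ.embeds.smooth true _) (Eventually.of_forall fun p => p.2) rfl rfl
    refine ⟨l, hl, hlz, ?_⟩
    filter_upwards [hle] with p hp
    exact Subtype.ext (Prod.ext hp.1 hp.2)

/-- The double Lie groupoid obtained by reflecting all squares in the antidiagonal: it exchanges
the two directions, and reverses all arrows. -/
def rev : DoubleLieGroupoid D H V M where
  hor := 𝒟.ver.op
  ver := 𝒟.hor.op
  sideV := 𝒟.sideH.op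
  sideH := 𝒟.sideV.op
  src_src α := (𝒟.tgt_tgt α).symm
  tgt_tgt α := (𝒟.src_src α).symm
  tgt_src α := (𝒟.tgt_src α).symm
  src_tgt α := (𝒟.src_tgt α).symm
  ver_src_mul α β e := 𝒟.hor_tgt_mul β α e.symm
  ver_tgt_mul α β e := 𝒟.hor_src_mul β α e.symm
  hor_src_mul α β e := 𝒟.ver_tgt_mul β α e.symm
  hor_tgt_mul α β e := 𝒟.ver_src_mul β α e.symm
  interchange α₁₁ α₁₂ α₂₁ α₂₂ e₁ e₂ e₃ e₄ :=
    (𝒟.interchange α₂₂ α₁₂ α₂₁ α₁₁ e₄.symm e₃.symm e₂.symm e₁.symm).symm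
  submersion_doubleSrc σ := by
    refine submersion_of_sections (Y := σ.mfd) (fun x => σ.embeds.smoothAt fun i => ?_) fun x => ?_
    · cases i
      · exact 𝒟.hor.submersion_tgt.contMDiff x
      · exact 𝒟.ver.submersion_tgt.contMDiff x
    · let p₀ : FiberProduct 𝒟.sideH.tgt 𝒟.sideV.tgt :=
        ⟨(𝒟.hor.tgt x, 𝒟.ver.tgt x), 𝒟.tgt_tgt x⟩
      obtain ⟨l, hl, hlz, hle⟩ := 𝒟.exists_lift_tgt_tgt (Z := σ.mfd) (z := p₀) x
        (σ.embeds.smooth true _)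
        (σ.embeds.smooth false _)
        (Eventually.of_forall fun p : FiberProduct 𝒟.sideH.tgt 𝒟.sideV.tgt => p.2.symm) rfl rfl
      refine ⟨l, hl, hlz, ?_⟩
      filter_upwards [hle] with p hp
      exact Subtype.ext (Prod.ext hp.2 hp.1)

end DoubleLieGroupoid

/-! ### Staircases of squares -/

namespace DoubleLieGroupoid

variable {D V H M : SmoothMfd.{u}} (𝒟 : DoubleLieGroupoid D V H M) {I : Type*}

/-- `A i i' j j'`, for `i ≤ i' ≤ j ≤ j'` in `S`, is a square occupying the rows from `i` to `i'`
and the columns from `j` to `j'` of a staircase, functorial in the rows and in the columns. The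
other values of `A` are irrelevant. -/
structure IsStairOn [LE I] (S : Set I) (A : I → I → I → I → D) : Prop where
  ver_comp : ∀ {i i' i'' j j' : I}, i ∈ S → i' ∈ S → i'' ∈ S → j ∈ S → j' ∈ S →
    i ≤ i' → i' ≤ i'' → i'' ≤ j → j ≤ j' →
      𝒟.ver.src (A i i' j j') = 𝒟.ver.tgt (A i' i'' j j') ∧
        A i i'' j j' = 𝒟.ver.mul (A i i' j j') (A i' i'' j j')
  ver_id : ∀ {i j j' : I}, i ∈ S → j ∈ S → j' ∈ S → i ≤ j → j ≤ j' →
    A i i j j' = 𝒟.ver.one (𝒟.ver.src (A i i j j'))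
  hor_comp : ∀ {i i' j j' j'' : I}, i ∈ S → i' ∈ S → j ∈ S → j' ∈ S → j'' ∈ S →
    i ≤ i' → i' ≤ j → j ≤ j' → j' ≤ j'' →
      𝒟.hor.src (A i i' j j') = 𝒟.hor.tgt (A i i' j' j'') ∧
        A i i' j j'' = 𝒟.hor.mul (A i i' j j') (A i i' j' j'')
  hor_id : ∀ {i i' j : I}, i ∈ S → i' ∈ S → j ∈ S → i ≤ i' → i' ≤ j →
    A i i' j j = 𝒟.hor.one (𝒟.hor.src (A i i' j j))

/-- `F i j` are squares, for `P i j`, such that those with the same first index have the same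
horizontal target, and such that the vertical targets of `F i j` and `F i j'` differ by an element
of `V` which does not depend on `i`. -/
structure IsFrame (P : I → I → Prop) (F : I → I → D) : Prop where
  tgt_eq : ∀ {i j j' : I}, P i j → P i j' → 𝒟.hor.tgt (F i j) = 𝒟.hor.tgt (F i j')
  ratio_eq : ∀ {i i' j j' : I}, P i j → P i j' → P i' j → P i' j' →
    𝒟.sideV.mul (𝒟.sideV.inv (𝒟.ver.tgt (F i j))) (𝒟.ver.tgt (F i j')) =
      𝒟.sideV.mul (𝒟.sideV.inv (𝒟.ver.tgt (F i' j))) (𝒟.ver.tgt (F i' j'))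

/-- The quotient of two squares of a frame. -/
def strip (F : I → I → D) (i j j' : I) : D := 𝒟.hor.mul (𝒟.hor.inv (F i j)) (F i j')

/-- The square spanned by four squares of a frame. -/
def rect (F : I → I → D) (i i' j j' : I) : D :=
  𝒟.ver.mul (𝒟.ver.inv (𝒟.strip F i j j')) (𝒟.strip F i' j j')

variable {𝒟}

variable {F : I → I → D} {i j j' : I}

theorem rect_ver_id : 𝒟.rect F i i j j' = 𝒟.ver.one (𝒟.ver.src (𝒟.rect F i i j j')) := by
  rw [rect, 𝒟.ver.inv_mul, 𝒟.ver.src_one]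

theorem strip_self : 𝒟.strip F i j j = 𝒟.hor.one (𝒟.hor.src (F i j)) := by
  rw [strip, 𝒟.hor.inv_mul]

namespace IsFrame

variable {P : I → I → Prop} {F : I → I → D} {i i' i'' j j' j'' : I}

theorem strip_comp (hF : 𝒟.IsFrame P F) (h : P i j) (h' : P i j') (h'' : P i j'') :
    𝒟.hor.src (𝒟.strip F i j j') = 𝒟.hor.tgt (𝒟.strip F i j' j'') ∧
      𝒟.strip F i j j'' = 𝒟.hor.mul (𝒟.strip F i j j') (𝒟.strip F i j' j'') := by
  have e1 : 𝒟.hor.src (𝒟.hor.inv (F i j)) = 𝒟.hor.tgt (F i j') := by simp [hF.tgt_eq h h']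
  have e2 : 𝒟.hor.src (𝒟.hor.inv (F i j')) = 𝒟.hor.tgt (F i j'') := by simp [hF.tgt_eq h' h'']
  refine ⟨?_, ?_⟩
  · rw [strip, strip, 𝒟.hor.src_mul _ _ e1, 𝒟.hor.tgt_mul _ _ e2, 𝒟.hor.tgt_inv]
  · rw [strip, strip, strip, 𝒟.hor.mul_assoc _ _ _ e1
      (by rw [𝒟.hor.tgt_mul _ _ e2, 𝒟.hor.tgt_inv]),
      𝒟.hor.mul_inv_cancel_left (hF.tgt_eq h' h'')]

theorem ver_tgt_strip (hF : 𝒟.IsFrame P F) (h : P i j) (h' : P i j') : 𝒟.ver.tgt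
    (𝒟.strip F i j j') =
    𝒟.sideV.mul (𝒟.sideV.inv (𝒟.ver.tgt (F i j))) (𝒟.ver.tgt (F i j')) := by
  rw [strip, 𝒟.ver_tgt_mul _ _ (by simp [hF.tgt_eq h h']), ver_tgt_hor_inv]

theorem ver_tgt_strip_eq (hF : 𝒟.IsFrame P F) (h₁ : P i j) (h₂ : P i j') (h₃ : P i' j)
    (h₄ : P i' j') :
    𝒟.ver.tgt (𝒟.strip F i j j') = 𝒟.ver.tgt (𝒟.strip F i' j j') := by
  rw [hF.ver_tgt_strip h₁ h₂, hF.ver_tgt_strip h₃ h₄, hF.ratio_eq h₁ h₂ h₃ h₄]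

theorem rect_composable (hF : 𝒟.IsFrame P F) (h₁ : P i j) (h₂ : P i j') (h₃ : P i' j)
    (h₄ : P i' j') :
    𝒟.ver.src (𝒟.ver.inv (𝒟.strip F i j j')) = 𝒟.ver.tgt (𝒟.strip F i' j j') := by
  rw [𝒟.ver.src_inv, hF.ver_tgt_strip_eq h₁ h₂ h₃ h₄]

theorem rect_ver_comp (hF : 𝒟.IsFrame P F) (h₁ : P i j) (h₂ : P i j') (h₃ : P i' j) (h₄ : P i' j')
    (h₅ : P i'' j)
    (h₆ : P i'' j') :
    𝒟.ver.src (𝒟.rect F i i' j j') = 𝒟.ver.tgt (𝒟.rect F i' i'' j j') ∧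
      𝒟.rect F i i'' j j' = 𝒟.ver.mul (𝒟.rect F i i' j j') (𝒟.rect F i' i'' j j') := by
  have e1 := hF.rect_composable h₁ h₂ h₃ h₄
  have e2 := hF.rect_composable h₃ h₄ h₅ h₆
  refine ⟨?_, ?_⟩
  · rw [rect, rect, 𝒟.ver.src_mul _ _ e1, 𝒟.ver.tgt_mul _ _ e2, 𝒟.ver.tgt_inv]
  · rw [rect, rect, rect, 𝒟.ver.mul_assoc _ _ _ e1
      (by rw [𝒟.ver.tgt_mul _ _ e2, 𝒟.ver.tgt_inv]),
      𝒟.ver.mul_inv_cancel_left (hF.ver_tgt_strip_eq h₃ h₄ h₅ h₆)]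

theorem rect_hor_comp (hF : 𝒟.IsFrame P F) (h₁ : P i j) (h₂ : P i j') (h₃ : P i j'') (h₄ : P i' j)
    (h₅ : P i' j')
    (h₆ : P i' j'') :
    𝒟.hor.src (𝒟.rect F i i' j j') = 𝒟.hor.tgt (𝒟.rect F i i' j' j'') ∧
      𝒟.rect F i i' j j'' = 𝒟.hor.mul (𝒟.rect F i i' j j') (𝒟.rect F i i' j' j'') := by
  have e1 := hF.rect_composable h₁ h₂ h₄ h₅
  have e2 := hF.rect_composable h₂ h₃ h₅ h₆
  obtain ⟨a1, a2⟩ := hF.strip_comp h₁ h₂ h₃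
  obtain ⟨b1, b2⟩ := hF.strip_comp h₄ h₅ h₆
  refine ⟨?_, ?_⟩
  · rw [rect, rect, 𝒟.hor_src_mul _ _ e1, 𝒟.hor_tgt_mul _ _ e2, hor_src_ver_inv,
      hor_tgt_ver_inv, a1, b1]
  · rw [rect, rect, rect, a2, b2, 𝒟.ver_inv_hor_mul a1,
      𝒟.interchange _ _ _ _ (by simp [a1]) b1 e1 e2]

theorem rect_hor_id (hF : 𝒟.IsFrame P F) (h : P i j) (h' : P i' j) :
    𝒟.rect F i i' j j = 𝒟.hor.one (𝒟.hor.src (𝒟.rect F i i' j j)) := by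
  have e1 := hF.rect_composable h h h' h'
  have e2 : 𝒟.sideH.src (𝒟.sideH.inv (𝒟.hor.src (F i j))) = 𝒟.sideH.tgt (𝒟.hor.src (F i' j)) := by
    rw [strip_self, strip_self, ver_inv_hor_one, ver_src_hor_one, ver_tgt_hor_one] at e1
    simpa using congrArg 𝒟.sideV.src e1
  rw [rect, strip_self, strip_self, ver_inv_hor_one, ← 𝒟.hor_one_mul e2, 𝒟.hor.src_one]

end IsFrame

theorem IsStairOn.mono [LE I] {S T : Set I} {A : I → I → I → I → D} (hA : 𝒟.IsStairOn S A)
    (h : T ⊆ S) : 𝒟.IsStairOn T A where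
  ver_comp h1 h2 h3 h4 h5 := hA.ver_comp (h h1) (h h2) (h h3) (h h4) (h h5)
  ver_id h1 h2 h3 := hA.ver_id (h h1) (h h2) (h h3)
  hor_comp h1 h2 h3 h4 h5 := hA.hor_comp (h h1) (h h2) (h h3) (h h4) (h h5)
  hor_id h1 h2 h3 := hA.hor_id (h h1) (h h2) (h h3)

theorem IsStairOn.comap {J : Type*} [LE I] [LE J] {S : Set I} {T : Set J}
    {A : I → I → I → I → D} (hA : 𝒟.IsStairOn S A) (m : J → I) (hm : ∀ a ∈ T, m a ∈ S)
    (hle : ∀ a ∈ T, ∀ b ∈ T, a ≤ b → m a ≤ m b) :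
    𝒟.IsStairOn T (fun i i' j j' => A (m i) (m i') (m j) (m j')) where
  ver_comp h1 h2 h3 h4 h5 l1 l2 l3 l4 := hA.ver_comp (hm _ h1) (hm _ h2) (hm _ h3) (hm _ h4)
    (hm _ h5) (hle _ h1 _ h2 l1) (hle _ h2 _ h3 l2) (hle _ h3 _ h4 l3) (hle _ h4 _ h5 l4)
  ver_id h1 h2 h3 l1 l2 := hA.ver_id (hm _ h1) (hm _ h2) (hm _ h3) (hle _ h1 _ h2 l1)
    (hle _ h2 _ h3 l2)
  hor_comp h1 h2 h3 h4 h5 l1 l2 l3 l4 := hA.hor_comp (hm _ h1) (hm _ h2) (hm _ h3) (hm _ h4)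
    (hm _ h5) (hle _ h1 _ h2 l1) (hle _ h2 _ h3 l2) (hle _ h3 _ h4 l3) (hle _ h4 _ h5 l4)
  hor_id h1 h2 h3 l1 l2 := hA.hor_id (hm _ h1) (hm _ h2) (hm _ h3) (hle _ h1 _ h2 l1)
    (hle _ h2 _ h3 l2)

theorem IsStairOn.congr [Preorder I] {S : Set I} {A B : I → I → I → I → D} (hA : 𝒟.IsStairOn S A)
    (h : ∀ i ∈ S, ∀ i' ∈ S, ∀ j ∈ S, ∀ j' ∈ S, i ≤ i' → i' ≤ j → j ≤ j' →
      B i i' j j' = A i i' j j') : 𝒟.IsStairOn S B where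
  ver_comp h1 h2 h3 h4 h5 l1 l2 l3 l4 := by
    rw [h _ h1 _ h2 _ h4 _ h5 l1 (l2.trans l3) l4, h _ h2 _ h3 _ h4 _ h5 l2 l3 l4,
      h _ h1 _ h3 _ h4 _ h5 (l1.trans l2) l3 l4]
    exact hA.ver_comp h1 h2 h3 h4 h5 l1 l2 l3 l4
  ver_id h1 h2 h3 l1 l2 := by
    rw [h _ h1 _ h1 _ h2 _ h3 le_rfl l1 l2]
    exact hA.ver_id h1 h2 h3 l1 l2
  hor_comp h1 h2 h3 h4 h5 l1 l2 l3 l4 := by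
    rw [h _ h1 _ h2 _ h3 _ h4 l1 l2 l3, h _ h1 _ h2 _ h4 _ h5 l1 (l2.trans l3) l4,
      h _ h1 _ h2 _ h3 _ h5 l1 l2 (l3.trans l4)]
    exact hA.hor_comp h1 h2 h3 h4 h5 l1 l2 l3 l4
  hor_id h1 h2 h3 l1 l2 := by
    rw [h _ h1 _ h2 _ h3 _ h3 l1 l2 le_rfl]
    exact hA.hor_id h1 h2 h3 l1 l2

open OrderDual in
/-- A staircase reflected in the antidiagonal. -/
theorem IsStairOn.rev [LE I] {S : Set I} {A : I → I → I → I → D} (hA : 𝒟.IsStairOn S A) :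
    𝒟.rev.IsStairOn (I := Iᵒᵈ) (ofDual ⁻¹' S)
      (fun i i' j j' => A (ofDual j') (ofDual j) (ofDual i') (ofDual i)) where
  ver_comp h1 h2 h3 h4 h5 l1 l2 l3 l4 :=
    have h := hA.hor_comp h5 h4 h3 h2 h1 l4 l3 l2 l1
    ⟨h.1.symm, h.2⟩
  ver_id h1 h2 h3 l1 l2 := 𝒟.hor.eq_one_tgt (hA.hor_id h3 h2 h1 l2 l1)
  hor_comp h1 h2 h3 h4 h5 l1 l2 l3 l4 :=
    have h := hA.ver_comp h5 h4 h3 h2 h1 l4 l3 l2 l1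
    ⟨h.1.symm, h.2⟩
  hor_id h1 h2 h3 l1 l2 := 𝒟.ver.eq_one_tgt (hA.ver_id h3 h2 h1 l2 l1)

section Base

variable [LinearOrder I]

variable (𝒟) in
/-- The frame which a staircase has with respect to an index `k`. It involves no more than three
indices at once, and determines the squares `A i i' j j'` with `k ≤ j`. -/
def baseFrame (k : I) (A : I → I → I → I → D) (i j : I) : D :=
  if k ≤ i then A k i i j else 𝒟.ver.inv (A i k k j)

variable {k : I} {A : I → I → I → I → D}

/-- The two cases in the definition of `baseFrame` agree for `i = k`, since `A k k k j` is a unit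
and hence equals its inverse. -/
theorem baseFrame_of_le {i j : I} (hA : 𝒟.IsStairOn {i, j, k} A) (h : i ≤ k) (h' : k ≤ j) :
    𝒟.baseFrame k A i j = 𝒟.ver.inv (A i k k j) := by
  rcases h.lt_or_eq with h | rfl
  · exact if_neg h.not_ge
  · rw [baseFrame, if_pos le_rfl, hA.ver_id (by simp) (by simp) (by simp) le_rfl h']
    simp

theorem IsStairOn.hor_tgt_eq {S : Set I} (hA : 𝒟.IsStairOn S A) {i i' j j' : I} (hi : i ∈ S)
    (hi' : i' ∈ S) (hj : j ∈ S) (hj' : j' ∈ S) (h : i ≤ i') (h' : i' ≤ j) (h'' : j ≤ j') :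
    𝒟.hor.tgt (A i i' j j') = 𝒟.hor.tgt (A i i' j j) := by
  have h1 := hA.hor_comp hi hi' hj hj hj' h h' le_rfl h''
  rw [← h1.1, hA.hor_id hi hi' hj h h']
  simp

theorem IsStairOn.hor_src_eq {S : Set I} (hA : 𝒟.IsStairOn S A) {i i' j j' : I} (hi : i ∈ S)
    (hi' : i' ∈ S) (hj : j ∈ S) (hj' : j' ∈ S) (h : i ≤ i') (h' : i' ≤ j) (h'' : j ≤ j') :
    𝒟.hor.src (A i i' j j') = 𝒟.hor.src (A i i' j' j') := by
  have h1 := hA.hor_comp hi hi' hj hj' hj' h h' h'' le_rfl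
  rw [h1.1, hA.hor_id hi hi' hj' h (h'.trans h'')]
  simp

theorem IsStairOn.ver_tgt_eq {S : Set I} (hA : 𝒟.IsStairOn S A) {i i' j j' : I} (hi : i ∈ S)
    (hi' : i' ∈ S) (hj : j ∈ S) (hj' : j' ∈ S) (h : i ≤ i') (h' : i' ≤ j) (h'' : j ≤ j') :
    𝒟.ver.tgt (A i i' j j') = 𝒟.ver.tgt (A i i j j') := by
  have h1 := hA.ver_comp hi hi hi' hj hj' le_rfl h h' h''
  rw [← h1.1, hA.ver_id hi hj hj' (h.trans h') h'']
  simp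

theorem IsStairOn.ver_src_eq {S : Set I} (hA : 𝒟.IsStairOn S A) {i i' j j' : I} (hi : i ∈ S)
    (hi' : i' ∈ S) (hj : j ∈ S) (hj' : j' ∈ S) (h : i ≤ i') (h' : i' ≤ j) (h'' : j ≤ j') :
    𝒟.ver.src (A i i' j j') = 𝒟.ver.src (A i' i' j j') := by
  have h1 := hA.ver_comp hi hi' hi' hj hj' h le_rfl h' h''
  rw [h1.1, hA.ver_id hi' hj hj' h' h'']
  simp

theorem hor_tgt_baseFrame {i j : I} (hA : 𝒟.IsStairOn {i, j, k} A) (h : i ≤ j) (h' : k ≤ j) :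
    𝒟.hor.tgt (𝒟.baseFrame k A i j) =
      if k ≤ i then 𝒟.hor.tgt (A k i i i) else 𝒟.sideH.inv (𝒟.hor.tgt (A i k k k)) := by
  rw [baseFrame]
  split_ifs with hk
  · exact hA.hor_tgt_eq (by simp) (by simp) (by simp) (by simp) hk le_rfl h
  · rw [hor_tgt_ver_inv, hA.hor_tgt_eq (by simp) (by simp) (by simp) (by simp) (not_le.1 hk).le
      le_rfl h']

theorem ver_tgt_baseFrame {i j : I} (hA : 𝒟.IsStairOn {i, j, k} A) (h : i ≤ j) (h' : k ≤ j) :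
    𝒟.ver.tgt (𝒟.baseFrame k A i j) =
      if k ≤ i then 𝒟.sideV.mul (𝒟.sideV.inv (𝒟.ver.tgt (A k k k i))) (𝒟.ver.tgt (A k k k j))
      else 𝒟.ver.tgt (A k k k j) := by
  rw [baseFrame]
  split_ifs with hk
  · rw [hA.ver_tgt_eq (by simp) (by simp) (by simp) (by simp) hk le_rfl h]
    obtain ⟨h1, h2⟩ := hA.hor_comp (i := k) (i' := k) (j := k) (j' := i) (j'' := j)
      (by simp) (by simp) (by simp) (by simp) (by simp) le_rfl le_rfl hk h
    rw [h2, 𝒟.ver_tgt_mul _ _ h1, 𝒟.sideV.inv_mul_cancel_left]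
    rw [← 𝒟.tgt_src, ← 𝒟.tgt_tgt, h1]
  · rw [𝒟.ver.tgt_inv, hA.ver_src_eq (by simp) (by simp) (by simp) (by simp) (not_le.1 hk).le
      le_rfl h', hA.ver_id (by simp) (by simp) (by simp) le_rfl h', 𝒟.ver.src_one, 𝒟.ver.tgt_one]

theorem sideV_tgt_base {i j : I} (hA : 𝒟.IsStairOn {i, j, k} A) (h : k ≤ i) (h' : k ≤ j) :
    𝒟.sideV.tgt (𝒟.ver.tgt (A k k k i)) = 𝒟.sideV.tgt (𝒟.ver.tgt (A k k k j)) := by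
  rw [← 𝒟.tgt_tgt, ← 𝒟.tgt_tgt, hA.hor_tgt_eq (by simp) (by simp) (by simp) (by simp) le_rfl
    le_rfl h, hA.hor_tgt_eq (by simp) (by simp) (by simp) (by simp) le_rfl le_rfl h']

/-- The vertical targets of `baseFrame k A i j` and of `baseFrame k A i j'` differ by the quotient of
the vertical targets of `A k k k j` and `A k k k j'`, for all `i`. -/
theorem isFrame_baseFrame (hA : ∀ i j, 𝒟.IsStairOn {i, j, k} A) :
    𝒟.IsFrame (fun i j => i ≤ j ∧ k ≤ j) (𝒟.baseFrame k A) where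
  tgt_eq {i j j'} h h' := by
    rw [hor_tgt_baseFrame (hA i j) h.1 h.2, hor_tgt_baseFrame (hA i j') h'.1 h'.2]
  ratio_eq {i i' j j'} h h' h'' h''' := by
    have key : ∀ i, i ≤ j → i ≤ j' →
        𝒟.sideV.mul (𝒟.sideV.inv (𝒟.ver.tgt (𝒟.baseFrame k A i j)))
          (𝒟.ver.tgt (𝒟.baseFrame k A i j')) =
        𝒟.sideV.mul (𝒟.sideV.inv (𝒟.ver.tgt (A k k k j))) (𝒟.ver.tgt (A k k k j')) := by
      intro i hij hij'
      rw [ver_tgt_baseFrame (hA i j) hij h.2, ver_tgt_baseFrame (hA i j') hij' h'.2]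
      split_ifs with hk
      · have e1 := sideV_tgt_base (hA i j) hk h.2
        have e2 := sideV_tgt_base (hA i j') hk h'.2
        rw [𝒟.sideV.inv_mul_rev (by simpa using e1), 𝒟.sideV.inv_inv,
          𝒟.sideV.mul_assoc _ _ _ (by simp [e1]) (by
            rw [𝒟.sideV.tgt_mul _ _ (by simp [e2]), 𝒟.sideV.tgt_inv]),
          𝒟.sideV.mul_inv_cancel_left e2]
      · rfl
    rw [key i h.1 h'.1, key i' h''.1 h'''.1]

/-- A staircase is determined by its frame, as far as the squares `A i i' j j'` with `k ≤ j` are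
concerned. -/
theorem IsStairOn.eq_rect {S : Set I} (hA : 𝒟.IsStairOn S A) (hk : k ∈ S) {i i' j j' : I}
    (hi : i ∈ S) (hi' : i' ∈ S) (hj : j ∈ S) (hj' : j' ∈ S) (h : i ≤ i') (h' : i' ≤ j)
    (h'' : j ≤ j') (hkj : k ≤ j) : A i i' j j' = 𝒟.rect (𝒟.baseFrame k A) i i' j j' := by
  have hs : ∀ i, i ∈ S → i ≤ j → 𝒟.strip (𝒟.baseFrame k A) i j j' =
      if k ≤ i then A k i j j' else 𝒟.ver.inv (A i k j j') := by
    intro i hi hij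
    rw [strip, baseFrame, baseFrame]
    split_ifs with hki
    · obtain ⟨h1, h2⟩ := hA.hor_comp hk hi hi hj hj' hki le_rfl hij h''
      rw [h2, 𝒟.hor.inv_mul_cancel_left h1]
    · obtain ⟨h1, h2⟩ := hA.hor_comp hi hk hk hj hj' (not_le.1 hki).le le_rfl hkj h''
      rw [h2, 𝒟.ver_inv_hor_mul h1, 𝒟.hor.inv_mul_cancel_left (by simp [h1])]
  rw [rect, hs i hi (h.trans h'), hs i' hi' h']
  by_cases h1 : k ≤ i
  · rw [if_pos h1, if_pos (h1.trans h)]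
    obtain ⟨h2, h3⟩ := hA.ver_comp hk hi hi' hj hj' h1 h h' h''
    rw [h3, 𝒟.ver.inv_mul_cancel_left h2]
  · rw [if_neg h1, 𝒟.ver.inv_inv]
    by_cases h2 : k ≤ i'
    · rw [if_pos h2]
      exact (hA.ver_comp hi hk hi' hj hj' (not_le.1 h1).le h2 h' h'').2
    · rw [if_neg h2]
      obtain ⟨h3, h4⟩ := hA.ver_comp hi hi' hk hj hj' h (not_le.1 h2).le hkj h''
      rw [h4, 𝒟.ver.mul_inv_cancel_right h3]

open OrderDual

/-- A staircase reflected in the antidiagonal. -/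
def revStair (A : I → I → I → I → D) (i i' j j' : Iᵒᵈ) : D :=
  A (ofDual j') (ofDual j) (ofDual i') (ofDual i)

variable (𝒟) in
/-- The square with index `(i, i', j, j')`, `i' ≤ k`, spanned by the squares of the frame of the
reflected staircase. -/
def corect (k : I) (A : I → I → I → I → D) (i i' j j' : I) : D :=
  𝒟.rev.rect (𝒟.rev.baseFrame (toDual k) (revStair A)) (toDual j') (toDual j) (toDual i')
    (toDual i)

variable (𝒟) in
/-- The staircase obtained from the squares of `A` with at most two indices different from `k`. -/
def glue (k : I) (A : I → I → I → I → D) (i i' j j' : I) : D :=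
  if k ≤ j then 𝒟.rect (𝒟.baseFrame k A) i i' j j' else 𝒟.corect k A i i' j j'

theorem rev_triple (hA : ∀ i j, 𝒟.IsStairOn {i, j, k} A) (i j : Iᵒᵈ) :
    𝒟.rev.IsStairOn {i, j, toDual k} (revStair A) :=
  (hA (ofDual i) (ofDual j)).rev

/-- For `i' ≤ k ≤ j` the square with index `(i, i', j, j')` can be obtained from the four squares
`A a k k b` either as a vertical quotient of horizontal quotients or the other way around; the
two results agree by the interchange law. -/
theorem rect_eq_corect (hA : ∀ i j, 𝒟.IsStairOn {i, j, k} A) {i i' j j' : I} (h : i ≤ i')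
    (h' : i' ≤ k) (hk : k ≤ j) (h'' : j ≤ j') :
    𝒟.rect (𝒟.baseFrame k A) i i' j j' = 𝒟.corect k A i i' j j' := by
  have hr := rev_triple hA
  have e1 : ∀ a b, a ≤ k → k ≤ b → 𝒟.baseFrame k A a b = 𝒟.ver.inv (A a k k b) :=
    fun a b ha hb => baseFrame_of_le (hA a b) ha hb
  have e2 : ∀ a b : I, a ≤ k → k ≤ b →
      𝒟.rev.baseFrame (toDual k) (revStair A) (toDual b) (toDual a) = 𝒟.hor.inv (A a k k b) :=
    fun a b ha hb => baseFrame_of_le (hr (toDual b) (toDual a)) hb ha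
  have c1 : ∀ a, a ≤ k → 𝒟.hor.tgt (A a k k j) = 𝒟.hor.tgt (A a k k j') := by
    intro a ha
    rw [(hA a j).hor_tgt_eq (by simp) (by simp) (by simp) (by simp) ha le_rfl hk,
      (hA a j').hor_tgt_eq (by simp) (by simp) (by simp) (by simp) ha le_rfl (hk.trans h'')]
  have c2 : ∀ b, k ≤ b → 𝒟.ver.src (A i k k b) = 𝒟.ver.src (A i' k k b) := by
    intro b hb
    rw [(hA i b).ver_src_eq (by simp) (by simp) (by simp) (by simp) (h.trans h') le_rfl hb,
      (hA i' b).ver_src_eq (by simp) (by simp) (by simp) (by simp) h' le_rfl hb]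
  have hi := h.trans h'
  have hj := hk.trans h''
  change 𝒟.ver.mul (𝒟.ver.inv (𝒟.hor.mul _ _)) (𝒟.hor.mul _ _) =
    𝒟.hor.mul (𝒟.ver.mul _ (𝒟.ver.inv _)) (𝒟.hor.inv (𝒟.ver.mul _ (𝒟.ver.inv _)))
  rw [e1 i j hi hk, e1 i j' hi hj, e1 i' j h' hk, e1 i' j' h' hj, e2 i j hi hk, e2 i j' hi hj,
    e2 i' j h' hk, e2 i' j' h' hj, 𝒟.ver_inv_hor_mul (by simp [c1 i hi]),
    𝒟.hor_inv_ver_mul (by simp [c2 j' hj]), 𝒟.hor_inv_ver_inv, 𝒟.hor_inv_ver_inv,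
    𝒟.hor_inv_ver_inv, 𝒟.hor.inv_inv, 𝒟.hor.inv_inv, 𝒟.ver.inv_inv, 𝒟.ver.inv_inv]
  exact 𝒟.interchange _ _ _ _ (by simp [c1 i hi]) (by simp [c1 i' h'])
    (by simp [c2 j hk]) (by simp [c2 j' hj])

theorem glue_of_le (hA : ∀ i j, 𝒟.IsStairOn {i, j, k} A) {i i' j j' : I} (h : i ≤ i')
    (h' : i' ≤ k) (h'' : j ≤ j') : 𝒟.glue k A i i' j j' = 𝒟.corect k A i i' j j' := by
  rw [glue]
  split_ifs with hk
  · exact rect_eq_corect hA h h' hk h''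
  · rfl

/-- Squares which form staircases on all triples of indices containing `k` extend to a
staircase. -/
theorem isStairOn_glue (hA : ∀ i j, 𝒟.IsStairOn {i, j, k} A) :
    𝒟.IsStairOn univ (𝒟.glue k A) := by
  -- for `k ≤ j` the axioms hold since `glue` comes from a frame, and otherwise since all the squares
  -- involved, which have `i' ≤ k`, come from a frame of the reflected staircase
  have hF := isFrame_baseFrame hA
  have hF' := isFrame_baseFrame (rev_triple hA)
  refine ⟨?_, ?_, ?_, ?_⟩
  · intro i i' i'' j j' _ _ _ _ _ h h' h'' h'''
    by_cases hk : k ≤ j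
    · simp only [glue, if_pos hk]
      have l2 := h'.trans h''
      have l1 := h.trans l2
      exact hF.rect_ver_comp ⟨l1, hk⟩ ⟨l1.trans h''', hk.trans h'''⟩ ⟨l2, hk⟩
        ⟨l2.trans h''', hk.trans h'''⟩ ⟨h'', hk⟩ ⟨h''.trans h''', hk.trans h'''⟩
    · have l3 : i'' ≤ k := h''.trans (not_le.1 hk).le
      have l2 : i' ≤ k := h'.trans l3
      have l1 : i ≤ k := h.trans l2
      have m2 := h'.trans h''
      have m1 := h.trans m2
      simp only [glue, if_neg hk]
      have := hF'.rect_hor_comp (i := toDual j') (i' := toDual j) (j := toDual i'')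
        (j' := toDual i') (j'' := toDual i) ⟨h''.trans h''', l3⟩ ⟨m2.trans h''', l2⟩
        ⟨m1.trans h''', l1⟩ ⟨h'', l3⟩ ⟨m2, l2⟩ ⟨m1, l1⟩
      exact ⟨this.1.symm, this.2⟩
  · intro i j j' _ _ _ h h'
    by_cases hk : k ≤ j
    · simp only [glue, if_pos hk]
      exact rect_ver_id
    · have l1 : i ≤ k := h.trans (not_le.1 hk).le
      simp only [glue, if_neg hk]
      have h1 := hF'.rect_hor_id (i := toDual j') (i' := toDual j) (j := toDual i)
        ⟨h.trans h', l1⟩ ⟨h, l1⟩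
      have h2 := congrArg 𝒟.rev.hor.tgt h1
      rw [𝒟.rev.hor.tgt_one] at h2
      exact h1.trans (congrArg 𝒟.rev.hor.one h2.symm)
  · intro i i' j j' j'' _ _ _ _ _ h h' h'' h'''
    by_cases hk : k ≤ j
    · simp only [glue, if_pos hk, if_pos (hk.trans h'')]
      have l1 := h.trans h'
      have hk' := hk.trans h''
      exact hF.rect_hor_comp ⟨l1, hk⟩ ⟨l1.trans h'', hk'⟩ ⟨l1.trans (h''.trans h'''), hk'.trans h'''⟩
        ⟨h', hk⟩ ⟨h'.trans h'', hk'⟩ ⟨h'.trans (h''.trans h'''), hk'.trans h'''⟩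
    · have l2 : i' ≤ k := h'.trans (not_le.1 hk).le
      have l1 : i ≤ k := h.trans l2
      rw [glue_of_le hA h l2 h'', glue_of_le hA h l2 h''', glue_of_le hA h l2 (h''.trans h''')]
      have m := h.trans h'
      have := hF'.rect_ver_comp (i := toDual j'') (i' := toDual j') (i'' := toDual j)
        (j := toDual i') (j' := toDual i) ⟨h'.trans (h''.trans h'''), l2⟩
        ⟨m.trans (h''.trans h'''), l1⟩ ⟨h'.trans h'', l2⟩ ⟨m.trans h'', l1⟩ ⟨h', l2⟩ ⟨m, l1⟩
      exact ⟨this.1.symm, this.2⟩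
  · intro i i' j _ _ _ h h'
    by_cases hk : k ≤ j
    · simp only [glue, if_pos hk]
      exact hF.rect_hor_id ⟨h.trans h', hk⟩ ⟨h', hk⟩
    · simp only [glue, if_neg hk]
      have h1 := rect_ver_id (𝒟 := 𝒟.rev) (F := 𝒟.rev.baseFrame (toDual k) (revStair A))
        (i := toDual j) (j := toDual i') (j' := toDual i)
      have h2 := congrArg 𝒟.rev.ver.tgt h1
      rw [𝒟.rev.ver.tgt_one] at h2
      exact h1.trans (congrArg 𝒟.rev.ver.one h2.symm)

/-- A staircase is the only extension of its squares with at most two indices different from `k`. -/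
theorem IsStairOn.eq_glue {S : Set I} (hA : 𝒟.IsStairOn S A) (hk : k ∈ S) {i i' j j' : I}
    (hi : i ∈ S) (hi' : i' ∈ S) (hj : j ∈ S) (hj' : j' ∈ S) (h : i ≤ i') (h' : i' ≤ j)
    (h'' : j ≤ j') : A i i' j j' = 𝒟.glue k A i i' j j' := by
  rw [glue]
  split_ifs with hkj
  · exact hA.eq_rect hk hi hi' hj hj' h h' h'' hkj
  · exact hA.rev.eq_rect (k := toDual k) (i := toDual j') (i' := toDual j) (j := toDual i')
      (j' := toDual i) hk hj' hj hi' hi h'' h' h (h'.trans (not_le.1 hkj).le)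

end Base

end DoubleLieGroupoid

/-! ### The bar construction in terms of staircases -/

namespace DoubleLieGroupoid

variable {D V H M : SmoothMfd.{u}} {𝒟 : DoubleLieGroupoid D V H M} {r : ℕ}

namespace Bar

/-- The square of the grid `x_p` with rows from `a` to `b` and columns from `c` to `d`. -/
def val (x : 𝒟.Bar r) {p q : ℕ} (e : p + q = r) {a b c d : ℕ} (hab : a ≤ b) (hb : b ≤ p)
    (hcd : c ≤ d) (hd : d ≤ q) : D :=
  (x.1 p q e).1 (.mk (i := ⟨a, by omega⟩) (j := ⟨b, by omega⟩) hab)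
    (.mk (i := ⟨c, by omega⟩) (j := ⟨d, by omega⟩) hcd)

/-- The relation `v_0 x_p = h_{p+1} x_{p+1}`: the square with columns from `c` to `d` of the grid
`x_{p+1}` has columns from `c + 1` to `d + 1` in the grid `x_p`. -/
theorem val_succ (x : 𝒟.Bar r) {p q : ℕ} (e : p + q + 1 = r) {a b c d : ℕ} (hab : a ≤ b)
    (hb : b ≤ p) (hcd : c ≤ d) (hd : d ≤ q) :
    x.val (p := p + 1) (q := q) (by omega) hab (by omega) hcd hd =
      x.val (p := p) (q := q + 1) (by omega) hab hb (c := c + 1) (d := d + 1) (by omega)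
        (by omega) := by
  have h := congrFun (congrFun (congrArg Subtype.val (x.2 p q e))
    (.mk (i := ⟨a, by omega⟩) (j := ⟨b, by omega⟩) hab))
    (.mk (i := ⟨c, by omega⟩) (j := ⟨d, by omega⟩) hcd)
  refine Eq.trans ?_ (h.symm.trans ?_)
  · refine congrArg (fun c' => (x.1 (p + 1) q _).1 c' (.mk (i := ⟨c, by omega⟩)
      (j := ⟨d, by omega⟩) hcd)) (Subtype.ext ?_)
    simp [Arrow.map]
  · change (x.1 p (q + 1) _).1 _ _ = (x.1 p (q + 1) _).1 _ _
    congr 1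

theorem val_add (x : 𝒟.Bar r) (m : ℕ) {p q : ℕ} (e : p + m + q = r) {a b c d : ℕ} (hab : a ≤ b)
    (hb : b ≤ p) (hcd : c ≤ d) (hd : d ≤ q) :
    x.val (p := p + m) (q := q) e hab (by omega) hcd hd =
      x.val (p := p) (q := q + m) (by omega) hab hb (c := c + m) (d := d + m) (by omega)
        (by omega) := by
  induction m generalizing q c d with
  | zero => rfl
  | succ m ih =>
    have h1 := x.val_succ (p := p + m) (q := q) (by omega) hab (by omega) hcd hd
    refine h1.trans ?_
    have h2 := ih (q := q + 1) (by omega) (c := c + 1) (d := d + 1) (by omega) (by omega)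
    refine h2.trans ?_
    have e1 : q + 1 + m = q + (m + 1) := by omega
    have e2 : c + 1 + m = c + (m + 1) := by omega
    have e3 : d + 1 + m = d + (m + 1) := by omega
    congr 1

/-- The square with rows from `i` to `i'` and columns from `j` to `j'`, for `i ≤ i' ≤ j ≤ j'`. It
is contained in all the grids `x_p` with `i' ≤ p ≤ j`. For other indices it is a junk value. -/
def sq (x : 𝒟.Bar r) (i i' j j' : Fin (r + 1)) : D :=
  if h : i ≤ i' ∧ i' ≤ j ∧ j ≤ j' then
    x.val (p := i') (q := r - i') (by omega) (a := i) (b := i') (c := j - i') (d := j' - i') h.1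
      le_rfl (Nat.sub_le_sub_right h.2.2 _) (by omega)
  else x.val (p := 0) (q := r) (by omega) (le_refl 0) le_rfl (le_refl 0) (by omega)

theorem sq_eq_val (x : 𝒟.Bar r) {i i' j j' : Fin (r + 1)} (h : i ≤ i') {p q : ℕ} (e : p + q = r)
    (hp : i' ≤ p) {c d : ℕ} (hc : j = p + c) (hd : j' = p + d) (hcd : c ≤ d) :
    x.sq i i' j j' = x.val e (a := i) (b := i') h hp hcd (by omega) := by
  have h1 : i' ≤ j := by rw [Fin.le_def]; omega
  have h2 : j ≤ j' := by rw [Fin.le_def]; omega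
  rw [sq, dif_pos ⟨h, h1, h2⟩]
  obtain ⟨m, rfl⟩ : ∃ m, p = i' + m := ⟨p - i', by omega⟩
  rw [x.val_add m e h le_rfl hcd (by omega)]
  have e1 : r - i' = q + m := by omega
  have e2 : j - i' = c + m := by omega
  have e3 : j' - i' = d + m := by omega
  simp only [e1, e2, e3]

theorem val_eq_sq (x : 𝒟.Bar r) {p q : ℕ} (e : p + q = r) (c : Arrow p) (d : Arrow q) :
    (x.1 p q e).1 c d = x.sq ⟨c.1.1, by omega⟩ ⟨c.1.2, by omega⟩ ⟨p + d.1.1, by omega⟩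
      ⟨p + d.1.2, by omega⟩ := by
  have hd : (d.1.1 : ℕ) ≤ d.1.2 := d.2
  have hc : (⟨c.1.1, by omega⟩ : Fin (r + 1)) ≤ ⟨c.1.2, by omega⟩ := c.2
  rw [x.sq_eq_val hc e (Nat.lt_succ_iff.1 c.1.2.2) rfl rfl hd]
  rfl

theorem coord_eq_sq (x : 𝒟.Bar r)
    (k : Σ a : {a : ℕ × ℕ // a.1 + a.2 = r}, Arrow a.1.1 × Arrow a.1.2) :
    have e : k.1.1.1 + k.1.1.2 = r := k.1.2
    Bar.coord k x = x.sq ⟨k.2.1.1.1, by omega⟩ ⟨k.2.1.1.2, by omega⟩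
      ⟨k.1.1.1 + k.2.2.1.1, by omega⟩ ⟨k.1.1.1 + k.2.2.1.2, by omega⟩ :=
  x.val_eq_sq k.1.2 k.2.1 k.2.2

theorem isStairOn_sq (x : 𝒟.Bar r) : 𝒟.IsStairOn univ x.sq where
  ver_comp {i i' i'' j j'} _ _ _ _ _ h h' h'' h''' := by
    have e : (i'' : ℕ) + (r - i'') = r := by omega
    have e1 : (j : ℕ) = i'' + (j - i'') := by omega
    have e2 : (j' : ℕ) = i'' + (j' - i'') := by omega
    have e3 : (j : ℕ) - i'' ≤ j' - i'' := by omega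
    rw [x.sq_eq_val h e h' e1 e2 e3, x.sq_eq_val h' e le_rfl e1 e2 e3,
      x.sq_eq_val (h.trans h') e le_rfl e1 e2 e3]
    exact (x.1 _ _ e).2.ver_comp _ _ _
  ver_id {i j j'} _ _ _ h h' := by
    have e : (i : ℕ) + (r - i) = r := by omega
    rw [x.sq_eq_val le_rfl e le_rfl (c := j - i) (d := j' - i) (by omega) (by omega) (by omega)]
    exact (x.1 _ _ e).2.ver_id _ _
  hor_comp {i i' j j' j''} _ _ _ _ _ h h' h'' h''' := by
    have e : (i' : ℕ) + (r - i') = r := by omega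
    have e1 : (j : ℕ) = i' + (j - i') := by omega
    have e2 : (j' : ℕ) = i' + (j' - i') := by omega
    have e3 : (j'' : ℕ) = i' + (j'' - i') := by omega
    rw [x.sq_eq_val h e le_rfl e1 e2 (by omega), x.sq_eq_val h e le_rfl e2 e3 (by omega),
      x.sq_eq_val h e le_rfl e1 e3 (by omega)]
    exact (x.1 _ _ e).2.hor_comp (i := ⟨j - i', by omega⟩) (j := ⟨j' - i', by omega⟩)
      (k := ⟨j'' - i', by omega⟩) (by rw [Fin.le_def]; dsimp only; omega)
      (by rw [Fin.le_def]; dsimp only; omega) _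
  hor_id {i i' j} _ _ _ h h' := by
    have e : (i' : ℕ) + (r - i') = r := by omega
    have e1 : (j : ℕ) = i' + (j - i') := by omega
    rw [x.sq_eq_val h e le_rfl e1 e1 le_rfl]
    exact (x.1 _ _ e).2.hor_id _ _

theorem ext_sq {x y : 𝒟.Bar r}
    (h : ∀ i i' j j', i ≤ i' → i' ≤ j → j ≤ j' → x.sq i i' j j' = y.sq i i' j j') : x = y := by
  apply Subtype.ext
  funext p q e
  apply Subtype.ext
  funext c d
  rw [val_eq_sq, val_eq_sq]
  refine h _ _ _ _ c.2 ?_ ?_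
  · have := c.1.2.2
    rw [Fin.le_def]; dsimp only; omega
  · have : (d.1.1 : ℕ) ≤ d.1.2 := d.2
    rw [Fin.le_def]; dsimp only; omega

/-- The element of the bar construction defined by a staircase. -/
def ofStair (A : Fin (r + 1) → Fin (r + 1) → Fin (r + 1) → Fin (r + 1) → D)
    (hA : 𝒟.IsStairOn univ A) : 𝒟.Bar r :=
  ⟨fun p q e => ⟨fun c d => A ⟨c.1.1, by omega⟩ ⟨c.1.2, by omega⟩ ⟨p + d.1.1, by omega⟩
      ⟨p + d.1.2, by omega⟩,
    { ver_comp := fun {i j k} hij hjk c => hA.ver_comp trivial trivial trivial trivial trivial hij hjk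
        (by rw [Fin.le_def]; dsimp only; omega)
        (by have : (c.1.1 : ℕ) ≤ c.1.2 := c.2
            rw [Fin.le_def]; dsimp only; omega)
      ver_id := fun i c => hA.ver_id trivial trivial trivial
        (by rw [Fin.le_def]; dsimp only; omega)
        (by have : (c.1.1 : ℕ) ≤ c.1.2 := c.2
            rw [Fin.le_def]; dsimp only; omega)
      hor_comp := fun {i j k} hij hjk c => hA.hor_comp trivial trivial trivial trivial trivial c.2
        (by rw [Fin.le_def]; dsimp only; omega)
        (by rw [Fin.le_def] at hij ⊢; dsimp only; omega)
        (by rw [Fin.le_def] at hjk ⊢; dsimp only; omega)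
      hor_id := fun i c => hA.hor_id trivial trivial trivial c.2
        (by rw [Fin.le_def]; dsimp only; omega) }⟩,
    by
      intro p q e
      apply Subtype.ext
      funext c d
      change A _ _ _ _ = A _ _ _ _
      congr 1
      · simp [Arrow.map, OrderHom.id]
      · simp [Arrow.map, OrderHom.id]
      · simp [Arrow.map, OrderHom.id]; omega
      · simp [Arrow.map, OrderHom.id]; omega⟩

theorem sq_ofStair {A : Fin (r + 1) → Fin (r + 1) → Fin (r + 1) → Fin (r + 1) → D}
    (hA : 𝒟.IsStairOn univ A) {i i' j j' : Fin (r + 1)} (h : i ≤ i') (h' : i' ≤ j) (h'' : j ≤ j') :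
    (ofStair A hA).sq i i' j j' = A i i' j j' := by
  rw [sq_eq_val _ h (p := i') (q := r - i') (by omega) le_rfl (c := j - i') (d := j' - i')
    (by omega) (by omega) (by omega)]
  change A _ _ _ _ = A _ _ _ _
  congr 1
  · apply Fin.ext; dsimp only; omega
  · apply Fin.ext; dsimp only; omega

/-- The face `f_l` omits the vertex `l`. -/
theorem sq_face (l : Fin (r + 2)) (x : 𝒟.Bar (r + 1)) {i i' j j' : Fin (r + 1)} (h : i ≤ i')
    (h' : i' ≤ j) (h'' : j ≤ j') : (x.face l).sq i i' j j' =
      x.sq (l.succAbove i) (l.succAbove i') (l.succAbove j) (l.succAbove j') := by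
  rw [sq_eq_val _ h (p := i') (q := r - i') (by omega) le_rfl (c := j - i') (d := j' - i')
    (by omega) (by omega) (by omega)]
  have hi : (i : ℕ) ≤ i' := h
  by_cases hl : (i' : ℕ) < l
  · rw [val]
    simp only [face, dif_pos hl]
    change (x.1 _ _ _).1 _ _ = _
    rw [val_eq_sq]
    congr 1
    · apply Fin.ext
      simp [Arrow.map, OrderHom.id, Fin.succAbove, Fin.lt_def, show (i : ℕ) < l by omega]
    · apply Fin.ext
      simp [Arrow.map, OrderHom.id, Fin.succAbove, Fin.lt_def, hl]
    · apply Fin.ext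
      simp only [Arrow.map, Fin.succAbove, Fin.lt_def, coface]
      simp [Fin.succAbove, Fin.lt_def]
      split_ifs <;> simp <;> omega
    · apply Fin.ext
      simp only [Arrow.map, Fin.succAbove, Fin.lt_def, coface]
      simp [Fin.succAbove, Fin.lt_def]
      split_ifs <;> simp <;> omega
  · rw [val]
    simp only [face, dif_neg hl]
    change (x.1 _ _ _).1 _ _ = _
    rw [val_eq_sq]
    congr 1
    · apply Fin.ext
      simp [Arrow.map, Fin.succAbove, Fin.lt_def]
      split_ifs <;> simp
    · apply Fin.ext
      simp [Arrow.map, Fin.succAbove, Fin.lt_def]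
      split_ifs <;> simp
    · apply Fin.ext
      simp [Arrow.map, OrderHom.id, Fin.succAbove, Fin.lt_def]
      split_ifs <;> simp <;> omega
    · apply Fin.ext
      simp [Arrow.map, OrderHom.id, Fin.succAbove, Fin.lt_def]
      split_ifs <;> simp <;> omega

/-- The degeneracy `δ_l` repeats the vertex `l`. -/
theorem sq_degen (l : Fin (r + 1)) (x : 𝒟.Bar r) {i i' j j' : Fin (r + 2)} (h : i ≤ i')
    (h' : i' ≤ j) (h'' : j ≤ j') : (x.degen l).sq i i' j j' =
      x.sq (l.predAbove i) (l.predAbove i') (l.predAbove j) (l.predAbove j') := by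
  have hi : (i : ℕ) ≤ i' := h
  have hi' : (i' : ℕ) ≤ j := h'
  have hj : (j : ℕ) ≤ j' := h''
  by_cases hl : (i' : ℕ) ≤ l
  · obtain ⟨q, hq⟩ : ∃ q, (i' : ℕ) + (q + 1) = r + 1 := ⟨r - i', by omega⟩
    rw [sq_eq_val _ h (p := i') (q := q + 1) hq le_rfl (c := j - i') (d := j' - i')
      (by omega) (by omega) (by omega)]
    rw [val]
    simp only [degen, dif_pos hl]
    change (x.1 _ _ _).1 _ _ = _
    rw [val_eq_sq]
    congr 1
    · apply Fin.ext
      simp [Arrow.map, OrderHom.id, Fin.predAbove, Fin.lt_def, show ¬ (l : ℕ) < i by omega]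
    · apply Fin.ext
      simp [Arrow.map, OrderHom.id, Fin.predAbove, Fin.lt_def, show ¬ (l : ℕ) < i' by omega]
    · apply Fin.ext
      simp [Arrow.map, Fin.predAbove, Fin.lt_def]
      split_ifs <;> simp <;> omega
    · apply Fin.ext
      simp [Arrow.map, Fin.predAbove, Fin.lt_def]
      split_ifs <;> simp <;> omega
  · obtain ⟨p, hp⟩ : ∃ p, (i' : ℕ) = p + 1 := ⟨i' - 1, by omega⟩
    rw [sq_eq_val _ h (p := p + 1) (q := r - p) (by omega) (by omega) (c := j - i') (d := j' - i')
      (by omega) (by omega) (by omega)]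
    rw [val]
    simp only [degen, dif_neg (show ¬ p + 1 ≤ (l : ℕ) by omega)]
    change (x.1 _ _ _).1 _ _ = _
    rw [val_eq_sq]
    congr 1
    · apply Fin.ext
      simp [Arrow.map, Fin.predAbove, Fin.lt_def]
      split_ifs <;> simp
    · apply Fin.ext
      simp [Arrow.map, Fin.predAbove, Fin.lt_def]
      split_ifs <;> simp
    · apply Fin.ext
      simp [Arrow.map, Fin.predAbove, Fin.lt_def]
      split_ifs <;> simp <;> omega
    · apply Fin.ext
      simp [Arrow.map, Fin.predAbove, Fin.lt_def]
      split_ifs <;> simp <;> omega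

end Bar

end DoubleLieGroupoid

/-! ### Fans -/

namespace DoubleLieGroupoid

variable {D V H M : SmoothMfd.{u}} (𝒟 : DoubleLieGroupoid D V H M) {r : ℕ}
  {Z : SmoothMfd.{w}}

/-- The squares `F i j = A 0 i i j`, `i ≤ j`, of a staircase `A` satisfy the following conditions.
Conversely, squares which satisfy them come from a unique staircase. -/
structure IsFan (F : Fin (r + 1) → Fin (r + 1) → D) : Prop where
  hor_tgt : ∀ {i j}, i ≤ j → 𝒟.hor.tgt (F i j) = 𝒟.hor.tgt (F i i)
  ver_tgt : ∀ {i j}, i ≤ j → 𝒟.ver.tgt (F i j) =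
    𝒟.sideV.mul (𝒟.sideV.inv (𝒟.ver.tgt (F 0 i))) (𝒟.ver.tgt (F 0 j))
  diag : ∀ i, F i i = 𝒟.hor.one (𝒟.hor.tgt (F i i))
  zero : ∀ j, F 0 j = 𝒟.ver.one (𝒟.ver.tgt (F 0 j))

variable {𝒟}

namespace IsFan

variable {F : Fin (r + 1) → Fin (r + 1) → D}

theorem sideV_tgt (hF : 𝒟.IsFan F) (i j : Fin (r + 1)) :
    𝒟.sideV.tgt (𝒟.ver.tgt (F 0 i)) = 𝒟.sideV.tgt (𝒟.ver.tgt (F 0 j)) := by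
  rw [← 𝒟.tgt_tgt, ← 𝒟.tgt_tgt, hF.hor_tgt (Fin.zero_le i), hF.hor_tgt (Fin.zero_le j)]

theorem isFrame (hF : 𝒟.IsFan F) : 𝒟.IsFrame (fun i j => i ≤ j) F where
  tgt_eq h h' := by rw [hF.hor_tgt h, hF.hor_tgt h']
  ratio_eq {i i' j j'} h h' h'' h''' := by
    have key : ∀ i, i ≤ j → i ≤ j' →
        𝒟.sideV.mul (𝒟.sideV.inv (𝒟.ver.tgt (F i j))) (𝒟.ver.tgt (F i j')) =
        𝒟.sideV.mul (𝒟.sideV.inv (𝒟.ver.tgt (F 0 j))) (𝒟.ver.tgt (F 0 j')) := by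
      intro i h h'
      have e1 := hF.sideV_tgt i j
      have e2 := hF.sideV_tgt i j'
      rw [hF.ver_tgt h, hF.ver_tgt h', 𝒟.sideV.inv_mul_rev (by simpa using e1), 𝒟.sideV.inv_inv,
        𝒟.sideV.mul_assoc _ _ _ (by simp [e1]) (by
            rw [𝒟.sideV.tgt_mul _ _ (by simp [e2]), 𝒟.sideV.tgt_inv]),
        𝒟.sideV.mul_inv_cancel_left e2]
    rw [key i h h', key i' h'' h''']

theorem isStairOn (hF : 𝒟.IsFan F) : 𝒟.IsStairOn univ (𝒟.rect F) where
  ver_comp _ _ _ _ _ h1 h2 h3 h4 := hF.isFrame.rect_ver_comp (h1.trans (h2.trans h3))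
    (h1.trans (h2.trans (h3.trans h4))) (h2.trans h3) (h2.trans (h3.trans h4)) h3 (h3.trans h4)
  ver_id _ _ _ _ _ := rect_ver_id
  hor_comp _ _ _ _ _ h1 h2 h3 h4 := hF.isFrame.rect_hor_comp (h1.trans h2)
    (h1.trans (h2.trans h3)) (h1.trans (h2.trans (h3.trans h4))) h2 (h2.trans h3)
    (h2.trans (h3.trans h4))
  hor_id _ _ _ h1 h2 := hF.isFrame.rect_hor_id (h1.trans h2) h2

theorem rect_eq (hF : 𝒟.IsFan F) {i j : Fin (r + 1)} (h : i ≤ j) : 𝒟.rect F 0 i i j = F i j := by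
  have e1 : 𝒟.strip F i i j = F i j := by
    rw [strip, hF.diag i, LieGroupoid.inv_one, ← hF.hor_tgt h, 𝒟.hor.one_mul]
  have e2 : 𝒟.ver.inv (𝒟.strip F 0 i j) = 𝒟.ver.one (𝒟.ver.tgt (F i j)) := by
    rw [strip, hF.zero i, hF.zero j, hor_inv_ver_one, ← 𝒟.ver_one_mul
      (by simpa using hF.sideV_tgt i j), 𝒟.ver.inv_one, hF.ver_tgt h]
  rw [rect, e1, e2, 𝒟.ver.one_mul]

end IsFan

theorem isFan_of_isStairOn {A : Fin (r + 1) → Fin (r + 1) → Fin (r + 1) → Fin (r + 1) → D}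
    (hA : 𝒟.IsStairOn univ A) : 𝒟.IsFan (fun i j => A 0 i i j) where
  hor_tgt h := hA.hor_tgt_eq trivial trivial trivial trivial (Fin.zero_le _) le_rfl h
  ver_tgt {i j} h := by
    have h1 := hA.hor_comp (i := 0) (i' := 0) (j := 0) (j' := i) (j'' := j) trivial trivial trivial
      trivial trivial le_rfl le_rfl (Fin.zero_le _) h
    rw [hA.ver_tgt_eq trivial trivial trivial trivial (Fin.zero_le _) le_rfl h, h1.2,
      𝒟.ver_tgt_mul _ _ h1.1, 𝒟.sideV.inv_mul_cancel_left]
    rw [← 𝒟.tgt_src, ← 𝒟.tgt_tgt, h1.1]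
  diag i := 𝒟.hor.eq_one_tgt (hA.hor_id trivial trivial trivial (Fin.zero_le _) le_rfl)
  zero j := 𝒟.ver.eq_one_tgt (hA.ver_id trivial trivial trivial (Fin.zero_le _) (Fin.zero_le _))

namespace Bar

/-- The squares with rows from `0` to `i` and columns from `i` to `j`. -/
def fan (x : 𝒟.Bar r) (i j : Fin (r + 1)) : D := x.sq 0 i i j

theorem isFan (x : 𝒟.Bar r) : 𝒟.IsFan x.fan := isFan_of_isStairOn x.isStairOn_sq

theorem sq_eq_rect (x : 𝒟.Bar r) {i i' j j' : Fin (r + 1)} (h : i ≤ i') (h' : i' ≤ j)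
    (h'' : j ≤ j') : x.sq i i' j j' = 𝒟.rect x.fan i i' j j' := by
  rw [x.isStairOn_sq.eq_rect (k := 0) trivial trivial trivial trivial trivial h h' h''
    (Fin.zero_le _)]
  congr 1

theorem ext_fan {x y : 𝒟.Bar r} (h : ∀ i j, i ≤ j → x.fan i j = y.fan i j) : x = y := by
  apply ext_sq
  intro i i' j j' l l' l''
  rw [sq_eq_rect x l l' l'', sq_eq_rect y l l' l'']
  simp only [rect, strip, h _ _ l', h _ _ (l'.trans l''), h _ _ (l.trans l'),
    h _ _ (l.trans (l'.trans l''))]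

/-- The element of the bar construction defined by a fan. -/
def ofFan (F : Fin (r + 1) → Fin (r + 1) → D) (hF : 𝒟.IsFan F) : 𝒟.Bar r :=
  ofStair (𝒟.rect F) hF.isStairOn

theorem fan_ofFan {F : Fin (r + 1) → Fin (r + 1) → D} (hF : 𝒟.IsFan F) {i j : Fin (r + 1)}
    (h : i ≤ j) : (ofFan F hF).fan i j = F i j := by
  rw [fan, ofFan, sq_ofStair _ (Fin.zero_le _) le_rfl h, hF.rect_eq h]

theorem fan_face {l : Fin (r + 2)} (hl : l ≠ 0) (x : 𝒟.Bar (r + 1)) {i j : Fin (r + 1)}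
    (h : i ≤ j) : (x.face l).fan i j = x.fan (l.succAbove i) (l.succAbove j) := by
  rw [fan, sq_face l x (Fin.zero_le _) le_rfl h, Fin.succAbove_ne_zero_zero hl, fan]

/-- All the squares of `y ζ` depend smoothly on `ζ`, at `z`. -/
def SmoothGerm (y : Z → 𝒟.Bar r) (z : Z) : Prop :=
  ∀ ⦃i i' j j' : Fin (r + 1)⦄, i ≤ i' → i' ≤ j → j ≤ j' →
    SmoothAt (fun ζ => (y ζ).sq i i' j j') z

theorem SmoothGerm.of_fan {y : Z → 𝒟.Bar r} {z : Z}
    (h : ∀ i j, i ≤ j → SmoothAt (fun ζ => (y ζ).fan i j) z) : SmoothGerm y z := by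
  intro i i' j j' l l' l''
  have hs : ∀ i, i ≤ j → SmoothAt (fun ζ => 𝒟.strip (y ζ).fan i j j') z := by
    intro i hij
    refine 𝒟.hor.smoothAt_mul (𝒟.hor.smoothAt_inv (h i j hij)) (h i j' (hij.trans l''))
      (Eventually.of_forall fun ζ => ?_)
    rw [𝒟.hor.src_inv, (y ζ).isFan.isFrame.tgt_eq hij (hij.trans l'')]
  have h1 : SmoothAt (fun ζ => 𝒟.rect (y ζ).fan i i' j j') z :=
    𝒟.ver.smoothAt_mul (𝒟.ver.smoothAt_inv (hs i (l.trans l'))) (hs i' l')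
      (Eventually.of_forall fun ζ => (y ζ).isFan.isFrame.rect_composable (l.trans l')
        (l.trans (l'.trans l'')) l' (l'.trans l''))
  exact h1.congr (Eventually.of_forall fun ζ => sq_eq_rect (y ζ) l l' l'')

theorem SmoothGerm.fan {y : Z → 𝒟.Bar r} {z : Z} (h : SmoothGerm y z) {i j : Fin (r + 1)}
    (hij : i ≤ j) : SmoothAt (fun ζ => (y ζ).fan i j) z := h (Fin.zero_le _) le_rfl hij

/-- A germ of fans is a germ of elements of the bar construction. -/
theorem exists_germ_of_fan {F : Z → Fin (r + 1) → Fin (r + 1) → D} {z : Z}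
    (hF : ∀ i j, i ≤ j → SmoothAt (fun ζ => F ζ i j) z) (h : ∀ᶠ ζ in 𝓝 z, 𝒟.IsFan (F ζ)) :
    ∃ y : Z → 𝒟.Bar r, SmoothGerm y z ∧
      ∀ᶠ ζ in 𝓝 z, ∀ i j, i ≤ j → (y ζ).fan i j = F ζ i j := by
  classical
  let y : Z → 𝒟.Bar r := fun ζ =>
    if hζ : 𝒟.IsFan (F ζ) then ofFan (F ζ) hζ else ofFan (F z) h.self_of_nhds
  have hy : ∀ᶠ ζ in 𝓝 z, ∀ i j, i ≤ j → (y ζ).fan i j = F ζ i j := by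
    filter_upwards [h] with ζ hζ i j hij
    simp only [y, dif_pos hζ]
    exact fan_ofFan hζ hij
  refine ⟨y, .of_fan fun i j hij => (hF i j hij).congr ?_, hy⟩
  filter_upwards [hy] with ζ hζ
  exact hζ i j hij

/-- Germs of elements of the bar construction lift through the face maps `f_l`, `l ≠ 0`: in a fan,
the squares with an index `l` may be chosen independently of each other. -/
theorem exists_lift_face_of_ne_zero {l : Fin (r + 2)} (hl : l ≠ 0) (x : 𝒟.Bar (r + 1))
    {y : Z → 𝒟.Bar r} {z : Z} (hy : SmoothGerm y z) (hyz : y z = x.face l) :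
    ∃ Y : Z → 𝒟.Bar (r + 1), SmoothGerm Y z ∧ Y z = x ∧ ∀ᶠ ζ in 𝓝 z, (Y ζ).face l = y ζ := by
  have h0 : l.succAbove 0 = 0 := Fin.succAbove_ne_zero_zero hl
  have hfan : ∀ i j, i ≤ j → (y z).fan i j = x.fan (l.succAbove i) (l.succAbove j) := by
    intro i j hij
    rw [hyz, fan_face hl x hij]
  -- the vertical targets `θ i` of the squares `F 0 i` of the lift, of which only `θ l` is not given
  have hθ : ∀ i, ∃ θ : Z → V, SmoothAt θ z ∧ θ z = 𝒟.ver.tgt (x.fan 0 i) ∧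
      (∀ᶠ ζ in 𝓝 z, 𝒟.sideV.tgt (θ ζ) = 𝒟.sideV.tgt (𝒟.ver.tgt ((y ζ).fan 0 0))) ∧
      ∀ i', l.succAbove i' = i → ∀ ζ, θ ζ = 𝒟.ver.tgt ((y ζ).fan 0 i') := by
    intro i
    rcases Fin.eq_self_or_eq_succAbove l i with rfl | ⟨i', rfl⟩
    · obtain ⟨θ, h1, h2, h3⟩ := 𝒟.sideV.submersion_tgt.exists_lift (𝒟.ver.tgt (x.fan 0 i))
        (g := fun ζ => 𝒟.sideV.tgt (𝒟.ver.tgt ((y ζ).fan 0 0)))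
        (𝒟.sideV.smoothAt_tgt (𝒟.ver.smoothAt_tgt (hy.fan le_rfl))) (by
          rw [hfan 0 0 le_rfl, h0]
          exact x.isFan.sideV_tgt _ _)
      exact ⟨θ, h1, h2, h3, fun i' hi' => absurd hi' (Fin.succAbove_ne _ _)⟩
    · refine ⟨fun ζ => 𝒟.ver.tgt ((y ζ).fan 0 i'), 𝒟.ver.smoothAt_tgt (hy.fan (Fin.zero_le _)), ?_,
        Eventually.of_forall fun ζ => (y ζ).isFan.sideV_tgt _ _, ?_⟩
      · dsimp only
        rw [hfan 0 i' (Fin.zero_le _), h0]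
      · intro i'' hi'' ζ
        rw [Fin.succAbove_right_injective hi'']
  choose θ hθs hθz hθt hθy using hθ
  -- the horizontal targets `η i` of the squares `F i j`, of which only `η l` is not given
  have hη : ∀ i, ∃ η : Z → H, SmoothAt η z ∧ η z = 𝒟.hor.tgt (x.fan i i) ∧
      (∀ᶠ ζ in 𝓝 z, 𝒟.sideH.tgt (η ζ) = 𝒟.sideV.src (θ i ζ)) ∧
      ∀ i', l.succAbove i' = i → ∀ ζ, η ζ = 𝒟.hor.tgt ((y ζ).fan i' i') := by
    have key : ∀ {r : ℕ} (x : 𝒟.Bar r) (i : Fin (r + 1)), 𝒟.sideH.tgt (𝒟.hor.tgt (x.fan i i)) =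
        𝒟.sideV.src (𝒟.ver.tgt (x.fan 0 i)) := by
      intro r x i
      rw [𝒟.tgt_tgt, x.isFan.ver_tgt le_rfl]
      simp
    intro i
    rcases Fin.eq_self_or_eq_succAbove l i with rfl | ⟨i', rfl⟩
    · obtain ⟨η, h1, h2, h3⟩ := 𝒟.sideH.submersion_tgt.exists_lift (𝒟.hor.tgt (x.fan i i))
        (g := fun ζ => 𝒟.sideV.src (θ i ζ)) (𝒟.sideV.smoothAt_src (hθs i)) (by
          rw [hθz, key])
      exact ⟨η, h1, h2, h3, fun i' hi' => absurd hi' (Fin.succAbove_ne _ _)⟩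
    · refine ⟨fun ζ => 𝒟.hor.tgt ((y ζ).fan i' i'), 𝒟.hor.smoothAt_tgt (hy.fan le_rfl), ?_,
        Eventually.of_forall fun ζ => ?_, ?_⟩
      · dsimp only
        rw [hfan i' i' le_rfl]
      · rw [key, hθy _ i' rfl]
      · intro i'' hi'' ζ
        rw [Fin.succAbove_right_injective hi'']
  choose η hηs hηz hηt hηy using hη
  -- the squares `F i j`: they are given by `y` if `i ≠ l` and `j ≠ l`, they are units for `i = j`
  -- and for `i = 0`, and the others may be any squares with the prescribed targets
  have hF : ∀ i j, ∃ f : Z → D, i ≤ j → SmoothAt f z ∧ f z = x.fan i j ∧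
      (∀ᶠ ζ in 𝓝 z, 𝒟.hor.tgt (f ζ) = η i ζ ∧
        𝒟.ver.tgt (f ζ) = 𝒟.sideV.mul (𝒟.sideV.inv (θ i ζ)) (θ j ζ) ∧
        (i = j → f ζ = 𝒟.hor.one (η i ζ)) ∧ (i = 0 → f ζ = 𝒟.ver.one (θ j ζ)) ∧
        ∀ i' j', l.succAbove i' = i → l.succAbove j' = j → f ζ = (y ζ).fan i' j') := by
    intro i j
    by_cases hij : i ≤ j
    swap
    · exact ⟨fun _ => x.fan 0 0, fun h => absurd h hij⟩
    suffices h : ∃ f : Z → D, SmoothAt f z ∧ f z = x.fan i j ∧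
      (∀ᶠ ζ in 𝓝 z, 𝒟.hor.tgt (f ζ) = η i ζ ∧
        𝒟.ver.tgt (f ζ) = 𝒟.sideV.mul (𝒟.sideV.inv (θ i ζ)) (θ j ζ) ∧
        (i = j → f ζ = 𝒟.hor.one (η i ζ)) ∧ (i = 0 → f ζ = 𝒟.ver.one (θ j ζ)) ∧
        ∀ i' j', l.succAbove i' = i → l.succAbove j' = j → f ζ = (y ζ).fan i' j') from
      h.imp fun f hf _ => hf
    have hθij : ∀ᶠ ζ in 𝓝 z, 𝒟.sideV.tgt (θ i ζ) = 𝒟.sideV.tgt (θ j ζ) := by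
      filter_upwards [hθt i, hθt j] with ζ h1 h2
      rw [h1, h2]
    by_cases hy' : ∃ i' j', l.succAbove i' = i ∧ l.succAbove j' = j
    · obtain ⟨i', j', rfl, rfl⟩ := hy'
      have hij' : i' ≤ j' := Fin.succAbove_le_succAbove_iff.1 hij
      refine ⟨fun ζ => (y ζ).fan i' j', hy.fan hij', hfan i' j' hij',
        Eventually.of_forall fun ζ => ⟨?_, ?_, ?_, ?_, ?_⟩⟩
      · rw [hηy _ i' rfl, (y ζ).isFan.hor_tgt hij']
      · rw [hθy _ i' rfl, hθy _ j' rfl, (y ζ).isFan.ver_tgt hij']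
      · intro h
        obtain rfl := Fin.succAbove_right_injective h
        rw [hηy _ i' rfl, ← (y ζ).isFan.diag]
      · intro h
        obtain rfl : i' = 0 := Fin.succAbove_right_injective (h.trans h0.symm)
        rw [hθy _ j' rfl, ← (y ζ).isFan.zero]
      · intro i'' j'' hi'' hj''
        rw [Fin.succAbove_right_injective hi'', Fin.succAbove_right_injective hj'']
    by_cases heq : i = j
    · subst heq
      have hil : i = l := by
        rcases Fin.eq_self_or_eq_succAbove l i with h | ⟨i', h⟩
        · exact h
        · exact absurd ⟨i', i', h.symm, h.symm⟩ hy'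
      refine ⟨fun ζ => 𝒟.hor.one (η i ζ), 𝒟.hor.smoothAt_one (hηs i), ?_, ?_⟩
      · dsimp only
        rw [hηz, ← x.isFan.diag]
      · filter_upwards [hηt i] with ζ h1
        refine ⟨by simp, by simp [h1], fun _ => rfl, fun h => absurd (hil.symm.trans h) hl,
          fun i' j' h2 => absurd (h2.trans hil) (Fin.succAbove_ne _ _)⟩
    by_cases hi0 : i = 0
    · subst hi0
      refine ⟨fun ζ => 𝒟.ver.one (θ j ζ), 𝒟.ver.smoothAt_one (hθs j), ?_, ?_⟩
      · dsimp only
        rw [hθz, ← x.isFan.zero]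
      · filter_upwards [hθij] with ζ h1
        have h2 : θ 0 ζ = 𝒟.sideV.one (𝒟.sideV.src (θ 0 ζ)) := by
          rw [hθy 0 0 h0, (y ζ).isFan.diag 0]
          simp
        have h3 : η 0 ζ = 𝒟.sideH.one (𝒟.sideV.tgt (θ 0 ζ)) := by
          rw [hηy 0 0 h0, hθy 0 0 h0, (y ζ).isFan.zero 0]
          simp
        refine ⟨?_, ?_, fun h => absurd h heq, fun _ => rfl, fun i' j' h4 h5 =>
          absurd ⟨i', j', h4, h5⟩ hy'⟩
        · rw [h3, hor_tgt_ver_one, h1]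
        · have h4 : 𝒟.sideV.src (θ 0 ζ) = 𝒟.sideV.tgt (θ j ζ) := by
            rw [← h1, h2]; simp
          rw [h2, 𝒟.sideV.inv_one, h4, 𝒟.sideV.one_mul, 𝒟.ver.tgt_one]
    · obtain ⟨f, h1, h2, h3⟩ := 𝒟.exists_lift_tgt_tgt (x.fan i j)
        (a := fun ζ => 𝒟.sideV.mul (𝒟.sideV.inv (θ i ζ)) (θ j ζ)) (b := η i)
        (𝒟.sideV.smoothAt_mul (𝒟.sideV.smoothAt_inv (hθs i)) (hθs j) (by simpa using hθij))
        (hηs i) (by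
          filter_upwards [hηt i, hθij] with ζ h1 h2
          rw [h1, 𝒟.sideV.tgt_mul _ _ (by simpa using h2), 𝒟.sideV.tgt_inv])
        (by rw [hθz, hθz, x.isFan.ver_tgt hij]) (by rw [hηz, x.isFan.hor_tgt hij])
      refine ⟨f, h1, h2, ?_⟩
      filter_upwards [h3] with ζ h4
      exact ⟨h4.2, h4.1, fun h => absurd h heq, fun h => absurd h hi0, fun i' j' h5 h6 =>
          absurd ⟨i', j', h5, h6⟩ hy'⟩
  choose F hF using hF
  have hev : ∀ᶠ ζ in 𝓝 z, ∀ i j, i ≤ j → 𝒟.hor.tgt (F i j ζ) = η i ζ ∧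
        𝒟.ver.tgt (F i j ζ) = 𝒟.sideV.mul (𝒟.sideV.inv (θ i ζ)) (θ j ζ) ∧
        (i = j → F i j ζ = 𝒟.hor.one (η i ζ)) ∧ (i = 0 → F i j ζ = 𝒟.ver.one (θ j ζ)) ∧
        ∀ i' j', l.succAbove i' = i → l.succAbove j' = j → F i j ζ = (y ζ).fan i' j' := by
    rw [eventually_all]
    intro i
    rw [eventually_all]
    intro j
    by_cases hij : i ≤ j
    · filter_upwards [(hF i j hij).2.2] with ζ hζ _ using hζ
    · exact Eventually.of_forall fun ζ h => absurd h hij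
  have hθF : ∀ᶠ ζ in 𝓝 z, ∀ j, 𝒟.ver.tgt (F 0 j ζ) = θ j ζ := by
    filter_upwards [hev] with ζ h1 j
    rw [(h1 0 j (Fin.zero_le _)).2.2.2.1 rfl, 𝒟.ver.tgt_one]
  obtain ⟨Y, hY, hYF⟩ := exists_germ_of_fan (𝒟 := 𝒟) (F := fun ζ i j => F i j ζ)
    (fun i j hij => (hF i j hij).1) (by
      filter_upwards [hev, hθF] with ζ h1 h2
      refine ⟨fun {i j} h => ?_, fun {i j} h => ?_, fun i => ?_, fun j => ?_⟩
      · rw [(h1 i j h).1, (h1 i i le_rfl).1]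
      · rw [(h1 i j h).2.1, h2, h2]
      · rw [(h1 i i le_rfl).1]
        exact (h1 i i le_rfl).2.2.1 rfl
      · rw [h2]
        exact (h1 0 j (Fin.zero_le _)).2.2.2.1 rfl)
  refine ⟨Y, hY, ?_, ?_⟩
  · apply ext_fan
    intro i j hij
    rw [hYF.self_of_nhds i j hij, (hF i j hij).2.1]
  · filter_upwards [hYF, hev] with ζ h1 h2
    apply ext_fan
    intro i j hij
    have hij' := Fin.succAbove_le_succAbove_iff (p := l).2 hij
    rw [fan_face hl _ hij, h1 _ _ hij', (h2 _ _ hij').2.2.2.2 i j rfl rfl]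

/-- The reflection of an element of the bar construction in the antidiagonal. -/
def rev (x : 𝒟.Bar r) : 𝒟.rev.Bar r :=
  ofStair (fun i i' j j' => x.sq j'.rev j.rev i'.rev i.rev)
    (x.isStairOn_sq.rev.comap (fun i : Fin (r + 1) => OrderDual.toDual i.rev)
      (fun _ _ => trivial) fun _ _ _ _ h => Fin.rev_le_rev.2 h)

theorem sq_rev (x : 𝒟.Bar r) {i i' j j' : Fin (r + 1)} (h : i ≤ i') (h' : i' ≤ j) (h'' : j ≤ j') :
    x.rev.sq i i' j j' = x.sq j'.rev j.rev i'.rev i.rev :=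
  sq_ofStair _ h h' h''

theorem rev_rev (x : 𝒟.Bar r) : (show 𝒟.Bar r from x.rev.rev) = x := by
  apply ext_sq
  intro i i' j j' h h' h''
  refine (sq_rev x.rev h h' h'').trans ?_
  rw [sq_rev x (Fin.rev_le_rev.2 h'') (Fin.rev_le_rev.2 h') (Fin.rev_le_rev.2 h)]
  simp only [Fin.rev_rev]

theorem rev_face (l : Fin (r + 2)) (x : 𝒟.Bar (r + 1)) : (x.face l).rev = x.rev.face l.rev := by
  apply ext_sq
  intro i i' j j' h h' h''
  rw [sq_rev _ h h' h'', sq_face _ _ h h' h'', sq_face _ _ (Fin.rev_le_rev.2 h'')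
    (Fin.rev_le_rev.2 h') (Fin.rev_le_rev.2 h), sq_rev _ (Fin.succAbove_le_succAbove_iff.2 h)
    (Fin.succAbove_le_succAbove_iff.2 h') (Fin.succAbove_le_succAbove_iff.2 h'')]
  simp only [Fin.rev_succAbove, Fin.rev_rev]

theorem SmoothGerm.rev {y : Z → 𝒟.Bar r} {z : Z} (hy : SmoothGerm y z) :
    SmoothGerm (fun ζ => (y ζ).rev) z := by
  intro i i' j j' h h' h''
  exact (hy (Fin.rev_le_rev.2 h'') (Fin.rev_le_rev.2 h') (Fin.rev_le_rev.2 h)).congr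
    (Eventually.of_forall fun ζ => sq_rev (y ζ) h h' h'')

/-- Germs of elements of the bar construction lift through all face maps: reflection exchanges `f_0`
with a face map of nonzero index. -/
theorem exists_lift_face (l : Fin (r + 2)) (x : 𝒟.Bar (r + 1))
    {y : Z → 𝒟.Bar r} {z : Z} (hy : SmoothGerm y z) (hyz : y z = x.face l) :
    ∃ Y : Z → 𝒟.Bar (r + 1), SmoothGerm Y z ∧ Y z = x ∧ ∀ᶠ ζ in 𝓝 z, (Y ζ).face l = y ζ := by
  by_cases hl : l = 0
  · subst hl
    have h0 : (Fin.rev (0 : Fin (r + 2))) ≠ 0 := by simp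
    obtain ⟨Y, h1, h2, h3⟩ := exists_lift_face_of_ne_zero h0 x.rev hy.rev
      (by rw [hyz, rev_face])
    refine ⟨fun ζ => (Y ζ).rev, h1.rev, ?_, ?_⟩
    · change (show 𝒟.Bar (r + 1) from (Y z).rev) = x
      rw [h2]
      exact rev_rev x
    · filter_upwards [h3] with ζ h4
      have h5 := rev_face (Fin.rev 0) (Y ζ)
      rw [h4, Fin.rev_rev] at h5
      exact h5.symm.trans (rev_rev (y ζ))
  · exact exists_lift_face_of_ne_zero hl x hy hyz

end Bar

end DoubleLieGroupoid

/-! ### Functions controlled by a family of maps -/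

/-- `c` is controlled by the family `pr` of smooth maps: it behaves like a smooth function of the
`pr i`, with respect to equality, convergence and differentials. -/
structure ControlledBy {X Y : SmoothMfd.{u}} {ι : Type*} {A : ι → SmoothMfd.{u}}
    (pr : ∀ i, X → A i) (c : X → Y) : Prop where
  smooth : Smooth c
  eq : ∀ x y, (∀ i, pr i x = pr i y) → c x = c y
  tendsto : ∀ (F : Filter X) (x : X), (∀ i, Tendsto (pr i) F (𝓝 (pr i x))) → Tendsto c F (𝓝 (c x))
  tmap_eq_zero : ∀ x a, (∀ i, tmap (pr i) x a = 0) → tmap c x a = 0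

namespace ControlledBy

variable {X Y Y' : SmoothMfd.{u}} {ι : Type*} {A : ι → SmoothMfd.{u}} {pr : ∀ i, X → A i}

theorem of_apply (i : ι) (h : Smooth (pr i)) : ControlledBy pr (pr i) where
  smooth := h
  eq _ _ h := h i
  tendsto _ _ h := h i
  tmap_eq_zero _ _ h := h i

theorem congr {c c' : X → Y} (hc : ControlledBy pr c) (h : ∀ x, c x = c' x) :
    ControlledBy pr c' := funext h ▸ hc

theorem comp {c : X → Y} (hc : ControlledBy pr c) {g : Y → Y'} (hg : Smooth g) :
    ControlledBy pr (fun x => g (c x)) where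
  smooth := ContMDiff.comp hg hc.smooth
  eq x y h := congrArg g (hc.eq x y h)
  tendsto F x h := (hg.continuous.tendsto _).comp (hc.tendsto F x h)
  tmap_eq_zero x a h := by
    rw [tmap_comp_apply (hg _) (hc.smooth x), hc.tmap_eq_zero x a h, map_zero]

theorem mul {M : SmoothMfd.{u}} (𝒢 : LieGroupoid Y M) {c c' : X → Y} (hc : ControlledBy pr c)
    (hc' : ControlledBy pr c') (h : ∀ x, 𝒢.src (c x) = 𝒢.tgt (c' x)) :
    ControlledBy pr (fun x => 𝒢.mul (c x) (c' x)) where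
  smooth x := 𝒢.smoothAt_mul (hc.smooth x) (hc'.smooth x) (Eventually.of_forall h)
  eq x y e := by rw [hc.eq x y e, hc'.eq x y e]
  tendsto F x e := 𝒢.tendsto_mul (h x) (hc.tendsto F x e) (hc'.tendsto F x e) h
  tmap_eq_zero x a e := 𝒢.tmap_mul_eq_zero (hc.smooth x) (hc'.smooth x) (Eventually.of_forall h)
    (hc.tmap_eq_zero x a e) (hc'.tmap_eq_zero x a e)

theorem of_embeds {κ : Type*} [Finite κ] {B : κ → SmoothMfd.{u}} {d : ∀ j, Y → B j} (hd : Embeds d)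
    {c : X → Y} (hc : ∀ j, ControlledBy pr (fun x => d j (c x))) : ControlledBy pr c := by
  have hs : Smooth c := fun x => hd.smoothAt fun j => (hc j).smooth x
  exact
    { smooth := hs
      eq := fun x y h => hd.injective fun j => (hc j).eq x y h
      tendsto := fun F x h => hd.tendsto fun j => (hc j).tendsto F x h
      tmap_eq_zero := fun x a h => hd.immersive _ _ fun j => by
        rw [← tmap_comp_apply (hd.smooth j _) (hs x)]
        exact (hc j).tmap_eq_zero x a h }

end ControlledBy

/-- If the maps of an embedding family are controlled by the family `pr`, then `pr` embeds as
well. -/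
theorem Embeds.of_controlledBy {X : SmoothMfd.{u}} {ι κ : Type*} {A : ι → SmoothMfd.{u}}
    {B : κ → SmoothMfd.{u}} {pr : ∀ i, X → A i} {c : ∀ j, X → B j} (hc : Embeds c)
    (hpr : ∀ i, Smooth (pr i)) (h : ∀ j, ControlledBy pr (c j)) : Embeds pr where
  smooth := hpr
  isEmbedding := by
    refine ⟨⟨le_antisymm ?_ ?_⟩, fun x y e => hc.injective fun j => (h j).eq x y (congrFun e)⟩
    · exact (continuous_pi fun i => (hpr i).continuous).le_induced
    · rw [le_iff_nhds]
      intro x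
      rw [nhds_induced]
      have := hc.tendsto (f := fun y => y) (x := x)
        (F := comap (fun x i => pr i x) (𝓝 fun i => pr i x)) fun j => (h j).tendsto _ _
          (tendsto_pi_nhds.1 tendsto_comap)
      exact this
  immersive x a e := hc.immersive x a fun j => (h j).tmap_eq_zero x a e

theorem embeds_id (X : SmoothMfd.{u}) : Embeds (fun (_ : Unit) (x : X) => x) where
  smooth _ := contMDiff_id
  isEmbedding := (Homeomorph.funUnique Unit X).symm.isEmbedding
  immersive x a h := by
    have := h ()
    rwa [tmap_id] at this

/-! ### The manifolds of the bar construction -/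

namespace DoubleLieGroupoid

variable {D V H M : SmoothMfd.{u}} {𝒟 : DoubleLieGroupoid D V H M} {r : ℕ}
  {Z : SmoothMfd.{w}}

instance (r : ℕ) : Finite {a : ℕ × ℕ // a.1 + a.2 = r} := by
  refine Finite.of_injective (β := Fin (r + 1)) (fun a => ⟨a.1.1, by have := a.2; omega⟩) ?_
  rintro ⟨⟨a, b⟩, h⟩ ⟨⟨a', b'⟩, h'⟩ e
  simp only [Fin.mk.injEq] at e h h'
  simp only [Subtype.mk.injEq, Prod.mk.injEq]
  omega

namespace Bar

theorem exists_coord_eq_sq {i i' j j' : Fin (r + 1)} (h : i ≤ i') (h' : i' ≤ j) (h'' : j ≤ j') :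
    ∃ k, ∀ x : 𝒟.Bar r, Bar.coord k x = x.sq i i' j j' := by
  have e : (i' : ℕ) + (r - i') = r := by omega
  refine ⟨⟨⟨(i', r - i'), e⟩, .mk (i := ⟨i, by dsimp only; rw [Fin.le_def] at h; omega⟩)
    (j := ⟨i', by dsimp only; omega⟩) h, .mk (i := ⟨j - i', by dsimp only; omega⟩)
    (j := ⟨j' - i', by dsimp only; omega⟩) (Nat.sub_le_sub_right h'' _)⟩, fun x => ?_⟩
  rw [x.sq_eq_val h e le_rfl (c := j - i') (d := j' - i') (by omega) (by omega)
    (Nat.sub_le_sub_right h'' _)]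
  rfl

theorem exists_sq_eq_coord (k : Σ a : {a : ℕ × ℕ // a.1 + a.2 = r}, Arrow a.1.1 × Arrow a.1.2) :
    ∃ i i' j j' : Fin (r + 1), i ≤ i' ∧ i' ≤ j ∧ j ≤ j' ∧
      ∀ x : 𝒟.Bar r, Bar.coord k x = x.sq i i' j j' := by
  have e : k.1.1.1 + k.1.1.2 = r := k.1.2
  have h1 : (k.2.2.1.1 : ℕ) ≤ k.2.2.1.2 := k.2.2.2
  have h2 := k.2.1.1.2.2
  exact ⟨⟨k.2.1.1.1, by omega⟩, ⟨k.2.1.1.2, by omega⟩, ⟨k.1.1.1 + k.2.2.1.1, by omega⟩,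
      ⟨k.1.1.1 + k.2.2.1.2, by omega⟩, k.2.1.2, by rw [Fin.le_def]; dsimp only; omega,
      by rw [Fin.le_def]; dsimp only; omega, fun x => x.coord_eq_sq k⟩

theorem SmoothGerm.coord {y : Z → 𝒟.Bar r} {z : Z} (hy : SmoothGerm y z)
    (k : Σ a : {a : ℕ × ℕ // a.1 + a.2 = r}, Arrow a.1.1 × Arrow a.1.2) :
    SmoothAt (fun ζ => Bar.coord k (y ζ)) z := by
  obtain ⟨i, i', j, j', h, h', h'', e⟩ := exists_sq_eq_coord (𝒟 := 𝒟) k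
  simp only [e]
  exact hy h h' h''

theorem SmoothGerm.smoothAt (σ : 𝒟.BarStructure r) {y : Z → 𝒟.Bar r} {z : Z}
    (hy : SmoothGerm y z) : SmoothAt (Y := σ.mfd) y z :=
  σ.embeds.smoothAt fun k => hy.coord k

theorem smooth_sq (σ : 𝒟.BarStructure r) {i i' j j' : Fin (r + 1)} (h : i ≤ i') (h' : i' ≤ j)
    (h'' : j ≤ j') : Smooth (X := σ.mfd) (fun x : 𝒟.Bar r => x.sq i i' j j') := by
  obtain ⟨k, hk⟩ := exists_coord_eq_sq (𝒟 := 𝒟) h h' h''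
  have := σ.embeds.smooth k
  exact (funext hk : Bar.coord k = _) ▸ this

theorem smoothGerm_of_smoothAt (σ : 𝒟.BarStructure r) {y : Z → 𝒟.Bar r} {z : Z}
    (hy : SmoothAt (Y := σ.mfd) y z) : SmoothGerm y z := fun _ _ _ _ h h' h'' =>
  SmoothAt.comp_of_eq (Y := σ.mfd) (smooth_sq σ h h' h'' _) hy rfl

theorem smoothGerm_id (σ : 𝒟.BarStructure r) (x : σ.mfd) :
    SmoothGerm (Z := σ.mfd) (fun x : 𝒟.Bar r => x) x :=
  smoothGerm_of_smoothAt σ (smoothAt_id x)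

theorem SmoothGerm.face {y : Z → 𝒟.Bar (r + 1)} {z : Z} (hy : SmoothGerm y z) (l : Fin (r + 2)) :
    SmoothGerm (fun ζ => (y ζ).face l) z := fun i i' j j' h h' h'' => by
  simp only [sq_face l _ h h' h'']
  exact hy (Fin.succAbove_le_succAbove_iff.2 h) (Fin.succAbove_le_succAbove_iff.2 h')
    (Fin.succAbove_le_succAbove_iff.2 h'')

theorem SmoothGerm.degen {y : Z → 𝒟.Bar r} {z : Z} (hy : SmoothGerm y z) (l : Fin (r + 1)) :
    SmoothGerm (fun ζ => (y ζ).degen l) z := fun i i' j j' h h' h'' => by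
  simp only [sq_degen l _ h h' h'']
  exact hy (Fin.predAbove_right_monotone l h) (Fin.predAbove_right_monotone l h')
    (Fin.predAbove_right_monotone l h'')

theorem smooth_face (σ : 𝒟.BarStructure (r + 1)) (τ : 𝒟.BarStructure r) (l : Fin (r + 2)) :
    Smooth (X := σ.mfd) (Y := τ.mfd) (Bar.face (𝒟 := 𝒟) l) := fun x =>
  ((smoothGerm_id σ x).face l).smoothAt τ

theorem smooth_degen (σ : 𝒟.BarStructure (r + 1)) (τ : 𝒟.BarStructure r) (l : Fin (r + 1)) :
    Smooth (X := τ.mfd) (Y := σ.mfd) (Bar.degen (𝒟 := 𝒟) l) := fun x =>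
  ((smoothGerm_id τ x).degen l).smoothAt σ

theorem submersion_face (σ : 𝒟.BarStructure (r + 1)) (τ : 𝒟.BarStructure r) (l : Fin (r + 2)) :
    Submersion (X := σ.mfd) (Y := τ.mfd) (Bar.face (𝒟 := 𝒟) l) := by
  refine submersion_of_sections (X := σ.mfd) (Y := τ.mfd) (smooth_face σ τ l) fun x => ?_
  obtain ⟨Y, hY, hYz, hYe⟩ := exists_lift_face (Z := τ.mfd) l (show 𝒟.Bar (r + 1) from x)
    (smoothGerm_id τ (Bar.face l (show 𝒟.Bar (r + 1) from x))) rfl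
  exact ⟨Y, hY.smoothAt σ, hYz, hYe⟩

/-- Transport of a manifold structure to the bar construction. -/
theorem nonempty_barStructure {P : SmoothMfd.{u}} (e : 𝒟.Bar r ≃ P)
    (he : ∀ p, SmoothGerm (fun p => e.symm p) p) {κ : Type*} {B : κ → SmoothMfd.{u}}
    {c : ∀ j, P → B j} (hc : Embeds c)
    (h : ∀ j, ControlledBy (fun k p => Bar.coord k (e.symm p)) (c j)) :
    Nonempty (𝒟.BarStructure r) :=
  Embeds.nonempty_embeddedStructure e (hc.of_controlledBy (fun k p => (he p).coord k) h)

theorem controlledBy_sq {P : SmoothMfd.{u}} {s : P → 𝒟.Bar r} (hs : ∀ p, SmoothGerm s p)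
    {i i' j j' : Fin (r + 1)} (h : i ≤ i') (h' : i' ≤ j) (h'' : j ≤ j') :
    ControlledBy (fun k p => Bar.coord k (s p)) (fun p => (s p).sq i i' j j') := by
  obtain ⟨k, hk⟩ := exists_coord_eq_sq (𝒟 := 𝒟) h h' h''
  simp only [← hk]
  exact ControlledBy.of_apply (pr := fun k p => Bar.coord k (s p)) k fun p => (hs p).coord k

/-- `W̄_0 ND` is `M`. -/
theorem nonempty_barStructure_zero (𝒟 : DoubleLieGroupoid D V H M) :
    Nonempty (𝒟.BarStructure 0) := by
  have hF : ∀ m, 𝒟.IsFan (r := 0) (fun _ _ => 𝒟.hor.one (𝒟.sideH.one m)) := fun m =>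
    { hor_tgt := fun _ => rfl
      ver_tgt := fun _ => by simp
      diag := fun _ => by simp
      zero := fun _ => by simp [hor_one_one] }
  let e : 𝒟.Bar 0 ≃ M :=
    { toFun := fun x => 𝒟.sideH.tgt (𝒟.hor.tgt (x.fan 0 0))
      invFun := fun m => ofFan _ (hF m)
      left_inv := fun x => by
        apply ext_fan
        intro i j hij
        obtain rfl : i = 0 := Subsingleton.elim (α := Fin 1) i 0
        obtain rfl : j = 0 := Subsingleton.elim (α := Fin 1) j 0
        rw [fan_ofFan _ le_rfl]
        have h1 := x.isFan.zero 0
        have h2 := x.isFan.diag 0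
        have h3 : 𝒟.hor.tgt (x.fan 0 0) = 𝒟.sideH.one (𝒟.sideH.tgt (𝒟.hor.tgt (x.fan 0 0))) := by
          rw [h1]; simp
        rw [← h3, ← h2]
      right_inv := fun m => by
        dsimp only
        rw [fan_ofFan _ le_rfl]
        simp }
  have he : ∀ p, SmoothGerm (fun p => e.symm p) p := fun p => .of_fan fun i j hij => by
    refine SmoothAt.congr (f := fun m => 𝒟.hor.one (𝒟.sideH.one m))
      (𝒟.hor.smoothAt_one (𝒟.sideH.smoothAt_one (smoothAt_id p))) (Eventually.of_forall fun m => ?_)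
    exact fan_ofFan (hF m) hij
  refine nonempty_barStructure e he (embeds_id M) fun _ => ?_
  have h1 := ((controlledBy_sq he (le_refl 0) (le_refl 0) (le_refl 0)).comp
    𝒟.hor.submersion_tgt.contMDiff).comp 𝒟.sideH.submersion_tgt.contMDiff
  exact (funext e.apply_symm_apply : (fun p => e (e.symm p)) = fun p => p) ▸ h1

end Bar

variable (𝒟) in
/-- The fan of an element of `W̄_1 ND`, i.e. of a pair of composable arrows in `V` and in `H`. -/
def edgeFan (θ : V) (η : H) (i j : Fin 2) : D :=
  if j = 0 then 𝒟.hor.one (𝒟.sideH.one (𝒟.sideV.tgt θ)) else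
    if i = 0 then 𝒟.ver.one θ else 𝒟.hor.one η

namespace Bar

theorem isFan_edgeFan {θ : V} {η : H} (e : 𝒟.sideV.src θ = 𝒟.sideH.tgt η) :
    𝒟.IsFan (r := 1) (𝒟.edgeFan θ η) where
  hor_tgt {i j} h := by
    fin_cases i <;> fin_cases j <;> simp [edgeFan] at h ⊢
  ver_tgt {i j} h := by
    have h2 : 𝒟.sideV.mul (𝒟.sideV.one (𝒟.sideV.tgt θ)) θ = θ := by simp
    fin_cases i <;> fin_cases j <;> simp [edgeFan, e] at h ⊢
  diag i := by
    fin_cases i <;> simp [edgeFan]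
  zero j := by
    fin_cases j <;> simp [edgeFan, hor_one_one]

theorem edgeFan_eq (x : 𝒟.Bar 1) {i j : Fin 2} (hij : i ≤ j) :
    𝒟.edgeFan (𝒟.ver.tgt (x.fan 0 1)) (𝒟.hor.tgt (x.fan 1 1)) i j = x.fan i j := by
  have h1 := x.isFan.zero 0
  have h2 := x.isFan.diag 0
  have h3 : 𝒟.hor.tgt (x.fan 0 0) = 𝒟.sideH.one (𝒟.sideV.tgt (𝒟.ver.tgt (x.fan 0 1))) := by
    rw [x.isFan.sideV_tgt 1 0, h1]; simp
  fin_cases i <;> fin_cases j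
  · refine Eq.trans ?_ h2.symm
    rw [h3]; rfl
  · exact (x.isFan.zero 1).symm
  · simp at hij
  · exact (x.isFan.diag 1).symm

theorem ext_edge {x y : 𝒟.Bar 1} (h : 𝒟.ver.tgt (x.fan 0 1) = 𝒟.ver.tgt (y.fan 0 1))
    (h' : 𝒟.hor.tgt (x.fan 1 1) = 𝒟.hor.tgt (y.fan 1 1)) : x = y :=
  ext_fan fun i j hij => by rw [← edgeFan_eq x hij, ← edgeFan_eq y hij, h, h']

theorem edge_composable (x : 𝒟.Bar 1) :
    𝒟.sideV.src (𝒟.ver.tgt (x.fan 0 1)) = 𝒟.sideH.tgt (𝒟.hor.tgt (x.fan 1 1)) := by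
  rw [𝒟.tgt_tgt, x.isFan.ver_tgt le_rfl]
  simp

theorem smoothAt_edgeFan {θ : Z → V} {η : Z → H} {z : Z} (hθ : SmoothAt θ z) (hη : SmoothAt η z)
    (i j : Fin 2) : SmoothAt (fun ζ => 𝒟.edgeFan (θ ζ) (η ζ) i j) z := by
  simp only [edgeFan]
  split_ifs
  · exact 𝒟.hor.smoothAt_one (𝒟.sideH.smoothAt_one (𝒟.sideV.smoothAt_tgt hθ))
  · exact 𝒟.ver.smoothAt_one hθ
  · exact 𝒟.hor.smoothAt_one hη

/-- `W̄_1 ND` is `V ×_M H`. -/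
theorem nonempty_barStructure_one (𝒟 : DoubleLieGroupoid D V H M) :
    Nonempty (𝒟.BarStructure 1) := by
  obtain ⟨σ⟩ := nonempty_fiberProductStructure 𝒟.sideV.submersion_src
    𝒟.sideH.submersion_tgt.contMDiff
  have hF : ∀ p : FiberProduct 𝒟.sideV.src 𝒟.sideH.tgt, 𝒟.IsFan (𝒟.edgeFan p.1.1 p.1.2) :=
    fun p => isFan_edgeFan p.2
  let e : 𝒟.Bar 1 ≃ σ.mfd :=
    { toFun := fun x => (⟨(𝒟.ver.tgt (x.fan 0 1), 𝒟.hor.tgt (x.fan 1 1)),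
        x.edge_composable⟩ : FiberProduct 𝒟.sideV.src 𝒟.sideH.tgt)
      invFun := fun p => ofFan _ (hF p)
      left_inv := fun x => ext_fan fun i j hij => by
        rw [fan_ofFan _ hij]
        exact edgeFan_eq x hij
      right_inv := fun p => by
        refine Subtype.ext (Prod.ext ?_ ?_)
        · dsimp only
          rw [fan_ofFan _ (Fin.zero_le _)]
          simp [edgeFan]
        · dsimp only
          rw [fan_ofFan _ le_rfl]
          simp [edgeFan] }
  have hθ : ∀ p, SmoothAt (X := σ.mfd) (fun p : FiberProduct 𝒟.sideV.src 𝒟.sideH.tgt => p.1.1) p :=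
    fun p => σ.embeds.smooth false p
  have hη : ∀ p, SmoothAt (X := σ.mfd) (fun p : FiberProduct 𝒟.sideV.src 𝒟.sideH.tgt => p.1.2) p :=
    fun p => σ.embeds.smooth true p
  have he : ∀ p, SmoothGerm (fun p => e.symm p) p := fun p => .of_fan fun i j hij =>
    (smoothAt_edgeFan (hθ p) (hη p) i j).congr (Eventually.of_forall fun m => fan_ofFan (hF m) hij)
  have hee : ∀ p, e (e.symm p) = p := e.apply_symm_apply
  refine nonempty_barStructure e he σ.embeds fun b => ?_
  cases b
  · have h1 := (controlledBy_sq he (le_refl 0) (le_refl 0) (Fin.zero_le 1)).comp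
      𝒟.ver.submersion_tgt.contMDiff
    exact h1.congr fun p =>
      congrArg (fun q : FiberProduct 𝒟.sideV.src 𝒟.sideH.tgt => q.1.1) (hee p)
  · have h1 := (controlledBy_sq he (Fin.zero_le 1) (le_refl 1) (le_refl 1)).comp
      𝒟.hor.submersion_tgt.contMDiff
    exact h1.congr fun p =>
      congrArg (fun q : FiberProduct 𝒟.sideV.src 𝒟.sideH.tgt => q.1.2) (hee p)

end Bar

end DoubleLieGroupoid

namespace DoubleLieGroupoid

variable {D V H M : SmoothMfd.{u}} {𝒟 : DoubleLieGroupoid D V H M} {m : ℕ}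

namespace Bar

/-- The retraction of `[m + 2]` onto `[m + 1]`. -/
def clamp (i : Fin (m + 3)) : Fin (m + 2) := ⟨min i (m + 1), by omega⟩

/-- The fan on `[m + 2]` with faces `x` and `y` opposite to the last two vertices, where `α` is the
square which belongs to these two vertices. -/
def joinFan (x y : 𝒟.Bar (m + 1)) (α : D) (i j : Fin (m + 3)) : D :=
  if j = Fin.last (m + 2) then
    if i = (Fin.last (m + 1)).castSucc then α else y.fan (clamp i) (Fin.last (m + 1))
  else x.fan (clamp i) (clamp j)

theorem clamp_castSucc (i : Fin (m + 2)) : clamp i.castSucc = i := by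
  apply Fin.ext
  simp [clamp]
  omega

theorem clamp_last : clamp (Fin.last (m + 2)) = Fin.last (m + 1) := by
  apply Fin.ext
  simp [clamp]

theorem joinFan_castSucc (x y : 𝒟.Bar (m + 1)) (α : D) (i j : Fin (m + 2)) :
    joinFan x y α i.castSucc j.castSucc = x.fan i j := by
  rw [joinFan, if_neg (Fin.castSucc_ne_last j), clamp_castSucc, clamp_castSucc]

theorem joinFan_last_last (x y : 𝒟.Bar (m + 1)) (α : D) :
    joinFan x y α (Fin.last (m + 2)) (Fin.last (m + 2)) =
      y.fan (Fin.last (m + 1)) (Fin.last (m + 1)) := by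
  rw [joinFan, if_pos rfl, if_neg (Fin.castSucc_ne_last _).symm, clamp_last]

theorem joinFan_castSucc_last (x y : 𝒟.Bar (m + 1)) (α : D) (i : Fin (m + 1)) :
    joinFan x y α i.castSucc.castSucc (Fin.last (m + 2)) =
      y.fan i.castSucc (Fin.last (m + 1)) := by
  rw [joinFan, if_pos rfl, if_neg, clamp_castSucc]
  exact fun h => Fin.castSucc_ne_last i (Fin.castSucc_injective _ h)

theorem joinFan_edge (x y : 𝒟.Bar (m + 1)) (α : D) :
    joinFan x y α (Fin.last (m + 1)).castSucc (Fin.last (m + 2)) = α := by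
  rw [joinFan, if_pos rfl, if_pos rfl]

theorem fan_eq_of_face_last_eq {x y : 𝒟.Bar (m + 1)}
    (h : x.face (Fin.last (m + 1)) = y.face (Fin.last (m + 1))) {i j : Fin (m + 1)} (hij : i ≤ j) :
    x.fan i.castSucc j.castSucc = y.fan i.castSucc j.castSucc := by
  have h1 := congrArg (fun w : 𝒟.Bar m => w.fan i j) h
  rw [fan_face (Fin.last_pos).ne' _ hij, fan_face (Fin.last_pos).ne' _ hij] at h1
  simpa using h1

/-- Two elements of `W̄_{m+1} ND` with a common last face and a square with suitable targets form a
fan. -/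
theorem isFan_joinFan {x y : 𝒟.Bar (m + 1)} {α : D}
    (h : x.face (Fin.last (m + 1)) = y.face (Fin.last (m + 1)))
    (h1 : 𝒟.hor.tgt α = 𝒟.hor.tgt (x.fan (Fin.last (m + 1)) (Fin.last (m + 1))))
    (h2 : 𝒟.ver.tgt α = 𝒟.sideV.mul (𝒟.sideV.inv (𝒟.ver.tgt (x.fan 0 (Fin.last (m + 1)))))
      (𝒟.ver.tgt (y.fan 0 (Fin.last (m + 1))))) :
    𝒟.IsFan (joinFan x y α) := by
  have c0 : (0 : Fin (m + 3)) = (0 : Fin (m + 1)).castSucc.castSucc := rfl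
  have c0' : (0 : Fin (m + 2)) = (0 : Fin (m + 1)).castSucc := rfl
  have hz : ∀ j : Fin (m + 2), joinFan x y α 0 j.castSucc = x.fan 0 j := fun j => by
    rw [c0, joinFan_castSucc, c0']
  have hz' : joinFan x y α 0 (Fin.last (m + 2)) = y.fan 0 (Fin.last (m + 1)) := by
    rw [c0, joinFan_castSucc_last, c0']
  refine ⟨fun {i j} hij => ?_, fun {i j} hij => ?_, fun i => ?_, fun j => ?_⟩
  · induction j using Fin.lastCases with
    | cast j =>
      obtain ⟨i, rfl⟩ : ∃ i', i = Fin.castSucc i' :=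
        ⟨i.castPred (ne_of_lt (hij.trans_lt (Fin.castSucc_lt_last j))), by simp⟩
      rw [joinFan_castSucc, joinFan_castSucc, x.isFan.hor_tgt (Fin.castSucc_le_castSucc_iff.1 hij)]
    | last =>
      induction i using Fin.lastCases with
      | last => rfl
      | cast i =>
        rw [joinFan_castSucc]
        induction i using Fin.lastCases with
        | last => rw [joinFan_edge, h1]
        | cast i =>
          rw [joinFan_castSucc_last, y.isFan.hor_tgt (Fin.le_last _),
            fan_eq_of_face_last_eq h le_rfl]
  · induction j using Fin.lastCases with
    | cast j =>
      obtain ⟨i, rfl⟩ : ∃ i', i = Fin.castSucc i' :=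
        ⟨i.castPred (ne_of_lt (hij.trans_lt (Fin.castSucc_lt_last j))), by simp⟩
      rw [joinFan_castSucc, hz, hz, x.isFan.ver_tgt (Fin.castSucc_le_castSucc_iff.1 hij)]
    | last =>
      rw [hz']
      induction i using Fin.lastCases with
      | last => rw [joinFan_last_last, hz', y.isFan.ver_tgt le_rfl]
      | cast i =>
        rw [hz]
        induction i using Fin.lastCases with
        | last => rw [joinFan_edge, h2]
        | cast i =>
          rw [joinFan_castSucc_last, y.isFan.ver_tgt (Fin.le_last _), c0',
            fan_eq_of_face_last_eq h (Fin.zero_le i)]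
  · induction i using Fin.lastCases with
    | cast i => rw [joinFan_castSucc, ← x.isFan.diag]
    | last => rw [joinFan_last_last, ← y.isFan.diag]
  · induction j using Fin.lastCases with
    | cast j => rw [hz, ← x.isFan.zero]
    | last => rw [hz', ← y.isFan.zero]

/-- An element of the bar construction is determined by its faces opposite to the last two
vertices, together with one square. -/
theorem eq_joinFan (w : 𝒟.Bar (m + 2)) {i j : Fin (m + 3)} (hij : i ≤ j) :
    joinFan (w.face (Fin.last (m + 2))) (w.face (Fin.last (m + 1)).castSucc)
      (w.fan (Fin.last (m + 1)).castSucc (Fin.last (m + 2))) i j = w.fan i j := by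
  have l1 : Fin.last (m + 2) ≠ 0 := (Fin.last_pos).ne'
  have l2 : (Fin.last (m + 1)).castSucc ≠ (0 : Fin (m + 3)) := by
    simp
  induction j using Fin.lastCases with
  | cast j =>
    obtain ⟨i, rfl⟩ : ∃ i', i = Fin.castSucc i' :=
      ⟨i.castPred (ne_of_lt (hij.trans_lt (Fin.castSucc_lt_last j))), by simp⟩
    rw [joinFan_castSucc, fan_face l1 _ (Fin.castSucc_le_castSucc_iff.1 hij)]
    simp
  | last =>
    induction i using Fin.lastCases with
    | last =>
      rw [joinFan_last_last, fan_face l2 _ le_rfl]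
      simp
    | cast i =>
      induction i using Fin.lastCases with
      | last => rw [joinFan_edge]
      | cast i =>
        rw [joinFan_castSucc_last, fan_face l2 _ (Fin.le_last _)]
        congr 1
        · rw [Fin.succAbove_of_castSucc_lt]
          exact Fin.castSucc_lt_castSucc_iff.2 (Fin.castSucc_lt_last i)
        · simp

theorem face_last_ofFan {x y : 𝒟.Bar (m + 1)} {α : D} (hF : 𝒟.IsFan (joinFan x y α)) :
    (ofFan _ hF).face (Fin.last (m + 2)) = x := by
  apply ext_fan
  intro i j hij
  rw [fan_face (Fin.last_pos).ne' _ hij, fan_ofFan _ (Fin.succAbove_le_succAbove_iff.2 hij)]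
  simp [joinFan_castSucc]

theorem face_castSucc_ofFan {x y : 𝒟.Bar (m + 1)} {α : D}
    (h : x.face (Fin.last (m + 1)) = y.face (Fin.last (m + 1))) (hF : 𝒟.IsFan (joinFan x y α)) :
    (ofFan _ hF).face (Fin.last (m + 1)).castSucc = y := by
  apply ext_fan
  intro i j hij
  have l2 : (Fin.last (m + 1)).castSucc ≠ (0 : Fin (m + 3)) := by simp
  have e1 : (Fin.last (m + 1)).castSucc.succAbove (Fin.last (m + 1)) = Fin.last (m + 2) := by simp
  have e2 : ∀ i : Fin (m + 1), (Fin.last (m + 1)).castSucc.succAbove i.castSucc =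
      i.castSucc.castSucc := fun i => by
    rw [Fin.succAbove_of_castSucc_lt]
    exact Fin.castSucc_lt_castSucc_iff.2 (Fin.castSucc_lt_last i)
  rw [fan_face l2 _ hij, fan_ofFan _ (Fin.succAbove_le_succAbove_iff.2 hij)]
  induction j using Fin.lastCases with
  | cast j =>
    obtain ⟨i, rfl⟩ : ∃ i', i = Fin.castSucc i' :=
      ⟨i.castPred (ne_of_lt (hij.trans_lt (Fin.castSucc_lt_last j))), by simp⟩
    rw [e2, e2, joinFan_castSucc, fan_eq_of_face_last_eq h (Fin.castSucc_le_castSucc_iff.1 hij)]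
  | last =>
    induction i using Fin.lastCases with
    | last => rw [e1, joinFan_last_last]
    | cast i => rw [e1, e2, joinFan_castSucc_last]

theorem smoothGerm_joinFan {Z : SmoothMfd.{w}} {x y : Z → 𝒟.Bar (m + 1)} {α : Z → D} {z : Z}
    (hx : SmoothGerm x z) (hy : SmoothGerm y z) (hα : SmoothAt α z) {i j : Fin (m + 3)}
    (hij : i ≤ j) : SmoothAt (fun ζ => joinFan (x ζ) (y ζ) (α ζ) i j) z := by
  have hc : clamp i ≤ clamp j := by
    rw [Fin.le_def] at hij ⊢
    simp only [clamp]
    omega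
  simp only [joinFan]
  split_ifs
  · exact hα
  · exact hy.fan (Fin.le_last _)
  · exact hx.fan hc

/-- `W̄_{m+2} ND` is a fiber product of `D` with the manifold of pairs of elements of `W̄_{m+1} ND`
which have the same last face. -/
theorem nonempty_barStructure_add_two (σ : 𝒟.BarStructure (m + 1)) (σ' : 𝒟.BarStructure m) :
    Nonempty (𝒟.BarStructure (m + 2)) := by
  let L : Fin (m + 2) := Fin.last (m + 1)
  let f : σ.mfd → σ'.mfd := Bar.face (𝒟 := 𝒟) L
  have hf : Submersion f := submersion_face σ σ' L
  obtain ⟨τ⟩ := nonempty_fiberProductStructure hf hf.contMDiff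
  obtain ⟨ρ⟩ := nonempty_fiberProductStructure 𝒟.sideV.submersion_tgt
    𝒟.sideH.submersion_tgt.contMDiff
  -- `τ`, `ρ` and `π` are the manifolds of pairs of faces, of pairs of sides of a square, and of pairs
  -- of faces together with a square
  let P₁ : Type u := {p : 𝒟.Bar (m + 1) × 𝒟.Bar (m + 1) // p.1.face L = p.2.face L}
  have hc : ∀ p : P₁, 𝒟.sideV.tgt (𝒟.ver.tgt (p.1.1.fan 0 L)) =
      𝒟.sideV.tgt (𝒟.ver.tgt (p.1.2.fan 0 L)) := by
    rintro ⟨⟨x, y⟩, h⟩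
    have h1 : x.fan 0 0 = y.fan 0 0 := fan_eq_of_face_last_eq (i := 0) (j := 0) h le_rfl
    dsimp only
    rw [x.isFan.sideV_tgt L 0, y.isFan.sideV_tgt L 0, h1]
  -- the sides of the squares which join a pair of faces
  let g : P₁ → FiberProduct 𝒟.sideV.tgt 𝒟.sideH.tgt := fun p =>
    ⟨(𝒟.sideV.mul (𝒟.sideV.inv (𝒟.ver.tgt (p.1.1.fan 0 L))) (𝒟.ver.tgt (p.1.2.fan 0 L)),
      𝒟.hor.tgt (p.1.1.fan L L)), by
        rw [𝒟.sideV.tgt_mul _ _ (by simpa using hc p), 𝒟.tgt_tgt, p.1.1.isFan.ver_tgt le_rfl]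
        simp⟩
  have hx : ∀ p : τ.mfd, SmoothGerm (Z := τ.mfd) (fun p : P₁ => p.1.1) p := fun p =>
    smoothGerm_of_smoothAt σ (τ.embeds.smooth false p)
  have hy : ∀ p : τ.mfd, SmoothGerm (Z := τ.mfd) (fun p : P₁ => p.1.2) p := fun p =>
    smoothGerm_of_smoothAt σ (τ.embeds.smooth true p)
  have hg : Smooth (X := τ.mfd) (Y := ρ.mfd) g := fun p => ρ.embeds.smoothAt fun b => by
    cases b
    · exact 𝒟.sideV.smoothAt_mul (𝒟.sideV.smoothAt_inv (𝒟.ver.smoothAt_tgt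
        ((hx p).fan (Fin.zero_le _)))) (𝒟.ver.smoothAt_tgt ((hy p).fan (Fin.zero_le _)))
        (Eventually.of_forall fun p => by simpa using hc p)
    · exact 𝒟.hor.smoothAt_tgt ((hx p).fan le_rfl)
  obtain ⟨π⟩ := nonempty_fiberProductStructure (X := D) (Y := τ.mfd) (Z := ρ.mfd)
    (𝒟.submersion_tgt_tgt ρ) hg
  let P : Type u := {p : D × P₁ // (⟨(𝒟.ver.tgt p.1, 𝒟.hor.tgt p.1), (𝒟.tgt_tgt p.1).symm⟩ :
    FiberProduct 𝒟.sideV.tgt 𝒟.sideH.tgt) = g p.2}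
  have hP : ∀ p : P, 𝒟.IsFan (joinFan p.1.2.1.1 p.1.2.1.2 p.1.1) := fun p =>
    isFan_joinFan p.1.2.2 (congrArg (fun q => q.1.2) p.2) (congrArg (fun q => q.1.1) p.2)
  let e : 𝒟.Bar (m + 2) ≃ P :=
    { toFun := fun w => ⟨(w.fan (Fin.last (m + 1)).castSucc (Fin.last (m + 2)),
        ⟨(w.face (Fin.last (m + 2)), w.face (Fin.last (m + 1)).castSucc), by
          apply ext_sq
          intro i i' j j' h h' h''
          have a1 := @Fin.succAbove_le_succAbove_iff (m + 1) (Fin.last (m + 1))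
          rw [sq_face _ _ h h' h'', sq_face _ _ h h' h'',
            sq_face _ _ (a1.2 h) (a1.2 h') (a1.2 h''),
            sq_face _ _ (a1.2 h) (a1.2 h') (a1.2 h'')]
          have e2 : ∀ i : Fin (m + 1), (Fin.last (m + 1)).castSucc.succAbove i.castSucc =
              i.castSucc.castSucc := fun i => by
            rw [Fin.succAbove_of_castSucc_lt]
            exact Fin.castSucc_lt_castSucc_iff.2 (Fin.castSucc_lt_last i)
          simp [e2]⟩), by
          have l1 : Fin.last (m + 2) ≠ 0 := (Fin.last_pos).ne'
          have l2 : (Fin.last (m + 1)).castSucc ≠ (0 : Fin (m + 3)) := by simp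
          have hle : (Fin.last (m + 1)).castSucc ≤ Fin.last (m + 2) := Fin.le_last _
          refine Subtype.ext (Prod.ext ?_ ?_)
          · dsimp only [g]
            rw [fan_face l1 _ (Fin.zero_le _), fan_face l2 _ (Fin.zero_le _), w.isFan.ver_tgt hle]
            simp [L]
          · dsimp only [g]
            rw [fan_face l1 _ le_rfl, w.isFan.hor_tgt hle]
            simp [L]⟩
      invFun := fun p => ofFan _ (hP p)
      left_inv := fun w => ext_fan fun i j hij => by
        rw [fan_ofFan _ hij]
        exact eq_joinFan w hij
      right_inv := fun p => by
        refine Subtype.ext (Prod.ext ?_ (Subtype.ext (Prod.ext ?_ ?_)))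
        · dsimp only
          rw [fan_ofFan _ (Fin.le_last _), joinFan_edge]
        · exact face_last_ofFan (hP p)
        · exact face_castSucc_ofFan p.1.2.2 (hP p) }
  have hα : ∀ p : π.mfd, SmoothAt (X := π.mfd) (fun p : P => p.1.1) p := π.embeds.smooth false
  have hp : ∀ p : π.mfd, SmoothAt (X := π.mfd) (Y := τ.mfd) (fun p : P => p.1.2) p :=
    π.embeds.smooth true
  have he : ∀ p : π.mfd, SmoothGerm (Z := π.mfd) (fun p : P => e.symm p) p := fun p =>
    .of_fan fun i j hij => by
      have h1 : SmoothGerm (Z := π.mfd) (fun p : P => p.1.2.1.1) p := smoothGerm_of_smoothAt σ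
        (SmoothAt.comp_of_eq (Y := τ.mfd) (τ.embeds.smooth false _) (hp p) rfl)
      have h2 : SmoothGerm (Z := π.mfd) (fun p : P => p.1.2.1.2) p := smoothGerm_of_smoothAt σ
        (SmoothAt.comp_of_eq (Y := τ.mfd) (τ.embeds.smooth true _) (hp p) rfl)
      exact (smoothGerm_joinFan h1 h2 (hα p) hij).congr
        (Eventually.of_forall fun q => fan_ofFan (hP q) hij)
  have hee : ∀ p, e (e.symm p) = p := e.apply_symm_apply
  -- the faces of an element of the bar construction are controlled by its squares
  have hface : ∀ l : Fin (m + 3), ControlledBy (X := π.mfd) (Y := σ.mfd)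
      (fun k (p : P) => Bar.coord k (e.symm p)) (fun p : P => (e.symm p).face l) := fun l => by
    refine ControlledBy.of_embeds σ.embeds fun k => ?_
    obtain ⟨i, i', j, j', h, h', h'', hk⟩ := exists_sq_eq_coord (𝒟 := 𝒟) k
    have a1 := @Fin.succAbove_le_succAbove_iff (m + 2) l
    have h1 := controlledBy_sq (P := π.mfd) he (a1.2 h) (a1.2 h') (a1.2 h'')
    refine h1.congr fun p => ?_
    rw [hk]
    exact (sq_face l (e.symm p) h h' h'').symm
  refine nonempty_barStructure (P := π.mfd) e he π.embeds fun b => ?_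
  cases b
  · have h1 := controlledBy_sq (P := π.mfd) he (Fin.zero_le (Fin.last (m + 1)).castSucc) le_rfl
      (Fin.le_last _)
    exact h1.congr fun p => congrArg (fun q : P => q.1.1) (hee p)
  · refine ControlledBy.of_embeds τ.embeds fun b => ?_
    cases b
    · exact (hface (Fin.last (m + 2))).congr fun p => congrArg (fun q : P => q.1.2.1.1) (hee p)
    · exact (hface (Fin.last (m + 1)).castSucc).congr fun p =>
        congrArg (fun q : P => q.1.2.1.2) (hee p)

/-- The spaces of the bar construction are embedded submanifolds. -/
theorem nonempty_barStructure_all (𝒟 : DoubleLieGroupoid D V H M) :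
    ∀ r, Nonempty (𝒟.BarStructure r)
  | 0 => nonempty_barStructure_zero 𝒟
  | 1 => nonempty_barStructure_one 𝒟
  | m + 2 => by
    obtain ⟨σ⟩ := nonempty_barStructure_all 𝒟 (m + 1)
    obtain ⟨σ'⟩ := nonempty_barStructure_all 𝒟 m
    exact nonempty_barStructure_add_two σ σ'

end Bar

end DoubleLieGroupoid

/-! ### The simplicial manifold -/

namespace DoubleLieGroupoid

variable {D V H M : SmoothMfd.{u}} {𝒟 : DoubleLieGroupoid D V H M} {r : ℕ}
  {Z : SmoothMfd.{w}}

namespace Bar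

theorem val_succAbove (l : Fin (r + 2)) (a : Fin (r + 1)) :
    (l.succAbove a : ℕ) = if (a : ℕ) < l then (a : ℕ) else a + 1 := by
  simp only [Fin.succAbove, Fin.lt_def, Fin.val_castSucc]
  split_ifs <;> simp

theorem val_predAbove (l : Fin (r + 1)) (a : Fin (r + 2)) :
    (l.predAbove a : ℕ) = if (l : ℕ) < a then (a : ℕ) - 1 else a := by
  simp only [Fin.predAbove, Fin.lt_def, Fin.val_castSucc]
  split_ifs <;> simp

theorem succAbove_mono (l : Fin (r + 2)) {i j : Fin (r + 1)} (h : i ≤ j) :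
    l.succAbove i ≤ l.succAbove j := Fin.succAbove_le_succAbove_iff.2 h

theorem predAbove_mono (l : Fin (r + 1)) {i j : Fin (r + 2)} (h : i ≤ j) :
    l.predAbove i ≤ l.predAbove j := Fin.predAbove_right_monotone l h

theorem succAbove_succAbove_of_le {i j : Fin (r + 2)} (h : i ≤ j) (a : Fin (r + 1)) :
    j.succ.succAbove (i.succAbove a) = i.castSucc.succAbove (j.succAbove a) := by
  rw [Fin.le_def] at h
  apply Fin.ext
  simp only [val_succAbove, Fin.val_castSucc, Fin.val_succ]
  split_ifs <;> omega

theorem face_face {i j : Fin (r + 2)} (h : i ≤ j) (x : 𝒟.Bar (r + 2)) :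
    (x.face j.succ).face i = (x.face i.castSucc).face j := by
  apply ext_sq
  intro a a' b b' l l' l''
  rw [sq_face _ _ l l' l'', sq_face _ _ l l' l'', sq_face _ _ (succAbove_mono _ l)
    (succAbove_mono _ l') (succAbove_mono _ l''), sq_face _ _ (succAbove_mono _ l)
    (succAbove_mono _ l') (succAbove_mono _ l'')]
  simp only [succAbove_succAbove_of_le h]

theorem degen_degen {i j : Fin (r + 1)} (h : i ≤ j) (x : 𝒟.Bar r) :
    (x.degen j).degen i.castSucc = (x.degen i).degen j.succ := by
  apply ext_sq
  intro a a' b b' l l' l''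
  have key : ∀ a : Fin (r + 3), j.predAbove (i.castSucc.predAbove a) =
      i.predAbove (j.succ.predAbove a) := by
    intro a
    rw [Fin.le_def] at h
    apply Fin.ext
    simp only [val_predAbove, Fin.val_castSucc, Fin.val_succ]
    split_ifs <;> omega
  rw [sq_degen _ _ l l' l'', sq_degen _ _ l l' l'', sq_degen _ _ (predAbove_mono _ l)
    (predAbove_mono _ l') (predAbove_mono _ l''), sq_degen _ _ (predAbove_mono _ l)
    (predAbove_mono _ l') (predAbove_mono _ l'')]
  simp only [key]

theorem face_degen_eq_self {l : Fin (r + 2)} {j : Fin (r + 1)}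
    (h : ∀ a, j.predAbove (l.succAbove a) = a) (x : 𝒟.Bar r) : (x.degen j).face l = x := by
  apply ext_sq
  intro a a' b b' l l' l''
  rw [sq_face _ _ l l' l'', sq_degen _ _ (succAbove_mono _ l) (succAbove_mono _ l')
    (succAbove_mono _ l'')]
  simp only [h]

theorem face_castSucc_degen (j : Fin (r + 1)) (x : 𝒟.Bar r) :
    (x.degen j).face j.castSucc = x := by
  refine face_degen_eq_self (fun a => ?_) x
  apply Fin.ext
  simp only [val_predAbove, val_succAbove, Fin.val_castSucc]
  split_ifs <;> omega

theorem face_succ_degen (j : Fin (r + 1)) (x : 𝒟.Bar r) : (x.degen j).face j.succ = x := by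
  refine face_degen_eq_self (fun a => ?_) x
  apply Fin.ext
  simp only [val_predAbove, val_succAbove, Fin.val_succ]
  split_ifs <;> omega

theorem face_degen_comm {l : Fin (r + 3)} {j' : Fin (r + 2)} {i : Fin (r + 2)} {j : Fin (r + 1)}
    (h : ∀ a, j'.predAbove (l.succAbove a) = i.succAbove (j.predAbove a)) (x : 𝒟.Bar (r + 1)) :
    (x.degen j').face l = (x.face i).degen j := by
  apply ext_sq
  intro a a' b b' l l' l''
  rw [sq_face _ _ l l' l'', sq_degen _ _ (succAbove_mono _ l) (succAbove_mono _ l')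
    (succAbove_mono _ l''), sq_degen _ _ l l' l'', sq_face _ _ (predAbove_mono _ l)
    (predAbove_mono _ l') (predAbove_mono _ l'')]
  simp only [h]

theorem face_degen_of_le {i : Fin (r + 2)} {j : Fin (r + 1)} (h : i ≤ j.castSucc)
    (x : 𝒟.Bar (r + 1)) : (x.degen j.succ).face i.castSucc = (x.face i).degen j := by
  refine face_degen_comm (fun a => ?_) x
  rw [Fin.le_def] at h
  apply Fin.ext
  simp only [val_predAbove, val_succAbove, Fin.val_castSucc, Fin.val_succ] at h ⊢
  split_ifs <;> omega

theorem face_degen_of_lt {i : Fin (r + 2)} {j : Fin (r + 1)} (h : j.castSucc < i)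
    (x : 𝒟.Bar (r + 1)) : (x.degen j.castSucc).face i.succ = (x.face i).degen j := by
  refine face_degen_comm (fun a => ?_) x
  rw [Fin.lt_def] at h
  apply Fin.ext
  simp only [val_predAbove, val_succAbove, Fin.val_castSucc, Fin.val_succ] at h ⊢
  split_ifs <;> omega

theorem embedding_degen (σ : 𝒟.BarStructure (r + 1)) (τ : 𝒟.BarStructure r) (l : Fin (r + 1)) :
    Embedding (X := τ.mfd) (Y := σ.mfd) (Bar.degen (𝒟 := 𝒟) l) where
  isImmersion := immersion_of_leftInverse (X := τ.mfd) (Y := σ.mfd) (smooth_degen σ τ l)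
    (smooth_face σ τ l.castSucc) (face_castSucc_degen l)
  isEmbedding := Topology.IsEmbedding.of_leftInverse (X := σ.mfd) (Y := τ.mfd)
    (f := Bar.face (𝒟 := 𝒟) l.castSucc) (face_castSucc_degen l)
    (smooth_face σ τ l.castSucc).continuous (smooth_degen σ τ l).continuous

theorem isSimplicialManifold (σ : ∀ r, 𝒟.BarStructure r) :
    (barData σ).IsSimplicialManifold where
  f_surjective {q} i x := by
    induction i using Fin.cases with
    | zero => exact ⟨Bar.degen 0 (show 𝒟.Bar q from x), face_castSucc_degen 0 _⟩
    | succ j => exact ⟨Bar.degen j (show 𝒟.Bar q from x), face_succ_degen j _⟩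
  f_submersion {q} i := submersion_face (σ (q + 1)) (σ q) i
  δ_embedding {q} i := embedding_degen (σ (q + 1)) (σ q) i
  f_f _ _ h x := face_face h x
  δ_δ _ _ h x := degen_degen h x
  f_δ_of_lt _ _ h x := face_degen_of_le h x
  f_δ_self j x := face_castSucc_degen j x
  f_δ_succ j x := face_succ_degen j x
  f_δ_of_gt _ _ h x := face_degen_of_lt h x

/-! ### Fillers of 2-dimensional horns -/

/-- A germ of 2-simplices through `w` from germs of its faces opposite to the vertices `2` and `1`
and of its square `α`. -/
theorem exists_germ_join (w : 𝒟.Bar 2) {x y : Z → 𝒟.Bar 1} {α : Z → D} {z : Z}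
    (hx : SmoothGerm x z) (hy : SmoothGerm y z) (hα : SmoothAt α z)
    (h : ∀ᶠ ζ in 𝓝 z, (x ζ).face 1 = (y ζ).face 1)
    (hα1 : ∀ᶠ ζ in 𝓝 z, 𝒟.ver.tgt (α ζ) = 𝒟.sideV.mul
      (𝒟.sideV.inv (𝒟.ver.tgt ((x ζ).fan 0 1))) (𝒟.ver.tgt ((y ζ).fan 0 1)))
    (hα2 : ∀ᶠ ζ in 𝓝 z, 𝒟.hor.tgt (α ζ) = 𝒟.hor.tgt ((x ζ).fan 1 1))
    (hxz : x z = w.face 2) (hyz : y z = w.face 1) (hαz : α z = w.fan 1 2) :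
    ∃ W : Z → 𝒟.Bar 2, SmoothGerm W z ∧ W z = w ∧
      ∀ᶠ ζ in 𝓝 z, (W ζ).face 2 = x ζ ∧ (W ζ).face 1 = y ζ ∧ (W ζ).fan 1 2 = α ζ := by
  have hF : ∀ᶠ ζ in 𝓝 z, 𝒟.IsFan (joinFan (x ζ) (y ζ) (α ζ)) := by
    filter_upwards [h, hα1, hα2] with ζ h1 h2 h3
    exact isFan_joinFan (m := 0) h1 h3 h2
  obtain ⟨W, hW, hWF⟩ := exists_germ_of_fan (F := fun ζ => joinFan (x ζ) (y ζ) (α ζ))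
    (fun i j hij => smoothGerm_joinFan hx hy hα hij) hF
  have hW' : ∀ᶠ ζ in 𝓝 z, ∃ hF : 𝒟.IsFan (joinFan (x ζ) (y ζ) (α ζ)), W ζ = ofFan _ hF := by
    filter_upwards [hF, hWF] with ζ h1 h2
    exact ⟨h1, ext_fan fun i j hij => by rw [h2 i j hij, fan_ofFan _ hij]⟩
  refine ⟨W, hW, ?_, ?_⟩
  · obtain ⟨hF, e⟩ := hW'.self_of_nhds
    refine ext_fan fun i j hij => ?_
    rw [e, fan_ofFan _ hij, ← eq_joinFan w hij, hxz, hyz, hαz]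
    rfl
  · filter_upwards [hW', h] with ζ h1 h2
    obtain ⟨hF, e⟩ := h1
    rw [e]
    refine ⟨face_last_ofFan (m := 0) hF, face_castSucc_ofFan (m := 0) h2 hF, ?_⟩
    rw [fan_ofFan _ (by decide)]
    exact joinFan_edge (m := 0) _ _ _

/-- Germs of horns opposite to the face `f_0` can be filled: the missing square may be any one whose
targets are prescribed by the two given faces. -/
theorem exists_lift_horn_zero (w : 𝒟.Bar 2) {x y : Z → 𝒟.Bar 1} {z : Z} (hx : SmoothGerm x z)
    (hy : SmoothGerm y z) (h : ∀ᶠ ζ in 𝓝 z, (x ζ).face 1 = (y ζ).face 1) (hxz : x z = w.face 2)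
    (hyz : y z = w.face 1) :
    ∃ W : Z → 𝒟.Bar 2, SmoothGerm W z ∧ W z = w ∧
      ∀ᶠ ζ in 𝓝 z, (W ζ).face 2 = x ζ ∧ (W ζ).face 1 = y ζ := by
  have hc : ∀ᶠ ζ in 𝓝 z, 𝒟.sideV.tgt (𝒟.ver.tgt ((x ζ).fan 0 1)) =
      𝒟.sideV.tgt (𝒟.ver.tgt ((y ζ).fan 0 1)) := by
    filter_upwards [h] with ζ hζ
    have h1 : (x ζ).fan 0 0 = (y ζ).fan 0 0 :=
      fan_eq_of_face_last_eq (m := 0) (i := 0) (j := 0) hζ le_rfl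
    rw [(x ζ).isFan.sideV_tgt 1 0, (y ζ).isFan.sideV_tgt 1 0, h1]
  have hx1 : (x z).fan 0 1 = w.fan 0 1 := by
    rw [hxz, fan_face (by decide) _ (Fin.zero_le _)]; rfl
  have hx2 : (x z).fan 1 1 = w.fan 1 1 := by
    rw [hxz, fan_face (by decide) _ le_rfl]; rfl
  have hy1 : (y z).fan 0 1 = w.fan 0 2 := by
    rw [hyz, fan_face (by decide) _ (Fin.zero_le _)]; rfl
  have h12 : (1 : Fin 3) ≤ 2 := by decide
  obtain ⟨α, hα, hαz, hαe⟩ := 𝒟.exists_lift_tgt_tgt (w.fan 1 2)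
    (a := fun ζ => 𝒟.sideV.mul (𝒟.sideV.inv (𝒟.ver.tgt ((x ζ).fan 0 1)))
      (𝒟.ver.tgt ((y ζ).fan 0 1))) (b := fun ζ => 𝒟.hor.tgt ((x ζ).fan 1 1))
    (𝒟.sideV.smoothAt_mul (𝒟.sideV.smoothAt_inv (𝒟.ver.smoothAt_tgt (hx.fan (Fin.zero_le _))))
      (𝒟.ver.smoothAt_tgt (hy.fan (Fin.zero_le _))) (by simpa using hc))
    (𝒟.hor.smoothAt_tgt (hx.fan le_rfl)) (by
      filter_upwards [hc] with ζ hζ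
      rw [𝒟.sideV.tgt_mul _ _ (by simpa using hζ), 𝒟.sideV.tgt_inv, edge_composable])
    (by rw [hx1, hy1, w.isFan.ver_tgt h12])
    (by rw [hx2, w.isFan.hor_tgt h12])
  obtain ⟨W, hW, hWz, hWe⟩ := exists_germ_join w hx hy hα h (hαe.mono fun _ h => h.1)
    (hαe.mono fun _ h => h.2) hxz hyz hαz
  exact ⟨W, hW, hWz, hWe.mono fun _ h => ⟨h.1, h.2.1⟩⟩

/-- The case of horns opposite to the face `f_2` is the reflection of that of horns opposite
to `f_0`. -/
theorem exists_lift_horn_two (w : 𝒟.Bar 2) {x y : Z → 𝒟.Bar 1} {z : Z} (hx : SmoothGerm x z)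
    (hy : SmoothGerm y z) (h : ∀ᶠ ζ in 𝓝 z, (x ζ).face 0 = (y ζ).face 0) (hxz : x z = w.face 0)
    (hyz : y z = w.face 1) :
    ∃ W : Z → 𝒟.Bar 2, SmoothGerm W z ∧ W z = w ∧
      ∀ᶠ ζ in 𝓝 z, (W ζ).face 0 = x ζ ∧ (W ζ).face 1 = y ζ := by
  obtain ⟨W, h1, h2, h3⟩ := exists_lift_horn_zero w.rev hx.rev hy.rev (by
    filter_upwards [h] with ζ hζ
    have h4 := congrArg Bar.rev hζ
    rwa [rev_face, rev_face] at h4) (by rw [hxz, rev_face]; rfl) (by rw [hyz, rev_face]; rfl)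
  refine ⟨fun ζ => (W ζ).rev, h1.rev, ?_, ?_⟩
  · change (show 𝒟.Bar 2 from (W z).rev) = w
    rw [h2]
    exact rev_rev w
  · filter_upwards [h3] with ζ h4
    have h5 := rev_face 2 (W ζ)
    have h6 := rev_face 1 (W ζ)
    rw [h4.1] at h5
    rw [h4.2] at h6
    exact ⟨h5.symm.trans (rev_rev (x ζ)), h6.symm.trans (rev_rev (y ζ))⟩

/-- The component in `V` of an element `(θ, η)` of `V ×_M H`, the first stage of the bar
construction. -/
def legV (x : 𝒟.Bar 1) : V := 𝒟.ver.tgt (x.fan 0 1)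

/-- The component in `H` of an element `(θ, η)` of `V ×_M H`, the first stage of the bar
construction. -/
def legH (x : 𝒟.Bar 1) : H := 𝒟.hor.tgt (x.fan 1 1)

theorem src_legV (x : 𝒟.Bar 1) : 𝒟.sideV.src x.legV = 𝒟.sideH.tgt x.legH := edge_composable x

theorem fan_zero_one (x : 𝒟.Bar 1) : x.fan 0 1 = 𝒟.ver.one x.legV :=
  (edgeFan_eq x (Fin.zero_le 1)).symm

theorem fan_one_one (x : 𝒟.Bar 1) : x.fan 1 1 = 𝒟.hor.one x.legH :=
  (edgeFan_eq x (le_refl 1)).symm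

theorem face_one_fan (x : 𝒟.Bar 1) :
    (x.face 1).fan 0 0 = 𝒟.hor.one (𝒟.sideH.one (𝒟.sideV.tgt x.legV)) := by
  rw [fan_face (by decide) _ le_rfl]
  exact (edgeFan_eq x (le_refl 0)).symm

theorem face_zero_fan (x : 𝒟.Bar 1) :
    (x.face 0).fan 0 0 = 𝒟.hor.one (𝒟.sideH.one (𝒟.sideH.src x.legH)) := by
  have h2 : (x.face 0).fan 0 0 = x.sq 1 1 1 1 := sq_face 0 x le_rfl le_rfl le_rfl
  have h3 : x.sq 1 1 1 1 = 𝒟.ver.one (𝒟.ver.src (x.fan 1 1)) := by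
    rw [x.isStairOn_sq.ver_id (i := 1) (j := 1) (j' := 1) trivial trivial trivial le_rfl le_rfl]
    exact congrArg 𝒟.ver.one (x.isStairOn_sq.ver_src_eq (i := 0) (i' := 1) (j := 1) (j' := 1)
      trivial trivial trivial trivial (Fin.zero_le _) le_rfl le_rfl).symm
  rw [h2, h3, fan_one_one]
  simp [𝒟.hor_one_one]

theorem ν_eq_sq (w : 𝒟.Bar 2) : w.ν = w.sq 0 1 1 2 := by
  rw [sq_eq_val _ (Fin.zero_le _) (p := 1) (q := 1) rfl le_rfl (c := 0) (d := 1) (by simp)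
    (by simp) (by simp)]
  rfl

theorem ν_eq_fan (w : 𝒟.Bar 2) : w.ν = w.fan 1 2 := ν_eq_sq w

theorem legH_face_two (w : 𝒟.Bar 2) : (w.face 2).legH = 𝒟.hor.tgt w.ν := by
  rw [legH, fan_face (by decide) _ le_rfl, ν_eq_fan,
    w.isFan.hor_tgt (i := 1) (j := 2) (by decide)]
  rfl

theorem legV_face_one (w : 𝒟.Bar 2) :
    𝒟.sideV.src (w.face 2).legV = 𝒟.sideV.tgt (𝒟.ver.tgt w.ν) ∧
      (w.face 1).legV = 𝒟.sideV.mul (w.face 2).legV (𝒟.ver.tgt w.ν) := by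
  have e : (w.face 1).legV = 𝒟.ver.tgt (w.fan 0 2) := by
    rw [legV, fan_face (by decide) _ (Fin.zero_le _)]; rfl
  have e' : (w.face 2).legV = 𝒟.ver.tgt (w.fan 0 1) := by
    rw [legV, fan_face (by decide) _ (Fin.zero_le _)]; rfl
  refine ⟨by rw [src_legV, legH_face_two, 𝒟.tgt_tgt], ?_⟩
  rw [e, e', ν_eq_fan, w.isFan.ver_tgt (i := 1) (j := 2) (by decide),
    𝒟.sideV.mul_inv_cancel_left (w.isFan.sideV_tgt _ _)]

theorem face_zero_leg (w : 𝒟.Bar 2) : (w.face 0).legV = 𝒟.ver.src w.ν ∧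
    𝒟.sideH.src (𝒟.hor.src w.ν) = 𝒟.sideH.tgt (w.face 0).legH ∧
    (w.face 1).legH = 𝒟.sideH.mul (𝒟.hor.src w.ν) (w.face 0).legH := by
  have hA := w.isStairOn_sq
  have h12 : (1 : Fin 3) ≤ 2 := by decide
  have e1 : (w.face 0).fan 0 1 = w.sq 1 1 1 2 :=
    sq_face 0 w (le_refl 0) (le_refl 0) (Fin.zero_le 1)
  have e2 : (w.face 0).fan 1 1 = w.sq 1 2 2 2 :=
    sq_face 0 w (Fin.zero_le 1) (le_refl 1) (le_refl 1)
  have e3 : (w.face 1).fan 1 1 = w.sq 0 2 2 2 :=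
    sq_face 1 w (Fin.zero_le 1) (le_refl 1) (le_refl 1)
  have h1 := hA.ver_comp (i := 0) (i' := 1) (i'' := 1) (j := 1) (j' := 2) trivial trivial trivial
    trivial trivial (Fin.zero_le _) le_rfl le_rfl h12
  have h2 := hA.ver_comp (i := 0) (i' := 1) (i'' := 2) (j := 2) (j' := 2) trivial trivial trivial
    trivial trivial (Fin.zero_le _) h12 le_rfl le_rfl
  have h3 : 𝒟.hor.src (w.sq 0 1 1 2) = 𝒟.hor.src (w.sq 0 1 2 2) :=
    hA.hor_src_eq trivial trivial trivial trivial (Fin.zero_le _) le_rfl h12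
  have h4 : 𝒟.hor.tgt (w.sq 0 1 2 2) = 𝒟.hor.src (w.sq 0 1 2 2) := by
    rw [hA.hor_id (i := 0) (i' := 1) (j := 2) trivial trivial trivial (Fin.zero_le _) h12]
    simp
  rw [legV, legH, legH, e1, e2, e3, ν_eq_sq]
  refine ⟨h1.1.symm, ?_, ?_⟩
  · rw [h3, ← h4, 𝒟.src_tgt, 𝒟.tgt_tgt, h2.1]
  · rw [h2.2, 𝒟.hor_tgt_mul _ _ h2.1, h4, h3]

/-- Germs of elements of `V ×_M H`. -/
theorem exists_germ_edge (w : 𝒟.Bar 1) {θ : Z → V} {η : Z → H} {z : Z} (hθ : SmoothAt θ z)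
    (hη : SmoothAt η z) (h : ∀ᶠ ζ in 𝓝 z, 𝒟.sideV.src (θ ζ) = 𝒟.sideH.tgt (η ζ))
    (hθz : θ z = w.legV) (hηz : η z = w.legH) :
    ∃ W : Z → 𝒟.Bar 1, SmoothGerm W z ∧ W z = w ∧
      ∀ᶠ ζ in 𝓝 z, (W ζ).legV = θ ζ ∧ (W ζ).legH = η ζ := by
  obtain ⟨v, hv, hvF⟩ := exists_germ_of_fan (F := fun ζ => 𝒟.edgeFan (θ ζ) (η ζ))
    (fun i j _ => smoothAt_edgeFan hθ hη i j) (h.mono fun ζ hζ => isFan_edgeFan hζ)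
  have hv' : ∀ᶠ ζ in 𝓝 z, (v ζ).legV = θ ζ ∧ (v ζ).legH = η ζ := by
    filter_upwards [hvF] with ζ h1
    rw [legV, legH, h1 0 1 (Fin.zero_le _), h1 1 1 le_rfl]
    simp [edgeFan]
  refine ⟨v, hv, ?_, hv'⟩
  obtain ⟨h1, h2⟩ := hv'.self_of_nhds
  exact ext_edge (h1.trans hθz) (h2.trans hηz)

/-- Germs of elements `(θ, α, η)` of `V ×_M D ×_M H`, the second stage of the bar construction. -/
theorem exists_germ_triple (w : 𝒟.Bar 2) {θ : Z → V} {α : Z → D} {η : Z → H} {z : Z}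
    (hθ : SmoothAt θ z) (hα : SmoothAt α z) (hη : SmoothAt η z)
    (hθα : ∀ᶠ ζ in 𝓝 z, 𝒟.sideV.src (θ ζ) = 𝒟.sideV.tgt (𝒟.ver.tgt (α ζ)))
    (hαη : ∀ᶠ ζ in 𝓝 z, 𝒟.sideH.src (𝒟.hor.src (α ζ)) = 𝒟.sideH.tgt (η ζ))
    (hθz : θ z = (w.face 2).legV) (hαz : α z = w.ν) (hηz : η z = (w.face 0).legH) :
    ∃ W : Z → 𝒟.Bar 2, SmoothGerm W z ∧ W z = w ∧
      ∀ᶠ ζ in 𝓝 z, ((W ζ).face 2).legV = θ ζ ∧ (W ζ).ν = α ζ ∧ ((W ζ).face 0).legH = η ζ := by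
  obtain ⟨w1, w2⟩ := legV_face_one w
  obtain ⟨w3, w4, w5⟩ := face_zero_leg w
  obtain ⟨x, hx, hxz, hxe⟩ := exists_germ_edge (w.face 2) hθ (𝒟.hor.smoothAt_tgt hα) (by
    filter_upwards [hθα] with ζ h1
    rw [h1, 𝒟.tgt_tgt]) hθz (by rw [hαz, legH_face_two])
  obtain ⟨y, hy, hyz, hye⟩ := exists_germ_edge (w.face 1)
    (𝒟.sideV.smoothAt_mul hθ (𝒟.ver.smoothAt_tgt hα) hθα)
    (𝒟.sideH.smoothAt_mul (𝒟.hor.smoothAt_src hα) hη hαη) (by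
      filter_upwards [hθα, hαη] with ζ h1 h2
      rw [𝒟.sideV.src_mul _ _ h1, 𝒟.sideH.tgt_mul _ _ h2, 𝒟.tgt_src])
    (by rw [hθz, hαz, w2]) (by rw [hαz, hηz, w5])
  obtain ⟨W, hW, hWz, hWe⟩ := exists_germ_join w hx hy hα (by
      filter_upwards [hxe, hye, hθα] with ζ h1 h2 h3
      refine ext_fan fun i j hij => ?_
      obtain rfl : i = 0 := Subsingleton.elim (α := Fin 1) i 0
      obtain rfl : j = 0 := Subsingleton.elim (α := Fin 1) j 0
      rw [face_one_fan, face_one_fan, h1.1, h2.1, 𝒟.sideV.tgt_mul _ _ h3]) (by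
      filter_upwards [hxe, hye, hθα] with ζ h1 h2 h3
      change _ = 𝒟.sideV.mul (𝒟.sideV.inv (x ζ).legV) (y ζ).legV
      rw [h1.1, h2.1, 𝒟.sideV.inv_mul_cancel_left h3]) (hxe.mono fun ζ h => h.2.symm) hxz hyz
    (by rw [hαz, ν_eq_fan])
  refine ⟨W, hW, hWz, ?_⟩
  filter_upwards [hWe, hxe, hye, hαη] with ζ h1 h2 h3 h4
  have hν : (W ζ).ν = α ζ := (ν_eq_fan _).trans h1.2.2
  refine ⟨by rw [h1.1, h2.1], hν, ?_⟩
  obtain ⟨k1, k2, k3⟩ := face_zero_leg (W ζ)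
  rw [hν] at k2 k3
  rw [h1.2.1, h3.2] at k3
  exact 𝒟.sideH.mul_left_cancel k2 h4 k3.symm

/-- Germs of horns opposite to the face `f_1` can be filled: the faces `f_2` and `f_0` prescribe
`t_H α` and `s_V α` in `(θ, α, η)`, besides `θ` and `η`. -/
theorem exists_lift_horn_one (w : 𝒟.Bar 2) {x y : Z → 𝒟.Bar 1} {z : Z} (hx : SmoothGerm x z)
    (hy : SmoothGerm y z) (h : ∀ᶠ ζ in 𝓝 z, (x ζ).face 0 = (y ζ).face 1) (hxz : x z = w.face 2)
    (hyz : y z = w.face 0) :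
    ∃ W : Z → 𝒟.Bar 2, SmoothGerm W z ∧ W z = w ∧
      ∀ᶠ ζ in 𝓝 z, (W ζ).face 2 = x ζ ∧ (W ζ).face 0 = y ζ := by
  have hc : ∀ᶠ ζ in 𝓝 z, 𝒟.sideV.tgt (y ζ).legV = 𝒟.sideH.src (x ζ).legH := by
    filter_upwards [h] with ζ hζ
    have h1 := congrArg (fun v : 𝒟.Bar 0 => 𝒟.sideH.src (𝒟.hor.src (v.fan 0 0))) hζ
    simp only [face_zero_fan, face_one_fan, 𝒟.hor.src_one, 𝒟.sideH.src_one] at h1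
    exact h1.symm
  obtain ⟨w1, w2, w3⟩ := face_zero_leg w
  obtain ⟨α, hα, hαz, hαe⟩ := 𝒟.exists_lift_src_tgt w.ν
    (a := fun ζ => (y ζ).legV) (b := fun ζ => (x ζ).legH)
    (𝒟.ver.smoothAt_tgt (hy.fan (Fin.zero_le _))) (𝒟.hor.smoothAt_tgt (hx.fan le_rfl)) hc
    (by rw [hyz, w1]) (by rw [hxz, legH_face_two])
  obtain ⟨W, hW, hWz, hWe⟩ := exists_germ_triple w (θ := fun ζ => (x ζ).legV) (α := α)
    (η := fun ζ => (y ζ).legH) (𝒟.ver.smoothAt_tgt (hx.fan (Fin.zero_le _))) hα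
    (𝒟.hor.smoothAt_tgt (hy.fan le_rfl)) (by
      filter_upwards [hαe] with ζ h1
      rw [src_legV, ← h1.2, 𝒟.tgt_tgt]) (by
      filter_upwards [hαe] with ζ h1
      rw [𝒟.src_src, h1.1, src_legV]) (by rw [hxz]) hαz (by rw [hyz])
  refine ⟨W, hW, hWz, ?_⟩
  filter_upwards [hWe, hαe] with ζ h1 h2
  refine ⟨ext_edge h1.1 ((legH_face_two _).trans ?_), ext_edge ((face_zero_leg _).1.trans ?_) h1.2.2⟩
  · rw [h1.2.1, h2.2]; rfl
  · rw [h1.2.1, h2.1]; rfl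

end Bar

end DoubleLieGroupoid

/-! ### The local Lie 2-groupoid -/

namespace DoubleLieGroupoid

open SimplicialData

variable {D V H M : SmoothMfd.{u}} {𝒟 : DoubleLieGroupoid D V H M} {r : ℕ}

namespace Bar

/-- A space of 2-horns is the fiber product of two face maps, so it is a manifold; the horn map is a
submersion if germs of horns can be filled. The given faces of the horn are those with the indices
`i` and `j + 1`. -/
theorem exists_hornStructure_two (σ : ∀ r, 𝒟.BarStructure r) (hX : (barData σ).IsSimplicialManifold)
    {k : Fin 3} {i j : Fin 2} (hij : i ≤ j) (hi : i.castSucc ≠ k) (hj : j.succ ≠ k)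
    (huniq : ∀ i' j' : Fin 2, i' ≤ j' → i'.castSucc ≠ k → j'.succ ≠ k → i' = i ∧ j' = j)
    (hcov : ∀ l, l ≠ k → l ≠ j.succ → l = i.castSucc) (hne : i.castSucc ≠ j.succ)
    (hlift : ∀ {Z : SmoothMfd.{u}} (w : 𝒟.Bar 2) {x y : Z → 𝒟.Bar 1} {z : Z}, SmoothGerm x z →
      SmoothGerm y z → (∀ᶠ ζ in 𝓝 z, (x ζ).face i = (y ζ).face j) → x z = w.face j.succ →
      y z = w.face i.castSucc → ∃ W : Z → 𝒟.Bar 2, SmoothGerm W z ∧ W z = w ∧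
        ∀ᶠ ζ in 𝓝 z, (W ζ).face j.succ = x ζ ∧ (W ζ).face i.castSucc = y ζ) :
    ∃ τ : EmbeddedStructure (Horn.coord (𝒳 := barData σ) (n := 0) (k := k)),
      Submersion (Y := τ.mfd) (hX.hornMap (n := 0) k) := by
  have hs : ∀ l : Fin 2, Submersion (X := (σ 1).mfd) (Y := (σ 0).mfd) (Bar.face (𝒟 := 𝒟) l) :=
    fun l => submersion_face (σ 1) (σ 0) l
  obtain ⟨π⟩ := nonempty_fiberProductStructure (hs i) (smooth_face (σ 1) (σ 0) j)
  let c : Fin 3 → 𝒟.Bar 1 × 𝒟.Bar 1 → 𝒟.Bar 1 := fun l p => if l = j.succ then p.1 else p.2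
  have c1 : ∀ p, c j.succ p = p.1 := fun p => if_pos rfl
  have c2 : ∀ p, c i.castSucc p = p.2 := fun p => if_neg hne
  let e : (barData σ).Horn (n := 0) k ≃ π.mfd :=
    { toFun := fun x => ⟨(x.1 ⟨j.succ, hj⟩, x.1 ⟨i.castSucc, hi⟩), x.2 i j hij hi hj⟩
      invFun := fun p => ⟨fun l => c l.1 p.1, by
        intro i' j' h' hi' hj'
        obtain ⟨rfl, rfl⟩ := huniq i' j' h' hi' hj'
        exact (congrArg (Bar.face i') (c1 p.1)).trans
          (p.2.trans (congrArg (Bar.face j') (c2 p.1)).symm)⟩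
      left_inv := by
        intro x
        apply Subtype.ext
        funext ⟨l, hl⟩
        by_cases h : l = j.succ
        · subst h; exact c1 _
        · obtain rfl := hcov l hl h; exact c2 _
      right_inv := by
        intro p
        exact Subtype.ext (Prod.ext (c1 p.1) (c2 p.1)) }
  have hsm : ∀ l, Smooth (X := π.mfd) (fun p => Horn.coord (𝒳 := barData σ) l (e.symm p)) := by
    rintro ⟨l, hl⟩
    by_cases h : l = j.succ
    · subst h
      exact (funext fun p : π.mfd => (c1 p.1).symm) ▸ π.contMDiff_pr false
    · obtain rfl := hcov l hl h
      exact (funext fun p : π.mfd => (c2 p.1).symm) ▸ π.contMDiff_pr true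
  have hE : Embeds (X := π.mfd) fun l p => Horn.coord (𝒳 := barData σ) l (e.symm p) := by
    refine π.embeds.of_controlledBy hsm fun b => ?_
    cases b with
    | false =>
      refine (ControlledBy.of_apply (pr := fun l p => Horn.coord (𝒳 := barData σ) l (e.symm p))
        ⟨j.succ, hj⟩ (hsm _)).congr fun p => ?_
      exact c1 p.1
    | true =>
      refine (ControlledBy.of_apply (pr := fun l p => Horn.coord (𝒳 := barData σ) l (e.symm p))
        ⟨i.castSucc, hi⟩ (hsm _)).congr fun p => ?_
      exact c2 p.1
  obtain ⟨τ⟩ := hE.nonempty_embeddedStructure e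
  refine ⟨τ, ?_⟩
  have hsmooth : Smooth (X := (σ 2).mfd) (Y := τ.mfd) (hX.hornMap (n := 0) k) := fun x =>
    τ.embeds.smoothAt fun l => smooth_face (σ 2) (σ 1) l.1 x
  refine submersion_of_sections (X := (σ 2).mfd) (Y := τ.mfd) hsmooth fun x => ?_
  have hg : ∀ l : {l : Fin 3 // l ≠ k}, SmoothGerm (𝒟 := 𝒟) (Z := τ.mfd)
      (fun t => (show (barData σ).Horn (n := 0) k from t).1 l) (hX.hornMap (n := 0) k x) := fun l =>
    smoothGerm_of_smoothAt (σ 1) (τ.embeds.smooth l _)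
  obtain ⟨W, hW, hWz, hWe⟩ := hlift (Z := τ.mfd) x (hg ⟨j.succ, hj⟩) (hg ⟨i.castSucc, hi⟩)
    (Eventually.of_forall fun t => t.2 i j hij hi hj) rfl rfl
  refine ⟨W, hW.smoothAt (σ 2), hWz, ?_⟩
  filter_upwards [hWe] with t ht
  apply Subtype.ext
  funext ⟨l, hl⟩
  by_cases h : l = j.succ
  · subst h; exact ht.1
  · obtain rfl := hcov l hl h; exact ht.2

theorem exists_hornStructure_zero (σ : ∀ r, 𝒟.BarStructure r)
    (hX : (barData σ).IsSimplicialManifold) (k : Fin 3) :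
    ∃ τ : EmbeddedStructure (Horn.coord (𝒳 := barData σ) (n := 0) (k := k)),
      Submersion (Y := τ.mfd) (hX.hornMap (n := 0) k) := by
  fin_cases k
  · exact exists_hornStructure_two σ hX (i := 1) (j := 1) le_rfl (by decide) (by decide)
      (by decide) (by decide) (by decide)
      fun w _ _ _ hx hy h hxz hyz => exists_lift_horn_zero w hx hy h hxz hyz
  · exact exists_hornStructure_two σ hX (i := 0) (j := 1) (by decide) (by decide) (by decide)
      (by decide) (by decide) (by decide)
      fun w _ _ _ hx hy h hxz hyz => exists_lift_horn_one w hx hy h hxz hyz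
  · refine exists_hornStructure_two σ hX (i := 0) (j := 0) le_rfl (by decide) (by decide)
      (by decide) (by decide) (by decide)
      fun w _ _ _ hx hy h hxz hyz => ?_
    obtain ⟨W, h1, h2, h3⟩ := exists_lift_horn_two w hy hx (h.mono fun _ h => h.symm) hyz hxz
    exact ⟨W, h1, h2, h3.mono fun _ h => ⟨h.2, h.1⟩⟩

end Bar

end DoubleLieGroupoid

/-! ### Horns of dimension at least three -/

namespace DoubleLieGroupoid

open SimplicialData OrderDual

variable {D V H M : SmoothMfd.{u}} {𝒟 : DoubleLieGroupoid D V H M} {r : ℕ}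

section Controlled

variable {I : Type*} [LinearOrder I] {X : SmoothMfd.{u}} {ι : Type*} {B : ι → SmoothMfd.{u}}
  {pr : ∀ l, X → B l} {A : X → I → I → I → I → D} {k : I}

/-- The case `k ≤ j` of `controlledBy_stair`, in which the square is the one spanned by the frame. -/
theorem controlledBy_rect (hA : ∀ x, 𝒟.IsStairOn univ (A x))
    (h : ∀ a b : I, ∀ i ∈ ({a, b, k} : Set I), ∀ i' ∈ ({a, b, k} : Set I),
      ∀ j ∈ ({a, b, k} : Set I), ∀ j' ∈ ({a, b, k} : Set I), i ≤ i' → i' ≤ j → j ≤ j' →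
      ControlledBy pr fun x => A x i i' j j') {i i' j j' : I} (l : i ≤ i') (l' : i' ≤ j)
    (l'' : j ≤ j') (hk : k ≤ j) : ControlledBy pr fun x => A x i i' j j' := by
  have hF : ∀ a b, a ≤ b → k ≤ b → ControlledBy pr fun x => 𝒟.baseFrame k (A x) a b := by
    intro a b hab hkb
    by_cases hka : k ≤ a
    · refine (h a b k (by simp) a (by simp) a (by simp) b (by simp) hka le_rfl hab).congr
        fun x => ?_
      rw [baseFrame, if_pos hka]
    · refine ((h a b a (by simp) k (by simp) k (by simp) b (by simp) (not_le.1 hka).le le_rfl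
        hkb).comp 𝒟.ver.smooth_inv).congr fun x => ?_
      rw [baseFrame, if_neg hka]
  have hfr : ∀ x, 𝒟.IsFrame (fun a b => a ≤ b ∧ k ≤ b) (𝒟.baseFrame k (A x)) := fun x =>
    isFrame_baseFrame fun a b => (hA x).mono (subset_univ _)
  have hS : ∀ a, a ≤ j → ControlledBy pr fun x => 𝒟.strip (𝒟.baseFrame k (A x)) a j j' := by
    intro a haj
    refine ControlledBy.mul 𝒟.hor ((hF a j haj hk).comp 𝒟.hor.smooth_inv)
      (hF a j' (haj.trans l'') (hk.trans l'')) fun x => ?_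
    rw [𝒟.hor.src_inv]
    exact (hfr x).tgt_eq ⟨haj, hk⟩ ⟨haj.trans l'', hk.trans l''⟩
  refine (ControlledBy.mul 𝒟.ver ((hS i (l.trans l')).comp 𝒟.ver.smooth_inv) (hS i' l')
    fun x => (hfr x).rect_composable ⟨l.trans l', hk⟩ ⟨(l.trans l').trans l'', hk.trans l''⟩
      ⟨l', hk⟩ ⟨l'.trans l'', hk.trans l''⟩).congr fun x => ?_
  exact ((hA x).eq_rect trivial trivial trivial trivial trivial l l' l'' hk).symm

/-- The squares of a staircase are controlled by those with at most two indices different from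
`k`. -/
theorem controlledBy_stair (hA : ∀ x, 𝒟.IsStairOn univ (A x))
    (h : ∀ a b : I, ∀ i ∈ ({a, b, k} : Set I), ∀ i' ∈ ({a, b, k} : Set I),
      ∀ j ∈ ({a, b, k} : Set I), ∀ j' ∈ ({a, b, k} : Set I), i ≤ i' → i' ≤ j → j ≤ j' →
      ControlledBy pr fun x => A x i i' j j') {i i' j j' : I} (l : i ≤ i') (l' : i' ≤ j)
    (l'' : j ≤ j') : ControlledBy pr fun x => A x i i' j j' := by
  by_cases hk : k ≤ j
  · exact controlledBy_rect hA h l l' l'' hk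
  · exact controlledBy_rect (𝒟 := 𝒟.rev) (I := Iᵒᵈ) (k := toDual k)
      (A := fun x => revStair (A x)) (i := toDual j') (i' := toDual j) (j := toDual i')
      (j' := toDual i) (fun x => (hA x).rev)
      (fun a b i hi i' hi' j hj j' hj' m m' m'' => h (ofDual a) (ofDual b) _ hj' _ hj _ hi' _ hi
        m'' m' m) l'' l' l (l'.trans (not_le.1 hk).le)

end Controlled

namespace Bar

variable {n : ℕ} {k : Fin (n + 4)}

theorem exists_ne_of_triple (a b : Fin (n + 4)) (k : Fin (n + 4)) :
    ∃ l, l ∉ ({a, b, k} : Finset (Fin (n + 4))) := by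
  by_contra! h
  have h1 : (Finset.univ : Finset (Fin (n + 4))) ⊆ {a, b, k} := fun l _ => h l
  have h2 := Finset.card_le_card h1
  have h3 : ({a, b, k} : Finset (Fin (n + 4))).card ≤ 3 := Finset.card_le_three
  rw [Finset.card_univ, Fintype.card_fin] at h2
  omega

/-- The left inverse of `l.succAbove`. -/
def dropIndex (l : Fin (n + 4)) : Fin (n + 4) → Fin (n + 3) := Function.invFun l.succAbove

theorem dropIndex_succAbove (l : Fin (n + 4)) (a : Fin (n + 3)) :
    dropIndex l (l.succAbove a) = a :=
  Function.leftInverse_invFun Fin.succAbove_right_injective a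

theorem succAbove_dropIndex {l a : Fin (n + 4)} (h : a ≠ l) :
    l.succAbove (dropIndex l a) = a := by
  obtain ⟨b, rfl⟩ := Fin.exists_succAbove_eq h
  rw [dropIndex_succAbove]

theorem dropIndex_mono {l a b : Fin (n + 4)} (ha : a ≠ l) (hb : b ≠ l) (h : a ≤ b) :
    dropIndex l a ≤ dropIndex l b := by
  rw [← Fin.succAbove_le_succAbove_iff (p := l), succAbove_dropIndex ha, succAbove_dropIndex hb]
  exact h

theorem sq_eq_sq_face {l : Fin (n + 4)} (w : 𝒟.Bar (n + 3)) {i i' j j' : Fin (n + 4)} (hi : i ≠ l)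
    (hi' : i' ≠ l) (hj : j ≠ l) (hj' : j' ≠ l) (h : i ≤ i') (h' : i' ≤ j) (h'' : j ≤ j') :
    w.sq i i' j j' =
      (w.face l).sq (dropIndex l i) (dropIndex l i') (dropIndex l j) (dropIndex l j') := by
  rw [sq_face l w (dropIndex_mono hi hi' h) (dropIndex_mono hi' hj h') (dropIndex_mono hj hj' h''),
    succAbove_dropIndex hi, succAbove_dropIndex hi', succAbove_dropIndex hj,
    succAbove_dropIndex hj']

/-- All but one of the faces of a simplex of dimension at least three determine it, together with
its variations. -/
theorem embeds_faces (σ : ∀ r, 𝒟.BarStructure r) (k : Fin (n + 4)) :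
    Embeds (X := (σ (n + 3)).mfd) (A := fun _ => (σ (n + 2)).mfd)
      fun (l : {l : Fin (n + 4) // l ≠ k}) x => Bar.face (𝒟 := 𝒟) l.1 x := by
  have hs : ∀ l : {l : Fin (n + 4) // l ≠ k}, Smooth (X := (σ (n + 3)).mfd)
      (Y := (σ (n + 2)).mfd) (Bar.face (𝒟 := 𝒟) l.1) := fun l => smooth_face _ _ l.1
  refine (σ (n + 3)).embeds.of_controlledBy hs fun c => ?_
  obtain ⟨i, i', j, j', h, h', h'', e⟩ := exists_sq_eq_coord (𝒟 := 𝒟) c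
  rw [funext e]
  refine controlledBy_stair (X := (σ (n + 3)).mfd) (k := k) (A := fun x : 𝒟.Bar (n + 3) => x.sq)
    (fun x : 𝒟.Bar (n + 3) => x.isStairOn_sq) ?_ h h' h''
  intro a b i hi i' hi' j hj j' hj' m m' m''
  obtain ⟨l, hl⟩ := exists_ne_of_triple a b k
  have hne : ∀ c ∈ ({a, b, k} : Set (Fin (n + 4))), c ≠ l := by
    rintro c hc rfl
    exact hl (by simpa using hc)
  refine ((ControlledBy.of_apply (X := (σ (n + 3)).mfd) (A := fun _ => (σ (n + 2)).mfd)
    (pr := fun (l : {l : Fin (n + 4) // l ≠ k}) x => Bar.face (𝒟 := 𝒟) l.1 x)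
    ⟨l, (hne k (by simp)).symm⟩ (hs _)).comp (smooth_sq (σ (n + 2))
      (dropIndex_mono (hne i hi) (hne i' hi') m) (dropIndex_mono (hne i' hi') (hne j hj) m')
      (dropIndex_mono (hne j hj) (hne j' hj') m''))).congr fun x => ?_
  exact (sq_eq_sq_face _ (hne i hi) (hne i' hi') (hne j hj) (hne j' hj') m m' m'').symm

/-- Two faces of a horn agree on the squares which avoid both of the opposite vertices. -/
theorem horn_sq_eq {x : {l : Fin (n + 4) // l ≠ k} → 𝒟.Bar (n + 2)}
    (hx : ∀ (i j : Fin (n + 3)), i ≤ j → ∀ (hi : i.castSucc ≠ k) (hj : j.succ ≠ k),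
      (x ⟨j.succ, hj⟩).face i = (x ⟨i.castSucc, hi⟩).face j)
    (l l' : {l : Fin (n + 4) // l ≠ k}) {i i' j j' : Fin (n + 4)}
    (hl : i ≠ l ∧ i' ≠ l ∧ j ≠ l ∧ j' ≠ l) (hl' : i ≠ l' ∧ i' ≠ l' ∧ j ≠ l' ∧ j' ≠ l')
    (h : i ≤ i') (h' : i' ≤ j) (h'' : j ≤ j') :
    (x l).sq (dropIndex l i) (dropIndex l i') (dropIndex l j) (dropIndex l j') =
      (x l').sq (dropIndex l' i) (dropIndex l' i') (dropIndex l' j) (dropIndex l' j') := by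
  wlog hll : l < l' generalizing l l'
  · rcases eq_or_lt_of_le (not_lt.1 hll) with e | e
    · subst e; rfl
    · exact (this l' l hl' hl e).symm
  obtain ⟨l, hlk⟩ := l
  obtain ⟨l', hlk'⟩ := l'
  have hll' : l < l' := hll
  obtain ⟨p, rfl⟩ : ∃ p : Fin (n + 3), l = p.castSucc :=
    ⟨l.castPred (ne_of_lt (hll'.trans_le (Fin.le_last _))), by simp⟩
  obtain ⟨q, rfl⟩ : ∃ q : Fin (n + 3), l' = q.succ :=
    ⟨l'.pred (ne_of_gt ((Fin.zero_le _).trans_lt hll')), by simp⟩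
  have hpq : p ≤ q := Fin.castSucc_lt_succ_iff.1 hll'
  -- a vertex different from `p` and from `q + 1` has an index `b` in the common face
  have hrep : ∀ a : Fin (n + 4), a ≠ p.castSucc → a ≠ q.succ →
      ∃ b : Fin (n + 2), dropIndex p.castSucc a = q.succAbove b ∧
        dropIndex q.succ a = p.succAbove b := by
    intro a ha ha'
    have h1 : q.succ.succAbove p = p.castSucc := Fin.succAbove_of_castSucc_lt _ _ hll'
    have h2 : dropIndex q.succ a ≠ p := by
      rintro e
      rw [← e, succAbove_dropIndex ha', e] at h1
      exact ha h1
    obtain ⟨b, hb⟩ := Fin.exists_succAbove_eq h2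
    refine ⟨b, ?_, hb.symm⟩
    rw [← dropIndex_succAbove p.castSucc (q.succAbove b), ← succAbove_succAbove_of_le hpq, hb,
      succAbove_dropIndex ha']
  obtain ⟨b1, e1, e1'⟩ := hrep i hl.1 hl'.1
  obtain ⟨b2, e2, e2'⟩ := hrep i' hl.2.1 hl'.2.1
  obtain ⟨b3, e3, e3'⟩ := hrep j hl.2.2.1 hl'.2.2.1
  obtain ⟨b4, e4, e4'⟩ := hrep j' hl.2.2.2 hl'.2.2.2
  have m := dropIndex_mono hl.1 hl.2.1 h
  have m' := dropIndex_mono hl.2.1 hl.2.2.1 h'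
  have m'' := dropIndex_mono hl.2.2.1 hl.2.2.2 h''
  dsimp only at m m' m'' ⊢
  rw [e1, e2, Fin.succAbove_le_succAbove_iff] at m
  rw [e2, e3, Fin.succAbove_le_succAbove_iff] at m'
  rw [e3, e4, Fin.succAbove_le_succAbove_iff] at m''
  rw [e1, e2, e3, e4, e1', e2', e3', e4', ← sq_face _ _ m m' m'', ← sq_face _ _ m m' m'',
    hx p q hpq hlk hlk']

/-- Four indices may involve all the vertices, but a triple which contains `k` avoids some vertex
other than `k`. Thus the squares on such triples are given by the faces of the horn, and they extend
to a staircase, the filler. -/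
theorem exists_horn_filler {x : {l : Fin (n + 4) // l ≠ k} → 𝒟.Bar (n + 2)}
    (hx : ∀ (i j : Fin (n + 3)), i ≤ j → ∀ (hi : i.castSucc ≠ k) (hj : j.succ ≠ k),
      (x ⟨j.succ, hj⟩).face i = (x ⟨i.castSucc, hi⟩).face j) :
    ∃ w : 𝒟.Bar (n + 3), ∀ l, w.face l.1 = x l := by
  classical
  have : Nonempty {l : Fin (n + 4) // l ≠ k} := by
    obtain ⟨l, hl⟩ := exists_ne_of_triple k k k
    exact ⟨l, fun h => hl (by simp [h])⟩
  -- an admissible vertex that a square avoids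
  let P (i i' j j' : Fin (n + 4)) (l : {l : Fin (n + 4) // l ≠ k}) : Prop :=
    i ≠ l ∧ i' ≠ l ∧ j ≠ l ∧ j' ≠ l
  let A (i i' j j' : Fin (n + 4)) : D :=
    let l := Classical.epsilon (P i i' j j')
    (x l).sq (dropIndex l i) (dropIndex l i') (dropIndex l j) (dropIndex l j')
  have hA : ∀ (l : {l : Fin (n + 4) // l ≠ k}) {i i' j j' : Fin (n + 4)}, i ≠ l → i' ≠ l → j ≠ l →
      j' ≠ l → i ≤ i' → i' ≤ j → j ≤ j' →
      A i i' j j' = (x l).sq (dropIndex l i) (dropIndex l i') (dropIndex l j) (dropIndex l j') := by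
    intro l i i' j j' h1 h2 h3 h4 m m' m''
    exact horn_sq_eq hx _ l (Classical.epsilon_spec (p := P i i' j j') ⟨l, h1, h2, h3, h4⟩)
      ⟨h1, h2, h3, h4⟩ m m' m''
  have hst : ∀ l : {l : Fin (n + 4) // l ≠ k}, 𝒟.IsStairOn {a | a ≠ l.1} A := by
    intro l
    refine ((x l).isStairOn_sq.comap (T := {a | a ≠ l.1}) (dropIndex l.1) (fun _ _ => trivial)
      fun a ha b hb h => dropIndex_mono ha hb h).congr fun i hi i' hi' j hj j' hj' m m' m'' => ?_
    exact hA l hi hi' hj hj' m m' m''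
  have ht : ∀ i j, 𝒟.IsStairOn {i, j, k} A := by
    intro i j
    obtain ⟨l, hl⟩ := exists_ne_of_triple i j k
    have hne : ∀ c ∈ ({i, j, k} : Set (Fin (n + 4))), c ≠ l := by
      rintro c hc rfl
      exact hl (by simpa using hc)
    exact (hst ⟨l, (hne k (by simp)).symm⟩).mono hne
  refine ⟨ofStair _ (isStairOn_glue ht), fun l => ext_sq fun i i' j j' h h' h'' => ?_⟩
  have m := succAbove_mono l.1 h
  have m' := succAbove_mono l.1 h'
  have m'' := succAbove_mono l.1 h''
  rw [sq_face _ _ h h' h'', sq_ofStair _ m m' m'', ← (hst l).eq_glue l.2.symm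
    (Fin.succAbove_ne _ _) (Fin.succAbove_ne _ _) (Fin.succAbove_ne _ _) (Fin.succAbove_ne _ _)
    m m' m'', hA l (Fin.succAbove_ne _ _) (Fin.succAbove_ne _ _) (Fin.succAbove_ne _ _)
    (Fin.succAbove_ne _ _) m m' m'']
  simp only [dropIndex_succAbove]

theorem horn_injective (σ : ∀ r, 𝒟.BarStructure r) (hX : (barData σ).IsSimplicialManifold)
    (k : Fin (n + 4)) : Function.Injective (hX.hornMap k) := fun _ _ h =>
  (embeds_faces σ k).injective fun l => congrFun (congrArg Subtype.val h) l

/-- As horns have unique fillers, on which the given faces are jointly embedding, the space of horns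
is a copy of the space of simplices. -/
theorem exists_hornStructure_succ (σ : ∀ r, 𝒟.BarStructure r)
    (hX : (barData σ).IsSimplicialManifold) (k : Fin (n + 4)) :
    ∃ τ : EmbeddedStructure (Horn.coord (𝒳 := barData σ) (n := n + 1) (k := k)),
      Submersion (Y := τ.mfd) (hX.hornMap k) ∧ Etale (Y := τ.mfd) (hX.hornMap k) := by
  have hb : Function.Bijective (hX.hornMap k) := by
    refine ⟨horn_injective σ hX k, fun x => ?_⟩
    obtain ⟨w, hw⟩ := exists_horn_filler (𝒟 := 𝒟) (x := x.1) x.2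
    exact ⟨w, Subtype.ext (funext hw)⟩
  let e : (σ (n + 3)).mfd ≃ (barData σ).Horn k := Equiv.ofBijective _ hb
  have he : ∀ x, e x = hX.hornMap k x := fun x => rfl
  obtain ⟨τ⟩ := Embeds.nonempty_embeddedStructure (S := (barData σ).Horn k)
    (pr := Horn.coord (𝒳 := barData σ) (n := n + 1) (k := k)) e.symm (embeds_faces σ k)
  have h1 : Smooth (X := (σ (n + 3)).mfd) (Y := τ.mfd) (hX.hornMap k) := fun x =>
    τ.embeds.smoothAt fun l => smooth_face (σ (n + 3)) (σ (n + 2)) l.1 x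
  have h2 : Smooth (X := τ.mfd) (Y := (σ (n + 3)).mfd) e.symm := fun t => by
    refine (embeds_faces σ k).smoothAt (Z := τ.mfd) fun l => ?_
    have h3 : ∀ t, Bar.face (𝒟 := 𝒟) l.1 (e.symm t) =
        Horn.coord (𝒳 := barData σ) (n := n + 1) (k := k) l t := fun t =>
      congrArg (Horn.coord (𝒳 := barData σ) (n := n + 1) (k := k) l) (e.apply_symm_apply t)
    exact (funext h3) ▸ τ.embeds.smooth l t
  refine ⟨τ, submersion_of_sections (X := (σ (n + 3)).mfd) (Y := τ.mfd) h1 fun x =>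
    ⟨e.symm, h2 _, e.symm_apply_apply x, Eventually.of_forall e.apply_symm_apply⟩, ?_⟩
  let Φ : Diffeomorph (𝓡 (σ (n + 3)).mfd.dim) (𝓡 τ.mfd.dim) (σ (n + 3)).mfd τ.mfd ∞ :=
    { toEquiv := e
      contMDiff_toFun := h1
      contMDiff_invFun := h2 }
  exact Φ.isLocalDiffeomorph

end Bar

/-- The bar construction of a double Lie groupoid is a local Lie 2-groupoid. -/
theorem isLocalLieTwoGroupoid (σ : ∀ r, 𝒟.BarStructure r) :
    (barData σ).IsLocalLieTwoGroupoid where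
  toIsSimplicialManifold := Bar.isSimplicialManifold σ
  horn_submersion {n} k := by
    cases n with
    | zero => exact Bar.exists_hornStructure_zero σ _ k
    | succ n =>
      obtain ⟨τ, h, -⟩ := Bar.exists_hornStructure_succ σ (Bar.isSimplicialManifold σ) k
      exact ⟨τ, h⟩
  horn_injective k := Bar.horn_injective σ _ k
  horn_etale k := by
    obtain ⟨τ, -, h⟩ := Bar.exists_hornStructure_succ σ (Bar.isSimplicialManifold σ) k
    exact ⟨τ, h⟩

end DoubleLieGroupoid

/-! ### Pullbacks of closed forms -/

theorem contDiffAt_compContinuousLinearMap {E F G : Type*} [NormedAddCommGroup E] [NormedSpace ℝ E]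
    [NormedAddCommGroup F] [NormedSpace ℝ F] [NormedAddCommGroup G] [NormedSpace ℝ G]
    [FiniteDimensional ℝ G] {η : E → F [⋀^Fin 2]→L[ℝ] ℝ} {g : E → G →L[ℝ] F} {x : E}
    (hη : ContDiffAt ℝ ∞ η x) (hg : ContDiffAt ℝ ∞ g x) :
    ContDiffAt ℝ ∞ (fun a => (η a).compContinuousLinearMap (g a)) x := by
  let C := ContinuousMultilinearMap ℝ (fun _ : Fin 2 => G) ℝ
  let J : (G [⋀^Fin 2]→L[ℝ] ℝ) →L[ℝ] C := ContinuousAlternatingMap.toContinuousMultilinearMapCLM ℝ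
  let J' : (F [⋀^Fin 2]→L[ℝ] ℝ) →L[ℝ] ContinuousMultilinearMap ℝ (fun _ : Fin 2 => F) ℝ :=
    ContinuousAlternatingMap.toContinuousMultilinearMapCLM ℝ
  have hJ : Function.Injective J := ContinuousAlternatingMap.toContinuousMultilinearMap_injective
  have : FiniteDimensional ℝ C := FiniteDimensional.of_injective
    (ContinuousMultilinearMap.toMultilinearMapLinear : C →ₗ[ℝ] _)
    ContinuousMultilinearMap.toMultilinearMap_injective
  obtain ⟨R, hR⟩ := LinearMap.exists_leftInverse_of_injective J.toLinearMap
    (LinearMap.ker_eq_bot.2 hJ)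
  have h1 : ContDiffAt ℝ ∞ (fun a => ((fun _ : Fin 2 => g a), J' (η a))) x :=
    (contDiffAt_pi.2 fun _ => hg).prodMk (J'.contDiff.contDiffAt.comp x hη)
  have h2 := (ContinuousMultilinearMap.analyticAt_uncurry_compContinuousLinearMap
    (𝕜 := ℝ) (G := ℝ) (Fm := fun _ : Fin 2 => G) (Em := fun _ : Fin 2 => F)
    (q := ((fun _ => g x), J' (η x)))).contDiffAt (n := ∞)
  have h3 := (LinearMap.toContinuousLinearMap R).contDiff.contDiffAt.comp x (h2.comp x h1)
  refine h3.congr_of_eventuallyEq (Eventually.of_forall fun a => ?_)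
  exact (LinearMap.congr_fun hR ((η a).compContinuousLinearMap (g a))).symm

namespace SmoothMfd

variable {X Y : SmoothMfd.{u}}

/-- In charts, the pullback of a form is the pullback along the map expressed in charts. -/
theorem TwoForm.inChart_pullback (ϖ : TwoForm Y) {f : X → Y} (hf : Smooth f) (x₀ : X) {b : X.Model}
    (hb : b ∈ (extChartAt (𝓡 X.dim) x₀).target) :
    ∃ (y₀ : Y) (g : X.Model → Y.Model), ContDiffAt ℝ ∞ g b ∧
      g b ∈ (extChartAt (𝓡 Y.dim) y₀).target ∧
      (ϖ.pullback f).inChart x₀ =ᶠ[𝓝 b]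
        fun a => (ϖ.inChart y₀ (g a)).compContinuousLinearMap (fderiv ℝ g a) := by
  let φ := extChartAt (𝓡 X.dim) x₀
  let y₀ := f (φ.symm b)
  let ψ := extChartAt (𝓡 Y.dim) y₀
  have hφo : IsOpen φ.target := isOpen_extChartAt_target x₀
  have hφ : ∀ a ∈ φ.target, ContMDiffAt 𝓘(ℝ, X.Model) (𝓡 X.dim) ∞ φ.symm a := fun a ha =>
    (contMDiffOn_extChartAt_symm x₀).contMDiffAt (hφo.mem_nhds ha)
  have hψ : ∀ y ∈ ψ.source, ContMDiffAt (𝓡 Y.dim) 𝓘(ℝ, Y.Model) ∞ ψ y := fun y hy =>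
    contMDiffAt_extChartAt' (by simpa [ψ, extChartAt_source] using hy)
  have hψo : IsOpen ψ.target := isOpen_extChartAt_target y₀
  have hψs : ∀ c ∈ ψ.target, ContMDiffAt 𝓘(ℝ, Y.Model) (𝓡 Y.dim) ∞ ψ.symm c := fun c hc =>
    (contMDiffOn_extChartAt_symm y₀).contMDiffAt (hψo.mem_nhds hc)
  have hfb : f (φ.symm b) ∈ ψ.source := mem_extChartAt_source _
  have hnear : ∀ᶠ a in 𝓝 b, a ∈ φ.target ∧ f (φ.symm a) ∈ ψ.source := by
    have hc : ContinuousAt (fun a => f (φ.symm a)) b :=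
      ContinuousAt.comp (f := φ.symm) hf.continuous.continuousAt (hφ b hb).continuousAt
    filter_upwards [hφo.mem_nhds hb, hc.eventually_mem
      ((isOpen_extChartAt_source y₀).mem_nhds hfb)] with a h1 h2
    exact ⟨h1, h2⟩
  have hg : ∀ a ∈ φ.target, f (φ.symm a) ∈ ψ.source →
      ContMDiffAt 𝓘(ℝ, X.Model) 𝓘(ℝ, Y.Model) ∞ (fun a => ψ (f (φ.symm a))) a := fun a ha ha' =>
    ContMDiffAt.comp (g := ψ) a (hψ _ ha') (ContMDiffAt.comp (g := f) a (hf _) (hφ a ha))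
  refine ⟨y₀, fun a => ψ (f (φ.symm a)), contMDiffAt_iff_contDiffAt.1 (hg b hb hfb),
    ψ.map_source hfb, ?_⟩
  filter_upwards [hnear.eventually_nhds] with a ha
  obtain ⟨ha1, ha2⟩ := ha.self_of_nhds
  -- the two ways from the chart of `X` to `Y` agree near `a`
  have e : (fun a => ψ.symm (ψ (f (φ.symm a)))) =ᶠ[𝓝 a] fun a => f (φ.symm a) :=
    ha.mono fun a' h => ψ.left_inv h.2
  have d1 : mfderiv 𝓘(ℝ, X.Model) (𝓡 Y.dim) (fun a => ψ.symm (ψ (f (φ.symm a)))) a =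
      (mfderiv 𝓘(ℝ, Y.Model) (𝓡 Y.dim) ψ.symm (ψ (f (φ.symm a)))).comp
        (mfderiv 𝓘(ℝ, X.Model) 𝓘(ℝ, Y.Model) (fun a => ψ (f (φ.symm a))) a) :=
    mfderiv_comp a ((hψs _ (ψ.map_source ha2)).mdifferentiableAt (by simp))
      ((hg a ha1 ha2).mdifferentiableAt (by simp))
  have d2 : mfderiv 𝓘(ℝ, X.Model) (𝓡 Y.dim) (fun a => f (φ.symm a)) a =
      (mfderiv (𝓡 X.dim) (𝓡 Y.dim) f (φ.symm a)).comp
        (mfderiv 𝓘(ℝ, X.Model) (𝓡 X.dim) φ.symm a) :=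
    mfderiv_comp a ((hf _).mdifferentiableAt (by simp)) ((hφ a ha1).mdifferentiableAt (by simp))
  have d3 := (e.mfderiv_eq (I := 𝓘(ℝ, X.Model)) (I' := 𝓡 Y.dim)).symm.trans d1
  rw [d2, mfderiv_eq_fderiv] at d3
  ext v
  have key : ∀ (y : Y) (h : y = f (φ.symm a)) (w : Fin 2 → Y.Model),
      ϖ (f (φ.symm a)) w = ϖ y w := by
    rintro _ rfl w; rfl
  have d4 : ∀ i, mfderiv (𝓡 X.dim) (𝓡 Y.dim) f (φ.symm a)
      (mfderiv 𝓘(ℝ, X.Model) (𝓡 X.dim) φ.symm a (v i)) =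
      mfderiv 𝓘(ℝ, Y.Model) (𝓡 Y.dim) ψ.symm (ψ (f (φ.symm a)))
        (fderiv ℝ (fun a => ψ (f (φ.symm a))) a (v i)) := fun i =>
    DFunLike.congr_fun d3 (v i)
  change ϖ (f (φ.symm a)) (fun i => mfderiv (𝓡 X.dim) (𝓡 Y.dim) f (φ.symm a)
      (mfderiv 𝓘(ℝ, X.Model) (𝓡 X.dim) φ.symm a (v i))) =
    ϖ (ψ.symm (ψ (f (φ.symm a)))) (fun i => mfderiv 𝓘(ℝ, Y.Model) (𝓡 Y.dim) ψ.symm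
      (ψ (f (φ.symm a))) (fderiv ℝ (fun a => ψ (f (φ.symm a))) a (v i)))
  rw [funext d4]
  exact key _ (ψ.left_inv ha2) _

theorem TwoForm.IsClosed.pullback {ϖ : TwoForm Y} (hϖ : ϖ.IsClosed) {f : X → Y} (hf : Smooth f) :
    (ϖ.pullback f).IsClosed := by
  have hs : ∀ (y₀ : Y) (c : Y.Model), c ∈ (extChartAt (𝓡 Y.dim) y₀).target →
      ContDiffAt ℝ ∞ (ϖ.inChart y₀) c := fun y₀ c hc =>
    (hϖ.1 y₀).contDiffAt ((isOpen_extChartAt_target y₀).mem_nhds hc)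
  constructor
  · intro x₀ b hb
    obtain ⟨y₀, g, hg, hgb, e⟩ := ϖ.inChart_pullback hf x₀ hb
    refine ContDiffAt.contDiffWithinAt (ContDiffAt.congr_of_eventuallyEq ?_ e)
    exact contDiffAt_compContinuousLinearMap ((hs y₀ _ hgb).comp b hg)
      (hg.fderiv_right (m := ∞) (by simp))
  · intro x₀ b hb
    obtain ⟨y₀, g, hg, hgb, e⟩ := ϖ.inChart_pullback hf x₀ hb
    rw [e.extDeriv_eq, extDeriv_pullback ((hs y₀ _ hgb).differentiableAt (by simp)) hg
      (by simpa using (WithTop.coe_le_coe.2 le_top : ((2 : ℕ∞) : WithTop ℕ∞) ≤ ∞)), hϖ.2 y₀ _ hgb]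
    rfl

end SmoothMfd

/-! ### Tangent vectors of the bar construction -/

namespace SmoothMfd

theorem tmap_comp_eq_zero {X : SmoothMfd.{u}} {Y : SmoothMfd.{v}} {Z : SmoothMfd.{w}} {g : Y → Z}
    {f : X → Y} {x : X} (hg : SmoothAt g (f x)) (hf : SmoothAt f x) {a : X.Model}
    (h : tmap f x a = 0) : tmap (fun y => g (f y)) x a = 0 := by
  rw [tmap_comp_apply hg hf, h, map_zero]

theorem tmap_congr_apply {X : SmoothMfd.{u}} {Y : SmoothMfd.{v}} {f g : X → Y} {x : X}
    (h : f =ᶠ[𝓝 x] g) (a : X.Model) : tmap f x a = tmap g x a := by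
  rw [tmap_congr h]

/-- The kernel of a 2-form as a subspace of the model space. -/
def TwoForm.kerAt {X : SmoothMfd.{u}} (ϖ : TwoForm X) (x : X) : Submodule ℝ X.Model := ϖ.ker x

theorem TwoForm.mem_kerAt {X : SmoothMfd.{u}} {ϖ : TwoForm X} {x : X} {a : X.Model} :
    a ∈ ϖ.kerAt x ↔ ∀ b : X.Model, ϖ x ![a, b] = 0 := Iff.rfl

theorem TwoForm.pullback_apply {X Y : SmoothMfd.{u}} (ϖ : TwoForm Y) (f : X → Y) (x : X)
    (a b : X.Model) : ϖ.pullback f x ![a, b] = ϖ (f x) ![tmap f x a, tmap f x b] := by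
  change ϖ (f x) (fun i => tmap f x (![a, b] i)) = _
  congr 1
  ext i
  fin_cases i <;> rfl

theorem TwoForm.mem_kerAt_pullback {X Y : SmoothMfd.{u}} (ϖ : TwoForm Y) {f : X → Y} {x : X}
    (hf : Function.Surjective (tmap f x)) {a : X.Model} :
    a ∈ (ϖ.pullback f).kerAt x ↔ tmap f x a ∈ ϖ.kerAt (f x) := by
  rw [mem_kerAt, mem_kerAt, hf.forall]
  exact forall_congr' fun b => by rw [ϖ.pullback_apply]

end SmoothMfd

namespace DoubleLieGroupoid

variable {D V H M : SmoothMfd.{u}} {𝒟 : DoubleLieGroupoid D V H M} {r : ℕ}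

namespace Bar

/-- The squares of a fan separate tangent vectors. -/
theorem eq_zero_of_tmap_fan (σ : 𝒟.BarStructure r) {x : σ.mfd} {a : σ.mfd.Model}
    (h : ∀ i j, i ≤ j → tmap (X := σ.mfd) (fun y : 𝒟.Bar r => y.fan i j) x a = 0) : a = 0 := by
  refine σ.embeds.immersive x a fun k => ?_
  obtain ⟨i, i', j, j', l, l', l'', e⟩ := exists_sq_eq_coord (𝒟 := 𝒟) k
  have hF : ∀ i j, i ≤ j → SmoothAt (X := σ.mfd) (fun y : 𝒟.Bar r => y.fan i j) x := fun i j hij =>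
    (smoothGerm_id σ x).fan hij
  have hc : ∀ i, i ≤ j → ∀ᶠ y : σ.mfd in 𝓝 x,
      𝒟.hor.src (𝒟.hor.inv (Bar.fan (𝒟 := 𝒟) y i j)) = 𝒟.hor.tgt (Bar.fan (𝒟 := 𝒟) y i j') :=
    fun i hij => Eventually.of_forall fun y => by
      rw [𝒟.hor.src_inv, (Bar.isFan (𝒟 := 𝒟) y).isFrame.tgt_eq hij (hij.trans l'')]
  have hs : ∀ i, i ≤ j → SmoothAt (X := σ.mfd) (fun y : 𝒟.Bar r => 𝒟.strip y.fan i j j') x ∧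
      tmap (X := σ.mfd) (fun y : 𝒟.Bar r => 𝒟.strip y.fan i j j') x a = 0 := fun i hij =>
    ⟨𝒟.hor.smoothAt_mul (Z := σ.mfd) (𝒟.hor.smoothAt_inv (hF i j hij)) (hF i j' (hij.trans l''))
        (hc i hij),
      𝒟.hor.tmap_mul_eq_zero (Z := σ.mfd) (𝒟.hor.smoothAt_inv (hF i j hij))
        (hF i j' (hij.trans l'')) (hc i hij)
        (tmap_comp_eq_zero (X := σ.mfd) (𝒟.hor.smooth_inv _) (hF i j hij) (h i j hij))
        (h i j' (hij.trans l''))⟩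
  have h1 : tmap (X := σ.mfd) (fun y : 𝒟.Bar r => 𝒟.rect y.fan i i' j j') x a = 0 :=
    𝒟.ver.tmap_mul_eq_zero (Z := σ.mfd) (𝒟.ver.smoothAt_inv (hs i (l.trans l')).1) (hs i' l').1
      (Eventually.of_forall fun y => (Bar.isFan (𝒟 := 𝒟) y).isFrame.rect_composable (l.trans l')
        (l.trans (l'.trans l'')) l' (l'.trans l''))
      (tmap_comp_eq_zero (X := σ.mfd) (𝒟.ver.smooth_inv _) (hs i (l.trans l')).1
        (hs i (l.trans l')).2) (hs i' l').2
  rw [← h1]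
  exact tmap_congr_apply (X := σ.mfd) (Eventually.of_forall fun y =>
    (e y).trans (sq_eq_rect (𝒟 := 𝒟) y l l' l'')) a

theorem smooth_legV (σ : 𝒟.BarStructure 1) : Smooth (X := σ.mfd) (legV (𝒟 := 𝒟)) := fun x =>
  𝒟.ver.smoothAt_tgt (Z := σ.mfd) ((smoothGerm_id σ x).fan (Fin.zero_le _))

theorem smooth_legH (σ : 𝒟.BarStructure 1) : Smooth (X := σ.mfd) (legH (𝒟 := 𝒟)) := fun x =>
  𝒟.hor.smoothAt_tgt (Z := σ.mfd) ((smoothGerm_id σ x).fan le_rfl)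

theorem smooth_ν (σ : 𝒟.BarStructure 2) : Smooth (X := σ.mfd) (ν (𝒟 := 𝒟)) := by
  rw [funext ν_eq_sq]
  exact smooth_sq σ (Fin.zero_le _) le_rfl (by decide)

/-- The projections of `V ×_M H` to `V` and `H` separate tangent vectors. -/
theorem eq_zero_of_tmap_leg (σ : 𝒟.BarStructure 1) {x : σ.mfd} {a : σ.mfd.Model}
    (hV : tmap (X := σ.mfd) (legV (𝒟 := 𝒟)) x a = 0)
    (hH : tmap (X := σ.mfd) (legH (𝒟 := 𝒟)) x a = 0) : a = 0 := by
  refine eq_zero_of_tmap_fan σ (x := x) fun i j hij => ?_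
  have h1 : ∀ y : 𝒟.Bar 1, y.fan i j = 𝒟.edgeFan y.legV y.legH i j := fun y =>
    (edgeFan_eq y hij).symm
  rw [funext h1]
  by_cases hj : j = 0
  · simp only [edgeFan, if_pos hj]
    have h2 : Smooth fun θ => 𝒟.hor.one (𝒟.sideH.one (𝒟.sideV.tgt θ)) := fun θ =>
      𝒟.hor.smoothAt_one (𝒟.sideH.smoothAt_one (𝒟.sideV.smoothAt_tgt (smoothAt_id θ)))
    exact tmap_comp_eq_zero (X := σ.mfd) (h2 _) (smooth_legV σ x) hV
  · by_cases hi : i = 0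
    · simp only [edgeFan, if_neg hj, if_pos hi]
      exact tmap_comp_eq_zero (X := σ.mfd) (𝒟.ver.smooth_one _) (smooth_legV σ x) hV
    · simp only [edgeFan, if_neg hj, if_neg hi]
      exact tmap_comp_eq_zero (X := σ.mfd) (𝒟.hor.smooth_one _) (smooth_legH σ x) hH

/-- The projections of `V ×_M D ×_M H` to `V`, `D` and `H` separate tangent vectors: the faces `f_2`
and `f_1` have components `(θ, t_H α)` and `(θ · t_V α, s_H α · η)`, and together with `α` they
determine the fan. -/
theorem eq_zero_of_tmap_triple (σ : ∀ r, 𝒟.BarStructure r) {x : (σ 2).mfd} {a : (σ 2).mfd.Model}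
    (hV : tmap (X := (σ 2).mfd) (fun w : 𝒟.Bar 2 => (w.face 2).legV) x a = 0)
    (hν : tmap (X := (σ 2).mfd) (ν (𝒟 := 𝒟)) x a = 0)
    (hH : tmap (X := (σ 2).mfd) (fun w : 𝒟.Bar 2 => (w.face 0).legH) x a = 0) : a = 0 := by
  have sf : ∀ l, SmoothAt (X := (σ 2).mfd) (Y := (σ 1).mfd) (Bar.face (𝒟 := 𝒟) l) x := fun l =>
    smooth_face (σ 2) (σ 1) l x
  have sν := smooth_ν (σ 2) x
  have hf : ∀ l, tmap (X := (σ 2).mfd) (fun w : 𝒟.Bar 2 => (w.face l).legV) x a = 0 →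
      tmap (X := (σ 2).mfd) (fun w : 𝒟.Bar 2 => (w.face l).legH) x a = 0 →
      tmap (X := (σ 2).mfd) (Y := (σ 1).mfd) (Bar.face (𝒟 := 𝒟) l) x a = 0 := by
    intro l h1 h2
    exact eq_zero_of_tmap_leg (σ 1)
      ((tmap_comp_apply (X := (σ 2).mfd) (Y := (σ 1).mfd) (smooth_legV (σ 1) _) (sf l) a).symm.trans
        h1)
      ((tmap_comp_apply (X := (σ 2).mfd) (Y := (σ 1).mfd) (smooth_legH (σ 1) _) (sf l) a).symm.trans
        h2)
  have sV : SmoothAt (X := (σ 2).mfd) (fun w : 𝒟.Bar 2 => (w.face 2).legV) x :=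
    SmoothAt.comp_of_eq (X := (σ 2).mfd) (Y := (σ 1).mfd) (smooth_legV (σ 1) _) (sf 2) rfl
  have sH : SmoothAt (X := (σ 2).mfd) (fun w : 𝒟.Bar 2 => (w.face 0).legH) x :=
    SmoothAt.comp_of_eq (X := (σ 2).mfd) (Y := (σ 1).mfd) (smooth_legH (σ 1) _) (sf 0) rfl
  have h2 := hf 2 hV (by
    rw [funext legH_face_two]
    exact tmap_comp_eq_zero (X := (σ 2).mfd) (𝒟.hor.submersion_tgt.contMDiff _) sν hν)
  have h1 := hf 1 (by
    rw [funext fun w => (legV_face_one (𝒟 := 𝒟) w).2]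
    exact 𝒟.sideV.tmap_mul_eq_zero (Z := (σ 2).mfd) sV (𝒟.ver.smoothAt_tgt sν)
      (Eventually.of_forall fun w => (legV_face_one (𝒟 := 𝒟) w).1) hV
      (tmap_comp_eq_zero (X := (σ 2).mfd) (𝒟.ver.submersion_tgt.contMDiff _) sν hν)) (by
    rw [funext fun w => (face_zero_leg (𝒟 := 𝒟) w).2.2]
    exact 𝒟.sideH.tmap_mul_eq_zero (Z := (σ 2).mfd) (𝒟.hor.smoothAt_src sν) sH
      (Eventually.of_forall fun w => (face_zero_leg (𝒟 := 𝒟) w).2.1)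
      (tmap_comp_eq_zero (X := (σ 2).mfd) (𝒟.hor.submersion_src.contMDiff _) sν hν) hH)
  have hfan : ∀ (l : Fin 3), l ≠ 0 → tmap (X := (σ 2).mfd) (Y := (σ 1).mfd)
      (Bar.face (𝒟 := 𝒟) l) x a = 0 → ∀ i j : Fin 2, i ≤ j →
      tmap (X := (σ 2).mfd) (fun w : 𝒟.Bar 2 => w.fan (l.succAbove i) (l.succAbove j)) x a = 0 := by
    intro l hl h i j hij
    have h3 : ∀ w : 𝒟.Bar 2, w.fan (l.succAbove i) (l.succAbove j) = (w.face l).fan i j := fun w =>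
      (fan_face hl w hij).symm
    rw [funext h3]
    exact tmap_comp_eq_zero (X := (σ 2).mfd) (Y := (σ 1).mfd)
      (g := fun y : 𝒟.Bar 1 => y.fan i j) ((smoothGerm_id (σ 1) _).fan hij) (sf l) h
  refine eq_zero_of_tmap_fan (σ 2) (x := x) fun i j hij => ?_
  have f2 := hfan 2 (by decide) h2
  have f1 := hfan 1 (by decide) h1
  fin_cases i <;> fin_cases j
  · exact f2 0 0 le_rfl
  · exact f2 0 1 (Fin.zero_le _)
  · exact f1 0 1 (Fin.zero_le _)
  · simp at hij
  · exact f2 1 1 le_rfl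
  · exact (funext ν_eq_fan : ν (𝒟 := 𝒟) = _) ▸ hν
  · simp at hij
  · simp at hij
  · exact f1 1 1 le_rfl

/-- Tangent vectors of `V ×_M H` from curves. -/
theorem exists_vector_edge (σ : 𝒟.BarStructure 1) (y : σ.mfd) {θ : euc 1 → V} {η : euc 1 → H}
    (hθ : SmoothAt θ 0) (hη : SmoothAt η 0)
    (h : ∀ᶠ ζ in 𝓝 0, 𝒟.sideV.src (θ ζ) = 𝒟.sideH.tgt (η ζ)) (hθz : θ 0 = legV (𝒟 := 𝒟) y)
    (hηz : η 0 = legH (𝒟 := 𝒟) y) :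
    ∃ a : σ.mfd.Model, tmap (X := σ.mfd) (legV (𝒟 := 𝒟)) y a = tmap θ 0 vel ∧
      tmap (X := σ.mfd) (legH (𝒟 := 𝒟)) y a = tmap η 0 vel := by
  obtain ⟨W, hW, rfl, hWe⟩ := exists_germ_edge (𝒟 := 𝒟) (Z := euc 1) y hθ hη h hθz hηz
  have hWs := hW.smoothAt σ
  refine ⟨tmap (Y := σ.mfd) W 0 vel, ?_, ?_⟩
  · rw [← tmap_comp_apply (Y := σ.mfd) (g := legV (𝒟 := 𝒟)) (smooth_legV σ _) hWs]
    exact tmap_congr_apply (X := euc 1) (hWe.mono fun _ h => h.1) _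
  · rw [← tmap_comp_apply (Y := σ.mfd) (g := legH (𝒟 := 𝒟)) (smooth_legH σ _) hWs]
    exact tmap_congr_apply (X := euc 1) (hWe.mono fun _ h => h.2) _

/-- Tangent vectors of `V ×_M D ×_M H` from curves. -/
theorem exists_vector_triple (σ : ∀ r, 𝒟.BarStructure r) (w : (σ 2).mfd) {θ : euc 1 → V}
    {α : euc 1 → D} {η : euc 1 → H} (hθ : SmoothAt θ 0) (hα : SmoothAt α 0) (hη : SmoothAt η 0)
    (hθα : ∀ᶠ ζ in 𝓝 0, 𝒟.sideV.src (θ ζ) = 𝒟.sideV.tgt (𝒟.ver.tgt (α ζ)))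
    (hαη : ∀ᶠ ζ in 𝓝 0, 𝒟.sideH.src (𝒟.hor.src (α ζ)) = 𝒟.sideH.tgt (η ζ))
    (hθz : θ 0 = (Bar.face (𝒟 := 𝒟) 2 w).legV) (hαz : α 0 = ν (𝒟 := 𝒟) w)
    (hηz : η 0 = (Bar.face (𝒟 := 𝒟) 0 w).legH) :
    ∃ a : (σ 2).mfd.Model,
      tmap (X := (σ 2).mfd) (fun w : 𝒟.Bar 2 => (w.face 2).legV) w a = tmap θ 0 vel ∧
      tmap (X := (σ 2).mfd) (ν (𝒟 := 𝒟)) w a = tmap α 0 vel ∧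
      tmap (X := (σ 2).mfd) (fun w : 𝒟.Bar 2 => (w.face 0).legH) w a = tmap η 0 vel := by
  obtain ⟨W, hW, rfl, hWe⟩ := exists_germ_triple (𝒟 := 𝒟) (Z := euc 1) w hθ hα hη hθα hαη hθz hαz
    hηz
  have hWs := hW.smoothAt (σ 2)
  have sf : ∀ l, Smooth (X := (σ 2).mfd) (Y := (σ 1).mfd) (Bar.face (𝒟 := 𝒟) l) := fun l =>
    smooth_face (σ 2) (σ 1) l
  have sV : Smooth (X := (σ 2).mfd) (fun w : 𝒟.Bar 2 => (w.face 2).legV) := fun x =>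
    SmoothAt.comp_of_eq (X := (σ 2).mfd) (Y := (σ 1).mfd) (smooth_legV (σ 1) _) (sf 2 x) rfl
  have sH : Smooth (X := (σ 2).mfd) (fun w : 𝒟.Bar 2 => (w.face 0).legH) := fun x =>
    SmoothAt.comp_of_eq (X := (σ 2).mfd) (Y := (σ 1).mfd) (smooth_legH (σ 1) _) (sf 0 x) rfl
  refine ⟨tmap (Y := (σ 2).mfd) W 0 vel, ?_, ?_, ?_⟩
  · rw [← tmap_comp_apply (Y := (σ 2).mfd) (g := fun w : 𝒟.Bar 2 => (w.face 2).legV) (sV _) hWs]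
    exact tmap_congr_apply (X := euc 1) (hWe.mono fun _ h => h.1) _
  · rw [← tmap_comp_apply (Y := (σ 2).mfd) (g := ν (𝒟 := 𝒟)) (smooth_ν (σ 2) _) hWs]
    exact tmap_congr_apply (X := euc 1) (hWe.mono fun _ h => h.2.1) _
  · rw [← tmap_comp_apply (Y := (σ 2).mfd) (g := fun w : 𝒟.Bar 2 => (w.face 0).legH) (sH _) hWs]
    exact tmap_congr_apply (X := euc 1) (hWe.mono fun _ h => h.2.2) _

/-- Any curve `α` in `D` through `ν w` can be completed to a curve `(θ, α, η)` in `V ×_M D ×_M H`. -/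
theorem tmap_ν_surjective (σ : ∀ r, 𝒟.BarStructure r) (w : (σ 2).mfd) :
    Function.Surjective (tmap (X := (σ 2).mfd) (ν (𝒟 := 𝒟)) w) := by
  intro b
  obtain ⟨α, hα, hαz, hαb⟩ := exists_curve (ν (𝒟 := 𝒟) w) b
  obtain ⟨θ, hθ, hθz, hθe⟩ := 𝒟.sideV.submersion_src.exists_lift (Bar.face (𝒟 := 𝒟) 2 w).legV
    (𝒟.sideV.smoothAt_tgt (𝒟.ver.smoothAt_tgt hα))
    (by rw [hαz, (legV_face_one (𝒟 := 𝒟) w).1])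
  obtain ⟨η, hη, hηz, hηe⟩ := 𝒟.sideH.submersion_tgt.exists_lift (Bar.face (𝒟 := 𝒟) 0 w).legH
    (𝒟.sideH.smoothAt_src (𝒟.hor.smoothAt_src hα))
    (by rw [hαz, (face_zero_leg (𝒟 := 𝒟) w).2.1])
  obtain ⟨a, -, ha, -⟩ := exists_vector_triple σ w hθ hα hη hθe (hηe.mono fun _ h => h.symm)
    hθz hαz hηz
  exact ⟨a, ha.trans hαb⟩

end Bar

end DoubleLieGroupoid

/-! ### The form on the bar construction -/

namespace DoubleLieGroupoid

open SimplicialData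

variable {D V H M : SmoothMfd.{u}} {𝒟 : DoubleLieGroupoid D V H M} {ϖ : TwoForm D}

namespace Bar

theorem pullback_face_barForm (σ : ∀ r, 𝒟.BarStructure r) (ϖ : TwoForm D) (l : Fin 4)
    {c : 𝒟.Bar 3 → D} (hc : ∀ y, (Bar.face l y).ν = c y) (x : (σ 3).mfd) (a b : (σ 3).mfd.Model) :
    TwoForm.pullback (X := (σ 3).mfd) (Y := (σ 2).mfd) (Bar.face (𝒟 := 𝒟) l) (barForm σ ϖ) x
        ![a, b] =
      ϖ (c x) ![tmap (X := (σ 3).mfd) c x a, tmap (X := (σ 3).mfd) c x b] := by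
  obtain rfl : (fun y => (Bar.face l y).ν) = c := funext hc
  have key : ∀ a, tmap (X := (σ 3).mfd) (fun y : 𝒟.Bar 3 => (Bar.face l y).ν) x a = _ := fun a =>
    tmap_comp_apply (X := (σ 3).mfd) (Y := (σ 2).mfd) (smooth_ν (σ 2) _)
      (smooth_face (σ 3) (σ 2) l x) a
  refine (TwoForm.pullback_apply (X := (σ 3).mfd) (Y := (σ 2).mfd) (barForm σ ϖ)
    (Bar.face (𝒟 := 𝒟) l) x a b).trans
    ((TwoForm.pullback_apply (X := (σ 2).mfd) ϖ ν _ _ _).trans ?_)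
  rw [key, key]

/-- The squares `ν (f_1 y)` and `ν (f_2 y)` are the products of `ν (f_0 y)` and of `ν (f_3 y)`,
respectively, with one and the same square of `y`, in the two directions. -/
theorem multiplicative_barForm (σ : ∀ r, 𝒟.BarStructure r) (hϖ : 𝒟.IsPresymplectic ϖ) :
    Multiplicative (𝒳 := barData σ) (barForm σ ϖ) := by
  have h01 : (0 : Fin 4) ≤ 1 := by decide
  have h12 : (1 : Fin 4) ≤ 2 := by decide
  have h23 : (2 : Fin 4) ≤ 3 := by decide
  have hA : ∀ y : 𝒟.Bar 3, 𝒟.IsStairOn univ y.sq := fun y => y.isStairOn_sq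
  -- the common factor is the square with rows from `0` to `1` and columns from `2` to `3`
  have e2 : ∀ y : 𝒟.Bar 3, _ := fun y => (hA y).hor_comp (i := 0) (i' := 1) (j := 1) (j' := 2)
    (j'' := 3) trivial trivial trivial trivial trivial h01 le_rfl h12 h23
  have e1 : ∀ y : 𝒟.Bar 3, _ := fun y => (hA y).ver_comp (i := 0) (i' := 1) (i'' := 2) (j := 2)
    (j' := 3) trivial trivial trivial trivial trivial h01 h12 le_rfl h23
  have f0 : ∀ y : 𝒟.Bar 3, (y.face 0).ν = y.sq 1 2 2 3 := fun y =>
    (ν_eq_sq _).trans (sq_face 0 y (i := 0) (i' := 1) (j := 1) (j' := 2) (by decide) le_rfl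
      (by decide))
  have f1 : ∀ y : 𝒟.Bar 3, (y.face 1).ν = 𝒟.ver.mul (y.sq 0 1 2 3) (y.sq 1 2 2 3) := fun y =>
    ((ν_eq_sq _).trans (sq_face 1 y (i := 0) (i' := 1) (j := 1) (j' := 2) (by decide) le_rfl
      (by decide))).trans (e1 y).2
  have f2 : ∀ y : 𝒟.Bar 3, (y.face 2).ν = 𝒟.hor.mul (y.sq 0 1 1 2) (y.sq 0 1 2 3) := fun y =>
    ((ν_eq_sq _).trans (sq_face 2 y (i := 0) (i' := 1) (j := 1) (j' := 2) (by decide) le_rfl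
      (by decide))).trans (e2 y).2
  have f3 : ∀ y : 𝒟.Bar 3, (y.face 3).ν = y.sq 0 1 1 2 := fun y =>
    (ν_eq_sq _).trans (sq_face 3 y (i := 0) (i' := 1) (j := 1) (j' := 2) (by decide) le_rfl
      (by decide))
  funext x
  ext v
  obtain ⟨a, b, rfl⟩ : ∃ a b, v = ![a, b] := ⟨v 0, v 1, by ext i; fin_cases i <;> rfl⟩
  have s1 : SmoothAt (X := (σ 3).mfd) (fun y : 𝒟.Bar 3 => y.sq 0 1 2 3) x :=
    smooth_sq (σ 3) h01 h12 h23 x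
  have s2 : SmoothAt (X := (σ 3).mfd) (fun y : 𝒟.Bar 3 => y.sq 1 2 2 3) x :=
    smooth_sq (σ 3) h12 le_rfl h23 x
  have s3 : SmoothAt (X := (σ 3).mfd) (fun y : 𝒟.Bar 3 => y.sq 0 1 1 2) x :=
    smooth_sq (σ 3) h01 le_rfl h12 x
  have m1 := hϖ.multiplicative_ver.apply (Z := (σ 3).mfd) s1 s2
    (Eventually.of_forall fun y => (e1 y).1) a b
  have m2 := hϖ.multiplicative_hor.apply (Z := (σ 3).mfd) s3 s1
    (Eventually.of_forall fun y => (e2 y).1) a b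
  have p0 := pullback_face_barForm σ ϖ 0 f0 x a b
  have p1 := pullback_face_barForm σ ϖ 1 f1 x a b
  have p2 := pullback_face_barForm σ ϖ 2 f2 x a b
  have p3 := pullback_face_barForm σ ϖ 3 f3 x a b
  rw [Fin.sum_univ_four]
  have key : ∀ P₀ P₁ P₂ P₃ A B C : ℝ, P₀ = B → P₁ = A + B → P₂ = C + A → P₃ = C →
      (-1 : ℝ) ^ (0 : ℕ) * P₀ + (-1 : ℝ) ^ (1 : ℕ) * P₁ + (-1 : ℝ) ^ (2 : ℕ) * P₂ +
        (-1 : ℝ) ^ (3 : ℕ) * P₃ = 0 := by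
    intros
    linarith
  exact key _ _ _ _ _ _ _ p0 (p1.trans m1) (p2.trans m2) p3

theorem isLocalPresymplectic (σ : ∀ r, 𝒟.BarStructure r) (hϖ : 𝒟.IsPresymplectic ϖ) :
    IsLocalPresymplectic (𝒳 := barData σ) (barForm σ ϖ) where
  toIsLocalLieTwoGroupoid := isLocalLieTwoGroupoid σ
  isClosed := TwoForm.IsClosed.pullback (X := (σ 2).mfd) hϖ.isClosed (smooth_ν (σ 2))
  multiplicative := multiplicative_barForm σ hϖ

/-- As `ν` is a submersion, the kernel of `ν^* ϖ` is the preimage of that of `ϖ`. -/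
theorem mem_ker_barForm (σ : ∀ r, 𝒟.BarStructure r) (ϖ : TwoForm D) (w : (σ 2).mfd)
    (a : (σ 2).mfd.Model) : a ∈ TwoForm.kerAt (X := (σ 2).mfd) (barForm σ ϖ) w ↔
      tmap (X := (σ 2).mfd) (ν (𝒟 := 𝒟)) w a ∈ ϖ.kerAt (ν (𝒟 := 𝒟) w) :=
  TwoForm.mem_kerAt_pullback (X := (σ 2).mfd) ϖ (tmap_ν_surjective σ w)

theorem mem_degenKer (σ : ∀ r, 𝒟.BarStructure r) (ϖ : TwoForm D) (i : Fin 2) {c : 𝒟.Bar 1 → D}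
    (hc : ∀ y, (Bar.degen i y).ν = c y) (y : (σ 1).mfd) (a : (σ 1).mfd.Model) :
    a ∈ degenKer (𝒳 := barData σ) (barForm σ ϖ) i y ↔
      tmap (X := (σ 1).mfd) c y a ∈ ϖ.kerAt (c y) := by
  obtain rfl : (fun y => (Bar.degen i y).ν) = c := funext hc
  have e := tmap_comp_apply (X := (σ 1).mfd) (Y := (σ 2).mfd) (g := ν (𝒟 := 𝒟))
    (f := Bar.degen (𝒟 := 𝒟) i) (smooth_ν (σ 2) _) (smooth_degen (σ 2) (σ 1) i y) a
  exact (mem_ker_barForm σ ϖ _ _).trans (iff_of_eq (congrArg (· ∈ ϖ.kerAt _) e.symm))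

theorem mem_degenKer_zero (σ : ∀ r, 𝒟.BarStructure r) (ϖ : TwoForm D) (y : (σ 1).mfd)
    (a : (σ 1).mfd.Model) : a ∈ degenKer (𝒳 := barData σ) (barForm σ ϖ) 0 y ↔
      tmap 𝒟.ver.one (legV (𝒟 := 𝒟) y) (tmap (X := (σ 1).mfd) (legV (𝒟 := 𝒟)) y a) ∈
        ϖ.kerAt (𝒟.ver.one (legV (𝒟 := 𝒟) y)) := by
  refine (mem_degenKer (c := fun y => 𝒟.ver.one y.legV) σ ϖ 0 (fun y => ?_) y a).trans
    (iff_of_eq (congrArg (· ∈ ϖ.kerAt _) (tmap_comp_apply (X := (σ 1).mfd) (𝒟.ver.smooth_one _)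
      (smooth_legV (σ 1) y) a)))
  rw [ν_eq_sq, sq_degen _ _ (by decide) le_rfl (by decide), ← fan_zero_one]
  rfl

theorem mem_degenKer_one (σ : ∀ r, 𝒟.BarStructure r) (ϖ : TwoForm D) (y : (σ 1).mfd)
    (a : (σ 1).mfd.Model) : a ∈ degenKer (𝒳 := barData σ) (barForm σ ϖ) 1 y ↔
      tmap 𝒟.hor.one (legH (𝒟 := 𝒟) y) (tmap (X := (σ 1).mfd) (legH (𝒟 := 𝒟)) y a) ∈
        ϖ.kerAt (𝒟.hor.one (legH (𝒟 := 𝒟) y)) := by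
  refine (mem_degenKer (c := fun y => 𝒟.hor.one y.legH) σ ϖ 1 (fun y => ?_) y a).trans
    (iff_of_eq (congrArg (· ∈ ϖ.kerAt _) (tmap_comp_apply (X := (σ 1).mfd) (𝒟.hor.smooth_one _)
      (smooth_legH (σ 1) y) a)))
  rw [ν_eq_sq, sq_degen _ _ (by decide) le_rfl (by decide), ← fan_one_one]
  rfl

end Bar

end DoubleLieGroupoid

/-! ### Nondegenerate forms -/

/-- Three subspaces are in direct sum as soon as every vector is, in a unique way, a sum of vectors
from the three subspaces. -/
theorem isInternal_fin_three {E : Type*} [AddCommGroup E] [Module ℝ E] (A : Fin 3 → Submodule ℝ E)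
    (h1 : ∀ a ∈ A 0, ∀ b ∈ A 1, ∀ c ∈ A 2, a + b + c = 0 → a = 0 ∧ b = 0 ∧ c = 0)
    (h2 : ∀ u, ∃ a ∈ A 0, ∃ b ∈ A 1, ∃ c ∈ A 2, a + b + c = u) : DirectSum.IsInternal A := by
  refine DirectSum.isInternal_submodule_of_iSupIndep_of_iSup_eq_top ?_ ?_
  · rw [iSupIndep_iff_finsetSum_eq_zero_imp_eq_zero]
    intro s v hv hs
    have h3 : ∀ i, (if i ∈ s then v i else 0) ∈ A i := fun i => by
      split_ifs with h
      · exact hv i h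
      · exact zero_mem _
    have h4 := h1 _ (h3 0) _ (h3 1) _ (h3 2) (by
      have h4 : ∑ i, (if i ∈ s then v i else 0) = ∑ i ∈ s, v i := by simp
      rw [Fin.sum_univ_three, hs] at h4
      exact h4)
    intro i hi
    fin_cases i
    · exact (if_pos hi).symm.trans h4.1
    · exact (if_pos hi).symm.trans h4.2.1
    · exact (if_pos hi).symm.trans h4.2.2
  · refine (Submodule.eq_top_iff').2 fun u => ?_
    obtain ⟨a, ha, b, hb, c, hc, rfl⟩ := h2 u
    exact add_mem (add_mem (Submodule.mem_iSup_of_mem 0 ha) (Submodule.mem_iSup_of_mem 1 hb))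
      (Submodule.mem_iSup_of_mem 2 hc)

theorem SmoothMfd.eq_zero_of_tmap_of_leftInverse {X Y : SmoothMfd.{u}} {f : X → Y}
    {g : Y → X} (hf : Smooth f) (hg : Smooth g) (h : ∀ x, g (f x) = x) {x : X}
    {a : X.Model} (ha : tmap f x a = 0) : a = 0 := by
  have h1 := tmap_comp_eq_zero (hg _) (hf x) ha
  rw [funext h, tmap_id] at h1
  exact h1

namespace DoubleLieGroupoid

open SimplicialData

variable {D V H M : SmoothMfd.{u}} {𝒟 : DoubleLieGroupoid D V H M} {ϖ : TwoForm D}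

theorem eq_zero_of_tmap_hor_one {h : H} {a : H.Model} (ha : tmap 𝒟.hor.one h a = 0) : a = 0 :=
  eq_zero_of_tmap_of_leftInverse 𝒟.hor.smooth_one 𝒟.hor.submersion_src.contMDiff 𝒟.hor.src_one ha

theorem eq_zero_of_tmap_ver_one {v : V} {a : V.Model} (ha : tmap 𝒟.ver.one v a = 0) : a = 0 :=
  eq_zero_of_tmap_of_leftInverse 𝒟.ver.smooth_one 𝒟.ver.submersion_src.contMDiff 𝒟.ver.src_one ha

namespace Bar

theorem tmap_legV_face (σ : ∀ r, 𝒟.BarStructure r) (l : Fin 3) (x : (σ 2).mfd)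
    (v : (σ 2).mfd.Model) :
    tmap (X := (σ 1).mfd) (legV (𝒟 := 𝒟)) (Bar.face (𝒟 := 𝒟) l x)
        (tmap (X := (σ 2).mfd) (Y := (σ 1).mfd) (Bar.face (𝒟 := 𝒟) l) x v) =
      tmap (X := (σ 2).mfd) (fun w : 𝒟.Bar 2 => (w.face l).legV) x v :=
  (tmap_comp_apply (X := (σ 2).mfd) (Y := (σ 1).mfd) (smooth_legV (σ 1) _)
    (smooth_face (σ 2) (σ 1) l x) v).symm

theorem tmap_legH_face (σ : ∀ r, 𝒟.BarStructure r) (l : Fin 3) (x : (σ 2).mfd)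
    (v : (σ 2).mfd.Model) :
    tmap (X := (σ 1).mfd) (legH (𝒟 := 𝒟)) (Bar.face (𝒟 := 𝒟) l x)
        (tmap (X := (σ 2).mfd) (Y := (σ 1).mfd) (Bar.face (𝒟 := 𝒟) l) x v) =
      tmap (X := (σ 2).mfd) (fun w : 𝒟.Bar 2 => (w.face l).legH) x v :=
  (tmap_comp_apply (X := (σ 2).mfd) (Y := (σ 1).mfd) (smooth_legH (σ 1) _)
    (smooth_face (σ 2) (σ 1) l x) v).symm

/-- The second component of `f_2 (θ, α, η)` is `t_H α`. -/
theorem tmap_legH_face_two (σ : ∀ r, 𝒟.BarStructure r) (x : (σ 2).mfd) (v : (σ 2).mfd.Model) :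
    tmap (X := (σ 1).mfd) (legH (𝒟 := 𝒟)) (Bar.face (𝒟 := 𝒟) 2 x)
        (tmap (X := (σ 2).mfd) (Y := (σ 1).mfd) (Bar.face (𝒟 := 𝒟) 2) x v) =
      tmap 𝒟.hor.tgt (ν (𝒟 := 𝒟) x) (tmap (X := (σ 2).mfd) (ν (𝒟 := 𝒟)) x v) := by
  refine (tmap_legH_face σ 2 x v).trans ?_
  rw [funext legH_face_two]
  exact tmap_comp_apply (X := (σ 2).mfd) (𝒟.hor.submersion_tgt.contMDiff _) (smooth_ν (σ 2) x) v

/-- The first component of `f_0 (θ, α, η)` is `s_V α`. -/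
theorem tmap_legV_face_zero (σ : ∀ r, 𝒟.BarStructure r) (x : (σ 2).mfd) (v : (σ 2).mfd.Model) :
    tmap (X := (σ 1).mfd) (legV (𝒟 := 𝒟)) (Bar.face (𝒟 := 𝒟) 0 x)
        (tmap (X := (σ 2).mfd) (Y := (σ 1).mfd) (Bar.face (𝒟 := 𝒟) 0) x v) =
      tmap 𝒟.ver.src (ν (𝒟 := 𝒟) x) (tmap (X := (σ 2).mfd) (ν (𝒟 := 𝒟)) x v) := by
  refine (tmap_legV_face σ 0 x v).trans ?_
  rw [funext fun w => (face_zero_leg (𝒟 := 𝒟) w).1]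
  exact tmap_comp_apply (X := (σ 2).mfd) (𝒟.ver.submersion_src.contMDiff _) (smooth_ν (σ 2) x) v

/-- The two legs of an element of `V ×_M H` meet in the same point of `M`. -/
theorem tmap_src_legV (σ : ∀ r, 𝒟.BarStructure r) (y : (σ 1).mfd) (b : (σ 1).mfd.Model) :
    tmap 𝒟.sideV.src (legV (𝒟 := 𝒟) y) (tmap (X := (σ 1).mfd) (legV (𝒟 := 𝒟)) y b) =
      tmap 𝒟.sideH.tgt (legH (𝒟 := 𝒟) y) (tmap (X := (σ 1).mfd) (legH (𝒟 := 𝒟)) y b) := by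
  refine (tmap_comp_apply (X := (σ 1).mfd) (𝒟.sideV.submersion_src.contMDiff _)
    (smooth_legV (σ 1) y) b).symm.trans (Eq.trans ?_ (tmap_comp_apply (X := (σ 1).mfd)
      (𝒟.sideH.submersion_tgt.contMDiff _) (smooth_legH (σ 1) y) b))
  exact tmap_congr_apply (X := (σ 1).mfd) (Eventually.of_forall (src_legV (𝒟 := 𝒟))) b

theorem tmap_leg_ext (σ : ∀ r, 𝒟.BarStructure r) {y : (σ 1).mfd} {a b : (σ 1).mfd.Model}
    (hV : tmap (X := (σ 1).mfd) (legV (𝒟 := 𝒟)) y a = tmap (X := (σ 1).mfd) (legV (𝒟 := 𝒟)) y b)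
    (hH : tmap (X := (σ 1).mfd) (legH (𝒟 := 𝒟)) y a = tmap (X := (σ 1).mfd) (legH (𝒟 := 𝒟)) y b) :
    a = b :=
  sub_eq_zero.1 (eq_zero_of_tmap_leg (σ 1) (x := y) (by rw [map_sub, hV, sub_self])
    (by rw [map_sub, hH, sub_self]))

/-- An element of `V ×_M D ×_M H` may be varied in its first component alone, within a source
fiber of `V`. -/
theorem exists_vector_of_legV (σ : ∀ r, 𝒟.BarStructure r) (x : (σ 2).mfd) (b : V.Model)
    (hb : tmap 𝒟.sideV.src (Bar.face (𝒟 := 𝒟) 2 x).legV b = 0) :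
    ∃ a : (σ 2).mfd.Model,
      tmap (X := (σ 2).mfd) (fun w : 𝒟.Bar 2 => (w.face 2).legV) x a = b ∧
      tmap (X := (σ 2).mfd) (ν (𝒟 := 𝒟)) x a = 0 ∧
      tmap (X := (σ 2).mfd) (fun w : 𝒟.Bar 2 => (w.face 0).legH) x a = 0 := by
  obtain ⟨θ, hθ, hθz, hθe, hθb⟩ := 𝒟.sideV.submersion_src.exists_lift_curve
    (Bar.face (𝒟 := 𝒟) 2 x).legV (g := fun _ => 𝒟.sideV.src (Bar.face (𝒟 := 𝒟) 2 x).legV)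
    (smoothAt_const _ _) rfl b (by rw [hb, tmap_const]; rfl)
  obtain ⟨a, h1, h2, h3⟩ := exists_vector_triple σ x hθ
    (smoothAt_const (ν (𝒟 := 𝒟) x) 0) (smoothAt_const (Bar.face (𝒟 := 𝒟) 0 x).legH 0)
    (hθe.mono fun ζ h => h.trans (legV_face_one (𝒟 := 𝒟) x).1)
    (Eventually.of_forall fun _ => (face_zero_leg (𝒟 := 𝒟) x).2.1) hθz rfl rfl
  rw [tmap_const] at h2 h3
  exact ⟨a, h1.trans hθb, h2, h3⟩

/-- An element of `V ×_M D ×_M H` may be varied in its last component alone, within a target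
fiber of `H`. -/
theorem exists_vector_of_legH (σ : ∀ r, 𝒟.BarStructure r) (x : (σ 2).mfd) (b : H.Model)
    (hb : tmap 𝒟.sideH.tgt (Bar.face (𝒟 := 𝒟) 0 x).legH b = 0) :
    ∃ a : (σ 2).mfd.Model,
      tmap (X := (σ 2).mfd) (fun w : 𝒟.Bar 2 => (w.face 2).legV) x a = 0 ∧
      tmap (X := (σ 2).mfd) (ν (𝒟 := 𝒟)) x a = 0 ∧
      tmap (X := (σ 2).mfd) (fun w : 𝒟.Bar 2 => (w.face 0).legH) x a = b := by
  obtain ⟨η, hη, hηz, hηe, hηb⟩ := 𝒟.sideH.submersion_tgt.exists_lift_curve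
    (Bar.face (𝒟 := 𝒟) 0 x).legH (g := fun _ => 𝒟.sideH.tgt (Bar.face (𝒟 := 𝒟) 0 x).legH)
    (smoothAt_const _ _) rfl b (by rw [hb, tmap_const]; rfl)
  obtain ⟨a, h1, h2, h3⟩ := exists_vector_triple σ x
    (smoothAt_const (Bar.face (𝒟 := 𝒟) 2 x).legV 0) (smoothAt_const (ν (𝒟 := 𝒟) x) 0) hη
    (Eventually.of_forall fun _ => (legV_face_one (𝒟 := 𝒟) x).1)
    (hηe.mono fun ζ h => (face_zero_leg (𝒟 := 𝒟) x).2.1.trans h.symm) rfl rfl hηz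
  rw [tmap_const] at h1 h2
  exact ⟨a, h1, h2, h3.trans hηb⟩

/-- As `ν ∘ δ_1` is the projection to `H` followed by the unit map, `δ_1^* ker Ω` is the kernel of
this projection, if `ϖ` is nondegenerate. -/
theorem mem_degenKer_one_iff (σ : ∀ r, 𝒟.BarStructure r) (hϖ : ϖ.Nondegenerate) (y : (σ 1).mfd)
    (a : (σ 1).mfd.Model) : a ∈ degenKer (𝒳 := barData σ) (barForm σ ϖ) 1 y ↔
      tmap (X := (σ 1).mfd) (legH (𝒟 := 𝒟)) y a = 0 := by
  refine (mem_degenKer_one σ ϖ y a).trans ⟨fun h => ?_, fun h => ?_⟩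
  · have h1 : ϖ.kerAt _ = ⊥ := hϖ (𝒟.hor.one (legH (𝒟 := 𝒟) y))
    rw [h1, Submodule.mem_bot] at h
    exact eq_zero_of_tmap_hor_one h
  · rw [h, map_zero]
    exact zero_mem _

/-- As `ν ∘ δ_0` is the projection to `V` followed by the unit map, `δ_0^* ker Ω` is the kernel of
this projection, if `ϖ` is nondegenerate. -/
theorem mem_degenKer_zero_iff (σ : ∀ r, 𝒟.BarStructure r) (hϖ : ϖ.Nondegenerate) (y : (σ 1).mfd)
    (a : (σ 1).mfd.Model) : a ∈ degenKer (𝒳 := barData σ) (barForm σ ϖ) 0 y ↔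
      tmap (X := (σ 1).mfd) (legV (𝒟 := 𝒟)) y a = 0 := by
  refine (mem_degenKer_zero σ ϖ y a).trans ⟨fun h => ?_, fun h => ?_⟩
  · have h1 : ϖ.kerAt _ = ⊥ := hϖ (𝒟.ver.one (legV (𝒟 := 𝒟) y))
    rw [h1, Submodule.mem_bot] at h
    exact eq_zero_of_tmap_ver_one h
  · rw [h, map_zero]
    exact zero_mem _

theorem mem_ker_barForm_iff (σ : ∀ r, 𝒟.BarStructure r) (hϖ : ϖ.Nondegenerate) (w : (σ 2).mfd)
    (a : (σ 2).mfd.Model) : a ∈ TwoForm.kerAt (X := (σ 2).mfd) (barForm σ ϖ) w ↔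
      tmap (X := (σ 2).mfd) (ν (𝒟 := 𝒟)) w a = 0 := by
  have h1 : ϖ.kerAt _ = ⊥ := hϖ (ν (𝒟 := 𝒟) w)
  rw [mem_ker_barForm, h1, Submodule.mem_bot]

/-- Both sides consist of the vectors along which only the component in `V` varies, within a source
fiber. -/
theorem bijOn_tmap_face_two (σ : ∀ r, 𝒟.BarStructure r) (hϖ : ϖ.Nondegenerate) (x : (σ 2).mfd) :
    BijOn (tmap (X := (σ 2).mfd) (Y := (σ 1).mfd) (Bar.face (𝒟 := 𝒟) 2) x)
      {v | tmap (X := (σ 2).mfd) (Y := (σ 1).mfd) (Bar.face (𝒟 := 𝒟) 0) x v = 0 ∧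
        v ∈ TwoForm.kerAt (X := (σ 2).mfd) (barForm σ ϖ) x}
      {b | b ∈ degenKer (𝒳 := barData σ) (barForm σ ϖ) 1 (Bar.face (𝒟 := 𝒟) 2 x)} := by
  simp only [mem_ker_barForm_iff σ hϖ]
  refine ⟨fun v hv => ?_, fun v hv v' hv' e => ?_, fun b hb => ?_⟩
  · refine (mem_degenKer_one_iff σ hϖ _ _).2 ((tmap_legH_face_two σ x v).trans ?_)
    rw [hv.2, map_zero]
  · refine sub_eq_zero.1 (eq_zero_of_tmap_triple σ (x := x) ?_ ?_ ?_)
    · rw [map_sub, ← tmap_legV_face, ← tmap_legV_face, e, sub_self]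
    · rw [map_sub, hv.2, hv'.2, sub_self]
    · rw [map_sub, ← tmap_legH_face, ← tmap_legH_face, hv.1, hv'.1, sub_self]
  · have hb' := (mem_degenKer_one_iff σ hϖ _ _).1 hb
    obtain ⟨a, h1, h2, h3⟩ := exists_vector_of_legV σ x _
      ((tmap_src_legV σ (Bar.face (𝒟 := 𝒟) 2 x) b).trans (by rw [hb', map_zero]))
    refine ⟨a, ⟨eq_zero_of_tmap_leg (σ 1) ((tmap_legV_face_zero σ x a).trans ?_)
      ((tmap_legH_face σ 0 x a).trans h3), h2⟩, tmap_leg_ext σ ((tmap_legV_face σ 2 x a).trans h1)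
      ((tmap_legH_face_two σ x a).trans ?_)⟩
    · rw [h2, map_zero]
    · rw [h2, map_zero, hb']

/-- Both sides consist of the vectors along which only the component in `H` varies, within a target
fiber. -/
theorem bijOn_tmap_face_zero (σ : ∀ r, 𝒟.BarStructure r) (hϖ : ϖ.Nondegenerate) (x : (σ 2).mfd) :
    BijOn (tmap (X := (σ 2).mfd) (Y := (σ 1).mfd) (Bar.face (𝒟 := 𝒟) 0) x)
      {v | tmap (X := (σ 2).mfd) (Y := (σ 1).mfd) (Bar.face (𝒟 := 𝒟) 2) x v = 0 ∧
        v ∈ TwoForm.kerAt (X := (σ 2).mfd) (barForm σ ϖ) x}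
      {b | b ∈ degenKer (𝒳 := barData σ) (barForm σ ϖ) 0 (Bar.face (𝒟 := 𝒟) 0 x)} := by
  simp only [mem_ker_barForm_iff σ hϖ]
  refine ⟨fun v hv => ?_, fun v hv v' hv' e => ?_, fun b hb => ?_⟩
  · refine (mem_degenKer_zero_iff σ hϖ _ _).2 ((tmap_legV_face_zero σ x v).trans ?_)
    rw [hv.2, map_zero]
  · refine sub_eq_zero.1 (eq_zero_of_tmap_triple σ (x := x) ?_ ?_ ?_)
    · rw [map_sub, ← tmap_legV_face, ← tmap_legV_face, hv.1, hv'.1, sub_self]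
    · rw [map_sub, hv.2, hv'.2, sub_self]
    · rw [map_sub, ← tmap_legH_face, ← tmap_legH_face, e, sub_self]
  · have hb' := (mem_degenKer_zero_iff σ hϖ _ _).1 hb
    obtain ⟨a, h1, h2, h3⟩ := exists_vector_of_legH σ x _
      ((tmap_src_legV σ (Bar.face (𝒟 := 𝒟) 0 x) b).symm.trans (by rw [hb', map_zero]))
    refine ⟨a, ⟨eq_zero_of_tmap_leg (σ 1) ((tmap_legV_face σ 2 x a).trans h1)
      ((tmap_legH_face_two σ x a).trans ?_), h2⟩, tmap_leg_ext σ
      ((tmap_legV_face_zero σ x a).trans ?_) ((tmap_legH_face σ 0 x a).trans h3)⟩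
    · rw [h2, map_zero]
    · rw [h2, map_zero, hb']

/-- The point of `M` represented by an element of `W̄_0 ND`. -/
def pt (x : 𝒟.Bar 0) : M := 𝒟.sideV.tgt (𝒟.ver.tgt (x.fan 0 0))

theorem pt_face_one (y : 𝒟.Bar 1) : (y.face 1).pt = 𝒟.sideV.tgt y.legV := by
  rw [pt, face_one_fan]
  simp

theorem leg_degen_zero (m : 𝒟.Bar 0) :
    (m.degen 0).legV = 𝒟.sideV.one m.pt ∧ (m.degen 0).legH = 𝒟.sideH.one m.pt := by
  have h1 : (m.degen 0).fan 0 1 = m.fan 0 0 := sq_degen _ _ (by decide) le_rfl (by decide)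
  have h2 : (m.degen 0).fan 1 1 = m.fan 0 0 := sq_degen _ _ (by decide) le_rfl (by decide)
  have h3 : m.fan 0 0 = 𝒟.hor.one (𝒟.sideH.one (𝒟.sideV.tgt (m.degen 0).legV)) := by
    rw [← face_one_fan]
    exact congrArg (fun x : 𝒟.Bar 0 => x.fan 0 0) (face_succ_degen (𝒟 := 𝒟) 0 m).symm
  rw [pt, legV, legH, h1, h2, h3]
  simp

theorem smooth_pt (σ : 𝒟.BarStructure 0) : Smooth (X := σ.mfd) (pt (𝒟 := 𝒟)) := fun x =>
  𝒟.sideV.smoothAt_tgt (Z := σ.mfd) (𝒟.ver.smoothAt_tgt (Z := σ.mfd)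
    ((smoothGerm_id σ x).fan le_rfl))

theorem tmap_legV_degen_zero (σ : ∀ r, 𝒟.BarStructure r) (m : (σ 0).mfd) (a : (σ 0).mfd.Model) :
    tmap (X := (σ 1).mfd) (legV (𝒟 := 𝒟)) (Bar.degen (𝒟 := 𝒟) 0 m)
        (tmap (X := (σ 0).mfd) (Y := (σ 1).mfd) (Bar.degen (𝒟 := 𝒟) 0) m a) =
      tmap 𝒟.sideV.one (pt (𝒟 := 𝒟) m) (tmap (X := (σ 0).mfd) (pt (𝒟 := 𝒟)) m a) := by
  refine (tmap_comp_apply (X := (σ 0).mfd) (Y := (σ 1).mfd) (smooth_legV (σ 1) _)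
    (smooth_degen (σ 1) (σ 0) 0 m) a).symm.trans (Eq.trans ?_ (tmap_comp_apply (X := (σ 0).mfd)
      (𝒟.sideV.smooth_one _) (smooth_pt (σ 0) m) a))
  exact tmap_congr_apply (X := (σ 0).mfd) (Eventually.of_forall fun m =>
    (leg_degen_zero (𝒟 := 𝒟) m).1) a

theorem tmap_legH_degen_zero (σ : ∀ r, 𝒟.BarStructure r) (m : (σ 0).mfd) (a : (σ 0).mfd.Model) :
    tmap (X := (σ 1).mfd) (legH (𝒟 := 𝒟)) (Bar.degen (𝒟 := 𝒟) 0 m)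
        (tmap (X := (σ 0).mfd) (Y := (σ 1).mfd) (Bar.degen (𝒟 := 𝒟) 0) m a) =
      tmap 𝒟.sideH.one (pt (𝒟 := 𝒟) m) (tmap (X := (σ 0).mfd) (pt (𝒟 := 𝒟)) m a) := by
  refine (tmap_comp_apply (X := (σ 0).mfd) (Y := (σ 1).mfd) (smooth_legH (σ 1) _)
    (smooth_degen (σ 1) (σ 0) 0 m) a).symm.trans (Eq.trans ?_ (tmap_comp_apply (X := (σ 0).mfd)
      (𝒟.sideH.smooth_one _) (smooth_pt (σ 0) m) a))
  exact tmap_congr_apply (X := (σ 0).mfd) (Eventually.of_forall fun m =>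
    (leg_degen_zero (𝒟 := 𝒟) m).2) a

theorem tmap_pt_surjective (σ : ∀ r, 𝒟.BarStructure r) (m : (σ 0).mfd) :
    Function.Surjective (tmap (X := (σ 0).mfd) (pt (𝒟 := 𝒟)) m) := by
  intro b
  obtain ⟨γ, hγ, hγz, rfl⟩ := exists_curve (pt (𝒟 := 𝒟) m) b
  let y : (σ 1).mfd := Bar.degen (𝒟 := 𝒟) 0 m
  have hy : Bar.face (𝒟 := 𝒟) 1 y = m := face_succ_degen (𝒟 := 𝒟) 0 m
  obtain ⟨a, h1, -⟩ := exists_vector_edge (σ 1) y (𝒟.sideV.smoothAt_one hγ)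
    (𝒟.sideH.smoothAt_one hγ)
    (Eventually.of_forall fun ζ => (𝒟.sideV.src_one _).trans (𝒟.sideH.tgt_one _).symm)
    (by rw [hγz]; exact (leg_degen_zero (𝒟 := 𝒟) m).1.symm)
    (by rw [hγz]; exact (leg_degen_zero (𝒟 := 𝒟) m).2.symm)
  let c : (σ 0).mfd.Model := tmap (X := (σ 1).mfd) (Y := (σ 0).mfd) (Bar.face (𝒟 := 𝒟) 1) y a
  have e1 : tmap (X := (σ 1).mfd) (fun y : 𝒟.Bar 1 => (y.face 1).pt) y a =
      tmap (X := (σ 0).mfd) (pt (𝒟 := 𝒟)) (Bar.face (𝒟 := 𝒟) 1 y) c :=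
    tmap_comp_apply (X := (σ 1).mfd) (Y := (σ 0).mfd) (smooth_pt (σ 0) _)
      (smooth_face (σ 1) (σ 0) 1 y) a
  have e2 : tmap (X := (σ 1).mfd) (fun y : 𝒟.Bar 1 => (y.face 1).pt) y a =
      tmap 𝒟.sideV.tgt (legV (𝒟 := 𝒟) y) (tmap (X := (σ 1).mfd) (legV (𝒟 := 𝒟)) y a) := by
    rw [funext pt_face_one]
    exact tmap_comp_apply (X := (σ 1).mfd) (𝒟.sideV.submersion_tgt.contMDiff _)
      (smooth_legV (σ 1) y) a
  have e3 : tmap (fun ζ => 𝒟.sideV.tgt (𝒟.sideV.one (γ ζ))) 0 vel =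
      tmap 𝒟.sideV.tgt (𝒟.sideV.one (γ 0)) (tmap (fun ζ => 𝒟.sideV.one (γ ζ)) 0 vel) :=
    tmap_comp_apply (𝒟.sideV.submersion_tgt.contMDiff _) (𝒟.sideV.smoothAt_one hγ) vel
  rw [funext fun ζ => 𝒟.sideV.tgt_one (γ ζ), hγz] at e3
  refine ⟨c, (congrArg (fun m => tmap (X := (σ 0).mfd) (pt (𝒟 := 𝒟)) m c) hy).symm.trans
    (e1.symm.trans (e2.trans ?_))⟩
  rw [h1, e3]
  exact congrArg (fun v => tmap 𝒟.sideV.tgt v _) (leg_degen_zero (𝒟 := 𝒟) m).1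

/-- In the tangent space of `V ×_M H` at a unit, `W_0^1` and `W_1^1` are the kernels of the two
projections, and `W_0^0` is a complement of their sum, which is the kernel of the projection
to `M`. -/
theorem isInternal_W (σ : ∀ r, 𝒟.BarStructure r) (hϖ : ϖ.Nondegenerate) (m : (σ 0).mfd) :
    DirectSum.IsInternal (W (𝒳 := barData σ) (barForm σ ϖ) m) := by
  let y : (σ 1).mfd := Bar.degen (𝒟 := 𝒟) 0 m
  have hyV : legV (𝒟 := 𝒟) y = 𝒟.sideV.one (pt (𝒟 := 𝒟) m) := (leg_degen_zero (𝒟 := 𝒟) m).1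
  have hyH : legH (𝒟 := 𝒟) y = 𝒟.sideH.one (pt (𝒟 := 𝒟) m) := (leg_degen_zero (𝒟 := 𝒟) m).2
  -- the differentials of the two legs, and of the point where they meet
  let LV : (σ 1).mfd.Model →L[ℝ] V.Model := tmap (X := (σ 1).mfd) (legV (𝒟 := 𝒟)) y
  let LH : (σ 1).mfd.Model →L[ℝ] H.Model := tmap (X := (σ 1).mfd) (legH (𝒟 := 𝒟)) y
  let Q : V.Model →L[ℝ] M.Model := tmap 𝒟.sideV.src (legV (𝒟 := 𝒟) y)
  let δ : (σ 0).mfd.Model →L[ℝ] (σ 1).mfd.Model :=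
    tmap (X := (σ 0).mfd) (Y := (σ 1).mfd) (Bar.degen (𝒟 := 𝒟) 0) m
  let P : (σ 0).mfd.Model →L[ℝ] M.Model := tmap (X := (σ 0).mfd) (pt (𝒟 := 𝒟)) m
  have hQ : ∀ a, Q (LV a) = tmap 𝒟.sideH.tgt (legH (𝒟 := 𝒟) y) (LH a) := tmap_src_legV σ y
  have hV : ∀ a, LV (δ a) = tmap 𝒟.sideV.one (pt (𝒟 := 𝒟) m) (P a) := tmap_legV_degen_zero σ m
  have hH : ∀ a, LH (δ a) = tmap 𝒟.sideH.one (pt (𝒟 := 𝒟) m) (P a) := tmap_legH_degen_zero σ m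
  have hQo : ∀ a, Q (tmap 𝒟.sideV.one (pt (𝒟 := 𝒟) m) a) = a := fun a => by
    have h1 := tmap_comp_apply (𝒟.sideV.submersion_src.contMDiff _)
      (𝒟.sideV.smooth_one (pt (𝒟 := 𝒟) m)) a
    rw [funext 𝒟.sideV.src_one, tmap_id] at h1
    rw [← hyV] at h1
    exact h1.symm
  have hext : ∀ a b, LV a = LV b → LH a = LH b → a = b := fun a b => tmap_leg_ext σ (y := y)
  have m0 : ∀ a, a ∈ W (𝒳 := barData σ) (barForm σ ϖ) m 0 ↔ ∃ c, δ c = a := fun a => Iff.rfl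
  have m1 : ∀ a, a ∈ W (𝒳 := barData σ) (barForm σ ϖ) m 1 ↔ LV a = 0 :=
    fun a => mem_degenKer_zero_iff σ hϖ y a
  have m2 : ∀ a, a ∈ W (𝒳 := barData σ) (barForm σ ϖ) m 2 ↔ LH a = 0 :=
    fun a => mem_degenKer_one_iff σ hϖ y a
  suffices h : DirectSum.IsInternal (show Fin 3 → Submodule ℝ (σ 1).mfd.Model from
    W (𝒳 := barData σ) (barForm σ ϖ) m) from h
  refine isInternal_fin_three _ ?_ ?_
  · intro a ha b hb c hc h
    obtain ⟨c', rfl⟩ := (m0 a).1 ha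
    replace hb : LV b = 0 := (m1 b).1 hb
    replace hc : LH c = 0 := (m2 c).1 hc
    have h' : δ c' + b + c = 0 := h
    have hc' : P c' = 0 := by
      have h1 := congrArg (fun a => Q (LV a)) h'
      simp only [map_add, map_zero] at h1
      rw [hb, hQ c, hc, map_zero, map_zero, hV, hQo] at h1
      simpa using h1
    have ha0 : δ c' = 0 := by
      refine hext _ _ ?_ ?_
      · rw [hV, hc', map_zero, map_zero]
      · rw [hH, hc', map_zero, map_zero]
    rw [ha0, zero_add] at h'
    have hc0 : c = 0 := by
      refine hext _ _ ?_ (by rw [hc, map_zero])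
      have h1 := congrArg LV h'
      rw [map_add, hb, zero_add] at h1
      exact h1
    rw [hc0, add_zero] at h'
    exact ⟨ha0, h', hc0⟩
  · intro u
    -- the components in `W_0^0` and in `W_1^1`
    obtain ⟨c, hc⟩ := tmap_pt_surjective σ m (Q (LV u))
    have hd : Q (LV (u - δ c)) = 0 := by rw [map_sub, map_sub, hV, hQo, hc, sub_self]
    obtain ⟨θ, hθ, hθz, hθe, hθb⟩ := 𝒟.sideV.submersion_src.exists_lift_curve
      (legV (𝒟 := 𝒟) y) (g := fun _ => 𝒟.sideV.src (legV (𝒟 := 𝒟) y)) (smoothAt_const _ _) rfl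
      (LV (u - δ c)) (hd.trans (by rw [tmap_const]; rfl))
    obtain ⟨b, h1, h2⟩ := exists_vector_edge (σ 1) y hθ (smoothAt_const (legH (𝒟 := 𝒟) y) 0)
      (hθe.mono fun ζ h => h.trans (src_legV (𝒟 := 𝒟) y)) hθz rfl
    rw [tmap_const] at h2
    refine ⟨δ c, (m0 _).2 ⟨c, rfl⟩, u - δ c - b, (m1 _).2 ?_, b, (m2 _).2 h2, by abel⟩
    rw [map_sub, ← hθb, sub_eq_zero]
    exact h1.symm

theorem isLocalSymplectic_of_nondegenerate (σ : ∀ r, 𝒟.BarStructure r)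
    (hϖ : 𝒟.IsPresymplectic ϖ) (hn : ϖ.Nondegenerate) :
    IsLocalSymplectic (𝒳 := barData σ) (barForm σ ϖ) where
  toIsLocalPresymplectic := isLocalPresymplectic σ hϖ
  iso_two_zero := bijOn_tmap_face_two σ hn
  iso_zero_two := bijOn_tmap_face_zero σ hn
  directSum := isInternal_W σ hn

end Bar

end DoubleLieGroupoid

/-! ### Kernels of multiplicative forms -/

namespace LieGroupoid

variable {G M : SmoothMfd.{u}} {𝒢 : LieGroupoid G M} {ϖ : TwoForm G}

/-- The multiplicativity of a 2-form, evaluated on two curves of composable pairs. -/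
theorem Multiplicative.apply_curves (hϖ : 𝒢.Multiplicative ϖ) {g h g' h' : euc 1 → G}
    (hg : SmoothAt g 0) (hh : SmoothAt h 0) (hg' : SmoothAt g' 0) (hh' : SmoothAt h' 0)
    (hc : ∀ᶠ ζ in 𝓝 0, 𝒢.src (g ζ) = 𝒢.tgt (h ζ))
    (hc' : ∀ᶠ ζ in 𝓝 0, 𝒢.src (g' ζ) = 𝒢.tgt (h' ζ)) (eg : g' 0 = g 0) (eh : h' 0 = h 0) :
    ϖ (𝒢.mul (g 0) (h 0)) ![tmap (fun ζ => 𝒢.mul (g ζ) (h ζ)) 0 vel,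
        tmap (fun ζ => 𝒢.mul (g' ζ) (h' ζ)) 0 vel] =
      ϖ (g 0) ![tmap g 0 vel, tmap g' 0 vel] + ϖ (h 0) ![tmap h 0 vel, tmap h' 0 vel] := by
  obtain ⟨σ⟩ := nonempty_fiberProductStructure 𝒢.submersion_src 𝒢.submersion_tgt.contMDiff
  let P : Type _ := FiberProduct 𝒢.src 𝒢.tgt
  obtain ⟨p, hp, hpe⟩ := σ.exists_germ hg hh hc
  obtain ⟨p', hp', hpe'⟩ := σ.exists_germ hg' hh' hc'
  let q : euc 1 → P := p
  let q' : euc 1 → P := p'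
  have hq : ∀ᶠ ζ in 𝓝 0, (q ζ).1 = (g ζ, h ζ) := hpe
  have hq' : ∀ᶠ ζ in 𝓝 0, (q' ζ).1 = (g' ζ, h' ζ) := hpe'
  have ez : p' 0 = p 0 := Subtype.ext (hq'.self_of_nhds.trans (by
    rw [eg, eh]; exact hq.self_of_nhds.symm))
  -- the differentials of maps on the manifold of composable pairs, on the velocities of the two curves
  have key : ∀ (k : P → G) (c : euc 1 → G), Smooth (X := σ.mfd) k →
      (∀ᶠ ζ in 𝓝 0, k (q ζ) = c ζ) → tmap (X := σ.mfd) k (p 0) (tmap p 0 vel) = tmap c 0 vel :=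
    fun k c hk hc => (tmap_comp_apply (Y := σ.mfd) (g := k) (f := p) (hk _) hp vel).symm.trans
      (tmap_congr_apply (X := euc 1) hc vel)
  have key' : ∀ (k : P → G) (c : euc 1 → G), Smooth (X := σ.mfd) k →
      (∀ᶠ ζ in 𝓝 0, k (q' ζ) = c ζ) →
      tmap (X := σ.mfd) k (p 0) (tmap p' 0 vel) = tmap c 0 vel := by
    intro k c hk hc
    rw [← ez]
    exact (tmap_comp_apply (Y := σ.mfd) (g := k) (f := p') (hk _) hp' vel).symm.trans
      (tmap_congr_apply (X := euc 1) hc vel)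
  have s1 : Smooth (X := σ.mfd) (fun x : P => x.1.1) := σ.embeds.smooth false
  have s2 : Smooth (X := σ.mfd) (fun x : P => x.1.2) := σ.embeds.smooth true
  have s3 : Smooth (X := σ.mfd) (fun x : P => 𝒢.mul x.1.1 x.1.2) := 𝒢.smooth_mul σ
  have m := hϖ.apply (Z := σ.mfd) (s1 (p 0)) (s2 (p 0)) (Eventually.of_forall fun x : P => x.2)
    (tmap p 0 vel) (tmap p' 0 vel)
  have key₂ : ∀ (k : P → G) (c c' : euc 1 → G), Smooth (X := σ.mfd) k →
      (∀ᶠ ζ in 𝓝 0, k (q ζ) = c ζ) → (∀ᶠ ζ in 𝓝 0, k (q' ζ) = c' ζ) →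
      ϖ (k (q 0)) ![tmap (X := σ.mfd) k (p 0) (tmap p 0 vel),
        tmap (X := σ.mfd) k (p 0) (tmap p' 0 vel)] = ϖ (c 0) ![tmap c 0 vel, tmap c' 0 vel] := by
    intro k c c' hk hc hc'
    rw [key k c hk hc, key' k c' hk hc', hc.self_of_nhds]
  exact (key₂ _ _ _ s3 (hq.mono fun ζ e => by rw [e]) (hq'.mono fun ζ e => by rw [e])).symm.trans
    (m.trans (congrArg₂ (· + ·)
      (key₂ _ _ _ s1 (hq.mono fun ζ e => congrArg Prod.fst e)
        (hq'.mono fun ζ e => congrArg Prod.fst e))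
      (key₂ _ _ _ s2 (hq.mono fun ζ e => congrArg Prod.snd e)
        (hq'.mono fun ζ e => congrArg Prod.snd e))))

/-- The kernel of a multiplicative form is stable under `a ↦ 1_* s_* a`. -/
theorem Multiplicative.tmap_one_src_mem (hϖ : 𝒢.Multiplicative ϖ) {g : G} {a : G.Model}
    (ha : a ∈ ϖ.kerAt g) :
    tmap (fun x => 𝒢.one (𝒢.src x)) g a ∈ ϖ.kerAt (𝒢.one (𝒢.src g)) := by
  obtain ⟨α, hα, rfl, rfl⟩ := exists_curve g a
  refine TwoForm.mem_kerAt.2 fun b => ?_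
  obtain ⟨k, hk, hkz, rfl⟩ := exists_curve (𝒢.one (𝒢.src (α 0))) b
  obtain ⟨β, hβ, hβz, hβe⟩ := 𝒢.submersion_src.exists_lift (α 0) (𝒢.smoothAt_tgt hk)
    (by rw [hkz, 𝒢.tgt_one])
  have m := hϖ.apply_curves hα (𝒢.smoothAt_one (𝒢.smoothAt_src hα)) hβ hk
    (Eventually.of_forall fun ζ => (𝒢.tgt_one _).symm) hβe hβz hkz
  have e1 : (fun ζ => 𝒢.mul (α ζ) (𝒢.one (𝒢.src (α ζ)))) = α := funext fun ζ => 𝒢.mul_one _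
  rw [e1, 𝒢.mul_one, TwoForm.mem_kerAt.1 ha, TwoForm.mem_kerAt.1 ha, zero_add] at m
  rw [← tmap_comp_apply (g := fun x => 𝒢.one (𝒢.src x))
    (𝒢.smoothAt_one (𝒢.smoothAt_src (smoothAt_id _))) hα]
  exact m.symm

/-- The kernel of a multiplicative form is stable under `a ↦ 1_* t_* a`. -/
theorem Multiplicative.tmap_one_tgt_mem (hϖ : 𝒢.Multiplicative ϖ) {g : G} {a : G.Model}
    (ha : a ∈ ϖ.kerAt g) :
    tmap (fun x => 𝒢.one (𝒢.tgt x)) g a ∈ ϖ.kerAt (𝒢.one (𝒢.tgt g)) := by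
  obtain ⟨α, hα, rfl, rfl⟩ := exists_curve g a
  refine TwoForm.mem_kerAt.2 fun b => ?_
  obtain ⟨k, hk, hkz, rfl⟩ := exists_curve (𝒢.one (𝒢.tgt (α 0))) b
  obtain ⟨β, hβ, hβz, hβe⟩ := 𝒢.submersion_tgt.exists_lift (α 0) (𝒢.smoothAt_src hk)
    (by rw [hkz, 𝒢.src_one])
  have m := hϖ.apply_curves (𝒢.smoothAt_one (𝒢.smoothAt_tgt hα)) hα hk hβ
    (Eventually.of_forall fun ζ => 𝒢.src_one _) (hβe.mono fun ζ h => h.symm) hkz hβz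
  have e1 : (fun ζ => 𝒢.mul (𝒢.one (𝒢.tgt (α ζ))) (α ζ)) = α := funext fun ζ => 𝒢.one_mul _
  rw [e1, 𝒢.one_mul, TwoForm.mem_kerAt.1 ha, TwoForm.mem_kerAt.1 ha, add_zero] at m
  rw [← tmap_comp_apply (g := fun x => 𝒢.one (𝒢.tgt x))
    (𝒢.smoothAt_one (𝒢.smoothAt_tgt (smoothAt_id _))) hα]
  exact m.symm

/-- Products of vectors in the kernel of a multiplicative form are in the kernel. -/
theorem Multiplicative.tmap_mul_mem (hϖ : 𝒢.Multiplicative ϖ) {g h : euc 1 → G}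
    (hg : SmoothAt g 0) (hh : SmoothAt h 0) (hc : ∀ᶠ ζ in 𝓝 0, 𝒢.src (g ζ) = 𝒢.tgt (h ζ))
    (h1 : tmap g 0 vel ∈ ϖ.kerAt (g 0)) (h2 : tmap h 0 vel ∈ ϖ.kerAt (h 0)) :
    tmap (fun ζ => 𝒢.mul (g ζ) (h ζ)) 0 vel ∈ ϖ.kerAt (𝒢.mul (g 0) (h 0)) := by
  have e := hc.self_of_nhds
  refine TwoForm.mem_kerAt.2 fun b => ?_
  obtain ⟨k, hk, hkz, rfl⟩ := exists_curve (𝒢.mul (g 0) (h 0)) b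
  -- every curve through `g 0 * h 0` is a product of curves through `g 0` and `h 0`
  obtain ⟨g', hg', hgz', hge'⟩ := 𝒢.submersion_tgt.exists_lift (g 0) (𝒢.smoothAt_tgt hk)
    (by rw [hkz, 𝒢.tgt_mul _ _ e])
  have m := hϖ.apply_curves hg hh hg' (𝒢.smoothAt_mul (𝒢.smoothAt_inv hg') hk
    (hge'.mono fun ζ h => (𝒢.src_inv _).trans h)) hc (hge'.mono fun ζ h => by
      rw [𝒢.tgt_mul _ _ ((𝒢.src_inv _).trans h), 𝒢.tgt_inv]) hgz'
    (by rw [hgz', hkz, 𝒢.inv_mul_cancel_left e])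
  rw [TwoForm.mem_kerAt.1 h1, TwoForm.mem_kerAt.1 h2, add_zero,
    tmap_congr_apply (X := euc 1) (hge'.mono fun ζ h => 𝒢.mul_inv_cancel_left h)] at m
  exact m

/-- Let `φ : K → G` be a morphism of Lie groupoids. If a multiplicative form `ϖ` on `G` has no
kernel vectors tangent to `φ` at units of `K`, it has none at all: such a vector at `k` is tangent
to the source fiber of `k`, and right translation by `k⁻¹` brings it to a unit. -/
theorem Multiplicative.eq_zero_of_tmap_mem {K B : SmoothMfd.{u}} {𝒦 : LieGroupoid K B}
    (hϖ : 𝒢.Multiplicative ϖ) {φ : K → G} (hφ : Smooth φ)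
    (hs : ∀ k, 𝒢.one (𝒢.src (φ k)) = φ (𝒦.one (𝒦.src k)))
    (hc : ∀ k l, 𝒦.src k = 𝒦.tgt l → 𝒢.src (φ k) = 𝒢.tgt (φ l))
    (hm : ∀ k l, 𝒦.src k = 𝒦.tgt l → φ (𝒦.mul k l) = 𝒢.mul (φ k) (φ l))
    (h1 : ∀ m a, tmap φ (𝒦.one m) a ∈ ϖ.kerAt (φ (𝒦.one m)) → a = 0) {k : K} {a : K.Model}
    (ha : tmap φ k a ∈ ϖ.kerAt (φ k)) : a = 0 := by
  have hu : Smooth fun x => 𝒦.one (𝒦.src x) := fun x =>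
    𝒦.smoothAt_one (𝒦.smoothAt_src (smoothAt_id x))
  -- `a` has no source component, since `1_* s_* a` is a kernel vector at a unit
  have hsrc : tmap 𝒦.src k a = 0 := by
    have h2 := hϖ.tmap_one_src_mem ha
    rw [hs, ← tmap_comp_apply (g := fun x => 𝒢.one (𝒢.src x))
      (𝒢.smoothAt_one (𝒢.smoothAt_src (smoothAt_id _))) (hφ k), funext hs,
      tmap_comp_apply (hφ _) (hu k)] at h2
    have h3 := h1 _ _ h2
    exact eq_zero_of_tmap_of_leftInverse 𝒦.smooth_one 𝒦.submersion_src.contMDiff 𝒦.src_one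
      ((tmap_comp_apply (𝒦.smooth_one _) (𝒦.submersion_src.contMDiff k) a).symm.trans h3)
  obtain ⟨η, hη, hηz, hηe, rfl⟩ := 𝒦.submersion_src.exists_lift_curve k
    (g := fun _ => 𝒦.src k) (smoothAt_const _ _) rfl a (by rw [hsrc, tmap_const]; rfl)
  have hk := smoothAt_const (X := euc 1) k 0
  have hki := smoothAt_const (X := euc 1) (𝒦.inv k) 0
  have hce : ∀ᶠ ζ in 𝓝 0, 𝒦.src (η ζ) = 𝒦.tgt (𝒦.inv k) :=
    hηe.mono fun ζ h => h.trans (𝒦.tgt_inv k).symm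
  have hρ := 𝒦.smoothAt_mul hη hki hce
  have hz : 𝒦.mul (η 0) (𝒦.inv k) = 𝒦.one (𝒦.tgt k) := by rw [hηz, 𝒦.mul_inv]
  -- the translate of `a` by `k⁻¹` is a kernel vector at a unit
  have h3 : tmap (fun ζ => 𝒦.mul (η ζ) (𝒦.inv k)) 0 vel = 0 := by
    refine h1 (𝒦.tgt k) _ ?_
    have hφη : SmoothAt (fun ζ => φ (η ζ)) 0 := SmoothAt.comp_of_eq (hφ _) hη rfl
    have h4 := hϖ.tmap_mul_mem hφη (smoothAt_const (φ (𝒦.inv k)) 0)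
      (hce.mono fun ζ h => hc _ _ h) (by
        rw [tmap_comp_apply (hφ _) hη, hηz]
        exact ha) (by
        rw [tmap_const]
        exact zero_mem _)
    rw [← hm _ _ hce.self_of_nhds, hz, ← tmap_congr_apply (X := euc 1)
      (hce.mono fun ζ h => hm _ _ h), tmap_comp_apply (hφ _) hρ, hz] at h4
    exact h4
  -- translation by `k` recovers `a`
  refine (tmap_congr_apply (X := euc 1) (hηe.mono fun ζ h => ?_) vel).trans
    (𝒦.tmap_mul_eq_zero hρ hk (hce.mono fun ζ h => ?_) h3 (by rw [tmap_const]; rfl))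
  · exact (𝒦.inv_mul_cancel_right h).symm
  · rw [𝒦.src_mul _ _ h, 𝒦.src_inv]

end LieGroupoid

namespace DoubleLieGroupoid

open SimplicialData

variable {D V H M : SmoothMfd.{u}} {𝒟 : DoubleLieGroupoid D V H M} {ϖ : TwoForm D}

namespace Bar

/-- A square `α` is the component of `(1, α, 1)` in `D`. -/
theorem ν_surjective (𝒟 : DoubleLieGroupoid D V H M) : Function.Surjective (ν (𝒟 := 𝒟)) := by
  intro α
  let m := 𝒟.hor.one (𝒟.sideH.one (𝒟.sideV.tgt (𝒟.ver.tgt α)))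
  let F : Fin 3 → Fin 3 → D := ![![m, m, 𝒟.ver.one (𝒟.ver.tgt α)],
    ![m, 𝒟.hor.one (𝒟.hor.tgt α), α], ![m, m, 𝒟.hor.one (𝒟.hor.src α)]]
  have hF : 𝒟.IsFan (r := 2) F :=
    { hor_tgt := fun {i j} h => by
        fin_cases i <;> fin_cases j <;> simp [F, m] at h ⊢
      ver_tgt := fun {i j} h => by
        have h1 : 𝒟.sideV.mul (𝒟.sideV.one (𝒟.sideV.tgt (𝒟.ver.tgt α))) (𝒟.ver.tgt α) =
          𝒟.ver.tgt α := by simp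
        fin_cases i <;> fin_cases j <;> simp [F, m, 𝒟.tgt_tgt, 𝒟.tgt_src] at h ⊢
      diag := fun i => by
        fin_cases i <;> simp [F, m]
      zero := fun j => by
        fin_cases j <;> simp [F, m, hor_one_one] }
  exact ⟨ofFan F hF, (ν_eq_fan _).trans (fan_ofFan hF (by decide))⟩

/-- `W_0^0`, `W_0^1` and `W_1^1` meet in `0` in pairs. -/
theorem eq_zero_of_mem_W {σ : ∀ r, 𝒟.BarStructure r}
    (h : IsLocalSymplectic (𝒳 := barData σ) (barForm σ ϖ)) (m : (σ 0).mfd) {i j : Fin 3}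
    (hij : i ≠ j) {a : (σ 1).mfd.Model} (hi : a ∈ W (𝒳 := barData σ) (barForm σ ϖ) m i)
    (hj : a ∈ W (𝒳 := barData σ) (barForm σ ϖ) m j) : a = 0 :=
  (Submodule.disjoint_def.1 ((h.directSum m).submodule_iSupIndep.pairwiseDisjoint hij)) a hi hj

theorem pt_surjective (𝒟 : DoubleLieGroupoid D V H M) : Function.Surjective (pt (𝒟 := 𝒟)) := by
  intro m
  obtain ⟨w, hw⟩ := ν_surjective 𝒟 (𝒟.hor.one (𝒟.sideH.one m))
  refine ⟨(w.face 0).face 1, ?_⟩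
  rw [pt_face_one, (face_zero_leg w).1, hw]
  simp

theorem mem_W_one (σ : ∀ r, 𝒟.BarStructure r) (m : (σ 0).mfd) {a : (σ 1).mfd.Model} {b : V.Model}
    (hb : tmap 𝒟.ver.one (𝒟.sideV.one (pt (𝒟 := 𝒟) m)) b ∈
      ϖ.kerAt (𝒟.ver.one (𝒟.sideV.one (pt (𝒟 := 𝒟) m))))
    (ha : tmap (X := (σ 1).mfd) (legV (𝒟 := 𝒟)) (Bar.degen (𝒟 := 𝒟) 0 m) a = b) :
    a ∈ W (𝒳 := barData σ) (barForm σ ϖ) m 1 := by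
  rw [← (leg_degen_zero (𝒟 := 𝒟) m).1, ← ha] at hb
  exact (mem_degenKer_zero σ ϖ _ a).2 hb

theorem mem_W_two (σ : ∀ r, 𝒟.BarStructure r) (m : (σ 0).mfd) {a : (σ 1).mfd.Model} {b : H.Model}
    (hb : tmap 𝒟.hor.one (𝒟.sideH.one (pt (𝒟 := 𝒟) m)) b ∈
      ϖ.kerAt (𝒟.hor.one (𝒟.sideH.one (pt (𝒟 := 𝒟) m))))
    (ha : tmap (X := (σ 1).mfd) (legH (𝒟 := 𝒟)) (Bar.degen (𝒟 := 𝒟) 0 m) a = b) :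
    a ∈ W (𝒳 := barData σ) (barForm σ ϖ) m 2 := by
  rw [← (leg_degen_zero (𝒟 := 𝒟) m).2, ← ha] at hb
  exact (mem_degenKer_one σ ϖ _ a).2 hb

/-- No nonzero vector tangent to the double units is in the kernel of `ϖ`, since it would be in
`W_0^0 ∩ W_0^1`. -/
theorem eq_zero_of_tmap_one_one_mem {σ : ∀ r, 𝒟.BarStructure r}
    (h : IsLocalSymplectic (𝒳 := barData σ) (barForm σ ϖ)) {x : M} {b : M.Model}
    (hb : tmap (fun x => 𝒟.ver.one (𝒟.sideV.one x)) x b ∈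
      ϖ.kerAt (𝒟.ver.one (𝒟.sideV.one x))) : b = 0 := by
  obtain ⟨m, rfl⟩ := pt_surjective 𝒟 x
  let m : (σ 0).mfd := m
  change tmap (fun x => 𝒟.ver.one (𝒟.sideV.one x)) (pt (𝒟 := 𝒟) m) b ∈ _ at hb
  rw [tmap_comp_apply (𝒟.ver.smooth_one _) (𝒟.sideV.smooth_one _)] at hb
  obtain ⟨c, rfl⟩ := tmap_pt_surjective σ m b
  have h0 : tmap (X := (σ 0).mfd) (Y := (σ 1).mfd) (Bar.degen (𝒟 := 𝒟) 0) m c = 0 :=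
    eq_zero_of_mem_W h m (i := 0) (j := 1) (by decide) ⟨c, rfl⟩
      (mem_W_one σ m hb (tmap_legV_degen_zero σ m c))
  have h1 := tmap_legV_degen_zero σ m c
  rw [h0, map_zero] at h1
  exact eq_zero_of_tmap_of_leftInverse 𝒟.sideV.smooth_one 𝒟.sideV.submersion_src.contMDiff
    𝒟.sideV.src_one h1.symm

/-- At a unit of `H`, no nonzero tangent vector of `H` is in the kernel of `ϖ`, since it would
be in `W_0^1 ∩ W_1^1`. -/
theorem eq_zero_of_tmap_hor_one_mem {σ : ∀ r, 𝒟.BarStructure r} (hϖ : 𝒟.IsPresymplectic ϖ)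
    (h : IsLocalSymplectic (𝒳 := barData σ) (barForm σ ϖ)) (x : M) (b : H.Model)
    (hb : tmap 𝒟.hor.one (𝒟.sideH.one x) b ∈ ϖ.kerAt (𝒟.hor.one (𝒟.sideH.one x))) : b = 0 := by
  have ht : tmap 𝒟.sideH.tgt (𝒟.sideH.one x) b = 0 := by
    have h1 := hϖ.multiplicative_ver.tmap_one_tgt_mem hb
    rw [← tmap_comp_apply (g := fun x => 𝒟.ver.one (𝒟.ver.tgt x))
      (𝒟.ver.smoothAt_one (𝒟.ver.smoothAt_tgt (smoothAt_id _))) (𝒟.hor.smooth_one _)] at h1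
    simp only [ver_tgt_hor_one] at h1
    rw [tmap_comp_apply (g := fun x => 𝒟.ver.one (𝒟.sideV.one x))
      (𝒟.ver.smoothAt_one (𝒟.sideV.smoothAt_one (smoothAt_id _)))
      (𝒟.sideH.submersion_tgt.contMDiff _)] at h1
    exact eq_zero_of_tmap_one_one_mem h h1
  obtain ⟨m, rfl⟩ := pt_surjective 𝒟 x
  let y : (σ 1).mfd := Bar.degen (𝒟 := 𝒟) 0 m
  have hyH : legH (𝒟 := 𝒟) y = 𝒟.sideH.one (pt (𝒟 := 𝒟) m) := (leg_degen_zero (𝒟 := 𝒟) m).2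
  obtain ⟨η, hη, hηz, hηe, hηb⟩ := 𝒟.sideH.submersion_tgt.exists_lift_curve
    (legH (𝒟 := 𝒟) y) (g := fun _ => 𝒟.sideH.tgt (legH (𝒟 := 𝒟) y)) (smoothAt_const _ _) rfl b
    (by rw [hyH, ht, tmap_const]; rfl)
  obtain ⟨a, h1, h2⟩ := exists_vector_edge (σ 1) y (smoothAt_const (legV (𝒟 := 𝒟) y) 0) hη
    (hηe.mono fun ζ h => (src_legV (𝒟 := 𝒟) y).trans h.symm) rfl hηz
  rw [tmap_const] at h1
  have ha : a = 0 := eq_zero_of_mem_W h m (i := 1) (j := 2) (by decide)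
    (mem_W_one σ m (b := 0) (by rw [map_zero]; exact zero_mem _) h1)
    (mem_W_two σ m hb (h2.trans hηb))
  rw [← hηb, ← h2, ha, map_zero]

/-- At a unit of `V`, no nonzero tangent vector of `V` is in the kernel of `ϖ`, since it would
be in `W_0^1 ∩ W_1^1`. -/
theorem eq_zero_of_tmap_ver_one_mem {σ : ∀ r, 𝒟.BarStructure r} (hϖ : 𝒟.IsPresymplectic ϖ)
    (h : IsLocalSymplectic (𝒳 := barData σ) (barForm σ ϖ)) (x : M) (b : V.Model)
    (hb : tmap 𝒟.ver.one (𝒟.sideV.one x) b ∈ ϖ.kerAt (𝒟.ver.one (𝒟.sideV.one x))) : b = 0 := by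
  have ht : tmap 𝒟.sideV.src (𝒟.sideV.one x) b = 0 := by
    have h1 := hϖ.multiplicative_hor.tmap_one_src_mem hb
    rw [← tmap_comp_apply (g := fun x => 𝒟.hor.one (𝒟.hor.src x))
      (𝒟.hor.smoothAt_one (𝒟.hor.smoothAt_src (smoothAt_id _))) (𝒟.ver.smooth_one _)] at h1
    simp only [hor_src_ver_one, hor_one_one] at h1
    rw [tmap_comp_apply (g := fun x => 𝒟.ver.one (𝒟.sideV.one x))
      (𝒟.ver.smoothAt_one (𝒟.sideV.smoothAt_one (smoothAt_id _)))
      (𝒟.sideV.submersion_src.contMDiff _)] at h1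
    exact eq_zero_of_tmap_one_one_mem h h1
  obtain ⟨m, rfl⟩ := pt_surjective 𝒟 x
  let y : (σ 1).mfd := Bar.degen (𝒟 := 𝒟) 0 m
  have hyV : legV (𝒟 := 𝒟) y = 𝒟.sideV.one (pt (𝒟 := 𝒟) m) := (leg_degen_zero (𝒟 := 𝒟) m).1
  obtain ⟨θ, hθ, hθz, hθe, hθb⟩ := 𝒟.sideV.submersion_src.exists_lift_curve
    (legV (𝒟 := 𝒟) y) (g := fun _ => 𝒟.sideV.src (legV (𝒟 := 𝒟) y)) (smoothAt_const _ _) rfl b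
    (by rw [hyV, ht, tmap_const]; rfl)
  obtain ⟨a, h1, h2⟩ := exists_vector_edge (σ 1) y hθ (smoothAt_const (legH (𝒟 := 𝒟) y) 0)
    (hθe.mono fun ζ h => h.trans (src_legV (𝒟 := 𝒟) y)) hθz rfl
  rw [tmap_const] at h2
  have ha : a = 0 := eq_zero_of_mem_W h m (i := 1) (j := 2) (by decide)
    (mem_W_one σ m hb (h1.trans hθb))
    (mem_W_two σ m (b := 0) (by rw [map_zero]; exact zero_mem _) h2)
  rw [← hθb, ← h1, ha, map_zero]

/-- A kernel vector of `ϖ` is killed by `s_V` and by `t_H`, hence comes from a kernel vector of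
`ν^* ϖ` which is killed by `f_0` and by `f_2`. -/
theorem nondegenerate_of_isLocalSymplectic {σ : ∀ r, 𝒟.BarStructure r}
    (hϖ : 𝒟.IsPresymplectic ϖ) (h : IsLocalSymplectic (𝒳 := barData σ) (barForm σ ϖ)) :
    ϖ.Nondegenerate := by
  intro α₀
  suffices key : ∀ b : D.Model, b ∈ ϖ.kerAt α₀ → b = 0 from (Submodule.eq_bot_iff _).2 key
  intro b hb
  -- `1_* s_V* b` is a kernel vector tangent to `V`, which is a subgroupoid of `D ⇉ H`
  have hV : tmap 𝒟.ver.src α₀ b = 0 := by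
    refine hϖ.multiplicative_hor.eq_zero_of_tmap_mem (𝒦 := 𝒟.sideV)
      (k := 𝒟.ver.src α₀) 𝒟.ver.smooth_one
      (fun v => by rw [hor_src_ver_one, hor_one_one]) (fun v v' e => by simp [e])
      (fun v v' e => 𝒟.ver_one_mul e) (eq_zero_of_tmap_ver_one_mem hϖ h) ?_
    rw [← tmap_comp_apply (𝒟.ver.smooth_one _) (𝒟.ver.submersion_src.contMDiff _)]
    exact hϖ.multiplicative_ver.tmap_one_src_mem hb
  -- `1_* t_H* b` is a kernel vector tangent to `H`, which is a subgroupoid of `D ⇉ V`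
  have hH : tmap 𝒟.hor.tgt α₀ b = 0 := by
    refine hϖ.multiplicative_ver.eq_zero_of_tmap_mem (𝒦 := 𝒟.sideH)
      (k := 𝒟.hor.tgt α₀) 𝒟.hor.smooth_one
      (fun v => by rw [ver_src_hor_one, hor_one_one]) (fun v v' e => by simp [e])
      (fun v v' e => 𝒟.hor_one_mul e) (eq_zero_of_tmap_hor_one_mem hϖ h) ?_
    rw [← tmap_comp_apply (𝒟.hor.smooth_one _) (𝒟.hor.submersion_tgt.contMDiff _)]
    exact hϖ.multiplicative_hor.tmap_one_tgt_mem hb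
  -- a curve with velocity `b` along which `s_V` and `t_H` are constant
  obtain ⟨α, hα, hαz, hαe, hαb⟩ : ∃ α : euc 1 → D, SmoothAt α 0 ∧ α 0 = α₀ ∧
      (∀ᶠ ζ in 𝓝 0, 𝒟.ver.src (α ζ) = 𝒟.ver.src α₀ ∧ 𝒟.hor.tgt (α ζ) = 𝒟.hor.tgt α₀) ∧
      tmap α 0 vel = b := by
    obtain ⟨τ⟩ := nonempty_fiberProductStructure 𝒟.sideV.submersion_tgt
      𝒟.sideH.submersion_src.contMDiff
    let Φ : D → FiberProduct 𝒟.sideV.tgt 𝒟.sideH.src := fun α =>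
      ⟨(𝒟.ver.src α, 𝒟.hor.tgt α), (𝒟.src_tgt α).symm⟩
    have hΦ : Submersion (Y := τ.mfd) Φ := 𝒟.submersion_src_tgt τ
    have h0 : tmap (Y := τ.mfd) Φ α₀ b = 0 := τ.embeds.immersive (Φ α₀) _ fun i => by
      refine (tmap_comp_apply (Y := τ.mfd) (τ.embeds.smooth i _) (hΦ.contMDiff α₀) b).symm.trans ?_
      cases i
      · exact hV
      · exact hH
    obtain ⟨α, hα, hαz, hαe, hαb⟩ := hΦ.exists_lift_curve (Y := τ.mfd) α₀ (g := fun _ => Φ α₀)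
      (smoothAt_const _ _) rfl b
      (h0.trans (DFunLike.congr_fun (tmap_const (Y := τ.mfd) (Φ α₀) 0) vel).symm)
    exact ⟨α, hα, hαz, hαe.mono fun ζ e => ⟨congrArg (fun p => p.1.1) e,
      congrArg (fun p => p.1.2) e⟩, hαb⟩
  -- moving `α` along this curve, with `θ` and `η` fixed, moves neither `f_0` nor `f_2`
  obtain ⟨w, rfl⟩ := ν_surjective 𝒟 α₀
  let x : (σ 2).mfd := w
  obtain ⟨a, h1, h2, h3⟩ := exists_vector_triple σ x
    (smoothAt_const (Bar.face (𝒟 := 𝒟) 2 x).legV 0) hα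
    (smoothAt_const (Bar.face (𝒟 := 𝒟) 0 x).legH 0)
    (hαe.mono fun ζ e => by
      rw [← 𝒟.tgt_tgt, e.2, 𝒟.tgt_tgt]; exact (legV_face_one w).1)
    (hαe.mono fun ζ e => by
      rw [𝒟.src_src, e.1, ← 𝒟.src_src]; exact (face_zero_leg w).2.1) rfl hαz rfl
  rw [tmap_const] at h1 h3
  replace h2 := h2.trans hαb
  have hν : tmap (X := (σ 2).mfd) (ν (𝒟 := 𝒟)) x a ∈ ϖ.kerAt (ν (𝒟 := 𝒟) x) := h2 ▸ hb
  have f0 : tmap (X := (σ 2).mfd) (Y := (σ 1).mfd) (Bar.face (𝒟 := 𝒟) 0) x a = 0 :=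
    eq_zero_of_tmap_leg (σ 1) ((tmap_legV_face_zero σ x a).trans (by rw [h2]; exact hV))
      ((tmap_legH_face σ 0 x a).trans h3)
  have f2 : tmap (X := (σ 2).mfd) (Y := (σ 1).mfd) (Bar.face (𝒟 := 𝒟) 2) x a = 0 :=
    eq_zero_of_tmap_leg (σ 1) ((tmap_legV_face σ 2 x a).trans h1)
      ((tmap_legH_face_two σ x a).trans (by rw [h2]; exact hH))
  have hz : tmap (X := (σ 2).mfd) (Y := (σ 1).mfd) (Bar.face (𝒟 := 𝒟) 2) x a =
      tmap (X := (σ 2).mfd) (Y := (σ 1).mfd) (Bar.face (𝒟 := 𝒟) 2) x 0 := by rw [f2, map_zero]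
  -- `f_2` is injective on the kernel vectors killed by `f_0`
  have ha : a = 0 := (h.iso_two_zero x).injOn ⟨f0, (mem_ker_barForm σ ϖ x a).2 hν⟩
    (zero_mem _) hz
  rw [← h2, ha, map_zero]

end Bar

end DoubleLieGroupoid

end

theorem mainTheorem2 {D V H M : SmoothMfd.{u}} (𝒟 : DoubleLieGroupoid D V H M)
    (ϖ : SmoothMfd.TwoForm D) (hϖ : 𝒟.IsPresymplectic ϖ) :
    (∀ r : ℕ, Nonempty (𝒟.BarStructure r)) ∧
      ∀ σ : ∀ r : ℕ, 𝒟.BarStructure r,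
        (DoubleLieGroupoid.barData σ).IsLocalLieTwoGroupoid ∧
          (SimplicialData.IsLocalSymplectic (𝒳 := DoubleLieGroupoid.barData σ)
              (DoubleLieGroupoid.barForm σ ϖ) ↔
            ϖ.Nondegenerate) := by
  exact ⟨DoubleLieGroupoid.Bar.nonempty_barStructure_all 𝒟, fun σ =>
    ⟨DoubleLieGroupoid.isLocalLieTwoGroupoid σ,
      DoubleLieGroupoid.Bar.nondegenerate_of_isLocalSymplectic hϖ,
      DoubleLieGroupoid.Bar.isLocalSymplectic_of_nondegenerate σ hϖ⟩⟩
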